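/- Let $\mathbb R^N=\mathbb R^{C_1}\oplus\cdots\oplus\mathbb R^{C_n}$, where $C_1,\dots,C_n$ are disjoint non-empty sets with union $\{1,\dots,N\}$, let $d_1,\dots,d_N>0$, and let $\mathbb R^N$ carry the dilations $\lambda\cdot x=(\lambda^{d_1}x_1,\dots,\lambda^{d_N}x_N)$. Write $\mathbf x=(\mathbf x_1,\dots,\mathbf x_n)$ with $\mathbf x_j=(x_l)_{l\in C_j}$ and put $Q_j=\sum_{l\in C_j}d_l$. For each $j$ let $n_j:\mathbb R^{C_j}\to[0,\infty)$ be a homogeneous norm, smooth away from $0$: $n_j(\lambda\cdot\mathbf x_j)=\lambda n_j(\mathbf x_j)$ for $\lambda>0$ and $n_j(\mathbf x_j)\approx\sum_{l\in C_j}|x_l|^{1/d_l}$. Let $\mathbf E=(e(j,k))$ be an $n\times n$ matrix of positive numbers with $e(j,j)=1$ and $e(j,l)\le e(j,k)e(k,l)$ for all $j,k,l$, and set $$N_j(\mathbf x)=\sum_{k=1}^n n_k(\mathbf x_k)^{e(j,k)},\qquad \widehat N_j(\boldsymbol\xi)=\sum_{k=1}^n n_k(\boldsymbol\xi_k)^{1/e(k,j)}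 .$$ For a multi-index $\gamma\in\mathbb N^N$ let $[\gamma_j]=\sum_{l\in C_j}\gamma_l d_l$. For $L\subseteq\{1,\dots,n\}$ let $\mathbb R^L=\bigoplus_{j\in L}\mathbb R^{C_j}$ and $N^L_j(\mathbf x_L)=\sum_{k\in L}n_k(\mathbf x_k)^{e(j,k)}$ for $j\in L$. For $\psi\in C_0^\infty(\mathbb R^L)$ and $R=(R_j)_{j\in L}$ with all $R_j>0$ let $\psi_R(\mathbf t)=\psi((R_j\cdot\mathbf t_j)_{j\in L})$, and let $\|\psi\|_{(m)}=\sup\{|\partial^\gamma\psi(\mathbf t)|:\mathbf t\in\mathbb R^L,\ |\gamma|\le m\}$. The unit ball of $\mathbb R^L$ is $\{n_j(\mathbf t_j)<1 \text{ for all } j\in L\}$. Test functions are real-valued, distributions are complex-valued. The class $\mathcal P_0(\mathbf E)$ consists of the distributions $\mathcal K$ on $\mathbb R^N$ such that: (a) away from the origin $\mathcal K$ is given by integration against a smooth function $K$, and for every $\gamma$ and every $M\ge0$ there is a constant $C_{M,\gamma}$ with $$|\partial^\gamma K(\mathbf x)|\le C_{M,\gamma}\prod_{j=1}^nN_j(\mathbf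 x)^{-(Q_j+[\gamma_j])}(1+|\mathbf x|)^{-M}\qquad(\mathbf x\ne0);$$ (b) for every non-empty $L\subseteq\{1,\dots,n\}$ with complement $L^c$, every $\psi\in C_0^\infty(\mathbb R^{L^c})$ supported in the unit ball and every $R=(R_j)_{j\in L^c}$ with all $R_j>0$, the distribution $\langle\mathcal K_{\psi,R},\varphi\rangle=\langle\mathcal K,\varphi\otimes\psi_R\rangle$ on $\mathbb R^L$ is given away from the origin by integration against a smooth function $K_{\psi,R}$ with $$|\partial^\gamma K_{\psi,R}(\mathbf x)|\le D_{M,\gamma}\,(1+|\mathbf x|)^{-M}\prod_{j\in L}N^L_j(\mathbf x)^{-(Q_j+[\gamma_j])}\qquad(\mathbf x\ne0)$$ for every multi-index $\gamma$ in the variables of $\mathbb R^L$ and every $M\ge 0$; for $L=\emptyset$, $|\langle\mathcal K,\psi_R\rangle|\le D$ for every $\psi\in C_0^\infty(\mathbb R^N)$ supported in the unit ball and every $R$. For fixed $\mathcal K$ and $L$, the constants $D_{M,\gamma}$ and $D$ do not depend on $R$, and they depend on $\psi$ only through bounds for the norms $\|\psi\|_{(m)}$, $m\in\mathbb N$ (one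 choice of constants serves all $\psi$ that satisfy $\|\psi\|_{(m)}\le B_m$ for all $m$, for a given sequence $(B_m)$). The class $\mathcal M_\infty(\mathbf E)$ consists of the $m\in C^\infty(\mathbb R^N)$, complex-valued, such that for every $\gamma$ there is a constant $C_\gamma$ with $$|\partial^\gamma m(\boldsymbol\xi)|\le C_\gamma\prod_{j=1}^n\bigl(1+\widehat N_j(\boldsymbol\xi)\bigr)^{-[\gamma_j]}\qquad(\boldsymbol\xi\in\mathbb R^N).$$ Theorem. If $\mathcal K\in\mathcal P_0(\mathbf E)$, then $\mathcal K$ is (the restriction to test functions of) a tempered distribution, and its Fourier transform is a smooth function belonging to $\mathcal M_\infty(\mathbf E)$. Moreover $\mathcal P_0(\mathbf E)=(\mathcal M_\infty(\mathbf E))^\vee$: a distribution lies in $\mathcal P_0(\mathbf E)$ if and only if it is the inverse Fourier transform of some $m\in\mathcal M_\infty(\mathbf E)$. -/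

import Mathlib

open scoped ContDiff Distributions SchwartzMap FourierTransform
open MeasureTheory

/-- The partial derivative `∂^γ f (x)` for a multi-index `γ : ι → ℕ`: the iterated derivative of
order `∑ l, γ l`, evaluated on the coordinate vectors, where the vector `e_l` is used exactly `γ l`
times. It is only applied to functions that are smooth near the point `x`, so that the order
in which the directions are listed is irrelevant. -/
noncomputable def multiDeriv {ι F : Type*} [Fintype ι] [DecidableEq ι]
    [NormedAddCommGroup F] [NormedSpace ℝ F] (γ : ι → ℕ) (f : EuclideanSpace ℝ ι → F)
    (x : EuclideanSpace ℝ ι) : F :=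
  iteratedFDeriv ℝ (Fintype.card (Σ l, Fin (γ l))) f x
    (fun i => EuclideanSpace.single ((Fintype.equivFin (Σ l, Fin (γ l))).symm i).1 (1 : ℝ))

/-- `‖φ‖_(m) ≤ B m` for every `m`, where `‖φ‖_(m) = sup {|∂^γ φ (x)| : x, |γ| ≤ m}`. -/
def SeminormsBoundedBy {ι : Type*} [Fintype ι] [DecidableEq ι]
    (φ : EuclideanSpace ℝ ι → ℝ) (B : ℕ → ℝ) : Prop :=
  ∀ (m : ℕ) (γ : ι → ℕ), ∑ l, γ l ≤ m → ∀ x, |multiDeriv γ φ x| ≤ B m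

/-- A linear functional `T` on test functions is, away from the origin, given by integration
against the function `g`, which is smooth there. -/
def IsGivenAwayFromZeroBy {ι : Type*} [Fintype ι]
    (T : 𝓓((⊤ : TopologicalSpace.Opens (EuclideanSpace ℝ ι)), ℝ) → ℂ)
    (g : EuclideanSpace ℝ ι → ℂ) : Prop :=
  ContDiffOn ℝ ∞ g {0}ᶜ ∧
    ∀ φ : 𝓓((⊤ : TopologicalSpace.Opens (EuclideanSpace ℝ ι)), ℝ), 0 ∉ tsupport φ →
      T φ = ∫ x, (φ x : ℂ) * g x

/-- A decomposition `ℝ^N = ℝ^{C_1} ⊕ ⋯ ⊕ ℝ^{C_n}` into coordinate subspaces, with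
`C_j = {l | block l = j}` (disjoint and non-empty, with union `{1, …, N}`), the exponents `d_l > 0`
of the dilations `λ · x = (λ^{d_1} x_1, …, λ^{d_N} x_N)`, and smooth homogeneous norms `n_j` on the
subspaces `ℝ^{C_j}`. -/
structure DilationStructure (N n : ℕ) where
  block : Fin N → Fin n
  block_surjective : Function.Surjective block
  d : Fin N → ℝ
  d_pos : ∀ l, 0 < d l
  nrm : (j : Fin n) → EuclideanSpace ℝ {l // block l = j} → ℝ
  nrm_nonneg : ∀ j t, 0 ≤ nrm j t
  nrm_smooth : ∀ j, ContDiffOn ℝ ∞ (nrm j) {0}ᶜ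
  nrm_homogeneous : ∀ j (r : ℝ), 0 < r → ∀ t : EuclideanSpace ℝ {l // block l = j},
    nrm j (WithLp.toLp 2 fun l => r ^ d l * t l) = r * nrm j t
  nrm_equiv : ∀ j, ∃ c C : ℝ, 0 < c ∧ 0 < C ∧ ∀ t : EuclideanSpace ℝ {l // block l = j},
    c * ∑ l, |t l| ^ (1 / d l) ≤ nrm j t ∧ nrm j t ≤ C * ∑ l, |t l| ^ (1 / d l)

/-- The basic hypothesis on the matrix `E = (e(j,k))` (with positive entries). -/
structure BasicHypothesis {n : ℕ} (e : Matrix (Fin n) (Fin n) ℝ) : Prop where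
  pos : ∀ j k, 0 < e j k
  diag : ∀ j, e j j = 1
  triangle : ∀ j k l, e j l ≤ e j k * e k l

namespace DilationStructure

variable {N n : ℕ} (D : DilationStructure N n)

/-- The space `ℝ^N`. -/
abbrev Space (_D : DilationStructure N n) : Type := EuclideanSpace ℝ (Fin N)

/-- The indices of the coordinates of `ℝ^L = ⨁_{j ∈ L} ℝ^{C_j}`, for `L ⊆ {1, …, n}`. -/
abbrev Coord (L : Finset (Fin n)) : Type := {l : Fin N // D.block l ∈ L}

/-- The space `ℝ^L = ⨁_{j ∈ L} ℝ^{C_j}`. -/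
abbrev SubSpace (L : Finset (Fin n)) : Type := EuclideanSpace ℝ (D.Coord L)

/-- The homogeneous dimension `Q_j` of `ℝ^{C_j}`. -/
def Q (j : Fin n) : ℝ := ∑ l with D.block l = j, D.d l

/-- The weighted length `⟦γ_j⟧ = ∑_{l ∈ C_j} γ_l d_l`. -/
def weight (γ : Fin N → ℕ) (j : Fin n) : ℝ := ∑ l with D.block l = j, (γ l : ℝ) * D.d l

/-- The weighted length `⟦γ_j⟧` for a multi-index in the variables of `ℝ^L`. -/
def subWeight (L : Finset (Fin n)) (γ : D.Coord L → ℕ) (j : Fin n) : ℝ :=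
  ∑ l with D.block l.1 = j, (γ l : ℝ) * D.d l.1

/-- The component `x_j ∈ ℝ^{C_j}` of `x ∈ ℝ^N`. -/
noncomputable def comp (x : D.Space) (j : Fin n) : EuclideanSpace ℝ {l // D.block l = j} :=
  WithLp.toLp 2 fun l => x l.1

/-- The component `x_j ∈ ℝ^{C_j}`, `j ∈ L`, of `x ∈ ℝ^L`. -/
noncomputable def subComp {L : Finset (Fin n)} (x : D.SubSpace L) (j : {j // j ∈ L}) :
    EuclideanSpace ℝ {l // D.block l = j.1} :=
  WithLp.toLp 2 fun l => x ⟨l.1, l.2.symm ▸ j.2⟩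

/-- The norm `N_j(x) = ∑_k n_k(x_k)^{e(j,k)}`. -/
noncomputable def norm (e : Matrix (Fin n) (Fin n) ℝ) (j : Fin n) (x : D.Space) : ℝ :=
  ∑ k, D.nrm k (D.comp x k) ^ e j k

/-- The dual norm `N̂_j(ξ) = ∑_k n_k(ξ_k)^{1/e(k,j)}`. -/
noncomputable def dualNorm (e : Matrix (Fin n) (Fin n) ℝ) (j : Fin n) (ξ : D.Space) : ℝ :=
  ∑ k, D.nrm k (D.comp ξ k) ^ (1 / e k j)

/-- The norm `N_j(x_L) = ∑_{k ∈ L} n_k(x_k)^{e(j,k)}` on `ℝ^L`. -/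
noncomputable def subNorm (e : Matrix (Fin n) (Fin n) ℝ) (L : Finset (Fin n)) (j : Fin n)
    (x : D.SubSpace L) : ℝ :=
  ∑ k : {k // k ∈ L}, D.nrm k.1 (D.subComp x k) ^ e j k

/-- The support of `ψ` lies in the unit ball `{t ∈ ℝ^N : n_j(t_j) < 1 for all j}`. -/
def SupportedInUnitBall (ψ : D.Space → ℝ) : Prop :=
  ∀ t ∈ tsupport ψ, ∀ j, D.nrm j (D.comp t j) < 1

/-- The support of `ψ` lies in the unit ball `{t ∈ ℝ^L : n_j(t_j) < 1 for all j ∈ L}`. -/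
def SubSupportedInUnitBall {L : Finset (Fin n)} (ψ : D.SubSpace L → ℝ) : Prop :=
  ∀ t ∈ tsupport ψ, ∀ j : {j // j ∈ L}, D.nrm j.1 (D.subComp t j) < 1

/-- The restriction `x ↦ x_L` from `ℝ^N` to `ℝ^L`. -/
noncomputable def restrict (L : Finset (Fin n)) (x : D.Space) : D.SubSpace L :=
  WithLp.toLp 2 fun l => x l.1

/-- The `n`-parameter dilation `R · x = (R_1 · x_1, …, R_n · x_n)` on `ℝ^N`. -/
noncomputable def dilate (R : Fin n → ℝ) (x : D.Space) : D.Space :=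
  WithLp.toLp 2 fun l => R (D.block l) ^ D.d l * x l

/-- The same dilation on `ℝ^L` (only the `R_j` with `j ∈ L` matter). -/
noncomputable def subDilate {L : Finset (Fin n)} (R : Fin n → ℝ) (x : D.SubSpace L) :
    D.SubSpace L :=
  WithLp.toLp 2 fun l => R (D.block l.1) ^ D.d l.1 * x l

/-- Test functions on `ℝ^N`: real-valued, smooth, with compact support. -/
abbrev Test (_D : DilationStructure N n) : Type :=
  𝓓((⊤ : TopologicalSpace.Opens (EuclideanSpace ℝ (Fin N))), ℝ)

/-- Test functions on `ℝ^L`. -/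
abbrev SubTest (L : Finset (Fin n)) : Type :=
  𝓓((⊤ : TopologicalSpace.Opens (D.SubSpace L)), ℝ)

/-- (Complex-valued) distributions on `ℝ^N`. -/
abbrev Distr (_D : DilationStructure N n) : Type :=
  𝓓'((⊤ : TopologicalSpace.Opens (EuclideanSpace ℝ (Fin N))), ℂ)

/-- The dilated test function `ψ_R(t) = ψ(R · t)` on `ℝ^N`. -/
noncomputable def dilateTest (R : Fin n → ℝ) (hR : ∀ j, 0 < R j) (ψ : D.Test) : D.Test where
  toFun x := ψ (D.dilate R x)
  contDiff' := by
    refine ψ.contDiff.comp ?_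
    unfold dilate
    fun_prop
  hasCompactSupport' := by
    refine HasCompactSupport.intro
      (K := (fun y : D.Space => (WithLp.toLp 2 fun l =>
        (R (D.block l) ^ D.d l)⁻¹ * y l : D.Space)) '' tsupport ψ)
      (ψ.hasCompactSupport.isCompact.image (by fun_prop)) ?_
    intro x hx
    by_contra h
    refine hx ⟨D.dilate R x, subset_tsupport _ h, ?_⟩
    ext l
    have := (Real.rpow_pos_of_pos (hR (D.block l)) (D.d l)).ne'
    simp [dilate, this]
  tsupport_subset' := by simp

/-- The test function `φ ⊗ ψ_R`, i.e. `x ↦ φ(x_L) ψ(R · x_M)`, on `ℝ^N = ℝ^L ⊕ ℝ^M`, where `M` is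
the complement of `L`. -/
noncomputable def tensorTest (L : Finset (Fin n)) (R : Fin n → ℝ) (hR : ∀ j, 0 < R j)
    (φ : D.SubTest L) (ψ : D.SubTest Lᶜ) : D.Test where
  toFun x := φ (D.restrict L x) * ψ (D.subDilate R (D.restrict Lᶜ x))
  contDiff' := by
    refine ContDiff.mul (φ.contDiff.comp ?_) (ψ.contDiff.comp ?_)
    · unfold restrict
      fun_prop
    · unfold subDilate restrict
      fun_prop
  hasCompactSupport' := by
    refine HasCompactSupport.intro
      (K := (fun y : D.SubSpace L × D.SubSpace Lᶜ => (WithLp.toLp 2 fun l =>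
        if h : D.block l ∈ L then y.1 ⟨l, h⟩ else
          (R (D.block l) ^ D.d l)⁻¹ * y.2 ⟨l, Finset.mem_compl.2 h⟩ : D.Space)) ''
            (tsupport φ ×ˢ tsupport ψ))
      ((φ.hasCompactSupport.isCompact.prod ψ.hasCompactSupport.isCompact).image ?_) ?_
    · refine (PiLp.continuous_toLp 2 _).comp (continuous_pi fun l => ?_)
      split_ifs <;> fun_prop
    · intro x hx
      by_contra h
      refine hx ⟨(D.restrict L x, D.subDilate R (D.restrict Lᶜ x)),
        ⟨subset_tsupport _ (left_ne_zero_of_mul h), subset_tsupport _ (right_ne_zero_of_mul h)⟩, ?_⟩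
      ext l
      have := (Real.rpow_pos_of_pos (hR (D.block l)) (D.d l)).ne'
      by_cases hl : D.block l ∈ L <;> simp [hl, subDilate, restrict, this]
  tsupport_subset' := by simp

/-- The class `𝒫₀(E)` of distributions. The inequalities with `M = 0` are those that define
the larger class `𝒫(E)`. -/
structure IsProperKernel (e : Matrix (Fin n) (Fin n) ℝ) (K : D.Distr) : Prop where
  /-- Differential inequalities. -/
  differential : ∃ g : D.Space → ℂ, IsGivenAwayFromZeroBy (fun φ => K φ) g ∧
    ∀ (M : ℕ) (γ : Fin N → ℕ), ∃ C : ℝ, ∀ x, x ≠ 0 →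
      ‖multiDeriv γ g x‖ ≤
        C * (∏ j, D.norm e j x ^ (-(D.Q j + D.weight γ j))) * (1 + ‖x‖) ^ (-(M : ℝ))
  /-- Cancellation conditions for `L ≠ ∅`: the distributions
  `⟨K_{ψ,R}, φ⟩ = ⟨K, φ ⊗ ψ_R⟩` on `ℝ^L` satisfy the analogous inequalities, with constants that
  depend on `ψ` only through bounds on the norms `‖ψ‖_(m)` and that do not depend on `R`. -/
  cancellation : ∀ L : Finset (Fin n), L.Nonempty → ∀ B : ℕ → ℝ,
    ∃ C : ℕ → (D.Coord L → ℕ) → ℝ,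
      ∀ ψ : D.SubTest Lᶜ, D.SubSupportedInUnitBall ψ → SeminormsBoundedBy ψ B →
      ∀ (R : Fin n → ℝ) (hR : ∀ j, 0 < R j),
        ∃ g : D.SubSpace L → ℂ,
          IsGivenAwayFromZeroBy (fun φ => K (D.tensorTest L R hR φ ψ)) g ∧
          ∀ (M : ℕ) (γ : D.Coord L → ℕ) (x : D.SubSpace L), x ≠ 0 →
            ‖multiDeriv γ g x‖ ≤
              C M γ * (1 + ‖x‖) ^ (-(M : ℝ)) *
                ∏ j ∈ L, D.subNorm e L j x ^ (-(D.Q j + D.subWeight L γ j))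
  /-- Cancellation condition for `L = ∅`. -/
  cancellation_empty : ∀ B : ℕ → ℝ, ∃ C : ℝ,
    ∀ ψ : D.Test, D.SupportedInUnitBall ψ → SeminormsBoundedBy ψ B →
    ∀ (R : Fin n → ℝ) (hR : ∀ j, 0 < R j), ‖K (D.dilateTest R hR ψ)‖ ≤ C

/-- The class `𝒫₀(E)` as a set of distributions on `ℝ^N`. -/
def properKernels (e : Matrix (Fin n) (Fin n) ℝ) : Set D.Distr := {K | D.IsProperKernel e K}

/-- The class `ℳ_∞(E)` of multipliers. -/
def multipliers (e : Matrix (Fin n) (Fin n) ℝ) : Set (D.Space → ℂ) :=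
  {m | ContDiff ℝ ∞ m ∧ ∀ γ : Fin N → ℕ, ∃ C : ℝ, ∀ ξ,
    ‖multiDeriv γ m ξ‖ ≤ C * ∏ j, (1 + D.dualNorm e j ξ) ^ (-(D.weight γ j))}

/-- The distribution `K` is tempered (it is the restriction of a tempered distribution `T` to test
functions; such a `T` is unique) and its Fourier transform, in the sense of tempered
distributions, is the function `m`. -/
def HasFourierTransform (K : D.Distr) (m : D.Space → ℂ) : Prop :=
  ∃ T : 𝓢'(EuclideanSpace ℝ (Fin N), ℂ),
    (∀ (φ : D.Test) (f : 𝓢(EuclideanSpace ℝ (Fin N), ℂ)), (∀ x, f x = (φ x : ℂ)) → K φ = T f) ∧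
    ∀ f : 𝓢(EuclideanSpace ℝ (Fin N), ℂ), (𝓕 T) f = ∫ ξ, m ξ * f ξ

/-- The set `ℱ^∨` of the distributions that are inverse Fourier transforms of functions
in `ℱ`. -/
def inverseFourierTransforms (F : Set (D.Space → ℂ)) : Set D.Distr :=
  {K | ∃ m ∈ F, D.HasFourierTransform K m}

end DilationStructure

/-!
# Duality of proper kernels and multipliers for dilations with several parameters

The basic hypothesis makes the numbers `f(l,l') = d_l e(j,k) / d_{l'}`, for `l ∈ C_j` and `l' ∈ C_k`,
exponents of the same kind (`IsExponentSystem`), and `N_j ^ d_l` is comparable to the sum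
`pNorm f l` of the powers `|x_{l'}| ^ f(l,l')`. The same is true of the dual norms and `qNorm`. All
weights can therefore be written coordinate by coordinate (`exists_kernelWeight_equiv`,
`exists_multiplierWeight_equiv`), and the homogeneous norms disappear from the argument.

Both inclusions rest on one estimate for oscillatory integrals, `exists_norm_fourier_le`. Each
variable has a scale, and every variable is controlled by one of a few distinguished variables, for
which the frequency is not small compared with the scale; one integrates by parts in those variables
only. The triangle inequality for the exponents is what makes such a grouping of the variables
possible.

*From multipliers to kernels.* The Fourier transform of a truncated multiplier satisfies the
differential inequalities of a kernel, uniformly in the truncation: near the origin the variables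
are grouped according to the dominant coordinates of `x` (`IsExponentSystem.exists_dominant`,
`exists_norm_fourier_le_near_zero`), and away from it one direction suffices. The truncations
converge (`exists_kernel_of_isSymbol`). The partial kernel `K_{ψ,R}` comes from the integral of the
multiplier, in some of the variables, against the Fourier transform of `ψ_R`. The `L¹` norm of the
latter is bounded uniformly in `R` (`exists_integral_norm_fourier_dilate_le`), so this integral is a
multiplier on `ℝ^L` with uniform constants (`isSymbol_integral_glue`), and the cancellation
conditions follow (`isProperKernel_of_integral`).

*From kernels to multipliers.* The derivative of order `γ` of the Fourier transform is, up to a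
constant factor, the pairing of the kernel with `x ^ γ` times a character; let these functions be
truncated to a box. Given the frequency `ξ`, a block of variables is dominated by a block that
contains a coordinate with a large frequency, its pivot, unless the truncation already localises it
(`exists_pivots`). A partition of unity decides from which blocks small values are cut off
(`sum_prod_cut_eq_one`). In a term of this partition, let `L` consist of these blocks and of their
pivots. In the variables outside `L` the test function is a dilate of a function from a bounded
family, so the cancellation condition for `L` replaces the distribution by a partial kernel on
`ℝ^L`, to which the oscillatory integral estimate applies (`exists_norm_fourier_cutKernel_le`). This
bounds the pairings uniformly in the truncation (`IsProperKernel.exists_norm_pairing_modBump_le`).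

The multiplier is the limit of the Fourier transforms of the kernel cut off from ever smaller
neighbourhoods of the origin, each corrected by the constant that is the pairing of the distribution
with the cutoff function (`IsProperKernel.exists_integral_eq`). The error in the identity for a test
function `φ` is the pairing with `φ - φ(0)` localised near the origin, which tends to zero by the
cancellation condition for `L = ∅` (`IsProperKernel.exists_norm_pairing_sub_le`).
-/


/-! ### Symmetry of iterated derivatives -/

section Symmetry

variable {E F : Type*} [NormedAddCommGroup E] [NormedSpace ℝ E] [NormedAddCommGroup F]
  [NormedSpace ℝ F]

/-- Two adjacent directions may be interchanged. This is proved for functions of finite smoothness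
at a point, by induction on the order: the interchange of the two outermost directions is the
symmetry of the second derivative of `D^{n-1} f`. -/
theorem iteratedFDeriv_comp_swap_castSucc_succ {n : ℕ} {f : E → F} {x : E}
    (hf : ContDiffAt ℝ (n + 1 : ℕ) f x) (i : Fin n) (v : Fin (n + 1) → E) :
    iteratedFDeriv ℝ (n + 1) f x (v ∘ Equiv.swap i.castSucc i.succ) =
      iteratedFDeriv ℝ (n + 1) f x v := by
  induction n generalizing x with
  | zero => exact i.elim0
  | succ n ih =>
    have hd : DifferentiableAt ℝ (iteratedFDeriv ℝ (n + 1) f) x :=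
      hf.differentiableAt_iteratedFDeriv (by exact_mod_cast Nat.lt_succ_self _)
    induction i using Fin.cases with
    | zero =>
      have hd' : ∀ᶠ y in nhds x, DifferentiableAt ℝ (iteratedFDeriv ℝ n f) y := by
        filter_upwards [hf.eventually (by simp)] with y hy
        exact hy.differentiableAt_iteratedFDeriv (by exact_mod_cast (by omega))
      have h2 : ContDiffAt ℝ 2 (iteratedFDeriv ℝ n f) x :=
        hf.iteratedFDeriv_right (by norm_cast; omega)
      have hs : IsSymmSndFDerivAt ℝ (iteratedFDeriv ℝ n f) x :=
        h2.isSymmSndFDerivAt (by simp)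
      have key : ∀ w : Fin (n + 2) → E, iteratedFDeriv ℝ (n + 2) f x w =
          fderiv ℝ (fderiv ℝ (iteratedFDeriv ℝ n f)) x (w 0) (w 1)
            (fun j => w j.succ.succ) := by
        intro w
        rw [iteratedFDeriv_succ_apply_left]
        have h3 : fderiv ℝ (iteratedFDeriv ℝ (n + 1) f) x (w 0) (Fin.tail w) =
            fderiv ℝ (fun y => iteratedFDeriv ℝ (n + 1) f y (Fin.tail w)) x (w 0) := by
          rw [fderiv_continuousMultilinear_apply_const_apply hd]
        rw [h3]
        have h4 : (fun y => iteratedFDeriv ℝ (n + 1) f y (Fin.tail w)) =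
            fun y => fderiv ℝ (iteratedFDeriv ℝ n f) y (w 1) (fun j => w j.succ.succ) := by
          funext y
          rw [iteratedFDeriv_succ_apply_left]
          rfl
        rw [h4]
        have h5 : DifferentiableAt ℝ (fderiv ℝ (iteratedFDeriv ℝ n f)) x :=
          (h2.fderiv_right (m := 1) (by norm_num)).differentiableAt (by simp)
        rw [fderiv_continuousMultilinear_apply_const_apply (h5.clm_apply (by fun_prop))]
        rw [fderiv_clm_apply h5 (by fun_prop)]
        simp
      rw [key, key, ← hs.eq]
      have e0 : (Equiv.swap (Fin.castSucc 0) (Fin.succ 0) : Equiv.Perm (Fin (n + 2))) =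
        Equiv.swap 0 1 := rfl
      rw [e0]
      congr 1
    | succ i =>
      have key : ∀ w : Fin (n + 2) → E, iteratedFDeriv ℝ (n + 2) f x w =
          fderiv ℝ (fun y => iteratedFDeriv ℝ (n + 1) f y (Fin.tail w)) x (w 0) := by
        intro w
        rw [iteratedFDeriv_succ_apply_left, fderiv_continuousMultilinear_apply_const_apply hd]
      rw [key, key]
      have h0 : (v ∘ Equiv.swap i.succ.castSucc i.succ.succ) 0 = v 0 := by
        simp only [Function.comp]
        rw [Equiv.swap_apply_of_ne_of_ne]
        · simp [Fin.ext_iff]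
        · simp [Fin.ext_iff]
      have h1 : Fin.tail (v ∘ Equiv.swap i.succ.castSucc i.succ.succ) =
          Fin.tail v ∘ Equiv.swap i.castSucc i.succ := by
        funext j
        simp only [Fin.tail, Function.comp]
        congr 1
        rw [show i.succ.castSucc = i.castSucc.succ from rfl]
        exact ((Fin.succ_injective _).map_swap _ _ _).symm
      rw [h0]
      congr 1
      refine Filter.EventuallyEq.fderiv_eq ?_
      filter_upwards [hf.eventually (by simp)] with y hy
      rw [h1]
      exact ih (hy.of_le (by exact_mod_cast Nat.le_succ _)) i _

/-- Iterated derivatives of functions that are only finitely differentiable are symmetric. -/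
theorem iteratedFDeriv_comp_perm_of_contDiffAt {n : ℕ} {f : E → F} {x : E}
    (hf : ContDiffAt ℝ n f x) (σ : Equiv.Perm (Fin n)) (v : Fin n → E) :
    iteratedFDeriv ℝ n f x (v ∘ σ) = iteratedFDeriv ℝ n f x v := by
  cases n with
  | zero => congr 1; funext i; exact i.elim0
  | succ n =>
    have hσ : σ ∈ Submonoid.closure
        (Set.range fun i : Fin n => Equiv.swap i.castSucc i.succ) := by
      rw [Equiv.Perm.mclosure_swap_castSucc_succ]; trivial
    induction hσ using Submonoid.closure_induction generalizing v with
    | mem τ h =>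
      obtain ⟨i, rfl⟩ := h
      exact iteratedFDeriv_comp_swap_castSucc_succ hf i v
    | one => rfl
    | mul τ ρ _ _ h1 h2 =>
      rw [Equiv.Perm.coe_mul, ← Function.comp_assoc, h2, h1]

end Symmetry

/-! ### Partial derivatives for multi-indices -/

section MultiDeriv

/-- The diagonal linear map `z ↦ (lam_l z_l)`. -/
noncomputable def diagMap {ι : Type*} [Fintype ι] (lam : ι → ℝ) : EuclideanSpace ℝ ι →L[ℝ] EuclideanSpace ℝ ι :=
  LinearMap.toContinuousLinearMap
    { toFun := fun z => WithLp.toLp 2 fun l => lam l * z l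
      map_add' := fun a b => by ext l; simp [mul_add]
      map_smul' := fun c a => by ext l; simp; ring }

@[simp] theorem diagMap_apply {ι : Type*} [Fintype ι] (lam : ι → ℝ) (z : EuclideanSpace ℝ ι) (l : ι) :
    diagMap lam z l = lam l * z l := rfl

variable {ι F : Type*} [Fintype ι] [DecidableEq ι] [NormedAddCommGroup F] [NormedSpace ℝ F]

/-- An iterated derivative in coordinate directions depends only on how often each direction occurs.
-/
theorem iteratedFDeriv_single_eq_multiDeriv {k : ℕ} {f : EuclideanSpace ℝ ι → F}
    {x : EuclideanSpace ℝ ι} (hf : ContDiffAt ℝ k f x) (r : Fin k → ι) {γ : ι → ℕ}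
    (hγ : ∀ l, Fintype.card {i // r i = l} = γ l) :
    iteratedFDeriv ℝ k f x (fun i => EuclideanSpace.single (r i) (1 : ℝ)) =
      multiDeriv γ f x := by
  have e1 : (Fin k) ≃ (Σ l, Fin (γ l)) :=
    (Equiv.sigmaFiberEquiv r).symm.trans
      (Equiv.sigmaCongrRight fun l => Fintype.equivFinOfCardEq (hγ l))
  have hk : k = Fintype.card (Σ l, Fin (γ l)) := by
    simpa using Fintype.card_congr e1
  subst hk
  unfold multiDeriv
  set s : Fin (Fintype.card (Σ l, Fin (γ l))) → ι :=
    fun i => ((Fintype.equivFin (Σ l, Fin (γ l))).symm i).1 with hs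
  have hcard : ∀ l, Fintype.card {i // s i = l} = γ l := by
    intro l
    have : {i // s i = l} ≃ Fin (γ l) :=
      ((Fintype.equivFin (Σ l, Fin (γ l))).symm.subtypeEquiv (fun _ => Iff.rfl)).trans
        (Equiv.sigmaSubtype l)
    simpa using Fintype.card_congr this
  let e : ∀ l, {i // r i = l} ≃ {i // s i = l} := fun l =>
    Fintype.equivOfCardEq (by rw [hγ, hcard])
  have h := iteratedFDeriv_comp_perm_of_contDiffAt hf (Equiv.ofFiberEquiv e)
    (fun i => EuclideanSpace.single (s i) (1 : ℝ))
  rw [← h]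
  congr 1
  funext i
  simp only [Function.comp]
  exact congrArg (fun l => EuclideanSpace.single l (1 : ℝ)) (Equiv.ofFiberEquiv_map e i).symm

theorem norm_multiDeriv_le (γ : ι → ℕ) (f : EuclideanSpace ℝ ι → F) (x : EuclideanSpace ℝ ι) :
    ‖multiDeriv γ f x‖ ≤ ‖iteratedFDeriv ℝ (∑ l, γ l) f x‖ := by
  unfold multiDeriv
  refine (ContinuousMultilinearMap.le_opNorm _ _).trans ?_
  simp only [PiLp.norm_single, norm_one, Finset.prod_const_one, mul_one]
  rw [show Fintype.card (Σ l, Fin (γ l)) = ∑ l, γ l by simp]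

/-- A continuous multilinear map is bounded by its values on the coordinate vectors. -/
theorem ContinuousMultilinearMap.opNorm_le_of_single {k : ℕ}
    (T : ContinuousMultilinearMap ℝ (fun _ : Fin k => EuclideanSpace ℝ ι) F) {C : ℝ}
    (hT : ∀ r : Fin k → ι, ‖T fun i => EuclideanSpace.single (r i) (1 : ℝ)‖ ≤ C) :
    ‖T‖ ≤ (Fintype.card ι : ℝ) ^ k * C := by
  have hC : 0 ≤ (Fintype.card ι : ℝ) ^ k * C := by
    rcases isEmpty_or_nonempty (Fin k → ι) with h | h
    · have : Fintype.card (Fin k → ι) = 0 := Fintype.card_eq_zero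
      rw [Fintype.card_fun, Fintype.card_fin] at this
      have h' : (Fintype.card ι : ℝ) ^ k = 0 := by exact_mod_cast this
      simp [h']
    · exact mul_nonneg (by positivity) ((norm_nonneg _).trans (hT h.some))
  refine ContinuousMultilinearMap.opNorm_le_bound hC fun v => ?_
  have hv : ∀ i, v i = ∑ l, v i l • EuclideanSpace.single l (1 : ℝ) := by
    intro i
    ext j
    simp [Finset.sum_apply, Pi.single_apply]
  have h1 : T v = ∑ r : Fin k → ι, (∏ i, v i (r i)) •
      T fun i => EuclideanSpace.single (r i) (1 : ℝ) := by
    conv_lhs => rw [show v = fun i => ∑ l, v i l • EuclideanSpace.single l (1 : ℝ) from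
      funext hv]
    rw [ContinuousMultilinearMap.map_sum]
    refine Finset.sum_congr rfl fun r _ => ?_
    rw [ContinuousMultilinearMap.map_smul_univ]
  rw [h1]
  refine (norm_sum_le _ _).trans ?_
  calc ∑ r : Fin k → ι, ‖(∏ i, v i (r i)) • T fun i => EuclideanSpace.single (r i) (1 : ℝ)‖
      ≤ ∑ _r : Fin k → ι, (∏ i, ‖v i‖) * C := by
        refine Finset.sum_le_sum fun r _ => ?_
        rw [norm_smul, norm_prod]
        gcongr with i
        · exact PiLp.norm_apply_le (v i) (r i)
        · exact hT r
    _ = (Fintype.card ι : ℝ) ^ k * C * ∏ i, ‖v i‖ := by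
        simp; ring

theorem norm_iteratedFDeriv_le_of_multiDeriv {k : ℕ} {f : EuclideanSpace ℝ ι → F}
    {x : EuclideanSpace ℝ ι} (hf : ContDiffAt ℝ k f x) {C : ℝ}
    (h : ∀ γ : ι → ℕ, ∑ l, γ l = k → ‖multiDeriv γ f x‖ ≤ C) :
    ‖iteratedFDeriv ℝ k f x‖ ≤ (Fintype.card ι : ℝ) ^ k * C := by
  refine ContinuousMultilinearMap.opNorm_le_of_single _ fun r => ?_
  rw [iteratedFDeriv_single_eq_multiDeriv hf r (γ := fun l => Fintype.card {i // r i = l})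
    fun _ => rfl]
  refine h _ ?_
  rw [← Fintype.card_sigma, Fintype.card_congr (Equiv.sigmaFiberEquiv r), Fintype.card_fin]

theorem multiDeriv_zero (f : EuclideanSpace ℝ ι → F) (x : EuclideanSpace ℝ ι) :
    multiDeriv 0 f x = f x := by
  unfold multiDeriv
  have h : Fintype.card (Σ l : ι, Fin ((0 : ι → ℕ) l)) = 0 := by simp
  have key : ∀ (n : ℕ) (_ : n = 0) (v : Fin n → EuclideanSpace ℝ ι),
      iteratedFDeriv ℝ n f x v = f x := by
    rintro n rfl v
    exact iteratedFDeriv_zero_apply v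
  exact key _ h _

theorem multiDeriv_congr {γ : ι → ℕ} {f g : EuclideanSpace ℝ ι → F} {x : EuclideanSpace ℝ ι}
    (h : f =ᶠ[nhds x] g) : multiDeriv γ f x = multiDeriv γ g x := by
  unfold multiDeriv
  rw [(h.iteratedFDeriv ℝ _).eq_of_nhds]

theorem diagMap_single (lam : ι → ℝ) (l : ι) (c : ℝ) :
    diagMap lam (EuclideanSpace.single l c) = lam l • EuclideanSpace.single l c := by
  ext j
  by_cases h : j = l
  · subst h; simp
  · simp [h]

/-- The chain rule for `z ↦ x + (lam_l z_l)`, at an arbitrary point `z`. -/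
theorem multiDeriv_comp_affine {f : EuclideanSpace ℝ ι → F} {x z : EuclideanSpace ℝ ι}
    (lam : ι → ℝ) (γ : ι → ℕ) (hf : ContDiffAt ℝ (∑ l, γ l : ℕ) f (x + diagMap lam z)) :
    multiDeriv γ (fun z => f (x + diagMap lam z)) z =
      (∏ l, lam l ^ γ l) • multiDeriv γ f (x + diagMap lam z) := by
  unfold multiDeriv
  have hk : Fintype.card (Σ l, Fin (γ l)) = ∑ l, γ l := by simp
  have h1 : iteratedFDeriv ℝ (Fintype.card (Σ l, Fin (γ l)))
      ((fun y => f (x + y)) ∘ diagMap lam) z =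
      (iteratedFDeriv ℝ (Fintype.card (Σ l, Fin (γ l))) (fun y => f (x + y))
        (diagMap lam z)).compContinuousLinearMap fun _ => diagMap lam := by
    have hc : ContDiffAt ℝ (Fintype.card (Σ l, Fin (γ l)) : ℕ) (fun y => f (x + y))
        (diagMap lam z) := by
      rw [hk]
      exact ContDiffAt.comp (diagMap lam z) (f := fun y => x + y) hf (by fun_prop)
    obtain ⟨u, hu, hfu⟩ := hc.contDiffOn le_rfl (fun h => absurd h (WithTop.coe_injective.ne (ENat.natCast_ne_top _)))
    obtain ⟨V, hVu, hVo, hxV⟩ := mem_nhds_iff.1 (by simpa using hu)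
    have hVo' : IsOpen (diagMap lam ⁻¹' V) := hVo.preimage (diagMap lam).continuous
    rw [← iteratedFDerivWithin_of_isOpen _ hVo' hxV, ← iteratedFDerivWithin_of_isOpen _ hVo hxV]
    exact (diagMap lam).iteratedFDerivWithin_comp_right ((hfu.mono hVu)) hVo.uniqueDiffOn
      hVo'.uniqueDiffOn hxV le_rfl
  have h2 : (fun z => f (x + diagMap lam z)) = (fun y => f (x + y)) ∘ diagMap lam := rfl
  rw [h2, h1, iteratedFDeriv_comp_add_left]
  simp only [ContinuousMultilinearMap.compContinuousLinearMap_apply, diagMap_single]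
  rw [ContinuousMultilinearMap.map_smul_univ]
  congr 1
  rw [Fintype.prod_equiv (Fintype.equivFin (Σ l, Fin (γ l))).symm _ (fun p => lam p.1)
    (fun _ => rfl), Fintype.prod_sigma]
  simp

end MultiDeriv

/-! ### Anisotropic bounds for derivatives -/

section ScaledBound

variable {ι : Type*} [Fintype ι]

/-- The Leibniz bound at a point, for functions that are only smooth near that point. -/
theorem norm_iteratedFDeriv_mul_le_of_contDiffAt {E : Type*} [NormedAddCommGroup E]
    [NormedSpace ℝ E] {f g : E → ℂ} {x : E} {n : ℕ} (hf : ContDiffAt ℝ n f x)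
    (hg : ContDiffAt ℝ n g x) :
    ‖iteratedFDeriv ℝ n (fun y => f y * g y) x‖ ≤
      ∑ i ∈ Finset.range (n + 1), (n.choose i : ℝ) * ‖iteratedFDeriv ℝ i f x‖ *
        ‖iteratedFDeriv ℝ (n - i) g x‖ := by
  have hn : (n : ℕ∞ω) ≠ ∞ := WithTop.coe_injective.ne (ENat.natCast_ne_top _)
  obtain ⟨U, hU, hfU⟩ := hf.contDiffOn le_rfl (fun h => absurd h hn)
  obtain ⟨V, hV, hgV⟩ := hg.contDiffOn le_rfl (fun h => absurd h hn)
  obtain ⟨W, hW, hWo, hxW⟩ := mem_nhds_iff.1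
    (Filter.inter_mem (by simpa using hU) (by simpa using hV) : U ∩ V ∈ nhds x)
  have h := norm_iteratedFDerivWithin_mul_le (hfU.mono (hW.trans Set.inter_subset_left))
    (hgV.mono (hW.trans Set.inter_subset_right)) hWo.uniqueDiffOn hxW (n := n) le_rfl
  simpa only [iteratedFDerivWithin_of_isOpen _ hWo hxW] using h

/-- Bounds at the point `x`, with the constant `C`, for all derivatives of `u` of order at most `m`
after the anisotropic rescaling `z ↦ x + (lam_l z_l)`. In coordinates, this says that
`(∏ l, |lam l| ^ γ l) * |∂^γ u (x)|` is bounded. A vanishing `lam l` means that nothing is claimed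
about derivatives in the direction `l`. -/
def ScaledBound (u : EuclideanSpace ℝ ι → ℂ) (x : EuclideanSpace ℝ ι) (lam : ι → ℝ) (m : ℕ)
    (C : ℝ) : Prop :=
  ∀ k ≤ m, ‖iteratedFDeriv ℝ k (fun z => u (x + diagMap lam z)) 0‖ ≤ C

namespace ScaledBound

variable {u v : EuclideanSpace ℝ ι → ℂ} {x : EuclideanSpace ℝ ι} {lam lam' : ι → ℝ} {m : ℕ}
  {C C' : ℝ}

theorem nonneg (h : ScaledBound u x lam m C) : 0 ≤ C :=
  (norm_nonneg _).trans (h 0 (Nat.zero_le _))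

theorem mono (h : ScaledBound u x lam m C) (hC : C ≤ C') : ScaledBound u x lam m C' :=
  fun k hk => (h k hk).trans hC

theorem tendsto_affine (x : EuclideanSpace ℝ ι) (lam : ι → ℝ) :
    Filter.Tendsto (fun z => x + diagMap lam z) (nhds 0) (nhds x) := by
  have h : Continuous fun z => x + diagMap lam z := by fun_prop
  simpa using h.tendsto 0

theorem contDiffAt_affine {n : ℕ∞ω} (h : ContDiffAt ℝ n u x) (lam : ι → ℝ) :
    ContDiffAt ℝ n (fun z => u (x + diagMap lam z)) 0 :=
  ContDiffAt.comp (0 : EuclideanSpace ℝ ι) (f := fun z => x + diagMap lam z) (by simpa using h)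
    (by fun_prop)

theorem congr (h : ScaledBound u x lam m C) (huv : u =ᶠ[nhds x] v) :
    ScaledBound v x lam m C := by
  intro k hk
  have h1 : (fun z => v (x + diagMap lam z)) =ᶠ[nhds 0] fun z => u (x + diagMap lam z) :=
    (tendsto_affine x lam).eventually (huv.mono fun _ h => h.symm)
  rw [(h1.iteratedFDeriv ℝ k).eq_of_nhds]
  exact h k hk

theorem const (c : ℂ) : ScaledBound (fun _ => c) x lam m ‖c‖ := by
  intro k _
  rcases Nat.eq_zero_or_pos k with rfl | hk
  · simp
  · rw [iteratedFDeriv_const_of_ne hk.ne']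
    simp

theorem add (hu : ContDiffAt ℝ ∞ u x) (hv : ContDiffAt ℝ ∞ v x)
    (h : ScaledBound u x lam m C) (h' : ScaledBound v x lam m C') :
    ScaledBound (fun y => u y + v y) x lam m (C + C') := by
  intro k hk
  have e := iteratedFDeriv_add_apply (i := k)
    ((contDiffAt_affine hu lam).of_le (by exact_mod_cast le_top))
    ((contDiffAt_affine hv lam).of_le (by exact_mod_cast le_top))
  have e' : (fun z => u (x + diagMap lam z) + v (x + diagMap lam z)) =
    (fun z => u (x + diagMap lam z)) + fun z => v (x + diagMap lam z) := rfl
  rw [e', e]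
  exact (norm_add_le _ _).trans (add_le_add (h k hk) (h' k hk))

theorem mul (hu : ContDiffAt ℝ ∞ u x) (hv : ContDiffAt ℝ ∞ v x)
    (h : ScaledBound u x lam m C) (h' : ScaledBound v x lam m C') :
    ScaledBound (fun y => u y * v y) x lam m (2 ^ m * (C * C')) := by
  intro k hk
  have hC := h.nonneg
  have hC' := h'.nonneg
  refine (norm_iteratedFDeriv_mul_le_of_contDiffAt
    ((contDiffAt_affine hu lam).of_le (by exact_mod_cast le_top))
    ((contDiffAt_affine hv lam).of_le (by exact_mod_cast le_top))).trans ?_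
  calc _ ≤ ∑ i ∈ Finset.range (k + 1), (k.choose i : ℝ) * (C * C') := by
        refine Finset.sum_le_sum fun i hi => ?_
        rw [mul_assoc]
        have h1 := h i (by simp at hi; omega)
        have h2 := h' (k - i) (by omega)
        gcongr
    _ = 2 ^ k * (C * C') := by
        rw [← Finset.sum_mul]
        congr 1
        exact_mod_cast Nat.sum_range_choose k
    _ ≤ 2 ^ m * (C * C') := by
        gcongr
        norm_num

theorem prod {κ : Type*} (s : Finset κ) {f : κ → EuclideanSpace ℝ ι → ℂ} {c : κ → ℝ}
    (hf : ∀ i ∈ s, ContDiffAt ℝ ∞ (f i) x) (h : ∀ i ∈ s, ScaledBound (f i) x lam m (c i)) :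
    ScaledBound (fun y => ∏ i ∈ s, f i y) x lam m ((2 ^ m) ^ s.card * ∏ i ∈ s, c i) := by
  classical
  induction s using Finset.induction_on with
  | empty => simpa using const (x := x) (lam := lam) (m := m) 1
  | insert a s ha ih =>
    have h1 := ih (fun i hi => hf i (Finset.mem_insert_of_mem hi))
      (fun i hi => h i (Finset.mem_insert_of_mem hi))
    have h2 := mul (hf a (Finset.mem_insert_self _ _))
      (contDiffAt_prod fun i hi => hf i (Finset.mem_insert_of_mem hi))
      (h a (Finset.mem_insert_self _ _)) h1
    have e : (fun y => ∏ i ∈ insert a s, f i y) = fun y => f a y * ∏ i ∈ s, f i y := by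
      funext y; rw [Finset.prod_insert ha]
    rw [e, Finset.card_insert_of_notMem ha, Finset.prod_insert ha]
    convert h2 using 1
    ring

/-- A function of the single coordinate `y_l` is only affected by the scale `lam_l`. -/
theorem oneVar {h : ℝ → ℂ} (hh : ContDiff ℝ ∞ h) (l : ι)
    (hC : ∀ k ≤ m, |lam l| ^ k * ‖iteratedDeriv k h (x l)‖ ≤ C) :
    ScaledBound (fun y => h (y l)) x lam m C := by
  intro k hk
  set p : EuclideanSpace ℝ ι →L[ℝ] ℝ := lam l • (EuclideanSpace.proj l) with hp
  have e : (fun z => h ((x + diagMap lam z) l)) = (fun t => h (x l + t)) ∘ p := by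
    funext z; simp [hp]
  rw [e, p.iteratedFDeriv_comp_right (n := ∞) (by fun_prop) _ (by exact_mod_cast le_top)]
  refine (ContinuousMultilinearMap.norm_compContinuousLinearMap_le _ _).trans ?_
  rw [iteratedFDeriv_comp_add_left]
  simp only [map_zero, add_zero, norm_iteratedFDeriv_eq_norm_iteratedDeriv, Finset.prod_const,
    Finset.card_univ, Fintype.card_fin]
  refine le_trans ?_ (hC k hk)
  rw [mul_comm]
  gcongr
  refine ContinuousLinearMap.opNorm_le_bound _ (abs_nonneg _) fun z => ?_
  simp only [hp, smul_apply, norm_smul, Real.norm_eq_abs]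
  gcongr
  exact PiLp.norm_apply_le z l

theorem norm_diagMap_le {q : ι → ℝ} {c : ℝ} (hc : 0 ≤ c) (h : ∀ l, |q l| ≤ c) :
    ‖diagMap q‖ ≤ c := by
  refine ContinuousLinearMap.opNorm_le_bound _ hc fun z => ?_
  rw [EuclideanSpace.norm_eq, EuclideanSpace.norm_eq, ← Real.sqrt_sq hc,
    ← Real.sqrt_mul (sq_nonneg c)]
  refine Real.sqrt_le_sqrt ?_
  rw [Finset.mul_sum]
  refine Finset.sum_le_sum fun l _ => ?_
  rw [diagMap_apply, norm_mul, mul_pow]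
  gcongr
  exact h l

/-- The scales may be decreased, or increased by a bounded factor. In particular, they may be replaced
by `0` in directions in which no information is needed. -/
theorem mono_scale (hu : ContDiffAt ℝ ∞ u x) (h : ScaledBound u x lam m C) {c : ℝ} (hc : 1 ≤ c)
    (hlam : ∀ l, |lam' l| ≤ c * |lam l|) : ScaledBound u x lam' m (C * c ^ m) := by
  intro k hk
  set q : ι → ℝ := fun l => lam' l / lam l with hq
  have hql : ∀ l, |q l| ≤ c := by
    intro l
    rw [hq, abs_div]
    exact div_le_of_le_mul₀ (abs_nonneg _) (by linarith) (hlam l)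
  have hmul : ∀ l, lam' l = lam l * q l := by
    intro l
    rcases eq_or_ne (lam l) 0 with h0 | h0
    · have := hlam l
      rw [h0, abs_zero, mul_zero] at this
      rw [h0, zero_mul]
      exact abs_nonpos_iff.1 this
    · rw [hq]; field_simp
  have e : (fun z => u (x + diagMap lam' z)) = (fun z => u (x + diagMap lam z)) ∘ diagMap q := by
    funext z
    simp only [Function.comp]
    congr 2
    ext l
    simp only [diagMap_apply, hmul]
    ring
  have hs : ContDiffAt ℝ k (fun z => u (x + diagMap lam z)) 0 :=
    (contDiffAt_affine hu lam).of_le (by exact_mod_cast le_top)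
  have hn : (k : ℕ∞ω) ≠ ∞ := WithTop.coe_injective.ne (ENat.natCast_ne_top _)
  obtain ⟨U, hU, hfU⟩ := hs.contDiffOn le_rfl (fun h => absurd h hn)
  obtain ⟨V, hVU, hVo, hxV⟩ := mem_nhds_iff.1 (by simpa using hU)
  have hVo' : IsOpen (diagMap q ⁻¹' V) := hVo.preimage (diagMap q).continuous
  have hx' : (0 : EuclideanSpace ℝ ι) ∈ diagMap q ⁻¹' V := by simpa using hxV
  have e2 : iteratedFDeriv ℝ k ((fun z => u (x + diagMap lam z)) ∘ diagMap q) 0 =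
      (iteratedFDeriv ℝ k (fun z => u (x + diagMap lam z)) 0).compContinuousLinearMap
        fun _ => diagMap q := by
    rw [← iteratedFDerivWithin_of_isOpen _ hVo' hx', ← iteratedFDerivWithin_of_isOpen _ hVo hxV]
    have := (diagMap q).iteratedFDerivWithin_comp_right ((hfU.mono hVU)) hVo.uniqueDiffOn
      hVo'.uniqueDiffOn hx' le_rfl
    simpa using this
  rw [e, e2]
  refine (ContinuousMultilinearMap.norm_compContinuousLinearMap_le _ _).trans ?_
  simp only [Finset.prod_const, Finset.card_univ, Fintype.card_fin]
  have h1 : ‖diagMap q‖ ^ k ≤ c ^ m :=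
    (pow_le_pow_left₀ (norm_nonneg _) (norm_diagMap_le (by linarith) hql) k).trans
      (pow_le_pow_right₀ hc hk)
  exact mul_le_mul (h k hk) h1 (by positivity) h.nonneg

variable [DecidableEq ι]

/-- Bounds for the partial derivatives imply a scaled bound. -/
theorem of_multiDeriv (hu : ContDiffAt ℝ ∞ u x)
    (h : ∀ γ : ι → ℕ, ∑ l, γ l ≤ m → (∏ l, |lam l| ^ γ l) * ‖multiDeriv γ u x‖ ≤ C) :
    ScaledBound u x lam m ((Fintype.card ι + 1 : ℝ) ^ m * C) := by
  intro k hk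
  have hC : 0 ≤ C := (by positivity : (0:ℝ) ≤ _).trans (h 0 (by simp))
  have h1 : ‖iteratedFDeriv ℝ k (fun z => u (x + diagMap lam z)) 0‖ ≤
      (Fintype.card ι : ℝ) ^ k * C := by
    refine norm_iteratedFDeriv_le_of_multiDeriv
      ((contDiffAt_affine hu lam).of_le (by exact_mod_cast le_top)) fun γ hγ => ?_
    rw [multiDeriv_comp_affine lam γ (by
      simpa using hu.of_le (by exact_mod_cast le_top)), norm_smul, norm_prod]
    simpa using h γ (hγ.le.trans hk)
  refine h1.trans ?_
  have h2 : (Fintype.card ι : ℝ) ^ k ≤ (Fintype.card ι + 1 : ℝ) ^ m :=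
    (pow_le_pow_left₀ (by positivity) (by linarith) k).trans
      (pow_le_pow_right₀ (by linarith [(Nat.cast_nonneg (Fintype.card ι) : (0:ℝ) ≤ _)]) hk)
  gcongr

/-- A scaled bound implies bounds for the partial derivatives. -/
theorem multiDeriv_le (hu : ContDiffAt ℝ ∞ u x) (h : ScaledBound u x lam m C) {γ : ι → ℕ}
    (hγ : ∑ l, γ l ≤ m) : (∏ l, |lam l| ^ γ l) * ‖multiDeriv γ u x‖ ≤ C := by
  refine le_trans (le_of_eq ?_) ((norm_multiDeriv_le γ _ _).trans (h _ hγ))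
  rw [multiDeriv_comp_affine lam γ (by
      simpa using hu.of_le (by exact_mod_cast le_top)), norm_smul, norm_prod]
  simp

end ScaledBound

end ScaledBound

/-! ### Fourier transforms and partial derivatives -/

section Fourier

variable {ι : Type*} [Fintype ι] [DecidableEq ι]

/-- A product over the list of directions encoded by the multi-index `γ` in `multiDeriv`. -/
theorem prod_multiIndex {ι M : Type*} [Fintype ι] [CommMonoid M] (γ : ι → ℕ) (c : ι → M) :
    ∏ i, c ((Fintype.equivFin (Σ l, Fin (γ l))).symm i).1 = ∏ l, c l ^ γ l := by
  rw [Fintype.prod_equiv (Fintype.equivFin (Σ l, Fin (γ l))).symm _ (fun p => c p.1)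
    (fun _ => rfl), Fintype.prod_sigma]
  simp

theorem fourier_multiDeriv {u : EuclideanSpace ℝ ι → ℂ} (hu : ContDiff ℝ ∞ u)
    (hi : ∀ k : ℕ, Integrable (iteratedFDeriv ℝ k u)) (γ : ι → ℕ) (ξ : EuclideanSpace ℝ ι) :
    𝓕 (multiDeriv γ u) ξ = (∏ l, (2 * Real.pi * Complex.I * ξ l) ^ γ l) * 𝓕 u ξ := by
  have h1 := congrFun (Real.fourier_iteratedFDeriv (N := ⊤) hu (fun n _ => hi n)
    (n := Fintype.card (Σ l, Fin (γ l))) le_top) ξ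
  have h2 := congrArg (fun T : ContinuousMultilinearMap ℝ
    (fun _ : Fin (Fintype.card (Σ l, Fin (γ l))) => EuclideanSpace ℝ ι) ℂ =>
      T (fun i => EuclideanSpace.single ((Fintype.equivFin (Σ l, Fin (γ l))).symm i).1 (1 : ℝ))) h1
  beta_reduce at h2
  rw [Real.fourier_continuousMultilinearMap_apply (hi _)] at h2
  have h3 : multiDeriv γ u = fun x => iteratedFDeriv ℝ (Fintype.card (Σ l, Fin (γ l))) u x
      (fun i => EuclideanSpace.single ((Fintype.equivFin (Σ l, Fin (γ l))).symm i).1 (1 : ℝ)) :=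
    rfl
  rw [h3, h2, VectorFourier.fourierPowSMulRight_apply]
  have h4 : ∀ i, ((-innerSL ℝ) ξ : EuclideanSpace ℝ ι →L[ℝ] ℝ) (EuclideanSpace.single
      ((Fintype.equivFin (Σ l, Fin (γ l))).symm i).1 (1 : ℝ)) =
      -ξ ((Fintype.equivFin (Σ l, Fin (γ l))).symm i).1 := by
    intro i
    simp [EuclideanSpace.inner_single_right]
  simp only [h4]
  rw [prod_multiIndex γ (fun l => -ξ l)]
  have h5 : (-(2 * Real.pi * Complex.I)) ^ Fintype.card (Σ l, Fin (γ l)) =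
      ∏ l, (-(2 * Real.pi * Complex.I)) ^ γ l := by
    rw [Finset.prod_pow_eq_pow_sum]; simp
  rw [h5, smul_eq_mul, Complex.real_smul, Complex.ofReal_prod, ← mul_assoc,
    ← Finset.prod_mul_distrib]
  congr 1
  refine Finset.prod_congr rfl fun l _ => ?_
  push_cast
  rw [← mul_pow]
  ring

theorem multiDeriv_fourier {h : EuclideanSpace ℝ ι → ℂ}
    (hi : ∀ k : ℕ, Integrable fun x => ‖x‖ ^ k * ‖h x‖) (hm : AEStronglyMeasurable h volume)
    (γ : ι → ℕ) (ξ : EuclideanSpace ℝ ι) :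
    multiDeriv γ (𝓕 h) ξ = 𝓕 (fun x => (∏ l, (-(2 * Real.pi * Complex.I) * x l) ^ γ l) * h x) ξ := by
  unfold multiDeriv
  rw [congrFun (Real.iteratedFDeriv_fourier (N := ⊤) (fun n _ => hi n) hm le_top) ξ,
    Real.fourier_continuousMultilinearMap_apply
      (VectorFourier.integrable_fourierPowSMulRight _ (hi _) hm)]
  refine congrFun (congrArg 𝓕 (funext fun x => ?_)) ξ
  rw [VectorFourier.fourierPowSMulRight_apply]
  have h4 : ∀ i, ((innerSL ℝ) x : EuclideanSpace ℝ ι →L[ℝ] ℝ) (EuclideanSpace.single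
      ((Fintype.equivFin (Σ l, Fin (γ l))).symm i).1 (1 : ℝ)) =
      x ((Fintype.equivFin (Σ l, Fin (γ l))).symm i).1 := by
    intro i
    simp [EuclideanSpace.inner_single_right]
  simp only [h4]
  rw [prod_multiIndex γ (fun l => x l)]
  have h5 : (-(2 * Real.pi * Complex.I)) ^ Fintype.card (Σ l, Fin (γ l)) =
      ∏ l, (-(2 * Real.pi * Complex.I)) ^ γ l := by
    rw [Finset.prod_pow_eq_pow_sum]; simp
  rw [h5, smul_eq_mul, Complex.real_smul, Complex.ofReal_prod, ← mul_assoc,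
    ← Finset.prod_mul_distrib]
  congr 1
  refine Finset.prod_congr rfl fun l _ => ?_
  push_cast
  rw [← mul_pow]

theorem integrable_iteratedFDeriv_of_hasCompactSupport {E : Type*} [NormedAddCommGroup E]
    [NormedSpace ℝ E] [MeasurableSpace E] [BorelSpace E] {μ : Measure E}
    [IsFiniteMeasureOnCompacts μ] {u : E → ℂ}
    (hu : ContDiff ℝ ∞ u) (hc : HasCompactSupport u) (k : ℕ) :
    Integrable (iteratedFDeriv ℝ k u) μ :=
  (hu.continuous_iteratedFDeriv (by exact_mod_cast le_top)).integrable_of_hasCompactSupport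
    (hc.iteratedFDeriv k)

/-- The integral of the Cauchy weight does not depend on the scale `a`. -/
theorem integral_cauchy_scaled {a : ℝ} (ha : 0 < a) :
    Integrable (fun t : ℝ => a * (1 + (a * t) ^ 2)⁻¹) ∧
      ∫ t : ℝ, a * (1 + (a * t) ^ 2)⁻¹ = Real.pi := by
  constructor
  · exact (integrable_inv_one_add_sq.comp_mul_left' ha.ne').const_mul a
  · rw [integral_const_mul, Measure.integral_comp_mul_left (fun t => (1 + t ^ 2)⁻¹) a,
      integral_univ_inv_one_add_sq, abs_of_pos (inv_pos.2 ha), smul_eq_mul]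
    field_simp

omit [DecidableEq ι] in
/-- The weight `∏_l a_l / (1 + (a_l x_l)²)` has an integral that does not depend on the
scales `a_l`. -/
theorem integral_prod_cauchy_scaled {a : ι → ℝ} (ha : ∀ l, 0 < a l) :
    Integrable (fun x : EuclideanSpace ℝ ι => ∏ l, (a l * (1 + (a l * x l) ^ 2)⁻¹)) ∧
      ∫ x : EuclideanSpace ℝ ι, ∏ l, (a l * (1 + (a l * x l) ^ 2)⁻¹) =
        Real.pi ^ Fintype.card ι := by
  have hp := EuclideanSpace.volume_preserving_symm_measurableEquiv_toLp ι
  constructor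
  · refine (hp.integrable_comp_emb (MeasurableEquiv.measurableEmbedding _)
      (g := fun x : ι → ℝ => ∏ l, (a l * (1 + (a l * x l) ^ 2)⁻¹))).2 ?_
    exact Integrable.fintype_prod (f := fun l t => a l * (1 + (a l * t) ^ 2)⁻¹)
      fun l => (integral_cauchy_scaled (ha l)).1
  · refine (hp.integral_comp (MeasurableEquiv.measurableEmbedding _)
      (fun x : ι → ℝ => ∏ l, (a l * (1 + (a l * x l) ^ 2)⁻¹))).trans ?_
    have h := integral_fintype_prod_eq_prod (𝕜 := ℝ) (ι := ι)
      (fun l t => a l * (1 + (a l * t) ^ 2)⁻¹) (μ := fun _ => volume)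
    refine h.trans ?_
    simp [fun l => (integral_cauchy_scaled (ha l)).2]

/-- Integration by parts `M` times in each of the coordinate directions in `P`. -/
theorem norm_fourier_le_of_multiDeriv {u : EuclideanSpace ℝ ι → ℂ} (hu : ContDiff ℝ ∞ u)
    (hc : HasCompactSupport u) (P : Finset ι) (M : ℕ) {a : ι → ℝ} (ha : ∀ l, 0 < a l)
    {ξ : EuclideanSpace ℝ ι} {C : ℝ} (hξ : ∀ l ∈ P, ξ l ≠ 0)
    (h : ∀ x, ‖multiDeriv (fun l => if l ∈ P then M else 0) u x‖ ≤
      C * (∏ l ∈ P, |ξ l| ^ M) * ∏ l, (a l * (1 + (a l * x l) ^ 2)⁻¹)) :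
    ‖𝓕 u ξ‖ ≤ C * Real.pi ^ Fintype.card ι := by
  set α : ι → ℕ := fun l => if l ∈ P then M else 0 with hα
  have h1 := fourier_multiDeriv hu (integrable_iteratedFDeriv_of_hasCompactSupport hu hc) α ξ
  have hprod : ∏ l ∈ P, |ξ l| ^ M ≤ ‖∏ l, (2 * Real.pi * Complex.I * ξ l) ^ α l‖ := by
    have e : ∏ l, (2 * Real.pi * Complex.I * ξ l) ^ α l =
        ∏ l ∈ P, (2 * Real.pi * Complex.I * (ξ l : ℂ)) ^ M := by
      simp only [hα, pow_ite, pow_zero]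
      rw [Finset.prod_ite_mem, Finset.univ_inter]
    rw [e, norm_prod]
    refine Finset.prod_le_prod (fun l _ => by positivity) fun l _ => ?_
    rw [norm_pow]
    refine pow_le_pow_left₀ (abs_nonneg _) ?_ _
    simp only [norm_mul, Complex.norm_ofNat, Complex.norm_real, Complex.norm_I, mul_one,
      Real.norm_eq_abs, abs_of_pos Real.pi_pos]
    nlinarith [abs_nonneg (ξ l), Real.pi_gt_three]
  have hpos : 0 < ∏ l ∈ P, |ξ l| ^ M :=
    Finset.prod_pos fun l hl => pow_pos (abs_pos.2 (hξ l hl)) _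
  have h2 : ‖𝓕 (multiDeriv α u) ξ‖ ≤ C * (∏ l ∈ P, |ξ l| ^ M) * Real.pi ^ Fintype.card ι := by
    rw [Real.fourier_eq]
    refine (norm_integral_le_integral_norm _).trans ?_
    rw [← (integral_prod_cauchy_scaled ha).2, ← integral_const_mul]
    refine integral_mono_of_nonneg (Filter.Eventually.of_forall fun x => norm_nonneg _)
      ((integral_prod_cauchy_scaled ha).1.const_mul _) (Filter.Eventually.of_forall fun x => ?_)
    simpa using h x
  rw [h1, norm_mul] at h2
  have h3 : (∏ l ∈ P, |ξ l| ^ M) * ‖𝓕 u ξ‖ ≤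
      (∏ l ∈ P, |ξ l| ^ M) * (C * Real.pi ^ Fintype.card ι) := by
    calc _ ≤ _ := mul_le_mul_of_nonneg_right hprod (norm_nonneg _)
      _ ≤ _ := h2
      _ = _ := by ring
  exact le_of_mul_le_mul_left h3 hpos

end Fourier

/-! ### Limits of smooth functions -/

/-- A sequence of smooth functions whose consecutive differences decrease geometrically, locally
uniformly on the open set `U` and together with all derivatives, converges on `U` to a smooth
function, and so do all derivatives. -/
theorem exists_contDiffOn_limit {E : Type*} [NormedAddCommGroup E] [NormedSpace ℝ E] {U : Set E}
    (hU : IsOpen U) {v : ℕ → E → ℂ} (hv : ∀ s, ContDiff ℝ ∞ (v s)) {r : ℝ} (hr : 0 ≤ r)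
    (hr1 : r < 1)
    (h : ∀ k : ℕ, ∀ x ∈ U, ∃ B : ℝ, ∀ᶠ y in nhds x, ∀ s : ℕ,
      ‖iteratedFDeriv ℝ k (v (s + 1)) y - iteratedFDeriv ℝ k (v s) y‖ ≤ B * r ^ s) :
    ∃ g : E → ℂ, ContDiffOn ℝ ∞ g U ∧ ∀ k : ℕ, ∀ x ∈ U,
      Filter.Tendsto (fun s => iteratedFDeriv ℝ k (v s) x) Filter.atTop
        (nhds (iteratedFDeriv ℝ k g x)) := by
  have hconv : ∀ k : ℕ, ∀ x ∈ U, ∃ G, Filter.Tendsto (fun s => iteratedFDeriv ℝ k (v s) x)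
      Filter.atTop (nhds G) := by
    intro k x hx
    obtain ⟨B, hB⟩ := h k x hx
    refine cauchySeq_tendsto_of_complete
      (cauchySeq_of_le_geometric r B hr1 fun s => ?_)
    rw [dist_comm, dist_eq_norm]
    exact hB.self_of_nhds s
  choose! G hG using hconv
  have hunif : ∀ k : ℕ, TendstoLocallyUniformlyOn (fun s => iteratedFDeriv ℝ k (v s))
      (G k) Filter.atTop U := by
    intro k
    rw [Metric.tendstoLocallyUniformlyOn_iff]
    intro ε hε x hx
    obtain ⟨B, hB⟩ := h k x hx
    refine ⟨{y | ∀ s : ℕ, ‖iteratedFDeriv ℝ k (v (s + 1)) y - iteratedFDeriv ℝ k (v s) y‖ ≤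
      B * r ^ s} ∩ U, mem_nhdsWithin_of_mem_nhds (Filter.inter_mem hB (hU.mem_nhds hx)), ?_⟩
    have hlim : Filter.Tendsto (fun s : ℕ => B * r ^ s / (1 - r)) Filter.atTop (nhds 0) := by
      have := ((tendsto_pow_atTop_nhds_zero_of_lt_one hr hr1).const_mul B).div_const (1 - r)
      simpa using this
    filter_upwards [hlim.eventually (gt_mem_nhds hε)] with s hs y hy
    rw [dist_comm]
    refine lt_of_le_of_lt ?_ hs
    refine dist_le_of_le_geometric_of_tendsto r B hr1 (fun s => ?_) (hG k y hy.2) s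
    rw [dist_comm, dist_eq_norm]
    exact hy.1 s
  have hcont : ∀ k : ℕ, ContinuousOn (G k) U := fun k =>
    (hunif k).continuousOn (Filter.Frequently.of_forall fun s =>
      ((hv s).continuous_iteratedFDeriv (by exact_mod_cast le_top)).continuousOn)
  have hder : ∀ k : ℕ, ∀ x ∈ U, HasFDerivAt (G k) (G (k + 1) x).curryLeft x := by
    intro k x hx
    have h1 : TendstoLocallyUniformlyOn (fun s y => fderiv ℝ (iteratedFDeriv ℝ k (v s)) y)
        (fun y => (G (k + 1) y).curryLeft) Filter.atTop U := by
      have h2 := (continuousMultilinearCurryLeftEquiv ℝ (fun _ : Fin (k + 1) => E)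
        ℂ).isometry.uniformContinuous.comp_tendstoLocallyUniformlyOn (hunif (k + 1))
      have h3 : ∀ s, fderiv ℝ (iteratedFDeriv ℝ k (v s)) =
          continuousMultilinearCurryLeftEquiv ℝ (fun _ : Fin (k + 1) => E) ℂ ∘
            iteratedFDeriv ℝ (k + 1) (v s) := fun s => fderiv_iteratedFDeriv
      simp only [h3]
      exact h2
    refine hasFDerivAt_of_tendstoLocallyUniformlyOn hU h1 (fun s y _ => ?_) (fun y hy => hG k y hy)
      hx
    exact (((hv s).differentiable_iteratedFDeriv (m := k)
      (by exact_mod_cast ENat.natCast_lt_top k)) y).hasFDerivAt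
  let p : E → FormalMultilinearSeries ℝ E ℂ := fun x k => G k x
  have hT : HasFTaylorSeriesUpToOn ∞ (fun x => G 0 x 0) p U := by
    refine ⟨fun x hx => rfl, fun k _ x hx => (hder k x hx).hasFDerivWithinAt, fun k _ => hcont k⟩
  refine ⟨fun x => G 0 x 0, hT.contDiffOn, fun k x hx => ?_⟩
  have := hT.eq_iteratedFDerivWithin_of_uniqueDiffOn (m := k) (by exact_mod_cast le_top)
    hU.uniqueDiffOn hx
  rw [← iteratedFDerivWithin_of_isOpen k hU hx, ← this]
  exact hG k x hx

/-! ### Differentiation under the integral sign -/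

/-- Differentiation under the integral sign, to all orders. -/
theorem contDiff_integral_param {E Ω : Type*} [NormedAddCommGroup E] [NormedSpace ℝ E]
    [MeasurableSpace Ω] {μ : Measure Ω} {F : E → Ω → ℂ}
    (hF : ∀ t, ContDiff ℝ ∞ fun x => F x t)
    (hm : ∀ (k : ℕ) (x : E), AEStronglyMeasurable
      (fun t => iteratedFDeriv ℝ k (fun x => F x t) x) μ)
    {w : Ω → ℝ} (hw : Integrable w μ) {B : ℕ → ℝ}
    (hB : ∀ (k : ℕ) (x : E) (t : Ω), ‖iteratedFDeriv ℝ k (fun x => F x t) x‖ ≤ B k * w t) :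
    ContDiff ℝ ∞ (fun x => ∫ t, F x t ∂μ) ∧ ∀ (k : ℕ) (x : E),
      iteratedFDeriv ℝ k (fun x => ∫ t, F x t ∂μ) x =
        ∫ t, iteratedFDeriv ℝ k (fun x => F x t) x ∂μ := by
  have hint : ∀ (k : ℕ) (x : E), Integrable (fun t => iteratedFDeriv ℝ k (fun x => F x t) x) μ :=
    fun k x => (hw.const_mul (B k)).mono' (hm k x) (Filter.Eventually.of_forall fun t => hB k x t)
  let p : E → FormalMultilinearSeries ℝ E ℂ := fun x k =>
    ∫ t, iteratedFDeriv ℝ k (fun x => F x t) x ∂μ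
  have hder : ∀ (k : ℕ) (x : E), HasFDerivAt (fun x => p x k) (p x (k + 1)).curryLeft x := by
    intro k x
    let Φ := continuousMultilinearCurryLeftEquiv ℝ (fun _ : Fin (k + 1) => E) ℂ
    have h3 : ∀ t, fderiv ℝ (iteratedFDeriv ℝ k (fun x => F x t)) =
        Φ ∘ iteratedFDeriv ℝ (k + 1) (fun x => F x t) := fun t => fderiv_iteratedFDeriv
    have h4 : (p x (k + 1)).curryLeft =
        ∫ t, fderiv ℝ (iteratedFDeriv ℝ k (fun x => F x t)) x ∂μ := by
      simp only [h3, Function.comp]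
      have := ContinuousLinearMap.integral_comp_comm (𝕜 := ℝ) (E := E [×(k + 1)]→L[ℝ] ℂ)
        (Fₗ := E →L[ℝ] E [×k]→L[ℝ] ℂ) Φ.toContinuousLinearEquiv.toContinuousLinearMap
        (hint (k + 1) x)
      exact this.symm
    rw [h4]
    refine hasFDerivAt_integral_of_dominated_of_fderiv_le (bound := fun t => B (k + 1) * w t)
      (F := fun x t => iteratedFDeriv ℝ k (fun x => F x t) x)
      (F' := fun x t => fderiv ℝ (iteratedFDeriv ℝ k fun x => F x t) x)
      (s := Set.univ) Filter.univ_mem (Filter.Eventually.of_forall fun y => hm k y) (hint k x) ?_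
      (Filter.Eventually.of_forall fun t y _ => ?_) (hw.const_mul _)
      (Filter.Eventually.of_forall fun t y _ => ?_)
    · simp only [h3, Function.comp]
      exact Φ.continuous.comp_aestronglyMeasurable (hm (k + 1) x)
    · rw [h3, Function.comp, LinearIsometryEquiv.norm_map]
      exact hB (k + 1) y t
    · exact ((hF t).differentiable_iteratedFDeriv (m := k)
        (by exact_mod_cast ENat.natCast_lt_top k) y).hasFDerivAt
  have hT : HasFTaylorSeriesUpToOn ∞ (fun x => ∫ t, F x t ∂μ) p Set.univ := by
    refine ⟨fun x _ => ?_, fun k _ x _ => (hder k x).hasFDerivWithinAt, fun k _ x _ =>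
      (hder k x).continuousAt.continuousWithinAt⟩
    have h1 := (continuousMultilinearCurryFin0 ℝ E
      ℂ).toContinuousLinearEquiv.toContinuousLinearMap.integral_comp_comm (hint 0 x)
    refine Eq.trans ?_ (h1.symm.trans ?_)
    · rfl
    · exact integral_congr_ae (Filter.Eventually.of_forall fun t => rfl)
  refine ⟨contDiffOn_univ.1 hT.contDiffOn, fun k x => ?_⟩
  have := hT.eq_iteratedFDerivWithin_of_uniqueDiffOn (m := k) (by exact_mod_cast le_top)
    uniqueDiffOn_univ (Set.mem_univ x)
  rw [← iteratedFDerivWithin_univ, ← this]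

/-! ### The oscillatory integral estimate -/

/-- The oscillatory integral estimate behind both halves of the duality. The directions in `P` are
those in which the frequency `ξ` is not small compared with the scales `a`. Where `u` does not
vanish, one derivative in the direction `k ∈ P` gains the factor `a_k / ρ_k`, and the product of
the numbers `ρ_k` controls all the rescaled variables `a_l x_l`. Repeated integration by parts in
the directions in `P` therefore makes the rescaled integral converge absolutely. -/
theorem exists_norm_fourier_le {ι : Type*} [Fintype ι] [DecidableEq ι] {c C C₀ C₁ : ℝ}
    (hc : 0 < c) (hc1 : c ≤ 1) (hC : 1 ≤ C) {M : ℕ} (hM : C₁ * (C₀ + 2) ≤ M)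
    (hC₀ : 0 ≤ C₀) (hC₁ : 0 ≤ C₁) :
    ∃ C' : ℝ, 0 ≤ C' ∧ ∀ (u : EuclideanSpace ℝ ι → ℂ) (P : Finset ι) (a : ι → ℝ) (W : ℝ)
      (ξ : EuclideanSpace ℝ ι), ContDiff ℝ ∞ u → HasCompactSupport u → (∀ l, 0 < a l) → 0 ≤ W →
      (∀ k ∈ P, c * a k ≤ |ξ k|) →
      (∀ x, u =ᶠ[nhds x] 0 ∨ ∃ ρ : ι → ℝ, (∀ k ∈ P, c ≤ ρ k) ∧
        ∏ l, (1 + |a l * x l|) ≤ C * ∏ k ∈ P, ρ k ^ C₁ ∧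
        ScaledBound u x (fun l => if l ∈ P then ρ l / a l else 0) (M * Fintype.card ι)
          (C * W * (∏ l, a l) * (∏ l, (1 + |a l * x l|)) ^ C₀)) →
      ‖𝓕 u ξ‖ ≤ C' * W := by
  set n := Fintype.card ι with hn
  refine ⟨C * C ^ (C₀ + 2) * (c⁻¹ ^ (M * n)) * (c⁻¹ ^ (M * n)) * Real.pi ^ n, by positivity, ?_⟩
  intro u P a W ξ hu hcs ha hW hξ h
  have hPn : P.card ≤ n := Finset.card_le_univ P
  have hci : 1 ≤ c⁻¹ := (one_le_inv₀ hc).2 hc1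
  have key : ‖𝓕 u ξ‖ ≤ (C * C ^ (C₀ + 2) * (c⁻¹ ^ (M * n)) * (c⁻¹ ^ (M * n)) * W) *
      Real.pi ^ Fintype.card ι := by
    -- `M` integrations by parts in each of the directions in `P`, where `ξ k` does not vanish
    refine norm_fourier_le_of_multiDeriv hu hcs P M ha (fun l hl h0 => ?_) fun x => ?_
    · have := hξ l hl
      rw [h0, abs_zero] at this
      nlinarith [ha l]
    rcases h x with h0 | ⟨ρ, hρ, hH, hSB⟩
    · have : multiDeriv (fun l => if l ∈ P then M else 0) u x = 0 := by
        rw [multiDeriv_congr h0]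
        unfold multiDeriv
        have e : (0 : EuclideanSpace ℝ ι → ℂ) = fun _ => 0 := rfl
        rw [e, iteratedFDeriv_fun_zero]
        simp
      rw [this, norm_zero]
      have h1 : ∀ l, 0 ≤ a l * (1 + (a l * x l) ^ 2)⁻¹ := fun l => by
        have := (ha l).le
        positivity
      have h2 := Finset.prod_nonneg (s := Finset.univ) fun l _ => h1 l
      positivity
    · set H := ∏ l, (1 + |a l * x l|) with hHdef
      have hH1 : 0 < H := Finset.prod_pos fun l _ => by positivity
      set X := ∏ l, a l with hXdef
      have hX : 0 < X := Finset.prod_pos fun l _ => ha l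
      have hρ0 : ∀ k ∈ P, 0 < ρ k := fun k hk => hc.trans_le (hρ k hk)
      have h1 := hSB.multiDeriv_le hu.contDiffAt
        (γ := fun l => if l ∈ P then M else 0) (by
          rw [Finset.sum_ite_mem, Finset.univ_inter, Finset.sum_const, smul_eq_mul, mul_comm]
          exact Nat.mul_le_mul_left _ hPn)
      have h2 : (∏ l, |(fun l => if l ∈ P then ρ l / a l else 0) l| ^
          (fun l => if l ∈ P then M else 0) l) = (∏ k ∈ P, ρ k ^ M) / ∏ k ∈ P, a k ^ M := by
        rw [← Finset.prod_div_distrib]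
        have : ∀ l, |(fun l => if l ∈ P then ρ l / a l else 0) l| ^
            (fun l => if l ∈ P then M else 0) l =
            if l ∈ P then ρ l ^ M / a l ^ M else 1 := by
          intro l
          by_cases hl : l ∈ P
          · simp only [hl, if_true]
            rw [abs_of_pos (div_pos (hρ0 l hl) (ha l)), div_pow]
          · simp [hl]
        simp only [this]
        rw [Finset.prod_ite_mem, Finset.univ_inter]
      rw [h2] at h1
      set D := ‖multiDeriv (fun l => if l ∈ P then M else 0) u x‖ with hD
      set A := ∏ k ∈ P, a k ^ M with hA
      set R := ∏ k ∈ P, ρ k ^ M with hR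
      have hApos : 0 < A := Finset.prod_pos fun k _ => pow_pos (ha k) _
      have hRpos : 0 < R := Finset.prod_pos fun k hk => pow_pos (hρ0 k hk) _
      have hAξ : A ≤ c⁻¹ ^ (M * n) * ∏ k ∈ P, |ξ k| ^ M := by
        calc A ≤ ∏ k ∈ P, (c⁻¹ ^ M * |ξ k| ^ M) := by
              refine Finset.prod_le_prod (fun k _ => pow_nonneg (ha k).le _) fun k hk => ?_
              rw [← mul_pow]
              refine pow_le_pow_left₀ (ha k).le ?_ _
              rw [le_inv_mul_iff₀ hc]
              exact hξ k hk
          _ = (c⁻¹ ^ M) ^ P.card * ∏ k ∈ P, |ξ k| ^ M := by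
              rw [Finset.prod_mul_distrib, Finset.prod_const]
          _ ≤ c⁻¹ ^ (M * n) * ∏ k ∈ P, |ξ k| ^ M := by
              rw [← pow_mul]
              gcongr
      -- The gain `∏ k ∈ P, ρ k ^ (-M)` is at most a multiple of `H ^ (-(C₀ + 2))`: the power `C₀`
      -- compensates for the growth of the bound for `u`, and the power `2` is absorbed by the
      -- integrable weight.
      have hRH : (H / C) ^ (C₀ + 2) ≤ c⁻¹ ^ (M * n) * R := by
        calc (H / C) ^ (C₀ + 2) ≤ (∏ k ∈ P, ρ k ^ C₁) ^ (C₀ + 2) := by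
              refine Real.rpow_le_rpow (by positivity) ?_ (by positivity)
              rw [div_le_iff₀' (by positivity)]
              exact hH
          _ = ∏ k ∈ P, (ρ k ^ C₁) ^ (C₀ + 2) :=
              (Real.finsetProd_rpow _ _ (fun k hk => (Real.rpow_pos_of_pos (hρ0 k hk) _).le) _).symm
          _ ≤ ∏ k ∈ P, (c⁻¹ ^ M * ρ k ^ M) := by
              refine Finset.prod_le_prod (fun k hk => by have := hρ0 k hk; positivity)
                fun k hk => ?_
              have hk0 := hρ0 k hk
              rw [← Real.rpow_mul hk0.le, ← mul_pow]
              have h5 : 1 ≤ c⁻¹ * ρ k := by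
                rw [le_inv_mul_iff₀ hc]; simpa using hρ k hk
              have h0 : 0 ≤ C₁ * (C₀ + 2) := by positivity
              calc ρ k ^ (C₁ * (C₀ + 2)) ≤ (c⁻¹ * ρ k) ^ (C₁ * (C₀ + 2)) := by
                      refine Real.rpow_le_rpow hk0.le ?_ h0
                      nlinarith
                  _ ≤ (c⁻¹ * ρ k) ^ (M : ℝ) := Real.rpow_le_rpow_of_exponent_le h5 hM
                  _ = (c⁻¹ * ρ k) ^ M := Real.rpow_natCast _ _
          _ = (c⁻¹ ^ M) ^ P.card * R := by
              rw [Finset.prod_mul_distrib, Finset.prod_const]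
          _ ≤ c⁻¹ ^ (M * n) * R := by
              rw [← pow_mul]
              gcongr
      have hweight : H ^ (-2 : ℝ) * X ≤ ∏ l, (a l * (1 + (a l * x l) ^ 2)⁻¹) := by
        rw [Finset.prod_mul_distrib, mul_comm]
        gcongr
        rw [hHdef, ← Real.finsetProd_rpow _ _ (fun l _ => by positivity)]
        refine Finset.prod_le_prod (fun l _ => by positivity) fun l _ => ?_
        rw [Real.rpow_neg (by positivity)]
        gcongr
        rw [Real.rpow_two, ← sq_abs (a l * x l)]
        nlinarith [abs_nonneg (a l * x l)]
      have h6 : D ≤ C * W * X * H ^ C₀ * A / R := by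
        rw [le_div_iff₀ hRpos]
        rw [div_mul_eq_mul_div, div_le_iff₀ hApos] at h1
        linarith
      have h7 : 1 / R ≤ c⁻¹ ^ (M * n) * C ^ (C₀ + 2) * (H ^ (-2 : ℝ) * H ^ (-C₀)) := by
        rw [← Real.rpow_add hH1, div_le_iff₀ hRpos]
        rw [Real.div_rpow hH1.le (by positivity), div_le_iff₀ (by positivity)] at hRH
        have e : H ^ (-2 + -C₀) = (H ^ (C₀ + 2))⁻¹ := by
          rw [← Real.rpow_neg hH1.le]; congr 1; ring
        rw [e]
        have hp : 0 < H ^ (C₀ + 2) := by positivity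
        calc (1 : ℝ) = H ^ (C₀ + 2) * (H ^ (C₀ + 2))⁻¹ := by field_simp
          _ ≤ (c⁻¹ ^ (M * n) * R * C ^ (C₀ + 2)) * (H ^ (C₀ + 2))⁻¹ := by gcongr
          _ = _ := by ring
      calc D ≤ C * W * X * H ^ C₀ * A * (1 / R) := by rw [mul_one_div]; exact h6
        _ ≤ C * W * X * H ^ C₀ * (c⁻¹ ^ (M * n) * ∏ k ∈ P, |ξ k| ^ M) *
            (c⁻¹ ^ (M * n) * C ^ (C₀ + 2) * (H ^ (-2 : ℝ) * H ^ (-C₀))) := by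
              gcongr
        _ = C * C ^ (C₀ + 2) * c⁻¹ ^ (M * n) * c⁻¹ ^ (M * n) * W *
            (∏ l ∈ P, |ξ l| ^ M) * (H ^ (-2 : ℝ) * X) * (H ^ C₀ * H ^ (-C₀)) := by ring
        _ = C * C ^ (C₀ + 2) * c⁻¹ ^ (M * n) * c⁻¹ ^ (M * n) * W *
            (∏ l ∈ P, |ξ l| ^ M) * (H ^ (-2 : ℝ) * X) := by
              rw [← Real.rpow_add hH1, add_neg_cancel, Real.rpow_zero, mul_one]
        _ ≤ _ := by
              gcongr
  refine key.trans (le_of_eq ?_)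
  rw [← hn]
  ring

/-! ### Cutoff functions on boxes -/

section Bump

/-- A smooth cutoff on the line: `1` on `[-1, 1]` and `0` off `(-2, 2)`. -/
noncomputable def lineBump (t : ℝ) : ℂ :=
  ((⟨1, 2, one_pos, one_lt_two⟩ : ContDiffBump (0 : ℝ)) t : ℝ)

theorem contDiff_lineBump : ContDiff ℝ ∞ lineBump :=
  Complex.ofRealCLM.contDiff.comp (ContDiffBump.contDiff _)

theorem lineBump_eq_one {t : ℝ} (ht : |t| ≤ 1) : lineBump t = 1 := by
  unfold lineBump
  rw [ContDiffBump.one_of_mem_closedBall]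
  · simp
  · simpa using ht

theorem lineBump_eq_zero {t : ℝ} (ht : 2 ≤ |t|) : lineBump t = 0 := by
  unfold lineBump
  rw [ContDiffBump.zero_of_le_dist]
  · simp
  · simpa using ht

theorem hasCompactSupport_lineBump : HasCompactSupport lineBump :=
  HasCompactSupport.intro (isCompact_Icc (a := (-2 : ℝ)) (b := 2)) fun t ht =>
    lineBump_eq_zero (by
      by_contra h
      rw [not_le, abs_lt] at h
      exact ht ⟨h.1.le, h.2.le⟩)

theorem exists_lineBump_bound (m : ℕ) :
    ∃ B : ℝ, 1 ≤ B ∧ ∀ k ≤ m, ∀ t, ‖iteratedDeriv k lineBump t‖ ≤ B := by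
  have h : ∀ k : ℕ, ∃ B : ℝ, ∀ t, ‖iteratedDeriv k lineBump t‖ ≤ B := by
    intro k
    have h1 : HasCompactSupport (iteratedFDeriv ℝ k lineBump) :=
      hasCompactSupport_lineBump.iteratedFDeriv k
    obtain ⟨B, hB⟩ := h1.exists_bound_of_continuous
      (contDiff_lineBump.continuous_iteratedFDeriv (by exact_mod_cast le_top))
    exact ⟨B, fun t => by rw [← norm_iteratedFDeriv_eq_norm_iteratedDeriv]; exact hB t⟩
  choose B hB using h
  refine ⟨1 + ∑ k ∈ Finset.range (m + 1), |B k|, ?_, fun k hk t => ?_⟩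
  · have : 0 ≤ ∑ k ∈ Finset.range (m + 1), |B k| := Finset.sum_nonneg fun _ _ => abs_nonneg _
    linarith
  · have h1 : |B k| ≤ ∑ k ∈ Finset.range (m + 1), |B k| :=
      Finset.single_le_sum (f := fun k => |B k|) (fun _ _ => abs_nonneg _)
        (Finset.mem_range.2 (by omega))
    linarith [hB k t, le_abs_self (B k)]

/-- The product cutoff `∏_{l ∈ s} χ(a_l x_l)`. -/
noncomputable def boxBump {ι : Type*} (a : ι → ℝ) (s : Finset ι) (x : EuclideanSpace ℝ ι) : ℂ :=
  ∏ l ∈ s, lineBump (a l * x l)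

variable {ι : Type*}

theorem contDiff_boxBump [Fintype ι] (a : ι → ℝ) (s : Finset ι) : ContDiff ℝ ∞ (boxBump a s) :=
  contDiff_prod fun l _ => contDiff_lineBump.comp (by fun_prop)

theorem boxBump_eq_one {a : ι → ℝ} {s : Finset ι} {x : EuclideanSpace ℝ ι}
    (h : ∀ l ∈ s, |a l * x l| ≤ 1) : boxBump a s x = 1 :=
  Finset.prod_eq_one fun l hl => lineBump_eq_one (h l hl)

theorem boxBump_eventuallyEq_one {a : ι → ℝ} {s : Finset ι} {x : EuclideanSpace ℝ ι}
    (h : ∀ l ∈ s, |a l * x l| < 1) : boxBump a s =ᶠ[nhds x] fun _ => 1 := by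
  have : ∀ᶠ y : EuclideanSpace ℝ ι in nhds x, ∀ l ∈ s, |a l * y l| < 1 := by
    rw [Filter.eventually_all_finset]
    intro l hl
    exact (Continuous.tendsto (by fun_prop) x).eventually_lt_const (h l hl)
  filter_upwards [this] with y hy
  exact boxBump_eq_one fun l hl => (hy l hl).le

theorem boxBump_eventuallyEq_zero {a : ι → ℝ} {s : Finset ι} {x : EuclideanSpace ℝ ι}
    (h : ∃ l ∈ s, 2 < |a l * x l|) : boxBump a s =ᶠ[nhds x] fun _ => 0 := by
  obtain ⟨l, hl, h⟩ := h
  have : ∀ᶠ y : EuclideanSpace ℝ ι in nhds x, 2 < |a l * y l| :=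
    (Continuous.tendsto (by fun_prop) x).eventually_const_lt h
  filter_upwards [this] with y hy
  exact Finset.prod_eq_zero hl (lineBump_eq_zero hy.le)

variable [Fintype ι]

theorem hasCompactSupport_boxBump_univ {a : ι → ℝ} (ha : ∀ l, 0 < a l) :
    HasCompactSupport (boxBump a Finset.univ) := by
  refine HasCompactSupport.intro (K := (fun y : ι → ℝ => WithLp.toLp 2 y) ''
    (Set.univ.pi fun l => Set.Icc (-(2 / a l)) (2 / a l)))
    ((isCompact_univ_pi fun l => isCompact_Icc).image (PiLp.continuous_toLp 2 _)) fun x hx => ?_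
  by_contra h
  refine hx ⟨WithLp.ofLp x, fun l _ => ?_, rfl⟩
  have h1 : lineBump (a l * x l) ≠ 0 := (Finset.prod_ne_zero_iff.1 h) l (Finset.mem_univ l)
  have h2 : |a l * x l| < 2 := by
    by_contra h3
    exact h1 (lineBump_eq_zero (not_lt.1 h3))
  rw [abs_mul, abs_of_pos (ha l), ← lt_div_iff₀' (ha l)] at h2
  exact ⟨by have := (abs_lt.1 h2).1; linarith, (abs_lt.1 h2).2.le⟩

theorem scaledBound_lineBump {m : ℕ} {B : ℝ}
    (hB : ∀ k ≤ m, ∀ t, ‖iteratedDeriv k lineBump t‖ ≤ B) {a : ℝ} {l : ι} {lam : ι → ℝ} {c : ℝ}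
    (hc : 1 ≤ c) (h : |lam l * a| ≤ c) (x : EuclideanSpace ℝ ι) :
    ScaledBound (fun y => lineBump (a * y l)) x lam m (c ^ m * B) := by
  refine ScaledBound.oneVar (h := fun t => lineBump (a * t))
    (contDiff_lineBump.comp (by fun_prop)) l fun k hk => ?_
  have hB0 : 0 ≤ B := (norm_nonneg _).trans (hB 0 (Nat.zero_le _) 0)
  have e := congrFun (iteratedDeriv_comp_const_smul (n := k) (f := lineBump)
    (contDiff_lineBump.of_le (by exact_mod_cast le_top)) a) (x l)
  beta_reduce at e
  rw [e, norm_smul, norm_pow, Real.norm_eq_abs, ← mul_assoc, ← mul_pow, ← abs_mul]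
  have h1 : |lam l * a| ^ k ≤ c ^ m :=
    (pow_le_pow_left₀ (abs_nonneg _) h k).trans (pow_le_pow_right₀ hc hk)
  exact mul_le_mul h1 (hB k hk _) (norm_nonneg _) (by positivity)

theorem exists_scaledBound_boxBump (ι : Type*) [Fintype ι] (m : ℕ) {c : ℝ} (hc : 1 ≤ c) :
    ∃ B : ℝ, 1 ≤ B ∧ ∀ (a : ι → ℝ) (s : Finset ι) (lam : ι → ℝ) (x : EuclideanSpace ℝ ι),
      (∀ l ∈ s, |lam l * a l| ≤ c) → ScaledBound (boxBump a s) x lam m B := by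
  obtain ⟨B, hB1, hB⟩ := exists_lineBump_bound m
  have h1 : 1 ≤ 2 ^ m * (c ^ m * B) :=
    one_le_mul_of_one_le_of_one_le (one_le_pow₀ (by norm_num))
      (one_le_mul_of_one_le_of_one_le (one_le_pow₀ hc) hB1)
  refine ⟨(2 ^ m * (c ^ m * B)) ^ Fintype.card ι, one_le_pow₀ h1, fun a s lam x h => ?_⟩
  have h2 := ScaledBound.prod (m := m) (lam := lam) s (f := fun l y => lineBump (a l * y l)) (x := x)
    (fun l _ => (contDiff_lineBump.comp (by fun_prop)).contDiffAt)
    (fun l hl => scaledBound_lineBump hB hc (h l hl) x)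
  refine h2.mono ?_
  rw [Finset.prod_const, ← mul_pow]
  exact pow_le_pow_right₀ h1 (Finset.card_le_univ s)

/-- The first alternative is that `x` lies off the support of the cutoff function, so that no
condition on the scales is needed; otherwise the scales must not exceed those of the cutoff
function. -/
theorem exists_scaledBound_one_sub_boxBump (ι : Type*) [Fintype ι] (m : ℕ) {c : ℝ} (hc : 1 ≤ c) :
    ∃ B : ℝ, 1 ≤ B ∧ ∀ (a : ι → ℝ) (s : Finset ι) (lam : ι → ℝ) (x : EuclideanSpace ℝ ι),
      ((∃ l ∈ s, 2 < |a l * x l|) ∨ ∀ l ∈ s, |lam l * a l| ≤ c) →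
        ScaledBound (fun y => 1 - boxBump a s y) x lam m B := by
  obtain ⟨B, hB1, hB⟩ := exists_scaledBound_boxBump ι m hc
  refine ⟨1 + 2 ^ m * B, le_add_of_nonneg_right (by positivity), fun a s lam x h => ?_⟩
  have h0 : (0 : ℝ) ≤ 2 ^ m * B := by positivity
  rcases h with h | h
  · have h1 : ScaledBound (fun _ => (1 : ℂ)) x lam m (1 + 2 ^ m * B) :=
      (ScaledBound.const 1).mono (by simpa using h0)
    refine h1.congr ?_
    filter_upwards [boxBump_eventuallyEq_zero h] with y hy
    rw [hy, sub_zero]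
  · have h1 := ScaledBound.add (m := m) (lam := lam) (x := x) contDiffAt_const
      (contDiffAt_const.mul (contDiff_boxBump a s).contDiffAt) (ScaledBound.const 1)
      (ScaledBound.mul (x := x) contDiffAt_const (contDiff_boxBump a s).contDiffAt
        (ScaledBound.const (-1)) (hB a s lam x h))
    have e : (fun y => 1 - boxBump a s y) = fun y => (1 : ℂ) + -1 * boxBump a s y := by
      funext y; ring
    rw [e]
    simpa using h1

end Bump

/-! ### Norms with several exponents, and symbols -/

section Exponents

variable {ι : Type*} [Fintype ι]

/-- The exponents `f(j,k)` of a family of norms `∑_k |x_k| ^ f(j,k)`: the basic hypothesis, for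
coordinates of weight `1`. -/
structure IsExponentSystem {ι : Type*} (f : ι → ι → ℝ) : Prop where
  pos : ∀ j k, 0 < f j k
  diag : ∀ j, f j j = 1
  triangle : ∀ j k l, f j l ≤ f j k * f k l

/-- The norm `∑_k |x_k| ^ f(l,k)`. -/
noncomputable def pNorm (f : ι → ι → ℝ) (l : ι) (x : EuclideanSpace ℝ ι) : ℝ :=
  ∑ k, |x k| ^ f l k

/-- The dual norm `∑_k |ξ_k| ^ (1 / f(k,l))`. -/
noncomputable def qNorm (f : ι → ι → ℝ) (l : ι) (ξ : EuclideanSpace ℝ ι) : ℝ :=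
  ∑ k, |ξ k| ^ (1 / f k l)

/-- `u` satisfies, with the weight `w`, the differential inequalities of a multiplier. -/
def IsSymbol (f : ι → ι → ℝ) (u : EuclideanSpace ℝ ι → ℂ) (w : EuclideanSpace ℝ ι → ℝ)
    (C : ℕ → ℝ) : Prop :=
  ∀ m ξ, ScaledBound u ξ (fun l => 1 + qNorm f l ξ) m (C m * w ξ)

variable {f : ι → ι → ℝ}

theorem qNorm_nonneg (l : ι) (ξ : EuclideanSpace ℝ ι) : 0 ≤ qNorm f l ξ :=
  Finset.sum_nonneg fun _ _ => by positivity

theorem pNorm_nonneg (l : ι) (x : EuclideanSpace ℝ ι) : 0 ≤ pNorm f l x :=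
  Finset.sum_nonneg fun _ _ => by positivity

theorem rpow_le_pNorm (l k : ι) (x : EuclideanSpace ℝ ι) : |x k| ^ f l k ≤ pNorm f l x :=
  Finset.single_le_sum (f := fun k => |x k| ^ f l k) (fun _ _ => by positivity) (Finset.mem_univ k)

theorem rpow_le_qNorm (l k : ι) (ξ : EuclideanSpace ℝ ι) : |ξ k| ^ (1 / f k l) ≤ qNorm f l ξ :=
  Finset.single_le_sum (f := fun k => |ξ k| ^ (1 / f k l)) (fun _ _ => by positivity)
    (Finset.mem_univ k)

theorem IsExponentSystem.abs_le_pNorm (hf : IsExponentSystem f) (l : ι) (x : EuclideanSpace ℝ ι) :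
    |x l| ≤ pNorm f l x := by
  simpa [hf.diag] using rpow_le_pNorm (f := f) l l x

theorem IsExponentSystem.abs_le_qNorm (hf : IsExponentSystem f) (l : ι) (x : EuclideanSpace ℝ ι) :
    |x l| ≤ qNorm f l x := by
  simpa [hf.diag] using rpow_le_qNorm (f := f) l l x

theorem pNorm_pos {x : EuclideanSpace ℝ ι} (hx : x ≠ 0) (l : ι) : 0 < pNorm f l x := by
  obtain ⟨k, hk⟩ : ∃ k, x k ≠ 0 := by
    by_contra h
    push Not at h
    exact hx (by ext k; simpa using h k)
  exact (Real.rpow_pos_of_pos (abs_pos.2 hk) _).trans_le (rpow_le_pNorm l k x)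

/-- The power of a finite sum, compared with the sum of the powers. -/
theorem Finset.rpow_sum_le_card_rpow_mul {κ : Type*} (s : Finset κ) {t : κ → ℝ}
    (ht : ∀ k ∈ s, 0 ≤ t k) {r : ℝ} (hr : 0 < r) :
    (∑ k ∈ s, t k) ^ r ≤ (s.card : ℝ) ^ r * ∑ k ∈ s, t k ^ r := by
  rcases s.eq_empty_or_nonempty with rfl | hs
  · simp [Real.zero_rpow hr.ne']
  · obtain ⟨k, hk, hmax⟩ := s.exists_max_image t hs
    calc (∑ k ∈ s, t k) ^ r ≤ (s.card * t k) ^ r := by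
          refine Real.rpow_le_rpow (Finset.sum_nonneg ht) ?_ hr.le
          rw [← nsmul_eq_mul]
          exact Finset.sum_le_card_nsmul s t _ hmax
      _ = (s.card : ℝ) ^ r * t k ^ r := Real.mul_rpow (by positivity) (ht k hk)
      _ ≤ _ := by
          gcongr
          exact Finset.single_le_sum (f := fun k => t k ^ r)
            (fun i hi => Real.rpow_nonneg (ht i hi) _) hk

/-- A common bound for all exponents and their inverses. -/
theorem exists_rpow_bounds (hf : IsExponentSystem f) :
    ∃ F : ℝ, 1 ≤ F ∧ (∀ j k, f j k ≤ F) ∧ ∀ j k, 1 / f j k ≤ F := by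
  refine ⟨1 + ∑ j, ∑ k, (f j k + 1 / f j k), ?_, fun j k => ?_, fun j k => ?_⟩
  · have : 0 ≤ ∑ j, ∑ k, (f j k + 1 / f j k) := Finset.sum_nonneg fun j _ =>
      Finset.sum_nonneg fun k _ => by have := hf.pos j k; positivity
    linarith
  all_goals
    have h1 : f j k + 1 / f j k ≤ ∑ j, ∑ k, (f j k + 1 / f j k) :=
      (Finset.single_le_sum (f := fun k => f j k + 1 / f j k)
        (fun k _ => by have := hf.pos j k; positivity) (Finset.mem_univ k)).trans
      (Finset.single_le_sum (f := fun j => ∑ k, (f j k + 1 / f j k)) (fun j _ =>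
        Finset.sum_nonneg fun k _ => by have := hf.pos j k; positivity) (Finset.mem_univ j))
    have h2 := hf.pos j k
    have h3 : 0 < 1 / f j k := by positivity
    linarith

/-- For a point `x` near the origin, every norm `N_j(x)` is comparable with `|x_k| ^ f(j,k)` for a
coordinate `k = κ(j)` that is itself dominant, in the sense that `N_k(x)` is comparable with
`|x_k|`. -/
theorem IsExponentSystem.exists_dominant (hf : IsExponentSystem f) :
    ∃ c : ℝ, 0 < c ∧ c ≤ 1 ∧ ∀ x : EuclideanSpace ℝ ι, x ≠ 0 → (∀ l, |x l| ≤ 1) →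
      (∀ j l, c * pNorm f l x ^ f j l ≤ pNorm f j x) ∧
      ∃ κ : ι → ι, (∀ j, κ (κ j) = κ j) ∧ (∀ j, c * pNorm f (κ j) x ≤ |x (κ j)|) ∧
        ∀ j, c * pNorm f j x ≤ pNorm f (κ j) x ^ f j (κ j) := by
  classical
  obtain ⟨F, hF1, hF, hF'⟩ := exists_rpow_bounds hf
  rcases isEmpty_or_nonempty ι with hι | hι
  · refine ⟨1, one_pos, le_rfl, fun x hx => ?_⟩
    exact absurd (Subsingleton.elim x 0) hx
  set n : ℝ := ((Fintype.card ι : ℕ) : ℝ) with hn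
  have hn1 : 1 ≤ n := by
    rw [hn]; exact_mod_cast Fintype.card_pos
  have hF0 : 0 < F := by linarith
  have hnF1 : 1 ≤ n ^ F := Real.one_le_rpow hn1 hF0.le
  have hb1 : 1 ≤ n ^ F * n := one_le_mul_of_one_le_of_one_le hnF1 hn1
  have hb : 1 ≤ (n ^ F * n) ^ F := Real.one_le_rpow hb1 hF0.le
  set c : ℝ := ((n ^ F * n) ^ F)⁻¹ with hc
  have hc0 : 0 < c := by positivity
  have hle : n ^ F * n ≤ (n ^ F * n) ^ F := by
    simpa using Real.rpow_le_rpow_of_exponent_le hb1 hF1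
  refine ⟨c, hc0, inv_le_one_of_one_le₀ hb, fun x hx hx1 => ?_⟩
  have hpos : ∀ l, 0 < pNorm f l x := pNorm_pos hx
  have hG : ∀ j l, pNorm f l x ^ f j l ≤ n ^ F * pNorm f j x := by
    intro j l
    have hjl := hf.pos j l
    calc pNorm f l x ^ f j l ≤ n ^ f j l * ∑ k, (|x k| ^ f l k) ^ f j l :=
          Finset.rpow_sum_le_card_rpow_mul _ (fun _ _ => by positivity) hjl
      _ ≤ n ^ F * ∑ k, |x k| ^ f j k := by
          have h1 : n ^ f j l ≤ n ^ F := Real.rpow_le_rpow_of_exponent_le hn1 (hF _ _)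
          gcongr with k
          rw [← Real.rpow_mul (abs_nonneg _)]
          refine Real.rpow_le_rpow_of_exponent_ge' (abs_nonneg _) (hx1 k) (hf.pos j k).le ?_
          rw [mul_comm]
          exact hf.triangle j l k
  refine ⟨fun j l => ?_, ?_⟩
  · rw [hc, inv_mul_le_iff₀ (by positivity)]
    refine (hG j l).trans ?_
    have := (hpos j).le
    gcongr
    nlinarith
  · have hmax : ∀ j, ∃ k, pNorm f j x ≤ n * |x k| ^ f j k := by
      intro j
      obtain ⟨k, -, hk⟩ := Finset.univ.exists_max_image (fun k => |x k| ^ f j k)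
        Finset.univ_nonempty
      refine ⟨k, ?_⟩
      rw [hn, ← Finset.card_univ, ← nsmul_eq_mul]
      exact Finset.sum_le_card_nsmul _ _ _ hk
    choose σ hσ using hmax
    -- The largest term of `pNorm f j x` belongs to a dominant coordinate, by the triangle
    -- inequality for the exponents, which is used in `hG`; the assumption `|x l| ≤ 1` enters there
    -- as well.
    have hdom : ∀ j, c * pNorm f (σ j) x ≤ |x (σ j)| := by
      intro j
      have hjk := hf.pos j (σ j)
      have h1 : pNorm f (σ j) x ^ f j (σ j) ≤ (n ^ F * n) * |x (σ j)| ^ f j (σ j) := by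
        refine (hG j (σ j)).trans ?_
        rw [mul_assoc]
        gcongr
        exact hσ j
      have h2 : pNorm f (σ j) x ≤ ((n ^ F * n) * |x (σ j)| ^ f j (σ j)) ^ (1 / f j (σ j)) := by
        rw [one_div, Real.le_rpow_inv_iff_of_pos (hpos _).le (by positivity) hjk]
        exact h1
      rw [Real.mul_rpow (by positivity) (by positivity), ← Real.rpow_mul (abs_nonneg _),
        mul_one_div_cancel hjk.ne', Real.rpow_one] at h2
      rw [hc, inv_mul_le_iff₀ (by positivity)]
      refine h2.trans ?_
      gcongr
      exact hF' _ _
    refine ⟨fun j => if c * pNorm f j x ≤ |x j| then j else σ j, fun j => ?_, fun j => ?_,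
      fun j => ?_⟩
    · by_cases h : c * pNorm f j x ≤ |x j|
      · simp [h]
      · simp [h, hdom j]
    · by_cases h : c * pNorm f j x ≤ |x j|
      · simp [h]
      · simpa [h] using hdom j
    · by_cases h : c * pNorm f j x ≤ |x j|
      · simp only [h, if_true, hf.diag, Real.rpow_one]
        nlinarith [hpos j, inv_le_one_of_one_le₀ hb]
      · simp only [h, if_false]
        rw [hc, inv_mul_le_iff₀ (by positivity)]
        calc pNorm f j x ≤ n * |x (σ j)| ^ f j (σ j) := hσ j
          _ ≤ (n ^ F * n) ^ F * pNorm f (σ j) x ^ f j (σ j) := by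
            have h3 : n ≤ (n ^ F * n) ^ F := by nlinarith
            have h4 := hf.abs_le_pNorm (σ j) x
            have h5 := (hf.pos j (σ j)).le
            gcongr

end Exponents

/-! ### The Fourier transform of a symbol near the origin -/

section KernelBound

variable {ι : Type*} [Fintype ι]

theorem fourier_finset_sum {κ : Type*} (s : Finset κ) {g : κ → EuclideanSpace ℝ ι → ℂ}
    (hg : ∀ i ∈ s, Integrable (g i)) (ξ : EuclideanSpace ℝ ι) :
    𝓕 (fun y => ∑ i ∈ s, g i y) ξ = ∑ i ∈ s, 𝓕 (g i) ξ := by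
  simp only [Real.fourier_eq, Finset.smul_sum]
  exact integral_finsetSum _ fun i hi => (Real.fourierIntegral_convergent_iff ξ).2 (hg i hi)

variable [DecidableEq ι] {f : ι → ι → ℝ}

theorem le_prod_of_one_le {κ : Type*} {s : Finset κ} {t : κ → ℝ} (ht : ∀ k ∈ s, 1 ≤ t k) {k : κ}
    (hk : k ∈ s) : t k ≤ ∏ i ∈ s, t i := by
  classical
  rw [← Finset.mul_prod_erase s t hk]
  have h1 : 1 ≤ ∏ i ∈ s.erase k, t i := by
    have := Finset.prod_le_prod (s := s.erase k) (f := fun _ => (1 : ℝ)) (g := t)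
      (fun _ _ => zero_le_one) fun i hi => ht i (Finset.mem_of_mem_erase hi)
    simpa using this
  nlinarith [ht k hk]

/-- The pointwise bound for the Fourier transform of a compactly supported symbol, near the origin.
Frequencies are measured with the scales `1 / N_l(x)`. The coordinates are grouped according to
the dominant coordinate of `x` that controls them, and in each group one integrates by parts in the
dominant direction, off the box where all rescaled frequencies of the group are small. -/
theorem exists_norm_fourier_le_near_zero (hf : IsExponentSystem f) (γ : ι → ℕ) (C : ℕ → ℝ) :
    ∃ C' : ℝ, 0 ≤ C' ∧ ∀ u : EuclideanSpace ℝ ι → ℂ, ContDiff ℝ ∞ u → HasCompactSupport u →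
      IsSymbol f u (fun ξ => ∏ l, (1 + qNorm f l ξ) ^ γ l) C →
      ∀ x : EuclideanSpace ℝ ι, x ≠ 0 → (∀ l, |x l| ≤ 1) →
        ‖𝓕 u x‖ ≤ C' * ∏ l, pNorm f l x ^ (-(1 + (γ l : ℝ))) := by
  rcases isEmpty_or_nonempty ι with hι | hι
  · exact ⟨0, le_rfl, fun u _ _ _ x hx => absurd (Subsingleton.elim x 0) hx⟩
  obtain ⟨F, hF1, hF, hF'⟩ := exists_rpow_bounds hf
  obtain ⟨c, hc0, hc1, hdom⟩ := hf.exists_dominant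
  set n : ℝ := ((Fintype.card ι : ℕ) : ℝ) with hn
  have hn1 : 1 ≤ n := by rw [hn]; exact_mod_cast Fintype.card_pos
  set Γ : ℕ := ∑ l, γ l with hΓ
  have hF0 : 0 < F := by linarith
  -- the number of integrations by parts that `exists_norm_fourier_le` asks for
  set M : ℕ := ⌈F * n * (F * Γ + 2)⌉₊ with hM
  set m : ℕ := M * Fintype.card ι with hm
  set K₁ : ℝ := c⁻¹ ^ F with hK₁
  have hci : 1 ≤ c⁻¹ := (one_le_inv₀ hc0).2 hc1
  have hK1 : 1 ≤ K₁ := Real.one_le_rpow hci hF0.le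
  have h2F : 1 ≤ (2 : ℝ) ^ F := Real.one_le_rpow (by norm_num) hF0.le
  obtain ⟨B₁, hB₁1, hB₁⟩ := exists_scaledBound_one_sub_boxBump ι m (c := n * 2 ^ F)
    (one_le_mul_of_one_le_of_one_le hn1 h2F)
  obtain ⟨B₂, hB₂1, hB₂⟩ := exists_scaledBound_boxBump ι m (c := 1) le_rfl
  set CY : ℝ := 2 ^ m * ((2 ^ m * B₁) ^ Fintype.card ι * (2 ^ m * B₂) ^ Fintype.card ι) with hCY
  set CU : ℝ := |C m| * K₁ ^ m * (2 * n * K₁) ^ Γ with hCU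
  set C₂ : ℝ := max (3 ^ Fintype.card ι) (2 ^ m * (CU * CY)) with hC₂
  have hC₂1 : 1 ≤ C₂ := (one_le_pow₀ (by norm_num)).trans (le_max_left _ _)
  obtain ⟨C', hC'0, hosc⟩ := exists_norm_fourier_le (ι := ι) (C₀ := F * Γ) (C₁ := F * n) hc0 hc1
    hC₂1 (Nat.le_ceil (F * n * (F * Γ + 2))) (by positivity) (by positivity)
  refine ⟨2 ^ Fintype.card ι * C', by positivity, fun u hu huc hsym x hx hx1 => ?_⟩
  obtain ⟨hG, κ, hκ, hκx, hκp⟩ := hdom x hx hx1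
  set a : ι → ℝ := fun l => pNorm f l x with ha
  have hapos : ∀ l, 0 < a l := fun l => pNorm_pos hx l
  have han : ∀ l, a l ≤ n := by
    intro l
    calc a l ≤ ∑ _k : ι, (1 : ℝ) := Finset.sum_le_sum fun k _ =>
          Real.rpow_le_one (abs_nonneg _) (hx1 k) (hf.pos l k).le
      _ = n := by simp [hn]
  -- `P` is the set of dominant coordinates, and `G k` the group of coordinates that `k` controls
  set P : Finset ι := Finset.univ.image κ with hP
  have hPκ : ∀ k ∈ P, κ k = k := by
    intro k hk
    obtain ⟨j, -, rfl⟩ := Finset.mem_image.1 hk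
    exact hκ j
  set G : ι → Finset ι := fun k => Finset.univ.filter fun j => κ j = k with hGdef
  have hmemG : ∀ j k, j ∈ G k ↔ κ j = k := fun j k => by simp [hGdef]
  -- `Y S` localises to frequencies for which exactly the groups `G k` with `k ∈ S` contain a large
  -- rescaled frequency
  set Y : Finset ι → EuclideanSpace ℝ ι → ℂ := fun S y =>
    (∏ k ∈ S, (1 - boxBump a (G k) y)) * ∏ k ∈ P \ S, boxBump a (G k) y with hY
  have hYc : ∀ S, ContDiff ℝ ∞ (Y S) := fun S =>
    (contDiff_prod fun k _ => contDiff_const.sub (contDiff_boxBump a (G k))).mul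
      (contDiff_prod fun k _ => contDiff_boxBump a (G k))
  have hsum : u = fun y => ∑ S ∈ P.powerset, u y * Y S y := by
    funext y
    rw [← Finset.mul_sum, hY]
    have := Finset.prod_add (fun k => 1 - boxBump a (G k) y) (fun k => boxBump a (G k) y) P
    simp only [sub_add_cancel, Finset.prod_const_one] at this
    rw [← this, mul_one]
  set W : ℝ := ∏ l, a l ^ (-(1 + (γ l : ℝ))) with hW
  have hW0 : 0 ≤ W := Finset.prod_nonneg fun l _ => Real.rpow_nonneg (hapos l).le _
  have hmain : ∀ S ∈ P.powerset, ‖𝓕 (fun y => u y * Y S y) x‖ ≤ C' * W := by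
    intro S hS
    rw [Finset.mem_powerset] at hS
    refine hosc _ S a W x (hu.mul (hYc S)) huc.mul_right hapos hW0
      (fun k hk => by simpa [hPκ k (hS hk)] using hκx k) fun y => ?_
    by_cases h1 : ∃ k ∈ S, ∀ j ∈ G k, |a j * y j| < 1
    · left
      obtain ⟨k, hk, h1⟩ := h1
      filter_upwards [boxBump_eventuallyEq_one h1] with z hz
      have : ∏ k ∈ S, (1 - boxBump a (G k) z) = 0 :=
        Finset.prod_eq_zero hk (by rw [hz, sub_self])
      simp [hY, this]
    by_cases h2 : ∃ k ∈ P \ S, ∃ j ∈ G k, 2 < |a j * y j|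
    · left
      obtain ⟨k, hk, h2⟩ := h2
      filter_upwards [boxBump_eventuallyEq_zero h2] with z hz
      have : ∏ k ∈ P \ S, boxBump a (G k) z = 0 := Finset.prod_eq_zero hk hz
      simp [hY, this]
    right
    push Not at h1 h2
    set η : ι → ℝ := fun j => |a j * y j| with hη
    have hη0 : ∀ j, 0 ≤ η j := fun j => abs_nonneg _
    -- `ρ k` is a rescaled form of `qNorm f k`, restricted to the group of `k`, in which each
    -- derivative in the direction `k` gains
    set ρ : ι → ℝ := fun k => ∑ j ∈ G k, η j ^ (1 / f j k) with hρ
    have hρle : ∀ k, ∀ j ∈ G k, η j ^ (1 / f j k) ≤ ρ k := fun k j hj =>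
      Finset.single_le_sum (f := fun j => η j ^ (1 / f j k))
        (fun i _ => Real.rpow_nonneg (hη0 i) _) hj
    have hρ1 : ∀ k ∈ S, 1 ≤ ρ k := by
      intro k hk
      obtain ⟨j, hj, h⟩ := h1 k hk
      exact (Real.one_le_rpow h (by have := hf.pos j k; positivity)).trans (hρle k j hj)
    have hρpow1 : ∀ k ∈ S, 1 ≤ ρ k ^ F := fun k hk => Real.one_le_rpow (hρ1 k hk) hF0.le
    set H : ℝ := ∏ l, (1 + |a l * y l|) with hH
    have hH1 : ∀ l, 1 + η l ≤ H := fun l =>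
      le_prod_of_one_le (t := fun l => 1 + |a l * y l|)
        (fun k _ => le_add_of_nonneg_right (abs_nonneg _)) (Finset.mem_univ l)
    have hHone : 1 ≤ H := (by have := hη0 hι.some; linarith : 1 ≤ 1 + η hι.some).trans (hH1 _)
    refine ⟨ρ, fun k hk => hc1.trans (hρ1 k hk), ?_, ?_⟩
    · -- every rescaled frequency is controlled by the product of the `ρ k`
      have hPi0 : 1 ≤ ∏ k ∈ S, ρ k ^ F := by
        have := Finset.prod_le_prod (s := S) (f := fun _ => (1 : ℝ)) (g := fun k => ρ k ^ F)
          (fun _ _ => zero_le_one) hρpow1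
        simpa using this
      have h3 : ∀ l, 1 + |a l * y l| ≤ 3 * ∏ k ∈ S, ρ k ^ F := by
        intro l
        by_cases hl : κ l ∈ S
        · have hlk : η l ≤ ρ (κ l) ^ F := by
            have h4 := hρle (κ l) l ((hmemG _ _).2 rfl)
            have hfl := hf.pos l (κ l)
            have hρp : 0 ≤ ρ (κ l) := zero_le_one.trans (hρ1 _ hl)
            rw [one_div, Real.rpow_inv_le_iff_of_pos (hη0 l) hρp hfl] at h4
            exact h4.trans (Real.rpow_le_rpow_of_exponent_le (hρ1 _ hl) (hF _ _))
          have h5 := le_prod_of_one_le hρpow1 hl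
          have h6 : |a l * y l| = η l := rfl
          linarith
        · have h4 : η l ≤ 2 := h2 (κ l) (Finset.mem_sdiff.2
            ⟨Finset.mem_image_of_mem _ (Finset.mem_univ l), hl⟩) l ((hmemG _ _).2 rfl)
          have h6 : |a l * y l| = η l := rfl
          linarith
      calc H ≤ ∏ _l : ι, (3 * ∏ k ∈ S, ρ k ^ F) :=
            Finset.prod_le_prod (fun l _ => by positivity) fun l _ => h3 l
        _ = 3 ^ Fintype.card ι * ∏ k ∈ S, ρ k ^ (F * n) := by
            rw [Finset.prod_const, mul_pow, Finset.card_univ, ← Finset.prod_pow]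
            congr 1
            refine Finset.prod_congr rfl fun k hk => ?_
            rw [← Real.rpow_natCast, ← Real.rpow_mul (zero_le_one.trans (hρ1 k hk))]
        _ ≤ C₂ * ∏ k ∈ S, ρ k ^ (F * n) := by
            gcongr
            exact le_max_left _ _
    · set lam : ι → ℝ := fun l => if l ∈ S then ρ l / a l else 0 with hlam
      have hyη : ∀ j, |y j| = η j / a j := fun j => by
        rw [hη]
        simp only [abs_mul, abs_of_pos (hapos j)]
        field_simp [(hapos j).ne']
      have hcpow : ∀ j k, (c⁻¹) ^ (1 / f j k) ≤ K₁ := fun j k =>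
        Real.rpow_le_rpow_of_exponent_le hci (hF' j k)
      -- the differentiation scales `ρ k / a k` do not exceed those of the symbol
      have hq1 : ∀ k ∈ S, ρ k / a k ≤ K₁ * qNorm f k y := by
        intro k hk
        rw [hρ, Finset.sum_div]
        calc ∑ j ∈ G k, η j ^ (1 / f j k) / a k ≤ ∑ j ∈ G k, K₁ * |y j| ^ (1 / f j k) := by
              refine Finset.sum_le_sum fun j hj => ?_
              have hfj := hf.pos j k
              rw [hyη, Real.div_rpow (hη0 j) (hapos j).le]
              have h5 : a j ^ (1 / f j k) ≤ K₁ * a k := by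
                have h6 := hκp j
                rw [(hmemG j k).1 hj] at h6
                have h7 : a j ≤ c⁻¹ * a k ^ f j k := by
                  rw [le_inv_mul_iff₀ hc0]; exact h6
                calc a j ^ (1 / f j k) ≤ (c⁻¹ * a k ^ f j k) ^ (1 / f j k) :=
                      Real.rpow_le_rpow (hapos j).le h7 (by positivity)
                  _ = (c⁻¹) ^ (1 / f j k) * a k := by
                      rw [Real.mul_rpow (by positivity) (Real.rpow_nonneg (hapos k).le _),
                        ← Real.rpow_mul (hapos k).le, mul_one_div_cancel hfj.ne', Real.rpow_one]
                  _ ≤ K₁ * a k := by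
                      have := (hapos k).le
                      gcongr
                      exact hcpow j k
              have h8 : 0 ≤ η j ^ (1 / f j k) := Real.rpow_nonneg (hη0 j) _
              have h9 : 0 < a j ^ (1 / f j k) := Real.rpow_pos_of_pos (hapos j) _
              rw [mul_div_assoc', div_le_div_iff₀ (hapos k) h9]
              calc η j ^ (1 / f j k) * a j ^ (1 / f j k) ≤ η j ^ (1 / f j k) * (K₁ * a k) := by
                    gcongr
                _ = _ := by ring
          _ = K₁ * ∑ j ∈ G k, |y j| ^ (1 / f j k) := by rw [Finset.mul_sum]
          _ ≤ K₁ * qNorm f k y := by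
              gcongr
              exact Finset.sum_le_sum_of_subset_of_nonneg (Finset.subset_univ _)
                fun _ _ _ => by positivity
      -- the symbol grows at most like a power of `H`, on the scales `1 / a l`
      have hq2 : ∀ l, 1 + qNorm f l y ≤ 2 * n * K₁ * H ^ F / a l := by
        intro l
        have hHF : 1 ≤ H ^ F := Real.one_le_rpow hHone hF0.le
        have h3 : qNorm f l y ≤ n * K₁ * H ^ F / a l := by
          calc qNorm f l y ≤ ∑ _k : ι, K₁ * H ^ F / a l := by
                refine Finset.sum_le_sum fun j _ => ?_
                have hfj := hf.pos j l
                rw [hyη, Real.div_rpow (hη0 j) (hapos j).le]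
                have h5 : a l ≤ K₁ * a j ^ (1 / f j l) := by
                  have h6 : a l ^ f j l ≤ c⁻¹ * a j := by
                    rw [le_inv_mul_iff₀ hc0]; exact hG j l
                  calc a l ≤ (c⁻¹ * a j) ^ (1 / f j l) := by
                        rw [one_div, Real.le_rpow_inv_iff_of_pos (hapos l).le
                          (mul_nonneg (by positivity) (hapos j).le) hfj]
                        exact h6
                    _ = (c⁻¹) ^ (1 / f j l) * a j ^ (1 / f j l) :=
                        Real.mul_rpow (by positivity) (hapos j).le
                    _ ≤ K₁ * a j ^ (1 / f j l) := by
                        have := Real.rpow_nonneg (hapos j).le (1 / f j l)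
                        gcongr
                        exact hcpow j l
                have h7 : η j ^ (1 / f j l) ≤ H ^ F := by
                  calc η j ^ (1 / f j l) ≤ H ^ (1 / f j l) := by
                        refine Real.rpow_le_rpow (hη0 j) ?_ (by positivity)
                        have := hH1 j; linarith
                    _ ≤ H ^ F := Real.rpow_le_rpow_of_exponent_le hHone (hF' _ _)
                have h9 : 0 < a j ^ (1 / f j l) := Real.rpow_pos_of_pos (hapos j) _
                rw [div_le_div_iff₀ h9 (hapos l)]
                calc η j ^ (1 / f j l) * a l ≤ H ^ F * (K₁ * a j ^ (1 / f j l)) :=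
                      mul_le_mul h7 h5 (hapos l).le (by positivity)
                  _ = _ := by ring
            _ = n * K₁ * H ^ F / a l := by
                rw [Finset.sum_const, Finset.card_univ, nsmul_eq_mul]; ring
        have h4 : 1 ≤ n * K₁ * H ^ F / a l := by
          rw [le_div_iff₀ (hapos l), one_mul]
          calc a l ≤ n := han l
            _ ≤ n * (K₁ * H ^ F) := le_mul_of_one_le_right (by linarith)
                (one_le_mul_of_one_le_of_one_le hK1 hHF)
            _ = _ := by ring
        calc 1 + qNorm f l y ≤ n * K₁ * H ^ F / a l + n * K₁ * H ^ F / a l := by linarith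
          _ = _ := by ring
      have hSBu : ScaledBound u y lam m (CU * (∏ l, a l ^ (-(γ l : ℝ))) * H ^ (F * Γ)) := by
        refine ((hsym m y).mono_scale (lam' := lam) hu.contDiffAt hK1 fun l => ?_).mono ?_
        · have hq := qNorm_nonneg (f := f) l y
          rw [abs_of_pos (by linarith : 0 < 1 + qNorm f l y)]
          by_cases hl : l ∈ S
          · simp only [hlam, hl, if_true]
            rw [abs_of_nonneg (div_nonneg (zero_le_one.trans (hρ1 l hl)) (hapos l).le)]
            have := hq1 l hl
            nlinarith
          · simp only [hlam, hl, if_false, abs_zero]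
            positivity
        · have hprod : ∏ l, (1 + qNorm f l y) ^ γ l ≤
              (2 * n * K₁) ^ Γ * H ^ (F * Γ) * ∏ l, a l ^ (-(γ l : ℝ)) := by
            calc ∏ l, (1 + qNorm f l y) ^ γ l ≤ ∏ l, (2 * n * K₁ * H ^ F / a l) ^ γ l := by
                  refine Finset.prod_le_prod (fun l _ => ?_) fun l _ => ?_
                  · have := qNorm_nonneg (f := f) l y
                    positivity
                  · have := qNorm_nonneg (f := f) l y
                    exact pow_le_pow_left₀ (by positivity) (hq2 l) _
              _ = ∏ l, ((2 * n * K₁ * H ^ F) ^ γ l * a l ^ (-(γ l : ℝ))) := by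
                  refine Finset.prod_congr rfl fun l _ => ?_
                  rw [div_pow, Real.rpow_neg (hapos l).le, Real.rpow_natCast, div_eq_mul_inv]
              _ = (2 * n * K₁ * H ^ F) ^ Γ * ∏ l, a l ^ (-(γ l : ℝ)) := by
                  rw [Finset.prod_mul_distrib, Finset.prod_pow_eq_pow_sum]
              _ = _ := by
                  rw [mul_pow, ← Real.rpow_natCast (H ^ F), ← Real.rpow_mul (by positivity)]
          have hnn : 0 ≤ ∏ l, (1 + qNorm f l y) ^ γ l := Finset.prod_nonneg fun l _ => by
            have := qNorm_nonneg (f := f) l y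
            positivity
          calc C m * (∏ l, (1 + qNorm f l y) ^ γ l) * K₁ ^ m
              ≤ |C m| * ((2 * n * K₁) ^ Γ * H ^ (F * Γ) * ∏ l, a l ^ (-(γ l : ℝ))) * K₁ ^ m := by
                gcongr
                exact le_abs_self _
            _ = _ := by rw [hCU]; ring
      have hlamG : ∀ k, ∀ l ∈ G k, l ≠ k → lam l = 0 := by
        intro k l hl hlk
        have : l ∉ S := fun h => hlk ((hPκ l (hS h)).symm.trans ((hmemG l k).1 hl))
        simp [hlam, this]
      have hSBY : ScaledBound (Y S) y lam m CY := by
        refine (ScaledBound.mul (x := y) (lam := lam) (m := m)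
          (contDiff_prod fun k _ => contDiff_const.sub (contDiff_boxBump a (G k))).contDiffAt
          (contDiff_prod fun k _ => contDiff_boxBump a (G k)).contDiffAt
          (ScaledBound.prod S (c := fun _ => B₁)
            (fun k _ => (contDiff_const.sub (contDiff_boxBump a (G k))).contDiffAt)
            fun k hk => hB₁ a (G k) lam y ?_)
          (ScaledBound.prod (P \ S) (c := fun _ => B₂)
            (fun k _ => (contDiff_boxBump a (G k)).contDiffAt)
            fun k hk => hB₂ a (G k) lam y ?_)).mono ?_
        · by_cases h3 : ∃ l ∈ G k, 2 < |a l * y l|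
          · exact Or.inl h3
          · right
            push Not at h3
            intro l hl
            by_cases hlk : l = k
            · subst hlk
              simp only [hlam, hk, if_true]
              rw [div_mul_cancel₀ _ (hapos l).ne', abs_of_nonneg (zero_le_one.trans (hρ1 l hk))]
              calc ρ l ≤ ∑ j ∈ G l, (2 : ℝ) ^ F := by
                    refine Finset.sum_le_sum fun j hj => ?_
                    calc η j ^ (1 / f j l) ≤ 2 ^ (1 / f j l) :=
                          Real.rpow_le_rpow (hη0 j) (h3 j hj)
                            (by have := hf.pos j l; positivity)
                      _ ≤ 2 ^ F := Real.rpow_le_rpow_of_exponent_le (by norm_num) (hF' _ _)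
                _ ≤ n * 2 ^ F := by
                    rw [Finset.sum_const, nsmul_eq_mul, hn]
                    gcongr
                    exact Finset.card_le_univ _
            · rw [hlamG k l hl hlk, zero_mul, abs_zero]
              positivity
        · intro l hl
          have hlS : l ∉ S := fun h => (Finset.mem_sdiff.1 hk).2
            (by rw [← (hmemG l k).1 hl, hPκ l (hS h)]; exact h)
          simp [hlam, hlS]
        · rw [hCY, Finset.prod_const, Finset.prod_const, ← mul_pow, ← mul_pow]
          have h3 : 1 ≤ 2 ^ m * B₁ :=
            one_le_mul_of_one_le_of_one_le (one_le_pow₀ (by norm_num)) hB₁1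
          have h4 : 1 ≤ 2 ^ m * B₂ :=
            one_le_mul_of_one_le_of_one_le (one_le_pow₀ (by norm_num)) hB₂1
          gcongr
          · exact Finset.card_le_univ _
          · exact Finset.card_le_univ _
      refine ((hSBu.mul hu.contDiffAt (hYc S).contDiffAt hSBY)).mono ?_
      have hWa : W * ∏ l, a l = ∏ l, a l ^ (-(γ l : ℝ)) := by
        rw [hW, ← Finset.prod_mul_distrib]
        refine Finset.prod_congr rfl fun l _ => ?_
        conv_lhs => rw [← Real.rpow_one (a l), ← Real.rpow_mul (hapos l).le]
        rw [← Real.rpow_add (hapos l)]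
        congr 1
        ring
      have hnn : 0 ≤ ∏ l, a l ^ (-(γ l : ℝ)) :=
        Finset.prod_nonneg fun l _ => Real.rpow_nonneg (hapos l).le _
      calc 2 ^ m * (CU * (∏ l, a l ^ (-(γ l : ℝ))) * H ^ (F * Γ) * CY)
          = (2 ^ m * (CU * CY)) * (∏ l, a l ^ (-(γ l : ℝ))) * H ^ (F * Γ) := by ring
        _ ≤ C₂ * (∏ l, a l ^ (-(γ l : ℝ))) * H ^ (F * Γ) := by
            gcongr
            exact le_max_right _ _
        _ = C₂ * W * (∏ l, a l) * H ^ (F * Γ) := by rw [← hWa]; ring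
  have hint : ∀ S ∈ P.powerset, Integrable fun y => u y * Y S y := fun S _ =>
    (hu.mul (hYc S)).continuous.integrable_of_hasCompactSupport huc.mul_right
  rw [hsum, fourier_finset_sum _ hint]
  calc ‖∑ S ∈ P.powerset, 𝓕 (fun y => u y * Y S y) x‖
      ≤ ∑ S ∈ P.powerset, ‖𝓕 (fun y => u y * Y S y) x‖ := norm_sum_le _ _
    _ ≤ ∑ _S ∈ P.powerset, C' * W := Finset.sum_le_sum hmain
    _ = 2 ^ P.card * (C' * W) := by
        rw [Finset.sum_const, Finset.card_powerset, nsmul_eq_mul]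
        push_cast
        rfl
    _ ≤ 2 ^ Fintype.card ι * (C' * W) := by
        gcongr
        · norm_num
        · exact Finset.card_le_univ _
    _ = _ := by ring

end KernelBound

/-! ### Monomials as symbols -/

section Monomial

variable {ι : Type*} [Fintype ι]

theorem scaledBound_coord {x : EuclideanSpace ℝ ι} {lam : ι → ℝ} {l : ι} {A : ℝ} (m : ℕ)
    (hx : |x l| ≤ A) (hlam : |lam l| ≤ A) :
    ScaledBound (fun y => (y l : ℂ)) x lam m A := by
  have hA : 0 ≤ A := (abs_nonneg _).trans hx
  refine ScaledBound.oneVar (h := fun t : ℝ => (t : ℂ)) Complex.ofRealCLM.contDiff l fun k _ => ?_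
  rcases k with _ | _ | k
  · simpa using hx
  · have : deriv (fun t : ℝ => (t : ℂ)) = fun _ => 1 := by
      funext t; exact (Complex.ofRealCLM.hasDerivAt (x := t)).deriv
    simpa [this] using hlam
  · have : deriv (fun t : ℝ => (t : ℂ)) = fun _ => 1 := by
      funext t; exact (Complex.ofRealCLM.hasDerivAt (x := t)).deriv
    rw [iteratedDeriv_succ', this, iteratedDeriv_const]
    simpa using hA

theorem contDiff_coord (l : ι) : ContDiff ℝ ∞ fun y : EuclideanSpace ℝ ι => (y l : ℂ) :=
  Complex.ofRealCLM.contDiff.comp (by fun_prop)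

/-- A monomial is bounded by its value at `A` as long as both the point and the scales are at most
`A`. -/
theorem scaledBound_monomial {x : EuclideanSpace ℝ ι} {lam A : ι → ℝ} (s : Finset ι) (β : ι → ℕ)
    (m : ℕ) (hx : ∀ l ∈ s, |x l| ≤ A l) (hlam : ∀ l ∈ s, |lam l| ≤ A l) :
    ScaledBound (fun y => ∏ l ∈ s, (y l : ℂ) ^ β l) x lam m
      ((2 ^ m) ^ (Fintype.card ι + ∑ l, β l) * ∏ l ∈ s, A l ^ β l) := by
  have h1 : ∀ l ∈ s, ScaledBound (fun y => (y l : ℂ) ^ β l) x lam m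
      ((2 ^ m) ^ β l * A l ^ β l) := by
    intro l hl
    have h := ScaledBound.prod (x := x) (lam := lam) (m := m) (Finset.range (β l))
      (f := fun _ y => (y l : ℂ)) (c := fun _ => A l)
      (fun _ _ => (contDiff_coord l).contDiffAt)
      (fun _ _ => scaledBound_coord m (hx l hl) (hlam l hl))
    simpa using h
  refine (ScaledBound.prod s (fun l _ => ((contDiff_coord l).pow _).contDiffAt) h1).mono ?_
  have hA : 0 ≤ ∏ l ∈ s, A l ^ β l :=
    Finset.prod_nonneg fun l hl => pow_nonneg ((abs_nonneg _).trans (hx l hl)) _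
  rw [Finset.prod_mul_distrib, ← mul_assoc, Finset.prod_pow_eq_pow_sum, ← pow_add]
  have h2 : ∑ l ∈ s, β l ≤ ∑ l, β l := Finset.sum_le_sum_of_subset (Finset.subset_univ s)
  have h3 := Finset.card_le_univ s
  refine mul_le_mul_of_nonneg_right ?_ hA
  exact pow_le_pow_right₀ (one_le_pow₀ (by norm_num)) (by omega)

theorem IsSymbol.mul {f : ι → ι → ℝ} {u v : EuclideanSpace ℝ ι → ℂ}
    {w w' : EuclideanSpace ℝ ι → ℝ} {C C' : ℕ → ℝ} (hu : ContDiff ℝ ∞ u) (hv : ContDiff ℝ ∞ v)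
    (h : IsSymbol f u w C) (h' : IsSymbol f v w' C') :
    IsSymbol f (fun ξ => u ξ * v ξ) (fun ξ => w ξ * w' ξ) fun m => 2 ^ m * (C m * C' m) := by
  intro m ξ
  refine ((h m ξ).mul hu.contDiffAt hv.contDiffAt (h' m ξ)).mono (le_of_eq ?_)
  ring

/-- A monomial of degree `β` is a symbol of order `β`. Multiplication by monomials therefore turns
derivatives of a Fourier transform into the Fourier transform of a symbol of higher order. -/
theorem isSymbol_monomial {f : ι → ι → ℝ} (hf : IsExponentSystem f) (β : ι → ℕ) :
    IsSymbol f (fun ξ => ∏ l, (ξ l : ℂ) ^ β l) (fun ξ => ∏ l, (1 + qNorm f l ξ) ^ β l)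
      fun m => (2 ^ m) ^ (Fintype.card ι + ∑ l, β l) := by
  intro m ξ
  refine scaledBound_monomial _ β m (fun l _ => ?_) (fun l _ => ?_)
  · linarith [hf.abs_le_qNorm l ξ]
  · rw [abs_of_nonneg]
    linarith [qNorm_nonneg (f := f) l ξ]

end Monomial

/-! ### The Fourier transform of a symbol: decay and derivatives -/

section KernelBound

variable {ι : Type*} [Fintype ι] [DecidableEq ι] {f : ι → ι → ℝ}

/-- Rapid decay of the Fourier transform of a symbol, from repeated integration by parts in the
single direction `l`: each derivative gains the factor `1 + qNorm f l ξ`, a power of which dominates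
all the frequencies. -/
theorem exists_norm_fourier_le_far (hf : IsExponentSystem f) (γ : ι → ℕ) (C : ℕ → ℝ) (M₀ : ℕ) :
    ∃ C' : ℝ, 0 ≤ C' ∧ ∀ u : EuclideanSpace ℝ ι → ℂ, ContDiff ℝ ∞ u → HasCompactSupport u →
      IsSymbol f u (fun ξ => ∏ l, (1 + qNorm f l ξ) ^ γ l) C →
      ∀ (x : EuclideanSpace ℝ ι) (l : ι), 1 ≤ |x l| → ‖𝓕 u x‖ ≤ C' * (|x l| ^ M₀)⁻¹ := by
  obtain ⟨F, hF1, hF, hF'⟩ := exists_rpow_bounds hf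
  set n : ℝ := ((Fintype.card ι : ℕ) : ℝ) with hn
  set Γ : ℕ := ∑ l, γ l with hΓ
  have hF0 : 0 < F := by linarith
  set s : ℝ := F * Γ + 2 with hs
  have hs0 : 0 < s := by positivity
  set M : ℕ := ⌈n * F * s⌉₊ + M₀ with hM
  have hMle : n * F * s ≤ M := by
    rw [hM]; push_cast
    have := Nat.le_ceil (n * F * s)
    have h2 : (0 : ℝ) ≤ M₀ := by positivity
    linarith
  set K : ℝ := |C M| * (1 + n) ^ Γ * (2 ^ Fintype.card ι) ^ s with hK
  refine ⟨K * Real.pi ^ Fintype.card ι, by positivity, fun u hu huc hsym x l hl => ?_⟩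
  have hxl : 0 < |x l| := by linarith
  have key : ‖𝓕 u x‖ ≤ (K * (|x l| ^ M)⁻¹) * Real.pi ^ Fintype.card ι := by
    refine norm_fourier_le_of_multiDeriv hu huc {l} M (a := fun _ => 1) (fun _ => one_pos)
      (fun k hk => ?_) fun ξ => ?_
    · rw [Finset.mem_singleton.1 hk]
      exact abs_pos.1 hxl
    -- all frequencies are dominated by a power of `q`, which each integration by parts gains
    set q : ℝ := 1 + qNorm f l ξ with hq
    have hq1 : 1 ≤ q := by rw [hq]; linarith [qNorm_nonneg (f := f) l ξ]
    set H : ℝ := ∏ l, (1 + |ξ l|) with hH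
    have hH1 : ∀ j, 1 + |ξ j| ≤ H := fun j =>
      le_prod_of_one_le (t := fun l => 1 + |ξ l|)
        (fun k _ => le_add_of_nonneg_right (abs_nonneg _)) (Finset.mem_univ j)
    have hHone : 1 ≤ H := (le_add_of_nonneg_right (abs_nonneg _)).trans (hH1 l)
    have hH0 : 0 < H := by linarith
    have h1 : ∀ j, 1 + qNorm f j ξ ≤ (1 + n) * H ^ F := by
      intro j
      have h2 : qNorm f j ξ ≤ ∑ _k : ι, H ^ F := by
        refine Finset.sum_le_sum fun k _ => ?_
        calc |ξ k| ^ (1 / f k j) ≤ H ^ (1 / f k j) := by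
              refine Real.rpow_le_rpow (abs_nonneg _) ?_ (by have := hf.pos k j; positivity)
              linarith [hH1 k]
          _ ≤ H ^ F := Real.rpow_le_rpow_of_exponent_le hHone (hF' _ _)
      rw [Finset.sum_const, Finset.card_univ, nsmul_eq_mul] at h2
      have h3 : 1 ≤ H ^ F := Real.one_le_rpow hHone hF0.le
      linarith
    have h2 : H ≤ 2 ^ Fintype.card ι * q ^ (n * F) := by
      calc H ≤ ∏ _j : ι, (2 * q ^ F) := by
            refine Finset.prod_le_prod (fun j _ => by positivity) fun j _ => ?_
            have hfj := hf.pos j l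
            have h3 : |ξ j| ≤ q ^ F := by
              have h4 : |ξ j| ^ (1 / f j l) ≤ q := by
                linarith [rpow_le_qNorm (f := f) l j ξ]
              rw [one_div, Real.rpow_inv_le_iff_of_pos (abs_nonneg _) (by linarith) hfj] at h4
              exact h4.trans (Real.rpow_le_rpow_of_exponent_le hq1 (hF _ _))
            have h4 : 1 ≤ q ^ F := Real.one_le_rpow hq1 hF0.le
            linarith
        _ = 2 ^ Fintype.card ι * q ^ (n * F) := by
            rw [Finset.prod_const, Finset.card_univ, mul_pow, ← Real.rpow_natCast (q ^ F),
              ← Real.rpow_mul (by linarith), mul_comm F]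
    have h3 := (hsym M ξ).multiDeriv_le hu.contDiffAt
      (γ := fun j => if j ∈ ({l} : Finset ι) then M else 0) (by simp)
    have h4 : ∏ j, |1 + qNorm f j ξ| ^ (if j ∈ ({l} : Finset ι) then M else 0) = q ^ M := by
      simp only [pow_ite, pow_zero]
      rw [Finset.prod_ite_mem, Finset.univ_inter, Finset.prod_singleton, abs_of_nonneg]
      linarith
    rw [h4] at h3
    have h5 : ∏ j, (1 + qNorm f j ξ) ^ γ j ≤ (1 + n) ^ Γ * H ^ (F * Γ) := by
      calc ∏ j, (1 + qNorm f j ξ) ^ γ j ≤ ∏ j, ((1 + n) * H ^ F) ^ γ j := by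
            refine Finset.prod_le_prod (fun j _ => ?_) fun j _ => ?_
            · have := qNorm_nonneg (f := f) j ξ
              positivity
            · have := qNorm_nonneg (f := f) j ξ
              exact pow_le_pow_left₀ (by positivity) (h1 j) _
        _ = _ := by
            rw [Finset.prod_pow_eq_pow_sum, mul_pow, ← Real.rpow_natCast (H ^ F),
              ← Real.rpow_mul hH0.le]
    have h6 : H ^ s ≤ (2 ^ Fintype.card ι) ^ s * q ^ M := by
      calc H ^ s ≤ (2 ^ Fintype.card ι * q ^ (n * F)) ^ s := Real.rpow_le_rpow hH0.le h2 hs0.le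
        _ = (2 ^ Fintype.card ι) ^ s * q ^ (n * F * s) := by
            rw [Real.mul_rpow (by positivity) (by positivity), ← Real.rpow_mul (by linarith)]
        _ ≤ (2 ^ Fintype.card ι) ^ s * q ^ M := by
            rw [← Real.rpow_natCast q M]
            gcongr
    have hqM : 0 < q ^ M := by positivity
    set D := ‖multiDeriv (fun j => if j ∈ ({l} : Finset ι) then M else 0) u ξ‖ with hD
    have h7 : q ^ M * D ≤ |C M| * ((1 + n) ^ Γ * H ^ (F * Γ)) := by
      refine h3.trans ?_
      have h8 : 0 ≤ ∏ j, (1 + qNorm f j ξ) ^ γ j := Finset.prod_nonneg fun j _ => by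
        have := qNorm_nonneg (f := f) j ξ
        positivity
      exact mul_le_mul (le_abs_self _) h5 h8 (abs_nonneg _)
    have h9 : D ≤ K * H ^ (-2 : ℝ) := by
      have e : H ^ s = H ^ (F * Γ) * H ^ (2 : ℝ) := Real.rpow_add hH0 _ _
      rw [Real.rpow_neg hH0.le, ← div_eq_mul_inv, le_div_iff₀ (by positivity)]
      have hHF : 0 < H ^ (F * Γ) := by positivity
      have hH2 : 0 < H ^ (2 : ℝ) := by positivity
      have hD0 : 0 ≤ D := norm_nonneg _
      refine le_of_mul_le_mul_left (a := q ^ M * H ^ (F * Γ)) ?_ (by positivity)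
      calc q ^ M * H ^ (F * Γ) * (D * H ^ (2 : ℝ)) = (q ^ M * D) * H ^ s := by rw [e]; ring
        _ ≤ (|C M| * ((1 + n) ^ Γ * H ^ (F * Γ))) * ((2 ^ Fintype.card ι) ^ s * q ^ M) :=
            mul_le_mul h7 h6 (by positivity) (by positivity)
        _ = _ := by rw [hK]; ring
    have h10 : H ^ (-2 : ℝ) ≤ ∏ j, (1 * (1 + (1 * ξ j) ^ 2)⁻¹) := by
      rw [hH, ← Real.finsetProd_rpow _ _ (fun l _ => by positivity)]
      refine Finset.prod_le_prod (fun l _ => by positivity) fun l _ => ?_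
      rw [Real.rpow_neg (by positivity), one_mul, one_mul]
      gcongr
      rw [Real.rpow_two, ← sq_abs (ξ l)]
      nlinarith [abs_nonneg (ξ l)]
    rw [Finset.prod_singleton, inv_mul_cancel_right₀ (by positivity)]
    exact h9.trans (mul_le_mul_of_nonneg_left h10 (by positivity))
  refine key.trans ?_
  have h11 : (|x l| ^ M)⁻¹ ≤ (|x l| ^ M₀)⁻¹ := by
    gcongr
    omega
  have : 0 ≤ K := by positivity
  calc K * (|x l| ^ M)⁻¹ * Real.pi ^ Fintype.card ι ≤
      K * (|x l| ^ M₀)⁻¹ * Real.pi ^ Fintype.card ι := by gcongr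
    _ = _ := by ring

theorem EuclideanSpace.norm_le_card_mul {x : EuclideanSpace ℝ ι} {A : ℝ} (h : ∀ l, |x l| ≤ A) :
    ‖x‖ ≤ Fintype.card ι * A := by
  have e : x = ∑ l, x l • EuclideanSpace.single l (1 : ℝ) := by
    ext j
    simp [Finset.sum_apply, Pi.single_apply]
  rw [e]
  refine (norm_sum_le _ _).trans ?_
  calc ∑ l, ‖x l • EuclideanSpace.single l (1 : ℝ)‖ ≤ ∑ _l : ι, A := by
        refine Finset.sum_le_sum fun l _ => ?_
        rw [norm_smul, PiLp.norm_single]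
        simpa using h l
    _ = _ := by simp

/-- The Fourier transform of a compactly supported symbol satisfies the differential inequalities
of a proper kernel, with constants that depend only on the constants of the symbol. -/
theorem exists_norm_fourier_le_kernel (hf : IsExponentSystem f) (γ : ι → ℕ) (C : ℕ → ℝ) (M : ℕ) :
    ∃ C' : ℝ, 0 ≤ C' ∧ ∀ u : EuclideanSpace ℝ ι → ℂ, ContDiff ℝ ∞ u → HasCompactSupport u →
      IsSymbol f u (fun ξ => ∏ l, (1 + qNorm f l ξ) ^ γ l) C →
      ∀ x : EuclideanSpace ℝ ι, x ≠ 0 →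
        ‖𝓕 u x‖ ≤ C' * (1 + ‖x‖) ^ (-(M : ℝ)) * ∏ l, pNorm f l x ^ (-(1 + (γ l : ℝ))) := by
  obtain ⟨F, hF1, hF, hF'⟩ := exists_rpow_bounds hf
  set n : ℝ := ((Fintype.card ι : ℕ) : ℝ) with hn
  have hn0 : 0 ≤ n := by positivity
  set Γ : ℝ := ∑ l, (1 + (γ l : ℝ)) with hΓ
  have hΓ0 : 0 ≤ Γ := Finset.sum_nonneg fun l _ => by positivity
  set M₀ : ℕ := M + ⌈F * Γ⌉₊ with hM₀
  obtain ⟨C₁, hC₁, h1⟩ := exists_norm_fourier_le_near_zero hf γ C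
  obtain ⟨C₂, hC₂, h2⟩ := exists_norm_fourier_le_far hf γ C M₀
  set C' : ℝ := (C₁ + C₂ * (1 + n) ^ Γ) * (1 + n) ^ M with hC'
  refine ⟨C', by positivity, fun u hu huc hsym x hx => ?_⟩
  have hPr0 : 0 ≤ ∏ l, pNorm f l x ^ (-(1 + (γ l : ℝ))) :=
    Finset.prod_nonneg fun l _ => Real.rpow_nonneg (pNorm_nonneg l x) _
  have hinv : ∀ A : ℝ, 0 < A → 1 + ‖x‖ ≤ (1 + n) * A →
      1 ≤ (1 + n) ^ M * A ^ M * (1 + ‖x‖) ^ (-(M : ℝ)) := by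
    intro A hA h
    rw [Real.rpow_neg (by positivity), Real.rpow_natCast, ← div_eq_mul_inv,
      one_le_div₀ (by positivity), ← mul_pow]
    gcongr
  have hM0 : 0 ≤ (1 + ‖x‖) ^ (-(M : ℝ)) := by positivity
  by_cases hx1 : ∀ l, |x l| ≤ 1
  · refine (h1 u hu huc hsym x hx hx1).trans ?_
    have h3 := hinv 1 one_pos (by
      have := EuclideanSpace.norm_le_card_mul hx1
      linarith)
    rw [one_pow, mul_one] at h3
    refine mul_le_mul_of_nonneg_right ?_ hPr0
    calc C₁ ≤ C₁ * ((1 + n) ^ M * (1 + ‖x‖) ^ (-(M : ℝ))) := le_mul_of_one_le_right hC₁ h3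
      _ ≤ (C₁ + C₂ * (1 + n) ^ Γ) * ((1 + n) ^ M * (1 + ‖x‖) ^ (-(M : ℝ))) := by
          gcongr
          have : 0 ≤ C₂ * (1 + n) ^ Γ := by positivity
          linarith
      _ = _ := by rw [hC']; ring
  · push Not at hx1
    obtain ⟨l₀, hl₀⟩ := hx1
    obtain ⟨l, -, hl⟩ := Finset.univ.exists_max_image (fun l => |x l|) ⟨l₀, Finset.mem_univ _⟩
    set A := |x l| with hA
    have hA1 : 1 ≤ A := hl₀.le.trans (hl l₀ (Finset.mem_univ _))
    have h3 := hinv A (by linarith) (by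
      have := EuclideanSpace.norm_le_card_mul (x := x) (A := A) fun k => hl k (Finset.mem_univ _)
      rw [← hn] at this
      linarith)
    have h4 : 1 ≤ ((1 + n) ^ Γ * A ^ (F * Γ)) * ∏ l, pNorm f l x ^ (-(1 + (γ l : ℝ))) := by
      have h5 : ∀ j, pNorm f j x ≤ (1 + n) * A ^ F := by
        intro j
        calc pNorm f j x ≤ ∑ _k : ι, A ^ F := by
              refine Finset.sum_le_sum fun k _ => ?_
              exact (Real.rpow_le_rpow (abs_nonneg _) (hl k (Finset.mem_univ _))
                (hf.pos j k).le).trans (Real.rpow_le_rpow_of_exponent_le hA1 (hF _ _))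
          _ = n * A ^ F := by simp [hn]
          _ ≤ (1 + n) * A ^ F := by gcongr; linarith
      have h6 : ((1 + n) ^ Γ * A ^ (F * Γ))⁻¹ ≤ ∏ l, pNorm f l x ^ (-(1 + (γ l : ℝ))) := by
        calc ((1 + n) ^ Γ * A ^ (F * Γ))⁻¹ = ((1 + n) * A ^ F) ^ (-Γ) := by
              rw [Real.rpow_neg (by positivity), Real.mul_rpow (by positivity) (by positivity),
                ← Real.rpow_mul (by linarith)]
          _ = ∏ l, ((1 + n) * A ^ F) ^ (-(1 + (γ l : ℝ))) := by
              rw [← Real.rpow_sum_of_pos (by positivity), Finset.sum_neg_distrib]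
          _ ≤ _ := by
              refine Finset.prod_le_prod (fun j _ => by positivity) fun j _ => ?_
              exact Real.rpow_le_rpow_of_nonpos (pNorm_pos hx j) (h5 j)
                (by have : (0 : ℝ) ≤ γ j := by positivity
                    linarith)
      rwa [inv_le_iff_one_le_mul₀' (by positivity)] at h6
    refine (h2 u hu huc hsym x l hA1).trans ?_
    have h7 : (A ^ M₀)⁻¹ * (A ^ M * A ^ (F * Γ)) ≤ 1 := by
      rw [inv_mul_le_iff₀ (by positivity), mul_one, hM₀, pow_add]
      gcongr
      rw [← Real.rpow_natCast]
      exact Real.rpow_le_rpow_of_exponent_le hA1 (Nat.le_ceil _)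
    set Pr := ∏ l, pNorm f l x ^ (-(1 + (γ l : ℝ))) with hPr
    set N := (1 + ‖x‖) ^ (-(M : ℝ)) with hN
    calc C₂ * (A ^ M₀)⁻¹ ≤ C₂ * (A ^ M₀)⁻¹ * (((1 + n) ^ M * A ^ M * N) *
          (((1 + n) ^ Γ * A ^ (F * Γ)) * Pr)) :=
          le_mul_of_one_le_right (by positivity) (one_le_mul_of_one_le_of_one_le h3 h4)
      _ = (C₂ * (1 + n) ^ Γ) * (1 + n) ^ M * N * Pr * ((A ^ M₀)⁻¹ * (A ^ M * A ^ (F * Γ))) := by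
          ring
      _ ≤ (C₂ * (1 + n) ^ Γ) * (1 + n) ^ M * N * Pr * 1 := by gcongr
      _ ≤ C' * N * Pr := by
          rw [mul_one, hC']
          gcongr
          linarith

/-- The same for the derivatives, which are Fourier transforms of the symbol times a monomial. -/
theorem exists_norm_multiDeriv_fourier_le_kernel (hf : IsExponentSystem f) (γ β : ι → ℕ)
    (C : ℕ → ℝ) (M : ℕ) :
    ∃ C' : ℝ, 0 ≤ C' ∧ ∀ u : EuclideanSpace ℝ ι → ℂ, ContDiff ℝ ∞ u → HasCompactSupport u →
      IsSymbol f u (fun ξ => ∏ l, (1 + qNorm f l ξ) ^ γ l) C →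
      ∀ x : EuclideanSpace ℝ ι, x ≠ 0 → ‖multiDeriv β (𝓕 u) x‖ ≤
        C' * (1 + ‖x‖) ^ (-(M : ℝ)) * ∏ l, pNorm f l x ^ (-(1 + (γ l : ℝ) + β l)) := by
  set c : ℂ := ∏ l, (-(2 * Real.pi * Complex.I)) ^ β l with hc
  obtain ⟨C', hC', h⟩ := exists_norm_fourier_le_kernel hf (fun l => β l + γ l)
    (fun m => 2 ^ m * (‖c‖ * (2 ^ m * ((2 ^ m) ^ (Fintype.card ι + ∑ l, β l) * C m)))) M
  refine ⟨C', hC', fun u hu huc hsym x hx => ?_⟩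
  have hint : ∀ k : ℕ, Integrable fun ξ : EuclideanSpace ℝ ι => ‖ξ‖ ^ k * ‖u ξ‖ := fun k =>
    (Continuous.mul (by fun_prop) hu.continuous.norm).integrable_of_hasCompactSupport
      huc.norm.mul_left
  rw [multiDeriv_fourier hint hu.continuous.aestronglyMeasurable]
  have e : (fun ξ : EuclideanSpace ℝ ι =>
      (∏ l, (-(2 * Real.pi * Complex.I) * ξ l) ^ β l) * u ξ) =
      fun ξ => c * ((∏ l, (ξ l : ℂ) ^ β l) * u ξ) := by
    funext ξ
    simp only [mul_pow, Finset.prod_mul_distrib]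
    rw [hc, mul_assoc]
  rw [e]
  have hmon : ContDiff ℝ ∞ fun ξ : EuclideanSpace ℝ ι => ∏ l, (ξ l : ℂ) ^ β l :=
    contDiff_prod fun l _ => (contDiff_coord l).pow _
  have hmu : ContDiff ℝ ∞ fun ξ : EuclideanSpace ℝ ι => (∏ l, (ξ l : ℂ) ^ β l) * u ξ := hmon.mul hu
  have h1 := h (fun ξ => c * ((∏ l, (ξ l : ℂ) ^ β l) * u ξ)) (contDiff_const.mul hmu)
    (huc.mul_left.mul_left) (fun m ξ => by
      have h2 := ((isSymbol_monomial hf β).mul hmon hu hsym) m ξ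
      refine (ScaledBound.mul contDiffAt_const hmu.contDiffAt (ScaledBound.const c) h2).mono
        (le_of_eq ?_)
      simp only [pow_add, Finset.prod_mul_distrib]
      ring) x hx
  refine h1.trans (le_of_eq ?_)
  congr 1
  refine Finset.prod_congr rfl fun l _ => ?_
  congr 1
  push_cast
  ring

end KernelBound

/-! ### Limits in terms of partial derivatives -/

section Limits

variable {ι : Type*} [Fintype ι] [DecidableEq ι]

theorem norm_iteratedFDeriv_le_of_multiDeriv_sum {k : ℕ} {f : EuclideanSpace ℝ ι → ℂ}
    {x : EuclideanSpace ℝ ι} (hf : ContDiffAt ℝ k f x) {B : (ι → ℕ) → ℝ}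
    (h : ∀ γ : ι → ℕ, ∑ l, γ l = k → ‖multiDeriv γ f x‖ ≤ B γ) :
    ‖iteratedFDeriv ℝ k f x‖ ≤
      Fintype.card ι ^ k * ∑ γ ∈ Finset.piAntidiag (Finset.univ : Finset ι) k, B γ := by
  have hmem : ∀ γ : ι → ℕ, ∑ l, γ l = k → γ ∈ Finset.piAntidiag (Finset.univ : Finset ι) k :=
    fun γ hγ => Finset.mem_piAntidiag.2 ⟨hγ, fun _ _ => Finset.mem_univ _⟩
  refine norm_iteratedFDeriv_le_of_multiDeriv hf fun γ hγ => (h γ hγ).trans ?_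
  refine Finset.single_le_sum (f := B) (fun β hβ => ?_) (hmem γ hγ)
  exact (norm_nonneg _).trans (h β (Finset.mem_piAntidiag.1 hβ).1)

theorem multiDeriv_sub {γ : ι → ℕ} {u v : EuclideanSpace ℝ ι → ℂ} (hu : ContDiff ℝ ∞ u)
    (hv : ContDiff ℝ ∞ v) (x : EuclideanSpace ℝ ι) :
    multiDeriv γ (fun y => u y - v y) x = multiDeriv γ u x - multiDeriv γ v x := by
  unfold multiDeriv
  have e := iteratedFDeriv_sub_apply (i := Fintype.card (Σ l, Fin (γ l))) (x := x)
    (hu.contDiffAt.of_le (by exact_mod_cast le_top))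
    (hv.contDiffAt.of_le (by exact_mod_cast le_top))
  have e' : (fun y => u y - v y) = u - v := rfl
  rw [e', e]
  rfl

theorem multiDeriv_const_mul {γ : ι → ℕ} {u : EuclideanSpace ℝ ι → ℂ} (hu : ContDiff ℝ ∞ u)
    (c : ℂ) (x : EuclideanSpace ℝ ι) :
    multiDeriv γ (fun y => c * u y) x = c * multiDeriv γ u x := by
  unfold multiDeriv
  have e := iteratedFDeriv_const_smul_apply (i := Fintype.card (Σ l, Fin (γ l))) (x := x) (a := c)
    (hu.contDiffAt.of_le (by exact_mod_cast le_top))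
  have e' : (fun y => c * u y) = c • u := rfl
  rw [e', e]
  rfl

/-- Limits of smooth functions whose successive differences decay geometrically, together with all
partial derivatives, locally uniformly. -/
theorem exists_contDiffOn_limit_of_multiDeriv {U : Set (EuclideanSpace ℝ ι)} (hU : IsOpen U)
    {v : ℕ → EuclideanSpace ℝ ι → ℂ} (hv : ∀ s, ContDiff ℝ ∞ (v s)) {r : ℝ} (hr : 0 ≤ r)
    (hr1 : r < 1)
    (h : ∀ γ : ι → ℕ, ∀ x ∈ U, ∃ B : ℝ, ∀ᶠ y in nhds x, ∀ s : ℕ,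
      ‖multiDeriv γ (fun y => v (s + 1) y - v s y) y‖ ≤ B * r ^ s) :
    ∃ g : EuclideanSpace ℝ ι → ℂ, ContDiffOn ℝ ∞ g U ∧ ∀ γ : ι → ℕ, ∀ x ∈ U,
      Filter.Tendsto (fun s => multiDeriv γ (v s) x) Filter.atTop (nhds (multiDeriv γ g x)) := by
  choose! B hB using h
  obtain ⟨g, hg, hlim⟩ := exists_contDiffOn_limit hU hv hr hr1 fun k x hx => by
    refine ⟨Fintype.card ι ^ k * ∑ γ ∈ Finset.piAntidiag (Finset.univ : Finset ι) k, B γ x, ?_⟩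
    have h1 : ∀ᶠ y in nhds x, ∀ γ ∈ Finset.piAntidiag (Finset.univ : Finset ι) k, ∀ s : ℕ,
        ‖multiDeriv γ (fun y => v (s + 1) y - v s y) y‖ ≤ B γ x * r ^ s := by
      rw [Filter.eventually_all_finset]
      exact fun γ _ => hB γ x hx
    filter_upwards [h1] with y hy s
    have e := iteratedFDeriv_sub_apply (i := k) (x := y)
      ((hv (s + 1)).contDiffAt.of_le (by exact_mod_cast le_top))
      ((hv s).contDiffAt.of_le (by exact_mod_cast le_top))
    rw [← e]
    have h2 := norm_iteratedFDeriv_le_of_multiDeriv_sum (k := k) (x := y)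
      (f := fun y => v (s + 1) y - v s y) (B := fun γ => B γ x * r ^ s)
      (((hv (s + 1)).sub (hv s)).contDiffAt.of_le (by exact_mod_cast le_top))
      (fun γ hγ => hy γ (Finset.mem_piAntidiag.2 ⟨hγ, fun _ _ => Finset.mem_univ _⟩) s)
    refine h2.trans (le_of_eq ?_)
    rw [← Finset.sum_mul, mul_assoc]
  refine ⟨g, hg, fun γ x hx => ?_⟩
  have h3 := hlim (Fintype.card (Σ l, Fin (γ l))) x hx
  exact ((continuous_eval_const (fun i => EuclideanSpace.single
    ((Fintype.equivFin (Σ l, Fin (γ l))).symm i).1 (1 : ℝ))).tendsto _).comp h3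

end Limits

/-! ### Truncations of multipliers -/

section Weights

variable {ι : Type*} [Fintype ι] {f : ι → ι → ℝ}

/-- Weights `t` for which the boxes `{|ξ_l| ≤ τ ^ t_l}` are adapted to the norms `qNorm`: on such a
box, `qNorm f l` is at most a multiple of `τ ^ t_l`. One may take `t_l = 1 / f(k₀,l)`, for any `k₀`.
-/
theorem IsExponentSystem.exists_weights {ι : Type*} {f : ι → ι → ℝ} (hf : IsExponentSystem f) :
    ∃ t : ι → ℝ, (∀ l, 0 < t l) ∧ ∀ k l, t k ≤ f k l * t l := by
  rcases isEmpty_or_nonempty ι with h | ⟨⟨k₀⟩⟩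
  · exact ⟨fun _ => 1, fun l => h.elim l, fun l => h.elim l⟩
  · refine ⟨fun l => 1 / f k₀ l, fun l => one_div_pos.2 (hf.pos _ _), fun k l => ?_⟩
    have := hf.triangle k₀ k l
    have h1 := hf.pos k₀ k
    have h2 := hf.pos k₀ l
    rw [mul_one_div, div_le_div_iff₀ h1 h2]
    linarith

theorem exists_pos_le_of_finite {t : ι → ℝ} (ht : ∀ l, 0 < t l) : ∃ c : ℝ, 0 < c ∧ ∀ l, c ≤ t l := by
  rcases isEmpty_or_nonempty ι with h | h
  · exact ⟨1, one_pos, fun l => h.elim l⟩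
  · obtain ⟨l, -, hl⟩ := Finset.univ.exists_min_image t Finset.univ_nonempty
    exact ⟨t l, ht l, fun k => hl k (Finset.mem_univ _)⟩

theorem IsSymbol.comp_neg {u : EuclideanSpace ℝ ι → ℂ} (hu : ContDiff ℝ ∞ u) {C : ℕ → ℝ}
    (h : IsSymbol f u (fun _ => 1) C) : IsSymbol f (fun ξ => u (-ξ)) (fun _ => 1) C := by
  intro m ξ k hk
  have h1 := (h m (-ξ)).mono_scale hu.contDiffAt le_rfl
    (lam' := fun l => -(1 + qNorm f l ξ)) (fun l => by simp [abs_neg, qNorm, -neg_add_rev]) k hk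
  have e : (fun z => u (-ξ + diagMap (fun l => -(1 + qNorm f l ξ)) z)) =
      fun z => u (-(ξ + diagMap (fun l => 1 + qNorm f l ξ) z)) := by
    funext z
    congr 1
    ext l
    simp only [PiLp.add_apply, PiLp.neg_apply, diagMap_apply]
    ring
  rw [e] at h1
  simpa using h1

/-- The truncations `∏_l χ(ξ_l / τ ^ t_l)` are symbols, uniformly in `τ ≥ 1`. -/
theorem exists_isSymbol_boxBump (hf : IsExponentSystem f) {t : ι → ℝ} (ht : ∀ l, 0 < t l)
    (htf : ∀ k l, t k ≤ f k l * t l) {b : ℝ} (hb : 1 ≤ b) :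
    ∃ C : ℕ → ℝ, (∀ m, 1 ≤ C m) ∧ ∀ τ : ℝ, 1 ≤ τ → ∀ a : ι → ℝ, (∀ l, |a l| ≤ τ ^ (-(t l))) →
      (∀ l, τ ^ (-(t l)) ≤ b * |a l|) →
      IsSymbol f (boxBump a Finset.univ) (fun _ => 1) C := by
  obtain ⟨F, hF1, hF, hF'⟩ := exists_rpow_bounds hf
  set n : ℝ := ((Fintype.card ι : ℕ) : ℝ) with hn
  set c : ℝ := 1 + n * (2 * b) ^ F with hc
  have hc1 : 1 ≤ c := le_add_of_nonneg_right (by positivity)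
  have := fun m => exists_scaledBound_boxBump ι m hc1
  choose C hC1 hC using this
  refine ⟨C, hC1, fun τ hτ a ha hab m ξ => ?_⟩
  have hτ0 : 0 < τ := by linarith
  rw [mul_one]
  by_cases hξ : ∃ l ∈ Finset.univ, 2 < |a l * ξ l|
  · have h0 : ScaledBound (fun _ => (0 : ℂ)) ξ (fun l => 1 + qNorm f l ξ) m (C m) :=
      (ScaledBound.const 0).mono (by simpa using zero_le_one.trans (hC1 m))
    exact h0.congr (boxBump_eventuallyEq_zero hξ).symm
  · push Not at hξ
    refine hC m a _ _ ξ fun l _ => ?_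
    have hx : ∀ k, |ξ k| ≤ 2 * b * τ ^ t k := by
      intro k
      have h1 := hξ k (Finset.mem_univ _)
      rw [abs_mul] at h1
      have h2 := hab k
      rw [Real.rpow_neg hτ0.le, inv_le_iff_one_le_mul₀ (by positivity)] at h2
      have h3 : 0 < τ ^ t k := by positivity
      calc |ξ k| ≤ |ξ k| * (b * |a k| * τ ^ t k) := le_mul_of_one_le_right (abs_nonneg _) h2
        _ = (|a k| * |ξ k|) * (b * τ ^ t k) := by ring
        _ ≤ 2 * (b * τ ^ t k) := by gcongr
        _ = _ := by ring
    have hq : qNorm f l ξ ≤ n * ((2 * b) ^ F * τ ^ t l) := by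
      calc qNorm f l ξ ≤ ∑ _k : ι, (2 * b) ^ F * τ ^ t l := by
            refine Finset.sum_le_sum fun k _ => ?_
            have hfk := hf.pos k l
            calc |ξ k| ^ (1 / f k l) ≤ (2 * b * τ ^ t k) ^ (1 / f k l) :=
                  Real.rpow_le_rpow (abs_nonneg _) (hx k) (by positivity)
              _ = (2 * b) ^ (1 / f k l) * τ ^ (t k * (1 / f k l)) := by
                  rw [Real.mul_rpow (by positivity) (by positivity), ← Real.rpow_mul hτ0.le]
              _ ≤ _ := by
                  gcongr
                  · linarith
                  · exact hF' k l
                  · rw [mul_one_div, div_le_iff₀ hfk]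
                    linarith [htf k l]
        _ = _ := by simp [hn]
    have hq0 := qNorm_nonneg (f := f) l ξ
    have h4 : 1 ≤ τ ^ t l := Real.one_le_rpow hτ (ht l).le
    have h5 : 1 + qNorm f l ξ ≤ c * τ ^ t l := by
      rw [hc]
      linarith
    rw [abs_mul, abs_of_nonneg (by linarith)]
    calc (1 + qNorm f l ξ) * |a l| ≤ (c * τ ^ t l) * τ ^ (-(t l)) := by
          gcongr
          exact ha l
      _ = c := by
          rw [mul_assoc, ← Real.rpow_add hτ0]
          simp

/-- The difference of two consecutive truncations is supported where `∏_l (1 + qNorm l)` is at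
least a power of `τ`; with this weight it is a symbol with small constants. -/
theorem exists_isSymbol_boxBump_sub [DecidableEq ι] (hf : IsExponentSystem f) {t : ι → ℝ}
    (ht : ∀ l, 0 < t l)
    (htf : ∀ k l, t k ≤ f k l * t l) {c : ℝ} (hct : ∀ l, c ≤ t l) :
    ∃ C : ℕ → ℝ, ∀ τ : ℝ, 1 ≤ τ →
      IsSymbol f (fun ξ => boxBump (fun l => (2 * τ) ^ (-(t l))) Finset.univ ξ -
        boxBump (fun l => τ ^ (-(t l))) Finset.univ ξ) (fun ξ => ∏ l, (1 + qNorm f l ξ) ^ 1)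
        fun m => τ ^ (-c) * C m := by
  obtain ⟨T, hT⟩ : ∃ T, ∀ l, t l ≤ T := by
    refine ⟨∑ l, t l, fun l => Finset.single_le_sum (fun k _ => (ht k).le) (Finset.mem_univ l)⟩
  have hb : (1 : ℝ) ≤ 2 ^ |T| := Real.one_le_rpow (by norm_num) (abs_nonneg _)
  obtain ⟨C, hC1, hC⟩ := exists_isSymbol_boxBump hf ht htf hb
  refine ⟨fun m => C m + 2 ^ m * C m, fun τ hτ m ξ => ?_⟩
  have hτ0 : 0 < τ := by linarith
  have hw1 : ∀ l, 1 ≤ (1 + qNorm f l ξ) ^ 1 := fun l => by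
    rw [pow_one]
    exact le_add_of_nonneg_right (qNorm_nonneg l ξ)
  have hw0 : 0 ≤ ∏ l, (1 + qNorm f l ξ) ^ 1 :=
    Finset.prod_nonneg fun l _ => zero_le_one.trans (hw1 l)
  have hCm := hC1 m
  by_cases hξ : ∀ l ∈ Finset.univ, |τ ^ (-(t l)) * ξ l| < 1
  · have hξ' : ∀ l ∈ Finset.univ, |(2 * τ) ^ (-(t l)) * ξ l| < 1 := by
      intro l hl
      refine lt_of_le_of_lt ?_ (hξ l hl)
      have h1 : 0 < (2 * τ) ^ (-(t l)) := by positivity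
      have h2 : 0 < τ ^ (-(t l)) := by positivity
      rw [abs_mul, abs_mul, abs_of_pos h1, abs_of_pos h2]
      refine mul_le_mul_of_nonneg_right ?_ (abs_nonneg _)
      exact Real.rpow_le_rpow_of_nonpos hτ0 (by linarith) (by linarith [ht l])
    have h0 : ScaledBound (fun _ => (0 : ℂ)) ξ (fun l => 1 + qNorm f l ξ) m
        (τ ^ (-c) * (C m + 2 ^ m * C m) * ∏ l, (1 + qNorm f l ξ) ^ 1) :=
      (ScaledBound.const 0).mono (by rw [norm_zero]; positivity)
    refine h0.congr ?_
    filter_upwards [boxBump_eventuallyEq_one hξ, boxBump_eventuallyEq_one hξ'] with y h1 h2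
    rw [h1, h2, sub_self]
  · push Not at hξ
    obtain ⟨l, -, hl⟩ := hξ
    have h1 : τ ^ c ≤ ∏ l, (1 + qNorm f l ξ) ^ 1 := by
      rw [abs_mul, abs_of_pos (by positivity), Real.rpow_neg hτ0.le, ← div_eq_inv_mul,
        one_le_div (by positivity)] at hl
      calc τ ^ c ≤ τ ^ t l := Real.rpow_le_rpow_of_exponent_le hτ (hct l)
        _ ≤ (1 + qNorm f l ξ) ^ 1 := by
            rw [pow_one]
            linarith [hf.abs_le_qNorm l ξ]
        _ ≤ _ := le_prod_of_one_le (t := fun l => (1 + qNorm f l ξ) ^ 1) (fun k _ => hw1 k)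
            (Finset.mem_univ l)
    have h2 : 1 ≤ τ ^ (-c) * ∏ l, (1 + qNorm f l ξ) ^ 1 := by
      rwa [Real.rpow_neg hτ0.le, ← div_eq_inv_mul, one_le_div (by positivity)]
    have hA := hC τ hτ (fun l => (2 * τ) ^ (-(t l)))
      (fun l => by
        rw [abs_of_pos (by positivity)]
        exact Real.rpow_le_rpow_of_nonpos hτ0 (by linarith) (by linarith [ht l]))
      (fun l => by
        have h1 : 0 < (2 * τ) ^ (-(t l)) := by positivity
        rw [abs_of_pos h1, Real.mul_rpow (by norm_num) hτ0.le, ← mul_assoc,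
          ← Real.rpow_add (by norm_num)]
        refine le_mul_of_one_le_left (by positivity) ?_
        exact Real.one_le_rpow (by norm_num) (by linarith [hT l, le_abs_self T])) m ξ
    have hB := hC τ hτ (fun l => τ ^ (-(t l))) (fun l => by rw [abs_of_pos (by positivity)])
      (fun l => by
        have h1 : 0 < τ ^ (-(t l)) := by positivity
        rw [abs_of_pos h1]
        exact le_mul_of_one_le_left h1.le hb) m ξ
    have h3 := ScaledBound.add (contDiff_boxBump _ _).contDiffAt
      (contDiffAt_const.mul (contDiff_boxBump _ _).contDiffAt) hA
      (ScaledBound.mul (x := ξ) contDiffAt_const (contDiff_boxBump _ _).contDiffAt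
        (ScaledBound.const (-1)) hB)
    have e : (fun ξ => boxBump (fun l => (2 * τ) ^ (-(t l))) Finset.univ ξ -
        boxBump (fun l => τ ^ (-(t l))) Finset.univ ξ) = fun ξ =>
        boxBump (fun l => (2 * τ) ^ (-(t l))) Finset.univ ξ +
        -1 * boxBump (fun l => τ ^ (-(t l))) Finset.univ ξ := by
      funext y; ring
    rw [e]
    refine h3.mono ?_
    have h4 : C m * 1 + 2 ^ m * (‖(-1 : ℂ)‖ * (C m * 1)) = C m + 2 ^ m * C m := by simp
    rw [h4, mul_right_comm]
    exact le_mul_of_one_le_left (by positivity) h2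

end Weights

/-! ### The kernel of a symbol of order zero -/

section KernelOfSymbol

variable {ι : Type*} [Fintype ι] {f : ι → ι → ℝ}

theorem continuous_pNorm (hf : IsExponentSystem f) (l : ι) : Continuous (pNorm f l) := by
  unfold pNorm
  refine continuous_finsetSum _ fun k _ => ?_
  exact Continuous.rpow_const (by fun_prop) fun _ => Or.inr (hf.pos l k).le

theorem continuousAt_prod_pNorm_rpow (hf : IsExponentSystem f) (r : ι → ℝ)
    {x : EuclideanSpace ℝ ι} (hx : x ≠ 0) : ContinuousAt (fun x => ∏ l, pNorm f l x ^ r l) x := by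
  refine tendsto_finsetProd _ fun l _ => ?_
  exact (continuous_pNorm hf l).continuousAt.rpow_const (Or.inl (pNorm_pos hx l).ne')

/-- The kernel weights are locally bounded away from the origin. -/
theorem eventually_prod_pNorm_rpow_le (hf : IsExponentSystem f) (r : ι → ℝ)
    {x : EuclideanSpace ℝ ι} (hx : x ≠ 0) :
    ∀ᶠ y in nhds x, ∏ l, pNorm f l y ^ r l ≤ ∏ l, pNorm f l x ^ r l + 1 :=
  ((continuousAt_prod_pNorm_rpow hf r hx).eventually_lt_const (lt_add_one _)).mono fun _ h => h.le

theorem fourier_const_mul (c : ℂ) (u : EuclideanSpace ℝ ι → ℂ) (x : EuclideanSpace ℝ ι) :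
    𝓕 (fun y => c * u y) x = c * 𝓕 u x := by
  simp only [Real.fourier_eq]
  rw [← integral_const_mul]
  refine integral_congr_ae (.of_forall fun y => ?_)
  simp only [Circle.smul_def, smul_eq_mul]
  ring

theorem fourier_sub' {u v : EuclideanSpace ℝ ι → ℂ} (hu : Integrable u) (hv : Integrable v)
    (x : EuclideanSpace ℝ ι) : 𝓕 (fun y => u y - v y) x = 𝓕 u x - 𝓕 v x := by
  simp only [Real.fourier_eq, smul_sub]
  exact integral_sub ((Real.fourierIntegral_convergent_iff x).2 hu)
    ((Real.fourierIntegral_convergent_iff x).2 hv)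

theorem contDiff_fourier_of_hasCompactSupport {u : EuclideanSpace ℝ ι → ℂ} (hu : ContDiff ℝ ∞ u)
    (huc : HasCompactSupport u) : ContDiff ℝ ∞ (𝓕 u) := by
  have h : (𝓕 u : EuclideanSpace ℝ ι → ℂ) = 𝓕 (huc.toSchwartzMap hu) := by
    rw [SchwartzMap.fourier_coe]
    rfl
  rw [h]
  exact (𝓕 (huc.toSchwartzMap hu)).smooth'

theorem integrable_fourier_of_hasCompactSupport {u : EuclideanSpace ℝ ι → ℂ} (hu : ContDiff ℝ ∞ u)
    (huc : HasCompactSupport u) : Integrable (𝓕 u) := by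
  have h : (𝓕 u : EuclideanSpace ℝ ι → ℂ) = 𝓕 (huc.toSchwartzMap hu) := by
    rw [SchwartzMap.fourier_coe]
    rfl
  rw [h]
  exact (𝓕 (huc.toSchwartzMap hu)).integrable

theorem integral_mul_fourier_eq {u v : EuclideanSpace ℝ ι → ℂ} (hu : Integrable u)
    (hv : Integrable v) : ∫ ξ, u ξ * 𝓕 v ξ = ∫ x, v x * 𝓕 u x := by
  have h := VectorFourier.integral_fourierIntegral_smul_eq_flip (L := innerₗ (EuclideanSpace ℝ ι))
    (e := Real.fourierChar) Real.continuous_fourierChar continuous_inner hu hv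
  simp only [smul_eq_mul, flip_innerₗ] at h
  have h' : ∫ x, 𝓕 u x * v x = ∫ x, u x * 𝓕 v x := h
  rw [← h']
  exact integral_congr_ae (.of_forall fun x => mul_comm _ _)

variable [DecidableEq ι]

/-- The bound for the kernel is homogeneous in the symbol, so that small symbols have small kernels.
-/
theorem exists_norm_multiDeriv_fourier_le_kernel_mul (hf : IsExponentSystem f) (γ β : ι → ℕ)
    (C : ℕ → ℝ) (M : ℕ) :
    ∃ C' : ℝ, 0 ≤ C' ∧ ∀ A : ℝ, 0 < A → ∀ u : EuclideanSpace ℝ ι → ℂ, ContDiff ℝ ∞ u →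
      HasCompactSupport u →
      IsSymbol f u (fun ξ => ∏ l, (1 + qNorm f l ξ) ^ γ l) (fun m => A * C m) →
      ∀ x : EuclideanSpace ℝ ι, x ≠ 0 → ‖multiDeriv β (𝓕 u) x‖ ≤
        A * C' * (1 + ‖x‖) ^ (-(M : ℝ)) * ∏ l, pNorm f l x ^ (-(1 + (γ l : ℝ) + β l)) := by
  obtain ⟨C', hC', h⟩ := exists_norm_multiDeriv_fourier_le_kernel hf γ β (fun m => 2 ^ m * C m) M
  refine ⟨C', hC', fun A hA u hu huc hsym x hx => ?_⟩
  have h1 := h (fun ξ => ((A⁻¹ : ℝ) : ℂ) * u ξ) (contDiff_const.mul hu) huc.mul_left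
    (fun m ξ => (ScaledBound.mul contDiffAt_const hu.contDiffAt (ScaledBound.const _)
      (hsym m ξ)).mono (le_of_eq (by
        rw [Complex.norm_real, Real.norm_of_nonneg (by positivity)]
        field_simp))) x hx
  have e : 𝓕 (fun ξ => ((A⁻¹ : ℝ) : ℂ) * u ξ) = fun y => ((A⁻¹ : ℝ) : ℂ) * 𝓕 u y :=
    funext fun y => fourier_const_mul _ _ _
  rw [e, multiDeriv_const_mul (contDiff_fourier_of_hasCompactSupport hu huc), norm_mul,
    Complex.norm_real, Real.norm_of_nonneg (by positivity), inv_mul_le_iff₀ hA] at h1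
  refine h1.trans (le_of_eq ?_)
  ring

/-- The Fourier transform of a symbol of order zero is, away from the origin, a smooth function
which satisfies the differential inequalities of a proper kernel. -/
theorem exists_kernel_of_isSymbol (hf : IsExponentSystem f) (C : ℕ → ℝ) :
    ∃ C' : ℕ → (ι → ℕ) → ℝ, ∀ m : EuclideanSpace ℝ ι → ℂ, ContDiff ℝ ∞ m →
      IsSymbol f m (fun _ => 1) C →
      ∃ g : EuclideanSpace ℝ ι → ℂ, ContDiffOn ℝ ∞ g {0}ᶜ ∧
        (∀ (M : ℕ) (γ : ι → ℕ) (x : EuclideanSpace ℝ ι), x ≠ 0 → ‖multiDeriv γ g x‖ ≤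
          C' M γ * (1 + ‖x‖) ^ (-(M : ℝ)) * ∏ l, pNorm f l x ^ (-(1 + (γ l : ℝ)))) ∧
        ∀ φ : EuclideanSpace ℝ ι → ℂ, ContDiff ℝ ∞ φ → HasCompactSupport φ → 0 ∉ tsupport φ →
          ∫ ξ, m ξ * 𝓕 φ ξ = ∫ x, φ x * g x := by
  obtain ⟨t, ht, htf⟩ := hf.exists_weights
  obtain ⟨c, hc, hct⟩ := exists_pos_le_of_finite ht
  obtain ⟨C₁, -, hC₁⟩ := exists_isSymbol_boxBump hf ht htf le_rfl
  obtain ⟨C₂, hC₂⟩ := exists_isSymbol_boxBump_sub hf ht htf hct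
  have hK1 := fun (M : ℕ) (γ : ι → ℕ) => exists_norm_multiDeriv_fourier_le_kernel hf (fun _ => 0) γ
    (fun m => 2 ^ m * (C m * C₁ m)) M
  have hK2 := fun (γ : ι → ℕ) => exists_norm_multiDeriv_fourier_le_kernel_mul hf (fun _ => 1) γ
    (fun m => 2 ^ m * (C m * C₂ m)) 0
  choose C' hC'0 hC' using hK1
  choose D hD0 hD using hK2
  refine ⟨C', fun m hm hsym => ?_⟩
  set χ : ℕ → EuclideanSpace ℝ ι → ℂ := fun s =>
    boxBump (fun l => ((2 : ℝ) ^ s) ^ (-(t l))) Finset.univ with hχ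
  have hpos : ∀ s : ℕ, ∀ l, 0 < ((2 : ℝ) ^ s) ^ (-(t l)) := fun s l => by positivity
  have hχs : ∀ s, ContDiff ℝ ∞ (χ s) := fun s => contDiff_boxBump _ _
  have hχc : ∀ s, HasCompactSupport (χ s) := fun s => hasCompactSupport_boxBump_univ (hpos s)
  have hmχ : ∀ s, ContDiff ℝ ∞ fun ξ => m ξ * χ s ξ := fun s => hm.mul (hχs s)
  have hmχc : ∀ s, HasCompactSupport fun ξ => m ξ * χ s ξ := fun s => (hχc s).mul_left
  have hmχi : ∀ s, Integrable fun ξ => m ξ * χ s ξ := fun s =>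
    (hmχ s).continuous.integrable_of_hasCompactSupport (hmχc s)
  have h2s : ∀ s : ℕ, (1 : ℝ) ≤ 2 ^ s := fun s => one_le_pow₀ (by norm_num)
  have hχsym : ∀ s, IsSymbol f (χ s) (fun _ => 1) C₁ := fun s =>
    hC₁ (2 ^ s) (h2s s) _ (fun l => by rw [abs_of_pos (hpos s l)])
      (fun l => by rw [abs_of_pos (hpos s l), one_mul])
  set v : ℕ → EuclideanSpace ℝ ι → ℂ := fun s => 𝓕 fun ξ => m ξ * χ s ξ with hv
  have hvs : ∀ s, ContDiff ℝ ∞ (v s) := fun s =>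
    contDiff_fourier_of_hasCompactSupport (hmχ s) (hmχc s)
  have hvb : ∀ (s M : ℕ) (γ : ι → ℕ) (x : EuclideanSpace ℝ ι), x ≠ 0 → ‖multiDeriv γ (v s) x‖ ≤
      C' M γ * (1 + ‖x‖) ^ (-(M : ℝ)) * ∏ l, pNorm f l x ^ (-(1 + (γ l : ℝ))) := by
    intro s M γ x hx
    have h := hC' M γ (fun ξ => m ξ * χ s ξ) (hmχ s) (hmχc s) (fun k ξ => by
      have := (hsym.mul hm (hχs s) (hχsym s)) k ξ
      simpa using this) x hx
    simpa using h
  -- The difference of consecutive truncations is regarded as a symbol of order one in each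
  -- coordinate. This makes the singularity at the origin worse, which does no harm locally, and the
  -- constants geometrically small.
  have hdiff : ∀ γ : ι → ℕ, ∀ x ∈ ({0}ᶜ : Set (EuclideanSpace ℝ ι)), ∃ B : ℝ, ∀ᶠ y in nhds x,
      ∀ s : ℕ, ‖multiDeriv γ (fun y => v (s + 1) y - v s y) y‖ ≤ B * ((2 : ℝ) ^ (-c)) ^ s := by
    intro γ x hx
    have hx : x ≠ 0 := hx
    refine ⟨D γ * (∏ l, pNorm f l x ^ (-(1 + ((1 : ℕ) : ℝ) + γ l)) + 1), ?_⟩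
    filter_upwards [eventually_prod_pNorm_rpow_le hf (fun l => -(1 + ((1 : ℕ) : ℝ) + γ l)) hx,
      isOpen_compl_singleton.mem_nhds hx] with y hy hy0 s
    have e1 : (fun y => v (s + 1) y - v s y) = 𝓕 fun ξ => m ξ * (χ (s + 1) ξ - χ s ξ) := by
      funext y
      rw [hv]
      beta_reduce
      rw [← fourier_sub' (hmχi _) (hmχi _)]
      simp only [mul_sub]
    have e2 : (fun ξ => m ξ * (χ (s + 1) ξ - χ s ξ)) = fun ξ => m ξ * χ (s + 1) ξ - m ξ * χ s ξ :=
      funext fun ξ => mul_sub _ _ _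
    have e3 : ((2 : ℝ) ^ (-c)) ^ s = ((2 : ℝ) ^ s) ^ (-c) := by
      rw [← Real.rpow_natCast, ← Real.rpow_mul (by norm_num), ← Real.rpow_natCast 2 s,
        ← Real.rpow_mul (by norm_num), mul_comm]
    have hsub : IsSymbol f (fun ξ => χ (s + 1) ξ - χ s ξ) (fun ξ => ∏ l, (1 + qNorm f l ξ) ^ 1)
        fun m => ((2 : ℝ) ^ s) ^ (-c) * C₂ m := by
      have := hC₂ (2 ^ s) (h2s s)
      rw [← pow_succ'] at this
      exact this
    have h := hD γ (((2 : ℝ) ^ s) ^ (-c)) (by positivity)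
      (fun ξ => m ξ * (χ (s + 1) ξ - χ s ξ)) (hm.mul ((hχs _).sub (hχs _)))
      (by rw [e2]; exact (hmχc _).sub (hmχc _))
      (fun k ξ => ((hsym.mul hm ((hχs _).sub (hχs _)) hsub) k ξ).mono (le_of_eq (by ring))) y hy0
    rw [e1, e3]
    refine h.trans ?_
    rw [Nat.cast_zero, neg_zero, Real.rpow_zero, mul_one]
    calc ((2 : ℝ) ^ s) ^ (-c) * D γ * ∏ l, pNorm f l y ^ (-(1 + ((1 : ℕ) : ℝ) + γ l))
        ≤ ((2 : ℝ) ^ s) ^ (-c) * D γ * (∏ l, pNorm f l x ^ (-(1 + ((1 : ℕ) : ℝ) + γ l)) + 1) := by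
          have := hD0 γ
          exact mul_le_mul_of_nonneg_left hy (by positivity)
      _ = _ := by ring
  obtain ⟨g, hg, hlim⟩ := exists_contDiffOn_limit_of_multiDeriv isOpen_compl_singleton hvs
    (r := (2 : ℝ) ^ (-c)) (by positivity) (Real.rpow_lt_one_of_one_lt_of_neg (by norm_num)
      (by linarith)) hdiff
  refine ⟨g, hg, fun M γ x hx => ?_, fun φ hφ hφc hφ0 => ?_⟩
  · exact le_of_tendsto (hlim γ x hx).norm (.of_forall fun s => hvb s M γ x hx)
  have hbd : ∀ ξ, ‖m ξ‖ ≤ C 0 := fun ξ => by simpa using hsym 0 ξ 0 le_rfl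
  have hχ1 : ∀ s ξ, ‖χ s ξ‖ ≤ C₁ 0 := fun s ξ => by simpa using hχsym s 0 ξ 0 le_rfl
  have hφi : Integrable φ := hφ.continuous.integrable_of_hasCompactSupport hφc
  have hφF : Integrable (𝓕 φ) := integrable_fourier_of_hasCompactSupport hφ hφc
  have hne : ∀ x ∈ tsupport φ, x ≠ 0 := fun x hx h => hφ0 (h ▸ hx)
  -- both sides are limits of the corresponding integrals for the truncated multiplier
  have hL : Filter.Tendsto (fun s => ∫ ξ, m ξ * χ s ξ * 𝓕 φ ξ) Filter.atTop
      (nhds (∫ ξ, m ξ * 𝓕 φ ξ)) := by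
    refine tendsto_integral_of_dominated_convergence (fun ξ => C 0 * C₁ 0 * ‖𝓕 φ ξ‖)
      (fun s => ?_) (hφF.norm.const_mul _) (fun s => .of_forall fun ξ => ?_)
      (.of_forall fun ξ => ?_)
    · exact (hmχ s).continuous.aestronglyMeasurable.mul hφF.aestronglyMeasurable
    · rw [norm_mul, norm_mul]
      have := (norm_nonneg _).trans (hbd ξ)
      gcongr
      · exact hbd ξ
      · exact hχ1 s ξ
    · have h1 : ∀ᶠ s in Filter.atTop, χ s ξ = 1 := by
        have h2 : ∀ l, ∀ᶠ s : ℕ in Filter.atTop, |((2 : ℝ) ^ s) ^ (-(t l)) * ξ l| ≤ 1 := by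
          intro l
          have h3 : Filter.Tendsto (fun s : ℕ => |((2 : ℝ) ^ s) ^ (-(t l)) * ξ l|) Filter.atTop
              (nhds |0 * ξ l|) :=
            (((tendsto_rpow_neg_atTop (ht l)).comp
              (tendsto_pow_atTop_atTop_of_one_lt one_lt_two)).mul_const _).abs
          exact (h3.eventually_lt_const (by simp)).mono fun s hs => hs.le
        filter_upwards [Filter.eventually_all.2 h2] with s hs
        exact boxBump_eq_one fun l _ => hs l
      refine tendsto_const_nhds.congr' ?_
      filter_upwards [h1] with s hs
      rw [hs, mul_one]
  have hR : Filter.Tendsto (fun s => ∫ x, φ x * v s x) Filter.atTop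
      (nhds (∫ x, φ x * g x)) := by
    have hcont : Continuous fun x => φ x * ((∏ l, pNorm f l x ^ (-(1 + ((0 : ℕ) : ℝ))) : ℝ) : ℂ) := by
      refine continuous_of_tsupport fun x hx => ?_
      refine hφ.continuous.continuousAt.mul (Complex.continuous_ofReal.continuousAt.comp ?_)
      exact continuousAt_prod_pNorm_rpow hf _ (hne x (closure_mono (fun y hy => by
        rw [Function.mem_support] at hy ⊢
        exact left_ne_zero_of_mul hy) hx))
    have hint := (hcont.integrable_of_hasCompactSupport (μ := volume) hφc.mul_right).norm.const_mul (C' 0 0)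
    refine tendsto_integral_of_dominated_convergence _
      (fun s => ?_) hint (fun s => .of_forall fun x => ?_)
      (.of_forall fun x => ?_)
    · exact (hφ.continuous.mul (hvs s).continuous).aestronglyMeasurable
    · by_cases hx : x ∈ tsupport φ
      · have h1 := hvb s 0 0 x (hne x hx)
        rw [multiDeriv_zero, Nat.cast_zero, neg_zero, Real.rpow_zero, mul_one] at h1
        have h2 : 0 ≤ ∏ l, pNorm f l x ^ (-(1 + ((0 : ℕ) : ℝ))) :=
          Finset.prod_nonneg fun l _ => Real.rpow_nonneg (pNorm_nonneg l x) _
        rw [norm_mul, norm_mul, Complex.norm_real, Real.norm_of_nonneg h2, mul_left_comm]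
        exact mul_le_mul_of_nonneg_left h1 (norm_nonneg _)
      · simp [image_eq_zero_of_notMem_tsupport hx]
    · by_cases hx : x ∈ tsupport φ
      · have := hlim 0 x (hne x hx)
        simp only [multiDeriv_zero] at this
        exact this.const_mul _
      · simp [image_eq_zero_of_notMem_tsupport hx]
  refine tendsto_nhds_unique hL (hR.congr fun s => ?_)
  exact (integral_mul_fourier_eq (hmχi s) hφi).symm

end KernelOfSymbol

/-! ### Sums of powers of homogeneous norms -/

section BlockNorm

/-- If `n_j` is comparable to `max_{l ∈ C_j} |x_l| ^ (1 / d_l)`, then `(∑_j n_j ^ ε_j) ^ d₀` is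
comparable to a sum of powers of the coordinates. -/
theorem exists_blockNorm_equiv {ι J : Type*} [Fintype ι] [Fintype J] (b : ι → J) {d : ι → ℝ}
    (hd : ∀ l, 0 < d l) {ε : J → ℝ} (hε : ∀ j, 0 < ε j) {d₀ : ℝ} (hd₀ : 0 < d₀) {C : ℝ}
    (hC : 0 ≤ C) :
    ∃ C' : ℝ, 1 ≤ C' ∧ ∀ (x : ι → ℝ) (n : J → ℝ), (∀ j, 0 ≤ n j) →
      (∀ l, |x l| ^ (1 / d l) ≤ C * n (b l)) →
      (∀ j A, 0 ≤ A → (∀ l, b l = j → |x l| ^ (1 / d l) ≤ A) → n j ≤ C * A) →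
      (∑ j, n j ^ ε j) ^ d₀ ≤ C' * ∑ l, |x l| ^ (ε (b l) * d₀ / d l) ∧
      ∑ l, |x l| ^ (ε (b l) * d₀ / d l) ≤ C' * (∑ j, n j ^ ε j) ^ d₀ := by
  set C₁ : ℝ := (∑ j, C ^ ε j) ^ d₀ with hC₁
  set C₂ : ℝ := ∑ l, C ^ (ε (b l) * d₀) with hC₂
  have hC₁0 : 0 ≤ C₁ := Real.rpow_nonneg (Finset.sum_nonneg fun j _ => by positivity) _
  have hC₂0 : 0 ≤ C₂ := Finset.sum_nonneg fun j _ => by positivity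
  refine ⟨1 + C₁ + C₂, by linarith, fun x n hn h1 h2 => ⟨?_, ?_⟩⟩
  · set S := ∑ l, |x l| ^ (ε (b l) * d₀ / d l) with hS
    have hS0 : 0 ≤ S := Finset.sum_nonneg fun l _ => by positivity
    have h3 : ∀ j, n j ^ ε j ≤ C ^ ε j * S ^ (1 / d₀) := by
      intro j
      have hεj := hε j
      have h4 : n j ≤ C * S ^ (1 / (ε j * d₀)) := by
        refine h2 j _ (by positivity) fun l hl => ?_
        have hdl := hd l
        rw [one_div (ε j * d₀), Real.le_rpow_inv_iff_of_pos (by positivity) hS0 (by positivity),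
          ← Real.rpow_mul (abs_nonneg _)]
        have h5 := Finset.single_le_sum (f := fun l => |x l| ^ (ε (b l) * d₀ / d l))
          (fun _ _ => by positivity) (Finset.mem_univ l)
        beta_reduce at h5
        rw [hl] at h5
        refine le_trans (le_of_eq ?_) h5
        congr 1
        ring
      calc n j ^ ε j ≤ (C * S ^ (1 / (ε j * d₀))) ^ ε j := Real.rpow_le_rpow (hn j) h4 hεj.le
        _ = C ^ ε j * S ^ (1 / d₀) := by
            rw [Real.mul_rpow hC (by positivity), ← Real.rpow_mul hS0]
            congr 2
            field_simp
    calc (∑ j, n j ^ ε j) ^ d₀ ≤ ((∑ j, C ^ ε j) * S ^ (1 / d₀)) ^ d₀ := by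
          refine Real.rpow_le_rpow (Finset.sum_nonneg fun j _ => Real.rpow_nonneg (hn j) _) ?_ hd₀.le
          rw [Finset.sum_mul]
          exact Finset.sum_le_sum fun j _ => h3 j
      _ = C₁ * S := by
          rw [Real.mul_rpow (Finset.sum_nonneg fun j _ => by positivity) (by positivity),
            ← Real.rpow_mul hS0, one_div_mul_cancel hd₀.ne', Real.rpow_one]
      _ ≤ (1 + C₁ + C₂) * S := by
          gcongr
          linarith
  · set T := ∑ j, n j ^ ε j with hT
    have hT0 : 0 ≤ T := Finset.sum_nonneg fun j _ => Real.rpow_nonneg (hn j) _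
    calc ∑ l, |x l| ^ (ε (b l) * d₀ / d l) ≤ ∑ l, C ^ (ε (b l) * d₀) * T ^ d₀ := by
          refine Finset.sum_le_sum fun l _ => ?_
          have hdl := hd l
          have hεj := hε (b l)
          calc |x l| ^ (ε (b l) * d₀ / d l) = (|x l| ^ (1 / d l)) ^ (ε (b l) * d₀) := by
                rw [← Real.rpow_mul (abs_nonneg _)]
                congr 1
                ring
            _ ≤ (C * n (b l)) ^ (ε (b l) * d₀) :=
                Real.rpow_le_rpow (by positivity) (h1 l) (by positivity)
            _ = C ^ (ε (b l) * d₀) * (n (b l) ^ ε (b l)) ^ d₀ := by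
                rw [Real.mul_rpow hC (hn _), ← Real.rpow_mul (hn _)]
            _ ≤ C ^ (ε (b l) * d₀) * T ^ d₀ := by
                gcongr
                · exact Real.rpow_nonneg (hn _) _
                · exact Finset.single_le_sum (f := fun j => n j ^ ε j)
                    (fun j _ => Real.rpow_nonneg (hn j) _) (Finset.mem_univ (b l))
      _ = C₂ * T ^ d₀ := by rw [← Finset.sum_mul]
      _ ≤ (1 + C₁ + C₂) * T ^ d₀ := by
          gcongr
          linarith

theorem IsExponentSystem.comp {ι κ : Type*} {f : ι → ι → ℝ} (hf : IsExponentSystem f) (g : κ → ι) :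
    IsExponentSystem fun k k' => f (g k) (g k') :=
  ⟨fun _ _ => hf.pos _ _, fun _ => hf.diag _, fun _ _ _ => hf.triangle _ _ _⟩

end BlockNorm

/-! ### The norms of a dilation structure in terms of the coordinates -/

namespace DilationStructure

variable {N n : ℕ} (D : DilationStructure N n) (e : Matrix (Fin n) (Fin n) ℝ)

/-- The exponents `d_l e(j,k) / d_{l'}`, for `l ∈ C_j` and `l' ∈ C_k`, for which
`N_j ^ d_l` is comparable to `∑_{l'} |x_{l'}| ^ f(l,l')`. -/
noncomputable def exponent (l l' : Fin N) : ℝ :=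
  D.d l * e (D.block l) (D.block l') / D.d l'

/-- The exponents of `ℝ^L`. -/
noncomputable def subExponent (L : Finset (Fin n)) (l l' : D.Coord L) : ℝ :=
  D.exponent e l.1 l'.1

variable {e}

theorem isExponentSystem_exponent (he : BasicHypothesis e) : IsExponentSystem (D.exponent e) where
  pos j k := by
    have h1 := D.d_pos j
    have h2 := D.d_pos k
    have h3 := he.pos (D.block j) (D.block k)
    unfold exponent
    positivity
  diag j := by
    have h1 := D.d_pos j
    unfold exponent
    rw [he.diag, mul_one, div_self h1.ne']
  triangle j k l := by
    have h1 := D.d_pos j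
    have h2 := D.d_pos k
    have h3 := D.d_pos l
    unfold exponent
    have h4 : D.d j * e (D.block j) (D.block k) / D.d k *
        (D.d k * e (D.block k) (D.block l) / D.d l) =
        D.d j * (e (D.block j) (D.block k) * e (D.block k) (D.block l)) / D.d l := by
      field_simp
    rw [h4]
    gcongr
    exact he.triangle _ _ _

theorem isExponentSystem_subExponent (he : BasicHypothesis e) (L : Finset (Fin n)) :
    IsExponentSystem (D.subExponent e L) :=
  (D.isExponentSystem_exponent he).comp Subtype.val

/-- The homogeneous norms are comparable to `max_l |t_l| ^ (1 / d_l)`, with a common constant. -/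
theorem exists_nrm_bounds : ∃ C : ℝ, 1 ≤ C ∧ ∀ j (t : EuclideanSpace ℝ {l // D.block l = j}),
    (∀ l, |t l| ^ (1 / D.d l) ≤ C * D.nrm j t) ∧
    ∀ A, 0 ≤ A → (∀ l, |t l| ^ (1 / D.d l) ≤ A) → D.nrm j t ≤ C * A := by
  choose c C hc hC h using D.nrm_equiv
  have h1 : ∀ j, 0 ≤ (c j)⁻¹ + C j * N := fun j => by
    have := hc j
    have := hC j
    positivity
  refine ⟨1 + ∑ j, ((c j)⁻¹ + C j * N), le_add_of_nonneg_right (Finset.sum_nonneg fun j _ => h1 j),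
    fun j t => ?_⟩
  have h2 : (c j)⁻¹ + C j * N ≤ ∑ j, ((c j)⁻¹ + C j * N) :=
    Finset.single_le_sum (f := fun j => (c j)⁻¹ + C j * N) (fun j _ => h1 j) (Finset.mem_univ j)
  have hcj := hc j
  have hCj := hC j
  have hN : 0 ≤ C j * N := by positivity
  have hci : 0 ≤ (c j)⁻¹ := by positivity
  obtain ⟨h3, h4⟩ := h j t
  refine ⟨fun l => ?_, fun A hA hl => ?_⟩
  · have h5 := Finset.single_le_sum (f := fun l : {l // D.block l = j} => |t l| ^ (1 / D.d l))
      (fun _ _ => by positivity) (Finset.mem_univ l)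
    calc |t l| ^ (1 / D.d l) ≤ (c j)⁻¹ * D.nrm j t := by
          rw [← div_eq_inv_mul, le_div_iff₀ hcj, mul_comm]
          exact (mul_le_mul_of_nonneg_left h5 hcj.le).trans h3
      _ ≤ _ := by
          have := D.nrm_nonneg j t
          gcongr
          linarith
  · calc D.nrm j t ≤ C j * ∑ l : {l // D.block l = j}, |t l| ^ (1 / D.d l) := h4
      _ ≤ C j * (N * A) := by
          gcongr
          refine (Finset.sum_le_card_nsmul _ _ A fun l _ => hl l).trans ?_
          rw [nsmul_eq_mul]
          gcongr
          simpa using Fintype.card_subtype_le fun l => D.block l = j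
      _ = C j * N * A := by ring
      _ ≤ _ := by
          gcongr
          linarith

theorem exists_norm_equiv (he : BasicHypothesis e) : ∃ C : ℝ, 1 ≤ C ∧ ∀ l (x : D.Space),
    D.norm e (D.block l) x ^ D.d l ≤ C * pNorm (D.exponent e) l x ∧
    pNorm (D.exponent e) l x ≤ C * D.norm e (D.block l) x ^ D.d l := by
  obtain ⟨C, hC, h⟩ := D.exists_nrm_bounds
  have h1 := fun l => exists_blockNorm_equiv D.block D.d_pos (ε := fun j => e (D.block l) j)
    (fun j => he.pos _ _) (D.d_pos l) (C := C) (by linarith)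
  choose C' hC' h' using h1
  have hS : ∀ l, C' l ≤ 1 + ∑ l, C' l := fun l => by
    have := Finset.single_le_sum (f := C') (fun l _ => zero_le_one.trans (hC' l)) (Finset.mem_univ l)
    linarith
  refine ⟨1 + ∑ l, C' l, le_add_of_nonneg_right
    (Finset.sum_nonneg fun l _ => zero_le_one.trans (hC' l)), fun l x => ?_⟩
  have h2 := h' l x (fun j => D.nrm j (D.comp x j)) (fun j => D.nrm_nonneg _ _)
    (fun k => (h (D.block k) (D.comp x (D.block k))).1 ⟨k, rfl⟩)
    (fun j A hA hk => (h j (D.comp x j)).2 A hA fun k => hk k.1 k.2)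
  have e1 : pNorm (D.exponent e) l x =
      ∑ k, |x k| ^ (e (D.block l) (D.block k) * D.d l / D.d k) := by
    unfold pNorm exponent
    simp only [mul_comm (D.d l)]
  have e2 : D.norm e (D.block l) x = ∑ j, D.nrm j (D.comp x j) ^ e (D.block l) j := rfl
  rw [← e1, ← e2] at h2
  have h3 : 0 ≤ D.norm e (D.block l) x := Finset.sum_nonneg fun j _ =>
    Real.rpow_nonneg (D.nrm_nonneg _ _) _
  exact ⟨h2.1.trans (mul_le_mul_of_nonneg_right (hS l) (pNorm_nonneg _ _)),
    h2.2.trans (mul_le_mul_of_nonneg_right (hS l) (by positivity))⟩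

theorem exists_dualNorm_equiv (he : BasicHypothesis e) : ∃ C : ℝ, 1 ≤ C ∧ ∀ l (ξ : D.Space),
    D.dualNorm e (D.block l) ξ ^ D.d l ≤ C * qNorm (D.exponent e) l ξ ∧
    qNorm (D.exponent e) l ξ ≤ C * D.dualNorm e (D.block l) ξ ^ D.d l := by
  obtain ⟨C, hC, h⟩ := D.exists_nrm_bounds
  have h1 := fun l => exists_blockNorm_equiv D.block D.d_pos (ε := fun j => 1 / e j (D.block l))
    (fun j => one_div_pos.2 (he.pos _ _)) (D.d_pos l) (C := C) (by linarith)
  choose C' hC' h' using h1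
  have hS : ∀ l, C' l ≤ 1 + ∑ l, C' l := fun l => by
    have := Finset.single_le_sum (f := C') (fun l _ => zero_le_one.trans (hC' l)) (Finset.mem_univ l)
    linarith
  refine ⟨1 + ∑ l, C' l, le_add_of_nonneg_right
    (Finset.sum_nonneg fun l _ => zero_le_one.trans (hC' l)), fun l x => ?_⟩
  have h2 := h' l x (fun j => D.nrm j (D.comp x j)) (fun j => D.nrm_nonneg _ _)
    (fun k => (h (D.block k) (D.comp x (D.block k))).1 ⟨k, rfl⟩)
    (fun j A hA hk => (h j (D.comp x j)).2 A hA fun k => hk k.1 k.2)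
  have e1 : qNorm (D.exponent e) l x =
      ∑ k, |x k| ^ (1 / e (D.block k) (D.block l) * D.d l / D.d k) := by
    unfold qNorm exponent
    refine Finset.sum_congr rfl fun k _ => ?_
    congr 1
    have h1 := D.d_pos k
    have h2 := D.d_pos l
    have h3 := he.pos (D.block k) (D.block l)
    field_simp
  have e2 : D.dualNorm e (D.block l) x = ∑ j, D.nrm j (D.comp x j) ^ (1 / e j (D.block l)) := rfl
  rw [← e1, ← e2] at h2
  have h3 : 0 ≤ D.dualNorm e (D.block l) x := Finset.sum_nonneg fun j _ =>
    Real.rpow_nonneg (D.nrm_nonneg _ _) _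
  exact ⟨h2.1.trans (mul_le_mul_of_nonneg_right (hS l) (qNorm_nonneg _ _)),
    h2.2.trans (mul_le_mul_of_nonneg_right (hS l) (by positivity))⟩

theorem exists_subNorm_equiv (he : BasicHypothesis e) (L : Finset (Fin n)) :
    ∃ C : ℝ, 1 ≤ C ∧ ∀ (l : D.Coord L) (x : D.SubSpace L),
    D.subNorm e L (D.block l.1) x ^ D.d l.1 ≤ C * pNorm (D.subExponent e L) l x ∧
    pNorm (D.subExponent e L) l x ≤ C * D.subNorm e L (D.block l.1) x ^ D.d l.1 := by
  obtain ⟨C, hC, h⟩ := D.exists_nrm_bounds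
  have h1 := fun l : D.Coord L => exists_blockNorm_equiv (J := {j // j ∈ L}) (ι := D.Coord L)
    (fun l => ⟨D.block l.1, l.2⟩) (d := fun l => D.d l.1) (fun l => D.d_pos l.1)
    (ε := fun j => e (D.block l.1) j.1) (fun j => he.pos _ _) (D.d_pos l.1) (C := C) (by linarith)
  choose C' hC' h' using h1
  have hS : ∀ l, C' l ≤ 1 + ∑ l, C' l := fun l => by
    have := Finset.single_le_sum (f := C') (fun l _ => zero_le_one.trans (hC' l)) (Finset.mem_univ l)
    linarith
  refine ⟨1 + ∑ l, C' l, le_add_of_nonneg_right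
    (Finset.sum_nonneg fun l _ => zero_le_one.trans (hC' l)), fun l x => ?_⟩
  have h2 := h' l x (fun j => D.nrm j.1 (D.subComp x j)) (fun j => D.nrm_nonneg _ _)
    (fun k => (h (D.block k.1) (D.subComp x ⟨D.block k.1, k.2⟩)).1 ⟨k.1, rfl⟩)
    (fun j A hA hk => (h j.1 (D.subComp x j)).2 A hA fun k =>
      hk ⟨k.1, k.2.symm ▸ j.2⟩ (Subtype.ext k.2))
  have e1 : pNorm (D.subExponent e L) l x =
      ∑ k : D.Coord L, |x k| ^ (e (D.block l.1) (D.block k.1) * D.d l.1 / D.d k.1) := by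
    unfold pNorm subExponent exponent
    simp only [mul_comm (D.d l.1)]
  have e2 : D.subNorm e L (D.block l.1) x =
      ∑ j : {j // j ∈ L}, D.nrm j.1 (D.subComp x j) ^ e (D.block l.1) j.1 := rfl
  rw [← e1, ← e2] at h2
  have h3 : 0 ≤ D.subNorm e L (D.block l.1) x := Finset.sum_nonneg fun j _ =>
    Real.rpow_nonneg (D.nrm_nonneg _ _) _
  exact ⟨h2.1.trans (mul_le_mul_of_nonneg_right (hS l) (pNorm_nonneg _ _)),
    h2.2.trans (mul_le_mul_of_nonneg_right (hS l) (by positivity))⟩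

/-- The weight `∏_j a_j ^ (-⟦γ_j⟧)`, coordinate by coordinate. -/
theorem prod_rpow_weight {a : Fin n → ℝ} (ha : ∀ j, 0 < a j) (γ : Fin N → ℕ) :
    ∏ j, a j ^ (-(D.weight γ j)) = ∏ l, (a (D.block l) ^ D.d l) ^ (-(γ l : ℝ)) := by
  rw [← Finset.prod_fiberwise (s := Finset.univ) (g := D.block)]
  refine Finset.prod_congr rfl fun j _ => ?_
  rw [weight, ← Finset.sum_neg_distrib, Real.rpow_sum_of_pos (ha j)]
  refine Finset.prod_congr rfl fun l hl => ?_
  rw [(Finset.mem_filter.1 hl).2, ← Real.rpow_mul (ha j).le]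
  congr 1
  ring

/-- The weight `∏_j a_j ^ (-(Q_j + ⟦γ_j⟧))`, coordinate by coordinate. -/
theorem prod_rpow_Q_add_weight {a : Fin n → ℝ} (ha : ∀ j, 0 < a j) (γ : Fin N → ℕ) :
    ∏ j, a j ^ (-(D.Q j + D.weight γ j)) =
      ∏ l, (a (D.block l) ^ D.d l) ^ (-(1 + (γ l : ℝ))) := by
  rw [← Finset.prod_fiberwise (s := Finset.univ) (g := D.block)]
  refine Finset.prod_congr rfl fun j _ => ?_
  rw [weight, Q, ← Finset.sum_add_distrib, ← Finset.sum_neg_distrib, Real.rpow_sum_of_pos (ha j)]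
  refine Finset.prod_congr rfl fun l hl => ?_
  rw [(Finset.mem_filter.1 hl).2, ← Real.rpow_mul (ha j).le]
  congr 1
  ring

theorem prod_rpow_Q_add_subWeight {L : Finset (Fin n)} {a : Fin n → ℝ} (ha : ∀ j ∈ L, 0 < a j)
    (γ : D.Coord L → ℕ) :
    ∏ j ∈ L, a j ^ (-(D.Q j + D.subWeight L γ j)) =
      ∏ l : D.Coord L, (a (D.block l.1) ^ D.d l.1) ^ (-(1 + (γ l : ℝ))) := by
  have hQ : ∀ j ∈ L, D.Q j = ∑ l : D.Coord L with D.block l.1 = j, D.d l.1 := by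
    intro j hj
    unfold Q
    refine Finset.sum_bij' (i := fun l hl => (⟨l, (Finset.mem_filter.1 hl).2.symm ▸ hj⟩ : D.Coord L))
      (j := fun l _ => l.1) ?_ ?_ ?_ ?_ ?_ <;> simp
  rw [← Finset.prod_fiberwise_of_maps_to (s := Finset.univ) (t := L)
    (g := fun l : D.Coord L => D.block l.1) (fun l _ => l.2)]
  refine Finset.prod_congr rfl fun j hj => ?_
  rw [subWeight, hQ j hj, ← Finset.sum_add_distrib, ← Finset.sum_neg_distrib,
    Real.rpow_sum_of_pos (ha j hj)]
  refine Finset.prod_congr rfl fun l hl => ?_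
  rw [(Finset.mem_filter.1 hl).2, ← Real.rpow_mul (ha j hj).le]
  congr 1
  ring

/-- Comparison of products of negative powers. -/
theorem _root_.exists_prod_rpow_le {ι : Type*} [Fintype ι] {C : ℝ} (hC : 1 ≤ C) {r : ι → ℝ}
    (hr : ∀ l, 0 ≤ r l) : ∃ C' : ℝ, 1 ≤ C' ∧ ∀ a b : ι → ℝ, (∀ l, 0 < b l) →
      (∀ l, b l ≤ C * a l) → ∏ l, a l ^ (-(r l)) ≤ C' * ∏ l, b l ^ (-(r l)) := by
  refine ⟨∏ l, C ^ r l, ?_, fun a b hb h => ?_⟩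
  · have := Finset.prod_le_prod (s := Finset.univ) (f := fun _ : ι => (1 : ℝ))
      (g := fun l => C ^ r l) (fun _ _ => zero_le_one) fun l _ => Real.one_le_rpow hC (hr l)
    simpa using this
  rw [← Finset.prod_mul_distrib]
  have ha : ∀ l, 0 < a l := fun l => by
    have := (hb l).trans_le (h l)
    exact pos_of_mul_pos_right this (by linarith)
  refine Finset.prod_le_prod (fun l _ => (Real.rpow_pos_of_pos (ha l) _).le) fun l _ => ?_
  have h1 := Real.rpow_le_rpow_of_nonpos (hb l) (h l) (z := -(r l)) (by linarith [hr l])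
  rw [Real.mul_rpow (by linarith) (ha l).le, Real.rpow_neg (by linarith), inv_mul_le_iff₀
    (Real.rpow_pos_of_pos (by linarith) _)] at h1
  exact h1

theorem norm_pos (he : BasicHypothesis e) {x : D.Space} (hx : x ≠ 0) (j : Fin n) :
    0 < D.norm e j x := by
  obtain ⟨C, hC, h⟩ := D.exists_norm_equiv he
  obtain ⟨l, rfl⟩ := D.block_surjective j
  have h1 := (pNorm_pos hx l).trans_le (h l x).2
  have h3 : 0 ≤ D.norm e (D.block l) x := Finset.sum_nonneg fun j _ =>
    Real.rpow_nonneg (D.nrm_nonneg _ _) _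
  refine lt_of_le_of_ne h3 fun h0 => ?_
  rw [← h0, Real.zero_rpow (D.d_pos l).ne', mul_zero] at h1
  exact lt_irrefl _ h1

theorem subNorm_pos (he : BasicHypothesis e) {L : Finset (Fin n)} {x : D.SubSpace L} (hx : x ≠ 0)
    {j : Fin n} (hj : j ∈ L) : 0 < D.subNorm e L j x := by
  obtain ⟨C, hC, h⟩ := D.exists_subNorm_equiv he L
  obtain ⟨l, rfl⟩ := D.block_surjective j
  have h1 := (pNorm_pos hx ⟨l, hj⟩).trans_le (h ⟨l, hj⟩ x).2
  have h3 : 0 ≤ D.subNorm e L (D.block l) x := Finset.sum_nonneg fun j _ =>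
    Real.rpow_nonneg (D.nrm_nonneg _ _) _
  refine lt_of_le_of_ne h3 fun h0 => ?_
  rw [← h0, Real.zero_rpow (D.d_pos l).ne', mul_zero] at h1
  exact lt_irrefl _ h1

/-- The weights in the differential inequalities of `𝒫₀(E)`, in terms of the coordinate norms. -/
theorem exists_kernelWeight_equiv (he : BasicHypothesis e) (γ : Fin N → ℕ) : ∃ C : ℝ, 1 ≤ C ∧
    ∀ x : D.Space, x ≠ 0 →
      ∏ l, pNorm (D.exponent e) l x ^ (-(1 + (γ l : ℝ))) ≤
        C * ∏ j, D.norm e j x ^ (-(D.Q j + D.weight γ j)) ∧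
      ∏ j, D.norm e j x ^ (-(D.Q j + D.weight γ j)) ≤
        C * ∏ l, pNorm (D.exponent e) l x ^ (-(1 + (γ l : ℝ))) := by
  obtain ⟨C, hC, h⟩ := D.exists_norm_equiv he
  obtain ⟨C', hC', h'⟩ := exists_prod_rpow_le (ι := Fin N) hC (r := fun l => 1 + (γ l : ℝ))
    (fun l => by positivity)
  refine ⟨C', hC', fun x hx => ?_⟩
  rw [D.prod_rpow_Q_add_weight (fun j => D.norm_pos he hx j)]
  exact ⟨h' _ _ (fun l => Real.rpow_pos_of_pos (D.norm_pos he hx _) _) fun l => (h l x).1,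
    h' _ _ (fun l => pNorm_pos hx l) fun l => (h l x).2⟩

/-- The same on the subspace `ℝ^L`. -/
theorem exists_subKernelWeight_equiv (he : BasicHypothesis e) (L : Finset (Fin n))
    (γ : D.Coord L → ℕ) : ∃ C : ℝ, 1 ≤ C ∧
    ∀ x : D.SubSpace L, x ≠ 0 →
      ∏ l, pNorm (D.subExponent e L) l x ^ (-(1 + (γ l : ℝ))) ≤
        C * ∏ j ∈ L, D.subNorm e L j x ^ (-(D.Q j + D.subWeight L γ j)) ∧
      ∏ j ∈ L, D.subNorm e L j x ^ (-(D.Q j + D.subWeight L γ j)) ≤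
        C * ∏ l, pNorm (D.subExponent e L) l x ^ (-(1 + (γ l : ℝ))) := by
  obtain ⟨C, hC, h⟩ := D.exists_subNorm_equiv he L
  obtain ⟨C', hC', h'⟩ := exists_prod_rpow_le (ι := D.Coord L) hC (r := fun l => 1 + (γ l : ℝ))
    (fun l => by positivity)
  refine ⟨C', hC', fun x hx => ?_⟩
  rw [D.prod_rpow_Q_add_subWeight (fun j hj => D.subNorm_pos he hx hj)]
  exact ⟨h' _ _ (fun l => Real.rpow_pos_of_pos (D.subNorm_pos he hx l.2) _) fun l => (h l x).1,
    h' _ _ (fun l => pNorm_pos hx l) fun l => (h l x).2⟩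

/-- The weights in the definition of `ℳ_∞(E)`, in terms of the coordinate norms. -/
theorem exists_multiplierWeight_equiv (he : BasicHypothesis e) (γ : Fin N → ℕ) : ∃ C : ℝ, 1 ≤ C ∧
    ∀ ξ : D.Space,
      ∏ l, (1 + qNorm (D.exponent e) l ξ) ^ (-(γ l : ℝ)) ≤
        C * ∏ j, (1 + D.dualNorm e j ξ) ^ (-(D.weight γ j)) ∧
      ∏ j, (1 + D.dualNorm e j ξ) ^ (-(D.weight γ j)) ≤
        C * ∏ l, (1 + qNorm (D.exponent e) l ξ) ^ (-(γ l : ℝ)) := by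
  obtain ⟨C, hC, h⟩ := D.exists_dualNorm_equiv he
  set C₁ : ℝ := ∑ l, (2 : ℝ) ^ D.d l + 1 with hC₁
  have hC₁1 : 1 ≤ C₁ := le_add_of_nonneg_left (Finset.sum_nonneg fun l _ => by positivity)
  have h2d : ∀ l, (2 : ℝ) ^ D.d l ≤ C₁ := fun l => by
    have := Finset.single_le_sum (f := fun l => (2 : ℝ) ^ D.d l) (fun l _ => by positivity)
      (Finset.mem_univ l)
    beta_reduce at this
    linarith
  obtain ⟨C', hC', h'⟩ := exists_prod_rpow_le (ι := Fin N)
    (C := C₁ * (1 + C)) (by nlinarith) (r := fun l => (γ l : ℝ)) (fun l => by positivity)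
  refine ⟨C', hC', fun ξ => ?_⟩
  have h3 : ∀ j, 0 ≤ D.dualNorm e j ξ := fun j => Finset.sum_nonneg fun k _ =>
    Real.rpow_nonneg (D.nrm_nonneg _ _) _
  have h4 : ∀ l, 0 ≤ qNorm (D.exponent e) l ξ := fun l => qNorm_nonneg l ξ
  rw [D.prod_rpow_weight (fun j => by linarith [h3 j])]
  refine ⟨h' _ _ (fun l => Real.rpow_pos_of_pos (by linarith [h3 (D.block l)]) _) fun l => ?_,
    h' _ _ (fun l => by linarith [h4 l]) fun l => ?_⟩
  · set t := D.dualNorm e (D.block l) ξ with ht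
    have ht0 : 0 ≤ t := h3 _
    have hd := D.d_pos l
    have h5 : (1 + t) ^ D.d l ≤ 2 ^ D.d l * (1 + t ^ D.d l) := by
      calc (1 + t) ^ D.d l ≤ (2 * max 1 t) ^ D.d l := by
            refine Real.rpow_le_rpow (by linarith) ?_ hd.le
            linarith [le_max_left 1 t, le_max_right 1 t]
        _ = 2 ^ D.d l * (max 1 t) ^ D.d l := Real.mul_rpow (by norm_num) (by positivity)
        _ ≤ _ := by
            gcongr
            rcases max_choice 1 t with h | h <;> rw [h]
            · rw [Real.one_rpow]
              exact le_add_of_nonneg_right (by positivity)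
            · linarith
    have h6 := (h l ξ).1
    have h7 := h4 l
    calc (1 + t) ^ D.d l ≤ C₁ * (1 + C * qNorm (D.exponent e) l ξ) :=
          h5.trans (mul_le_mul (h2d l) (by linarith) (by positivity) (by linarith))
      _ ≤ C₁ * ((1 + C) * (1 + qNorm (D.exponent e) l ξ)) := by
          gcongr
          nlinarith
      _ = _ := by ring
  · set t := D.dualNorm e (D.block l) ξ with ht
    have ht0 : 0 ≤ t := h3 _
    have hd := D.d_pos l
    have h5 : 1 ≤ (1 + t) ^ D.d l := Real.one_le_rpow (by linarith) hd.le
    have h6 : t ^ D.d l ≤ (1 + t) ^ D.d l := Real.rpow_le_rpow ht0 (by linarith) hd.le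
    have h7 := (h l ξ).2
    calc 1 + qNorm (D.exponent e) l ξ ≤ (1 + t) ^ D.d l + C * (1 + t) ^ D.d l := by
          have := mul_le_mul_of_nonneg_left h6 (by linarith : 0 ≤ C)
          linarith
      _ = (1 + C) * (1 + t) ^ D.d l := by ring
      _ ≤ C₁ * (1 + C) * (1 + t) ^ D.d l := by
          gcongr
          nlinarith

/-- The elements of `ℳ_∞(E)` are symbols of order zero for the coordinate exponents. -/
theorem exists_isSymbol_of_mem_multipliers (he : BasicHypothesis e) {m : D.Space → ℂ}
    (hm : m ∈ D.multipliers e) : ∃ C : ℕ → ℝ, IsSymbol (D.exponent e) m (fun _ => 1) C := by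
  obtain ⟨hs, hb⟩ := hm
  choose C hC using hb
  choose C' hC'1 hC' using fun γ => D.exists_multiplierWeight_equiv he γ
  refine ⟨fun k => (Fintype.card (Fin N) + 1) ^ k *
    ∑ j ∈ Finset.range (k + 1), ∑ γ ∈ Finset.piAntidiag Finset.univ j, |C γ| * C' γ,
    fun k ξ => ?_⟩
  rw [mul_one]
  refine ScaledBound.of_multiDeriv hs.contDiffAt fun γ hγ => ?_
  have h4 : ∀ l, 0 < 1 + qNorm (D.exponent e) l ξ := fun l => by
    linarith [qNorm_nonneg (f := D.exponent e) l ξ]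
  have hpos : 0 < ∏ l, (1 + qNorm (D.exponent e) l ξ) ^ γ l :=
    Finset.prod_pos fun l _ => pow_pos (h4 l) _
  have h5 : ‖multiDeriv γ m ξ‖ ≤
      |C γ| * C' γ * ∏ l, (1 + qNorm (D.exponent e) l ξ) ^ (-(γ l : ℝ)) := by
    have hnn : 0 ≤ ∏ j, (1 + D.dualNorm e j ξ) ^ (-(D.weight γ j)) :=
      Finset.prod_nonneg fun j _ => Real.rpow_nonneg (by
        have : 0 ≤ D.dualNorm e j ξ := Finset.sum_nonneg fun k _ =>
          Real.rpow_nonneg (D.nrm_nonneg _ _) _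
        linarith) _
    rw [mul_assoc]
    exact (hC γ ξ).trans (mul_le_mul (le_abs_self _) (hC' γ ξ).2 hnn (abs_nonneg _))
  have h6 : (∏ l, |1 + qNorm (D.exponent e) l ξ| ^ γ l) *
      ∏ l, (1 + qNorm (D.exponent e) l ξ) ^ (-(γ l : ℝ)) = 1 := by
    rw [← Finset.prod_mul_distrib]
    refine Finset.prod_eq_one fun l _ => ?_
    rw [abs_of_pos (h4 l), Real.rpow_neg (h4 l).le, Real.rpow_natCast]
    exact mul_inv_cancel₀ (pow_pos (h4 l) _).ne'
  have hnn : ∀ γ, 0 ≤ |C γ| * C' γ := fun γ =>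
    mul_nonneg (abs_nonneg _) (zero_le_one.trans (hC'1 γ))
  calc (∏ l, |1 + qNorm (D.exponent e) l ξ| ^ γ l) * ‖multiDeriv γ m ξ‖
      ≤ (∏ l, |1 + qNorm (D.exponent e) l ξ| ^ γ l) *
        (|C γ| * C' γ * ∏ l, (1 + qNorm (D.exponent e) l ξ) ^ (-(γ l : ℝ))) := by gcongr
    _ = |C γ| * C' γ := by rw [mul_left_comm, h6, mul_one]
    _ ≤ ∑ γ ∈ Finset.piAntidiag Finset.univ (∑ l, γ l), |C γ| * C' γ :=
        Finset.single_le_sum (f := fun γ => |C γ| * C' γ) (fun γ _ => hnn γ)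
          (Finset.mem_piAntidiag.2 ⟨rfl, fun _ _ => Finset.mem_univ _⟩)
    _ ≤ _ := Finset.single_le_sum
        (f := fun j => ∑ γ ∈ Finset.piAntidiag Finset.univ j, |C γ| * C' γ)
        (fun j _ => Finset.sum_nonneg fun γ _ => hnn γ)
        (Finset.mem_range.2 (Nat.lt_succ_of_le hγ))

end DilationStructure

/-! ### Splitting the variables -/

section Glue

variable {ι A B : Type*} [Fintype ι] [Fintype A] [Fintype B]

/-- The isomorphism `ℝ^A ⊕ ℝ^B → ℝ^ι` that comes from a bijection of `A ⊕ B` with `ι`. -/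
noncomputable def glue (σ : A ⊕ B ≃ ι) :
    (EuclideanSpace ℝ A × EuclideanSpace ℝ B) →L[ℝ] EuclideanSpace ℝ ι :=
  LinearMap.toContinuousLinearMap
    { toFun := fun p => WithLp.toLp 2 fun i => Sum.elim p.1 p.2 (σ.symm i)
      map_add' := fun p q => by
        ext i
        rcases h : σ.symm i with a | a <;> simp [h]
      map_smul' := fun c p => by
        ext i
        rcases h : σ.symm i with a | a <;> simp [h] }

theorem glue_apply (σ : A ⊕ B ≃ ι) (p : EuclideanSpace ℝ A × EuclideanSpace ℝ B) (i : ι) :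
    glue σ p i = Sum.elim p.1 p.2 (σ.symm i) := rfl

@[simp] theorem glue_inl (σ : A ⊕ B ≃ ι) (p : EuclideanSpace ℝ A × EuclideanSpace ℝ B) (a : A) :
    glue σ p (σ (.inl a)) = p.1 a := by
  simp [glue_apply]

@[simp] theorem glue_inr (σ : A ⊕ B ≃ ι) (p : EuclideanSpace ℝ A × EuclideanSpace ℝ B) (b : B) :
    glue σ p (σ (.inr b)) = p.2 b := by
  simp [glue_apply]

theorem sum_glue {M : Type*} [AddCommMonoid M] (σ : A ⊕ B ≃ ι) (F : ι → M) :
    ∑ i, F i = ∑ a, F (σ (.inl a)) + ∑ b, F (σ (.inr b)) := by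
  rw [← Equiv.sum_comp σ, Fintype.sum_sum_type]

theorem inner_glue (σ : A ⊕ B ≃ ι) (p q : EuclideanSpace ℝ A × EuclideanSpace ℝ B) :
    inner ℝ (glue σ p) (glue σ q) = inner ℝ p.1 q.1 + inner ℝ p.2 q.2 := by
  simp only [PiLp.inner_apply]
  rw [sum_glue σ]
  simp

/-- The isomorphism `glue` as a measurable equivalence. -/
noncomputable def glueEquiv (σ : A ⊕ B ≃ ι) :
    (EuclideanSpace ℝ A × EuclideanSpace ℝ B) ≃ᵐ EuclideanSpace ℝ ι :=
  ((((MeasurableEquiv.toLp 2 (A → ℝ)).symm.prodCongr (MeasurableEquiv.toLp 2 (B → ℝ)).symm).trans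
    (MeasurableEquiv.sumPiEquivProdPi fun _ : A ⊕ B => ℝ).symm).trans
      (MeasurableEquiv.piCongrLeft (fun _ : ι => ℝ) σ)).trans (MeasurableEquiv.toLp 2 (ι → ℝ))

theorem glueEquiv_apply (σ : A ⊕ B ≃ ι) (p : EuclideanSpace ℝ A × EuclideanSpace ℝ B) :
    glueEquiv σ p = glue σ p := by
  ext i
  obtain ⟨s, rfl⟩ := σ.surjective i
  have h : glueEquiv σ p (σ s) = Sum.elim p.1 p.2 s := by
    refine (Equiv.piCongrLeft_apply_apply (fun _ : ι => ℝ) σ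
      ((MeasurableEquiv.sumPiEquivProdPi fun _ : A ⊕ B => ℝ).symm (p.1.ofLp, p.2.ofLp)) s).trans ?_
    rcases s with s | s <;> rfl
  rw [h, glue_apply, Equiv.symm_apply_apply]

/-- The isomorphism `ℝ^A ⊕ ℝ^B → ℝ^ι` preserves Lebesgue measure, since it permutes coordinates. -/
theorem measurePreserving_glueEquiv (σ : A ⊕ B ≃ ι) :
    MeasurePreserving (glueEquiv σ) volume volume := by
  refine MeasurePreserving.trans (μb := volume) (MeasurePreserving.trans (μb := volume)
    (MeasurePreserving.trans (μb := volume) ?_ ?_) ?_) ?_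
  · exact (EuclideanSpace.volume_preserving_symm_measurableEquiv_toLp A).prod
      (EuclideanSpace.volume_preserving_symm_measurableEquiv_toLp B)
  · exact volume_measurePreserving_sumPiEquivProdPi_symm _
  · exact volume_measurePreserving_piCongrLeft _ _
  · exact PiLp.volume_preserving_toLp ι

theorem integral_glue (σ : A ⊕ B ≃ ι) (F : EuclideanSpace ℝ ι → ℂ) :
    ∫ x, F x = ∫ p, F (glue σ p) := by
  rw [← (measurePreserving_glueEquiv σ).integral_comp (MeasurableEquiv.measurableEmbedding _)]
  simp only [glueEquiv_apply]

/-- The Fourier transform of a tensor product. -/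
theorem fourier_tensor (σ : A ⊕ B ≃ ι) {u : EuclideanSpace ℝ A → ℂ} {v : EuclideanSpace ℝ B → ℂ}
    {w : EuclideanSpace ℝ ι → ℂ} (hw : ∀ p, w (glue σ p) = u p.1 * v p.2)
    (p : EuclideanSpace ℝ A × EuclideanSpace ℝ B) :
    𝓕 w (glue σ p) = 𝓕 u p.1 * 𝓕 v p.2 := by
  simp only [Real.fourier_eq']
  rw [integral_glue σ, ← integral_prod_mul]
  refine integral_congr_ae (.of_forall fun q => ?_)
  beta_reduce
  rw [inner_glue, hw]
  simp only [smul_eq_mul]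
  rw [show ((-2 * Real.pi * (inner ℝ q.1 p.1 + inner ℝ q.2 p.2) : ℝ) : ℂ) * Complex.I =
    ((-2 * Real.pi * inner ℝ q.1 p.1 : ℝ) : ℂ) * Complex.I +
      ((-2 * Real.pi * inner ℝ q.2 p.2 : ℝ) : ℂ) * Complex.I by push_cast; ring, Complex.exp_add]
  ring

/-- The scaled bounds restrict to the partial functions `x ↦ u (x, y)`. -/
theorem ScaledBound.comp_glue (σ : A ⊕ B ≃ ι) {u : EuclideanSpace ℝ ι → ℂ} (hu : ContDiff ℝ ∞ u)
    {p : EuclideanSpace ℝ A × EuclideanSpace ℝ B} {lam : ι → ℝ} {m : ℕ} {C : ℝ}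
    (h : ScaledBound u (glue σ p) lam m C) {lam' : A → ℝ}
    (hlam : ∀ a, |lam' a| ≤ |lam (σ (.inl a))|) :
    ScaledBound (fun x => u (glue σ (x, p.2))) p.1 lam' m C := by
  intro k hk
  set lam'' : ι → ℝ := fun i => Sum.elim lam' (fun _ => 0) (σ.symm i) with hlam''
  have h1 := h.mono_scale hu.contDiffAt le_rfl (lam' := lam'') (fun i => by
    obtain ⟨s, rfl⟩ := σ.surjective i
    rcases s with s | s
    · simpa [hlam''] using hlam s
    · simp [hlam'']) k hk
  have e : (fun z => u (glue σ (p.1 + diagMap lam' z, p.2))) =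
      (fun z => u (glue σ p + diagMap lam'' z)) ∘
        (glue σ).comp (ContinuousLinearMap.inl ℝ (EuclideanSpace ℝ A) (EuclideanSpace ℝ B)) := by
    funext z
    simp only [Function.comp]
    congr 1
    ext i
    obtain ⟨s, rfl⟩ := σ.surjective i
    rcases s with s | s <;> simp [hlam'']
  rw [e, ContinuousLinearMap.iteratedFDeriv_comp_right (n := ∞) _ (by fun_prop) _
    (by exact_mod_cast le_top)]
  refine (ContinuousMultilinearMap.norm_compContinuousLinearMap_le _ _).trans ?_
  have h2 : ‖(glue σ).comp (ContinuousLinearMap.inl ℝ (EuclideanSpace ℝ A) (EuclideanSpace ℝ B))‖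
      ≤ 1 := by
    refine ContinuousLinearMap.opNorm_le_bound _ zero_le_one fun z => ?_
    rw [one_mul, EuclideanSpace.norm_eq, EuclideanSpace.norm_eq, sum_glue σ]
    simp
  rw [map_zero]
  have h3 : ∏ _i : Fin k, ‖(glue σ).comp
      (ContinuousLinearMap.inl ℝ (EuclideanSpace ℝ A) (EuclideanSpace ℝ B))‖ ≤ 1 :=
    Finset.prod_le_one (fun _ _ => norm_nonneg _) fun _ _ => h2
  refine (mul_le_of_le_one_right (norm_nonneg _) h3).trans ?_
  simpa using h1

end Glue

/-! ### Partial integrals of symbols -/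

section PartialIntegral

variable {ι A B : Type*} [Fintype ι] [Fintype A] [Fintype B]

/-- Integrating a symbol of order zero against an integrable function of some of the variables
yields a symbol of order zero in the remaining variables. -/
theorem isSymbol_integral_glue (σ : A ⊕ B ≃ ι) {f : ι → ι → ℝ} {m : EuclideanSpace ℝ ι → ℂ}
    (hm : ContDiff ℝ ∞ m) {C : ℕ → ℝ} (hsym : IsSymbol f m (fun _ => 1) C)
    {v : EuclideanSpace ℝ B → ℂ} (hvc : Continuous v) (hv : Integrable v) {W : ℝ}
    (hW : ∫ η, ‖v η‖ ≤ W) :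
    ContDiff ℝ ∞ (fun ξ => ∫ η, m (glue σ (ξ, η)) * v η) ∧
      IsSymbol (fun a a' => f (σ (.inl a)) (σ (.inl a')))
        (fun ξ => ∫ η, m (glue σ (ξ, η)) * v η) (fun _ => 1) fun k => C k * W := by
  have hq : ∀ (a : A) (p : EuclideanSpace ℝ A × EuclideanSpace ℝ B),
      qNorm (fun a a' => f (σ (.inl a)) (σ (.inl a'))) a p.1 ≤ qNorm f (σ (.inl a)) (glue σ p) := by
    intro a p
    unfold qNorm
    rw [sum_glue σ]
    simp only [glue_inl, glue_inr]
    exact le_add_of_nonneg_right (Finset.sum_nonneg fun _ _ => by positivity)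
  have hsb : ∀ (k : ℕ) (p : EuclideanSpace ℝ A × EuclideanSpace ℝ B),
      ScaledBound (fun x => m (glue σ (x, p.2))) p.1
        (fun a => 1 + qNorm (fun a a' => f (σ (.inl a)) (σ (.inl a'))) a p.1) k (C k) := by
    intro k p
    refine ScaledBound.comp_glue σ hm ((hsym k (glue σ p)).mono (by simp)) fun a => ?_
    have h1 := qNorm_nonneg (f := fun a a' => f (σ (.inl a)) (σ (.inl a'))) a p.1
    have h2 := hq a p
    rw [abs_of_nonneg (by linarith), abs_of_nonneg (by linarith)]
    linarith
  have hgs : ∀ η, ContDiff ℝ ∞ fun ξ => m (glue σ (ξ, η)) := fun η => hm.comp (by fun_prop)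
  have hFc : ∀ (k : ℕ) (x : EuclideanSpace ℝ A) (lam : A → ℝ), Continuous fun η =>
      iteratedFDeriv ℝ k (fun z => m (glue σ (x + diagMap lam z, η))) 0 := by
    intro k x lam
    have e : ∀ η, iteratedFDeriv ℝ k (fun z => m (glue σ (x + diagMap lam z, η))) 0 =
        (iteratedFDeriv ℝ k m (glue σ (x, η))).compContinuousLinearMap fun _ =>
          ((glue σ).comp (ContinuousLinearMap.inl ℝ (EuclideanSpace ℝ A)
            (EuclideanSpace ℝ B))).comp (diagMap lam) := by
      intro η
      have e1 : (fun z => m (glue σ (x + diagMap lam z, η))) =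
          (fun y => m (glue σ (x, η) + y)) ∘ (((glue σ).comp (ContinuousLinearMap.inl ℝ
            (EuclideanSpace ℝ A) (EuclideanSpace ℝ B))).comp (diagMap lam)) := by
        funext z
        simp only [Function.comp, ContinuousLinearMap.comp_apply, ContinuousLinearMap.inl_apply,
          ← map_add, Prod.mk_add_mk, add_zero]
      rw [e1, ContinuousLinearMap.iteratedFDeriv_comp_right (n := ∞) _ (by fun_prop) _
        (by exact_mod_cast le_top), iteratedFDeriv_comp_add_left, map_zero, add_zero]
    simp only [e]
    have h1 : Continuous (iteratedFDeriv ℝ k m) :=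
      hm.continuous_iteratedFDeriv (by exact_mod_cast le_top)
    have h2 : Continuous fun η => iteratedFDeriv ℝ k m (glue σ (x, η)) := h1.comp (by fun_prop)
    exact (ContinuousMultilinearMap.compContinuousLinearMapL (𝕜 := ℝ) (F := ℂ) fun _ : Fin k =>
          ((glue σ).comp (ContinuousLinearMap.inl ℝ (EuclideanSpace ℝ A)
            (EuclideanSpace ℝ B))).comp (diagMap lam)).continuous.comp h2
  have e0 : ∀ (k : ℕ) (lam : A → ℝ) (x : EuclideanSpace ℝ A) (η : EuclideanSpace ℝ B),
      iteratedFDeriv ℝ k (fun z => m (glue σ (x + diagMap lam z, η)) * v η) 0 =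
      v η • iteratedFDeriv ℝ k (fun z => m (glue σ (x + diagMap lam z, η))) 0 := by
    intro k lam x η
    have h1 := iteratedFDeriv_const_smul_apply (i := k) (a := v η)
      (f := fun z => m (glue σ (x + diagMap lam z, η))) (x := 0)
      (((hgs η).comp (by fun_prop : ContDiff ℝ ∞ fun z => x + diagMap lam z)).contDiffAt.of_le
        (by exact_mod_cast le_top))
    rw [← h1]
    congr 1
    funext z
    simp [mul_comm]
  have hmain : ∀ (lam : A → ℝ) (x : EuclideanSpace ℝ A) (Bd : ℕ → ℝ),
      (∀ k z η, ‖iteratedFDeriv ℝ k (fun z' => m (glue σ (x + diagMap lam z + diagMap lam z', η))) 0‖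
        ≤ Bd k) →
      ContDiff ℝ ∞ (fun z => ∫ η, m (glue σ (x + diagMap lam z, η)) * v η) ∧
      ∀ k z, iteratedFDeriv ℝ k (fun z => ∫ η, m (glue σ (x + diagMap lam z, η)) * v η) z =
        ∫ η, iteratedFDeriv ℝ k (fun z => m (glue σ (x + diagMap lam z, η)) * v η) z := by
    intro lam x Bd hBd
    have tr : ∀ (k : ℕ) (z : EuclideanSpace ℝ A) (η : EuclideanSpace ℝ B),
        iteratedFDeriv ℝ k (fun z => m (glue σ (x + diagMap lam z, η)) * v η) z =
        iteratedFDeriv ℝ k (fun z' => m (glue σ (x + diagMap lam z + diagMap lam z', η)) * v η) 0 := by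
      intro k z η
      have := iteratedFDeriv_comp_add_left (𝕜 := ℝ) k z (0 : EuclideanSpace ℝ A)
        (f := fun z => m (glue σ (x + diagMap lam z, η)) * v η)
      rw [add_zero] at this
      rw [← this]
      simp only [map_add, add_assoc]
    refine contDiff_integral_param (w := fun η => ‖v η‖) (B := Bd) (fun η => ?_) (fun k z => ?_)
      hv.norm fun k z η => ?_
    · exact ((hgs η).comp (by fun_prop : ContDiff ℝ ∞ fun z => x + diagMap lam z)).mul contDiff_const
    · simp only [tr, e0]
      exact (hvc.smul (hFc k _ lam)).aestronglyMeasurable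
    · rw [tr, e0, norm_smul, mul_comm]
      exact mul_le_mul_of_nonneg_right (hBd k z η) (norm_nonneg _)
  have hd1 : diagMap (fun _ : A => (1 : ℝ)) = ContinuousLinearMap.id ℝ _ := by
    ext z a
    simp
  constructor
  · have h1 := (hmain (fun _ => 1) 0 C fun k z η => ?_).1
    · simpa [hd1] using h1
    · refine (((hsb k (0 + diagMap (fun _ => 1) z, η)).mono_scale (hgs η).contDiffAt le_rfl
        (lam' := fun _ => 1) fun a => ?_) k le_rfl).trans (le_of_eq (by simp))
      have h1 := qNorm_nonneg (f := fun a a' => f (σ (.inl a)) (σ (.inl a'))) a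
        (0 + diagMap (fun _ => 1) z)
      rw [abs_one, one_mul, abs_of_nonneg (by linarith)]
      linarith
  · intro k₀ ξ k hk
    set lam := fun a => 1 + qNorm (fun a a' => f (σ (.inl a)) (σ (.inl a'))) a ξ with hlam
    obtain ⟨Q, hQ1, hQ⟩ : ∃ Q : ℝ, 1 ≤ Q ∧ ∀ a, |lam a| ≤ Q := by
      refine ⟨1 + ∑ a, |lam a|, le_add_of_nonneg_right (Finset.sum_nonneg fun _ _ => abs_nonneg _),
        fun a => ?_⟩
      have := Finset.single_le_sum (f := fun a => |lam a|) (fun _ _ => abs_nonneg _)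
        (Finset.mem_univ a)
      beta_reduce at this
      linarith
    have h1 := (hmain lam ξ (fun k => C k * Q ^ k) fun k z η => by
      refine ((hsb k (ξ + diagMap lam z, η)).mono_scale (hgs η).contDiffAt hQ1
        (lam' := lam) fun a => ?_) k le_rfl
      have h1 := qNorm_nonneg (f := fun a a' => f (σ (.inl a)) (σ (.inl a'))) a
        (ξ + diagMap lam z)
      have h2 : 1 ≤ |1 + qNorm (fun a a' => f (σ (.inl a)) (σ (.inl a'))) a (ξ + diagMap lam z)| := by
        rw [abs_of_nonneg (by linarith)]
        linarith
      exact (hQ a).trans (le_mul_of_one_le_right (by linarith) h2)).2 k 0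
    rw [h1]
    have hC0 : 0 ≤ C k₀ := (hsb k₀ (ξ, 0)).nonneg
    rw [mul_one]
    calc ‖∫ η, iteratedFDeriv ℝ k (fun z => m (glue σ (ξ + diagMap lam z, η)) * v η) 0‖
        ≤ ∫ η, C k₀ * ‖v η‖ := by
          refine norm_integral_le_of_norm_le (hv.norm.const_mul _) (.of_forall fun η => ?_)
          rw [e0, norm_smul, mul_comm]
          exact mul_le_mul_of_nonneg_right (hsb k₀ (ξ, η) k hk) (norm_nonneg _)
      _ = C k₀ * ∫ η, ‖v η‖ := integral_const_mul _ _
      _ ≤ C k₀ * W := by gcongr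

end PartialIntegral

/-! ### Fourier transforms of dilated test functions -/

section DilatedTest

variable {ι : Type*} [Fintype ι] [DecidableEq ι]

theorem multiDeriv_ofReal {γ : ι → ℕ} {φ : EuclideanSpace ℝ ι → ℝ} (hφ : ContDiff ℝ ∞ φ)
    (x : EuclideanSpace ℝ ι) :
    multiDeriv γ (fun y => (φ y : ℂ)) x = ((multiDeriv γ φ x : ℝ) : ℂ) := by
  unfold multiDeriv
  have e := Complex.ofRealCLM.iteratedFDeriv_comp_left (f := φ) (x := x)
    (i := Fintype.card (Σ l, Fin (γ l))) hφ.contDiffAt (by exact_mod_cast le_top)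
  have e' : (fun y => (φ y : ℂ)) = Complex.ofRealCLM ∘ φ := rfl
  rw [e', e]
  rfl

theorem multiDeriv_eq_zero_of_notMem_tsupport {γ : ι → ℕ} {u : EuclideanSpace ℝ ι → ℂ}
    {x : EuclideanSpace ℝ ι} (hx : x ∉ tsupport u) : multiDeriv γ u x = 0 := by
  rw [multiDeriv_congr (notMem_tsupport_iff_eventuallyEq.1 hx)]
  unfold multiDeriv
  simp

/-- The `L¹` norm of the Fourier transform of a dilated test function is bounded uniformly in the
dilation. -/
theorem exists_integral_norm_fourier_dilate_le (ι : Type*) [Fintype ι] [DecidableEq ι] (B r : ℝ) :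
    ∃ W : ℝ, 0 ≤ W ∧ ∀ ψ : EuclideanSpace ℝ ι → ℂ, ContDiff ℝ ∞ ψ → HasCompactSupport ψ →
      (∀ x ∈ tsupport ψ, ∀ l, |x l| ≤ r) →
      (∀ γ : ι → ℕ, ∑ l, γ l ≤ 2 * Fintype.card ι → ∀ x, ‖multiDeriv γ ψ x‖ ≤ B) →
      ∀ ρ : ι → ℝ, (∀ l, 0 < ρ l) → HasCompactSupport (fun x => ψ (diagMap ρ x)) →
        ∫ η, ‖𝓕 (fun x => ψ (diagMap ρ x)) η‖ ≤ W := by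
  set n := Fintype.card ι with hn
  set K : ℝ := |B| * (1 + r ^ 2) ^ n with hK
  have hK0 : 0 ≤ K := by positivity
  refine ⟨K * 2 ^ n * Real.pi ^ n * Real.pi ^ n, by positivity,
    fun ψ hψ hψc hsupp hB ρ hρ hc => ?_⟩
  set u : EuclideanSpace ℝ ι → ℂ := fun x => ψ (diagMap ρ x) with hu
  have hus : ContDiff ℝ ∞ u := hψ.comp (by fun_prop)
  have hρi : ∀ l, 0 < (ρ l)⁻¹ := fun l => inv_pos.2 (hρ l)
  have key : ∀ η : EuclideanSpace ℝ ι, ‖𝓕 u η‖ ≤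
      K * 2 ^ n * Real.pi ^ n * ∏ l, ((ρ l)⁻¹ * (1 + ((ρ l)⁻¹ * η l) ^ 2)⁻¹) := by
    intro η
    -- two integrations by parts in each direction whose frequency exceeds the scale
    set P : Finset ι := Finset.univ.filter fun l => ρ l ≤ |η l| with hP
    have hPη : ∀ l ∈ P, 0 < |η l| := fun l hl =>
      (hρ l).trans_le (Finset.mem_filter.1 hl).2
    have h1 : ‖𝓕 u η‖ ≤ (K * (∏ l ∈ P, ρ l ^ 2 / |η l| ^ 2) * ∏ l, (ρ l)⁻¹) * Real.pi ^ n := by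
      refine norm_fourier_le_of_multiDeriv hus hc P 2 hρ (fun l hl => abs_pos.1 (hPη l hl))
        fun x => ?_
      set α : ι → ℕ := fun l => if l ∈ P then 2 else 0 with hα
      have hαn : ∑ l, α l ≤ 2 * n := by
        calc ∑ l, α l ≤ ∑ _l : ι, 2 := Finset.sum_le_sum fun l _ => by
              simp only [hα]; split_ifs <;> simp
          _ = 2 * n := by simp [hn, mul_comm]
      have e1 : multiDeriv α u x = (∏ l, ρ l ^ α l) • multiDeriv α ψ (diagMap ρ x) := by
        have := multiDeriv_comp_affine (f := ψ) (x := 0) (z := x) ρ α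
          (hψ.contDiffAt.of_le (by exact_mod_cast le_top))
        simpa [hu] using this
      have e2 : ∏ l, ρ l ^ α l = ∏ l ∈ P, ρ l ^ 2 := by
        simp only [hα, pow_ite, pow_zero]
        rw [Finset.prod_ite_mem, Finset.univ_inter]
      have e3 : K * (∏ l ∈ P, ρ l ^ 2 / |η l| ^ 2) * (∏ l, (ρ l)⁻¹) * (∏ l ∈ P, |η l| ^ 2) *
          ∏ l, (ρ l * (1 + (ρ l * x l) ^ 2)⁻¹) =
          (∏ l ∈ P, ρ l ^ 2) * (K * ∏ l, (1 + (ρ l * x l) ^ 2)⁻¹) := by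
        rw [Finset.prod_div_distrib, Finset.prod_mul_distrib, Finset.prod_inv_distrib]
        have h2 : ∏ l ∈ P, |η l| ^ 2 ≠ 0 := (Finset.prod_pos fun l hl => pow_pos (hPη l hl) 2).ne'
        have h3 : ∏ l, ρ l ≠ 0 := (Finset.prod_pos fun l _ => hρ l).ne'
        field_simp
      rw [e3, e1, norm_smul, e2, Real.norm_of_nonneg (Finset.prod_nonneg fun l _ => sq_nonneg _)]
      refine mul_le_mul_of_nonneg_left ?_ (Finset.prod_nonneg fun l _ => sq_nonneg _)
      by_cases hx : diagMap ρ x ∈ tsupport ψ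
      · refine (hB α hαn _).trans ((le_abs_self B).trans ?_)
        rw [hK, mul_assoc]
        refine le_mul_of_one_le_right (abs_nonneg _) ?_
        rw [hn, ← Finset.card_univ, ← Finset.prod_const, ← Finset.prod_mul_distrib]
        have h4 : ∀ l, 1 ≤ (1 + r ^ 2) * (1 + (ρ l * x l) ^ 2)⁻¹ := by
          intro l
          have h5 : |ρ l * x l| ≤ r := by simpa using hsupp _ hx l
          rw [← div_eq_mul_inv, one_le_div (by positivity)]
          have := sq_le_sq' (abs_le.1 h5).1 (abs_le.1 h5).2
          linarith
        have := Finset.prod_le_prod (s := Finset.univ) (f := fun _ : ι => (1 : ℝ))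
          (g := fun l => (1 + r ^ 2) * (1 + (ρ l * x l) ^ 2)⁻¹) (fun _ _ => zero_le_one)
          fun l _ => h4 l
        simpa using this
      · rw [multiDeriv_eq_zero_of_notMem_tsupport hx, norm_zero]
        exact mul_nonneg hK0 (Finset.prod_nonneg fun l _ => by positivity)
    refine h1.trans ?_
    have h2 : ∏ l ∈ P, ρ l ^ 2 / |η l| ^ 2 ≤ ∏ l, (2 * (1 + ((ρ l)⁻¹ * η l) ^ 2)⁻¹) := by
      have e : ∏ l ∈ P, ρ l ^ 2 / |η l| ^ 2 = ∏ l, if l ∈ P then ρ l ^ 2 / |η l| ^ 2 else 1 := by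
        rw [Finset.prod_ite_mem, Finset.univ_inter]
      rw [e]
      refine Finset.prod_le_prod (fun l _ => by split_ifs <;> positivity) fun l _ => ?_
      have hρl := hρ l
      have e4 : ((ρ l)⁻¹ * η l) ^ 2 = |η l| ^ 2 / ρ l ^ 2 := by
        rw [mul_pow, sq_abs, inv_pow]
        ring
      rw [e4, ← div_eq_mul_inv]
      split_ifs with hl
      · have h3 : ρ l ≤ |η l| := (Finset.mem_filter.1 hl).2
        have h5 := pow_le_pow_left₀ hρl.le h3 2
        have h6 := hPη l hl
        rw [le_div_iff₀ (by positivity)]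
        have h7 : ρ l ^ 2 / |η l| ^ 2 ≤ 1 := (div_le_one (by positivity)).2 h5
        have h8 : ρ l ^ 2 / |η l| ^ 2 * (|η l| ^ 2 / ρ l ^ 2) = 1 := by field_simp
        linarith [mul_add (ρ l ^ 2 / |η l| ^ 2) 1 (|η l| ^ 2 / ρ l ^ 2)]
      · have h3 : |η l| ≤ ρ l := by
          by_contra h
          exact hl (Finset.mem_filter.2 ⟨Finset.mem_univ _, (not_le.1 h).le⟩)
        have h5 := pow_le_pow_left₀ (abs_nonneg _) h3 2
        rw [le_div_iff₀ (by positivity), one_mul]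
        have h7 : |η l| ^ 2 / ρ l ^ 2 ≤ 1 := (div_le_one (by positivity)).2 h5
        linarith
    have h3 : 0 ≤ ∏ l, (ρ l)⁻¹ := Finset.prod_nonneg fun l _ => (hρi l).le
    calc K * (∏ l ∈ P, ρ l ^ 2 / |η l| ^ 2) * (∏ l, (ρ l)⁻¹) * Real.pi ^ n
        ≤ K * (∏ l, (2 * (1 + ((ρ l)⁻¹ * η l) ^ 2)⁻¹)) * (∏ l, (ρ l)⁻¹) * Real.pi ^ n := by gcongr
      _ = _ := by
          simp only [Finset.prod_mul_distrib, Finset.prod_const, Finset.card_univ, ← hn]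
          ring
  obtain ⟨hi, he⟩ := integral_prod_cauchy_scaled hρi
  calc ∫ η, ‖𝓕 u η‖ ≤ ∫ η : EuclideanSpace ℝ ι,
        K * 2 ^ n * Real.pi ^ n * ∏ l, ((ρ l)⁻¹ * (1 + ((ρ l)⁻¹ * η l) ^ 2)⁻¹) :=
        integral_mono_of_nonneg (.of_forall fun η => norm_nonneg _) (hi.const_mul _)
          (.of_forall key)
    _ = _ := by rw [integral_const_mul, he]

end DilatedTest

/-! ### The inverse Fourier transform of a multiplier is a proper kernel -/

namespace DilationStructure

variable {N n : ℕ} (D : DilationStructure N n) {e : Matrix (Fin n) (Fin n) ℝ}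

/-- The coordinates of `ℝ^N` are those of `ℝ^L` and those of the complementary subspace. -/
def splitEquiv (L : Finset (Fin n)) : D.Coord L ⊕ D.Coord Lᶜ ≃ Fin N :=
  (Equiv.sumCongr (Equiv.refl _)
    (Equiv.subtypeEquivRight fun _ => Finset.mem_compl)).trans
      (Equiv.sumCompl fun l => D.block l ∈ L)

theorem restrict_glue (L : Finset (Fin n)) (p : D.SubSpace L × D.SubSpace Lᶜ) :
    D.restrict L (glue (D.splitEquiv L) p) = p.1 := by
  ext l
  exact glue_inl (D.splitEquiv L) p l

theorem restrict_compl_glue (L : Finset (Fin n)) (p : D.SubSpace L × D.SubSpace Lᶜ) :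
    D.restrict Lᶜ (glue (D.splitEquiv L) p) = p.2 := by
  ext l
  exact glue_inr (D.splitEquiv L) p l

/-- The unit balls of all the spaces `ℝ^L` lie in a common box. -/
theorem exists_abs_le_of_supported : ∃ r : ℝ, (∀ (L : Finset (Fin n)) (ψ : D.SubSpace L → ℝ),
      D.SubSupportedInUnitBall ψ → ∀ x ∈ tsupport ψ, ∀ l, |x l| ≤ r) ∧
    ∀ ψ : D.Space → ℝ, D.SupportedInUnitBall ψ → ∀ x ∈ tsupport ψ, ∀ l, |x l| ≤ r := by
  obtain ⟨C, hC, h⟩ := D.exists_nrm_bounds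
  have key : ∀ (l : Fin N) (t s : ℝ), s < 1 → |t| ^ (1 / D.d l) ≤ C * s →
      |t| ≤ ∑ l, C ^ D.d l := by
    intro l t s hs ht
    have hd := D.d_pos l
    have h1 : |t| ^ (1 / D.d l) ≤ C := ht.trans (by nlinarith)
    rw [one_div, Real.rpow_inv_le_iff_of_pos (abs_nonneg _) (by linarith) hd] at h1
    exact h1.trans (Finset.single_le_sum (f := fun l => C ^ D.d l) (fun l _ => by positivity)
      (Finset.mem_univ l))
  refine ⟨∑ l, C ^ D.d l, fun L ψ hψ x hx l => ?_, fun ψ hψ x hx l => ?_⟩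
  · exact key l.1 _ _ (hψ x hx ⟨D.block l.1, l.2⟩)
      ((h _ (D.subComp x ⟨D.block l.1, l.2⟩)).1 ⟨l.1, rfl⟩)
  · exact key l _ _ (hψ x hx (D.block l)) ((h _ (D.comp x (D.block l))).1 ⟨l, rfl⟩)

/-- The inverse Fourier transform of a multiplier is a proper kernel. By Parseval's identity, the
partial kernel `K_{ψ,R}` on `ℝ^L` is the inverse Fourier transform of the integral of the
multiplier, over the remaining frequencies, against the Fourier transform of `ψ_R`. As the latter is
bounded in `L¹` uniformly in `R`, this integral is a symbol of order zero with uniform constants. -/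
theorem isProperKernel_of_integral (he : BasicHypothesis e) {m : D.Space → ℂ}
    (hm : ContDiff ℝ ∞ m) {C : ℕ → ℝ} (hsym : IsSymbol (D.exponent e) m (fun _ => 1) C)
    {K : D.Distr} (hK : ∀ φ : D.Test, K φ = ∫ ξ, m ξ * 𝓕 (fun x => (φ x : ℂ)) ξ) :
    D.IsProperKernel e K := by
  have hbd : ∀ ξ, ‖m ξ‖ ≤ C 0 := fun ξ => by simpa using hsym 0 ξ 0 le_rfl
  have hC0 : 0 ≤ C 0 := (norm_nonneg _).trans (hbd 0)
  obtain ⟨r, hr, hr'⟩ := D.exists_abs_le_of_supported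
  have hofReal : ∀ {ι : Type} [Fintype ι]
      (φ : 𝓓((⊤ : TopologicalSpace.Opens (EuclideanSpace ℝ ι)), ℝ)),
      ContDiff ℝ ∞ (fun x => (φ x : ℂ)) ∧ HasCompactSupport (fun x => (φ x : ℂ)) ∧
        tsupport (fun x => (φ x : ℂ)) = tsupport φ := by
    intro ι _ φ
    have hs : Function.support (fun x => (φ x : ℂ)) = Function.support φ := by
      ext x; simp
    have ht : tsupport (fun x => (φ x : ℂ)) = tsupport φ := by
      unfold tsupport; rw [hs]
    refine ⟨Complex.ofRealCLM.contDiff.comp φ.contDiff, ?_, ht⟩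
    have := φ.hasCompactSupport
    unfold HasCompactSupport at this ⊢
    rwa [ht]
  have hL1 : ∀ {ι : Type} [Fintype ι] [DecidableEq ι] (B : ℕ → ℝ), ∃ W : ℝ, 0 ≤ W ∧
      ∀ φ : 𝓓((⊤ : TopologicalSpace.Opens (EuclideanSpace ℝ ι)), ℝ),
      (∀ x ∈ tsupport φ, ∀ l, |x l| ≤ r) → SeminormsBoundedBy φ B →
      ∀ ρ : ι → ℝ, (∀ l, 0 < ρ l) → HasCompactSupport (fun x => (φ (diagMap ρ x) : ℂ)) →
        ∫ η, ‖𝓕 (fun x => (φ (diagMap ρ x) : ℂ)) η‖ ≤ W := by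
    intro ι _ _ B
    obtain ⟨W, hW0, hW⟩ := exists_integral_norm_fourier_dilate_le ι (B (2 * Fintype.card ι)) r
    refine ⟨W, hW0, fun φ hφ hB ρ hρ hc => ?_⟩
    obtain ⟨h1, h2, h3⟩ := hofReal φ
    refine hW (fun x => (φ x : ℂ)) h1 h2 (by rw [h3]; exact hφ) (fun γ hγ x => ?_) ρ hρ hc
    rw [multiDeriv_ofReal φ.contDiff, Complex.norm_real]
    exact hB _ γ hγ x
  refine ⟨?_, ?_, ?_⟩
  · obtain ⟨C', hC'⟩ := exists_kernel_of_isSymbol (D.isExponentSystem_exponent he) C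
    obtain ⟨g, hg, hgb, hgi⟩ := hC' m hm hsym
    refine ⟨g, ⟨hg, fun φ hφ => ?_⟩, fun M γ => ?_⟩
    · obtain ⟨h1, h2, h3⟩ := hofReal φ
      exact (hK φ).trans (hgi _ h1 h2 (by rw [h3]; exact hφ))
    · obtain ⟨C₂, hC₂1, hC₂⟩ := D.exists_kernelWeight_equiv he γ
      refine ⟨|C' M γ| * C₂, fun x hx => (hgb M γ x hx).trans ?_⟩
      have h1 := (hC₂ x hx).1
      have h2 : 0 ≤ (1 + ‖x‖) ^ (-(M : ℝ)) := by positivity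
      have h3 : 0 ≤ ∏ l, pNorm (D.exponent e) l x ^ (-(1 + (γ l : ℝ))) :=
        Finset.prod_nonneg fun l _ => Real.rpow_nonneg (pNorm_nonneg l x) _
      calc C' M γ * (1 + ‖x‖) ^ (-(M : ℝ)) * ∏ l, pNorm (D.exponent e) l x ^ (-(1 + (γ l : ℝ)))
          ≤ |C' M γ| * (1 + ‖x‖) ^ (-(M : ℝ)) *
            (C₂ * ∏ j, D.norm e j x ^ (-(D.Q j + D.weight γ j))) := by
            gcongr
            exact le_abs_self _
        _ = _ := by ring
  · intro L _ B
    obtain ⟨W, hW0, hW⟩ := hL1 (ι := D.Coord Lᶜ) B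
    obtain ⟨C', hC'⟩ := exists_kernel_of_isSymbol (D.isExponentSystem_subExponent he L)
      (fun k => C k * W)
    choose C₂ hC₂1 hC₂ using fun γ => D.exists_subKernelWeight_equiv he L γ
    refine ⟨fun M γ => |C' M γ| * C₂ γ, fun ψ hψ hB R hR => ?_⟩
    set ρ : D.Coord Lᶜ → ℝ := fun l => R (D.block l.1) ^ D.d l.1 with hρ
    have hρ0 : ∀ l, 0 < ρ l := fun l => Real.rpow_pos_of_pos (hR _) _
    have hdil : ∀ x : D.SubSpace Lᶜ, D.subDilate R x = diagMap ρ x := fun x => rfl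
    set u : D.SubSpace Lᶜ → ℂ := fun x => (ψ (diagMap ρ x) : ℂ) with hu
    have hus : ContDiff ℝ ∞ u :=
      (Complex.ofRealCLM.contDiff.comp ψ.contDiff).comp (by fun_prop)
    have huc : HasCompactSupport u := by
      refine HasCompactSupport.intro (K := diagMap (fun l => (ρ l)⁻¹) '' tsupport ψ)
        (ψ.hasCompactSupport.isCompact.image (by fun_prop)) fun x hx => ?_
      by_contra h
      refine hx ⟨diagMap ρ x, subset_tsupport _ fun h0 => h (by simp [hu, h0]), ?_⟩
      ext l
      simp [(hρ0 l).ne']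
    have hL := hW ψ (hr Lᶜ ψ hψ) hB ρ hρ0 huc
    have hFi : Integrable (𝓕 u) := integrable_fourier_of_hasCompactSupport hus huc
    obtain ⟨hms, hmsym⟩ := isSymbol_integral_glue (D.splitEquiv L) hm hsym
      (contDiff_fourier_of_hasCompactSupport hus huc).continuous hFi hL
    obtain ⟨g, hg, hgb, hgi⟩ := hC' _ hms hmsym
    refine ⟨g, ⟨hg, fun φ hφ => ?_⟩, fun M γ x hx => (hgb M γ x hx).trans ?_⟩
    · obtain ⟨h1, h2, h3⟩ := hofReal φ
      refine (hK _).trans ?_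
      rw [← hgi _ h1 h2 (by rw [h3]; exact hφ)]
      have hφi : Integrable (𝓕 fun x => (φ x : ℂ)) := integrable_fourier_of_hasCompactSupport h1 h2
      have e1 : ∀ p, m (glue (D.splitEquiv L) p) *
          𝓕 (fun x => ((D.tensorTest L R hR φ ψ) x : ℂ)) (glue (D.splitEquiv L) p) =
          m (glue (D.splitEquiv L) p) * (𝓕 (fun x => (φ x : ℂ)) p.1 * 𝓕 u p.2) := by
        intro p
        rw [fourier_tensor (D.splitEquiv L) (u := fun x => (φ x : ℂ)) (v := u) fun q => ?_]
        have : (D.tensorTest L R hR φ ψ) (glue (D.splitEquiv L) q) =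
            φ (D.restrict L (glue (D.splitEquiv L) q)) *
              ψ (D.subDilate R (D.restrict Lᶜ (glue (D.splitEquiv L) q))) := rfl
        rw [this, restrict_glue, restrict_compl_glue, hdil]
        push_cast
        rfl
      rw [integral_glue (D.splitEquiv L)]
      simp only [e1]
      have hint : Integrable (fun p : D.SubSpace L × D.SubSpace Lᶜ =>
          m (glue (D.splitEquiv L) p) * (𝓕 (fun x => (φ x : ℂ)) p.1 * 𝓕 u p.2))
          (volume.prod volume) := by
        refine (hφi.mul_prod hFi).bdd_mul (c := C 0)
          (hm.continuous.comp (by fun_prop)).aestronglyMeasurable (.of_forall fun p => hbd _)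
      rw [Measure.volume_eq_prod, integral_prod _ hint]
      refine integral_congr_ae (.of_forall fun ξ => ?_)
      beta_reduce
      rw [← integral_mul_const]
      refine integral_congr_ae (.of_forall fun η => ?_)
      beta_reduce
      ring
    · have h1 := (hC₂ γ x hx).1
      have h2 : 0 ≤ (1 + ‖x‖) ^ (-(M : ℝ)) := by positivity
      have h3 : 0 ≤ ∏ l, pNorm (D.subExponent e L) l x ^ (-(1 + (γ l : ℝ))) :=
        Finset.prod_nonneg fun l _ => Real.rpow_nonneg (pNorm_nonneg l x) _
      calc C' M γ * (1 + ‖x‖) ^ (-(M : ℝ)) *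
            ∏ l, pNorm (D.subExponent e L) l x ^ (-(1 + (γ l : ℝ)))
          ≤ |C' M γ| * (1 + ‖x‖) ^ (-(M : ℝ)) *
            (C₂ γ * ∏ j ∈ L, D.subNorm e L j x ^ (-(D.Q j + D.subWeight L γ j))) := by
            gcongr
            exact le_abs_self _
        _ = _ := by ring
  · intro B
    obtain ⟨W, hW0, hW⟩ := hL1 (ι := Fin N) B
    refine ⟨C 0 * W, fun ψ hψ hB R hR => ?_⟩
    set ρ : Fin N → ℝ := fun l => R (D.block l) ^ D.d l with hρ
    have hρ0 : ∀ l, 0 < ρ l := fun l => Real.rpow_pos_of_pos (hR _) _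
    obtain ⟨h1, h2, h3⟩ := hofReal (D.dilateTest R hR ψ)
    have hL := hW ψ (hr' ψ hψ) hB ρ hρ0 h2
    have hFi : Integrable (𝓕 (fun x => ((D.dilateTest R hR ψ) x : ℂ))) :=
      integrable_fourier_of_hasCompactSupport h1 h2
    rw [hK]
    calc ‖∫ ξ, m ξ * 𝓕 (fun x => ((D.dilateTest R hR ψ) x : ℂ)) ξ‖
        ≤ ∫ ξ, C 0 * ‖𝓕 (fun x => ((D.dilateTest R hR ψ) x : ℂ)) ξ‖ := by
          refine norm_integral_le_of_norm_le (hFi.norm.const_mul _) (.of_forall fun ξ => ?_)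
          rw [norm_mul]
          exact mul_le_mul_of_nonneg_right (hbd ξ) (norm_nonneg _)
      _ = C 0 * ∫ ξ, ‖𝓕 (fun x => ((D.dilateTest R hR ψ) x : ℂ)) ξ‖ := integral_const_mul _ _
      _ ≤ C 0 * W := by
          gcongr
          exact hL

end DilationStructure

/-! ### Oscillatory integrals of cut-off kernels -/

section KernelOscillation

variable {ι J : Type*} [Fintype ι] [DecidableEq J] {f : ι → ι → ℝ}

/-- A kernel, multiplied by a monomial, by a bump function at the scales `1 / T_l`, and by cutoff
functions which vanish where all the variables of a block `j ∈ S` are small on the scales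
`1 / a_l`. -/
noncomputable def cutKernel (G : EuclideanSpace ℝ ι → ℂ) (b : ι → J) (γ : ι → ℕ) (T a : ι → ℝ)
    (S : Finset J) (x : EuclideanSpace ℝ ι) : ℂ :=
  G x * ((boxBump T Finset.univ x * ∏ l, (x l : ℂ) ^ γ l) *
    ∏ j ∈ S, (1 - boxBump a (Finset.univ.filter fun l => b l = j) x))

theorem cutKernel_eventuallyEq_zero {G : EuclideanSpace ℝ ι → ℂ} {b : ι → J} {γ : ι → ℕ}
    {T a : ι → ℝ} {S : Finset J} {x : EuclideanSpace ℝ ι} {j : J} (hj : j ∈ S)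
    (h : ∀ l, b l = j → |a l * x l| < 1) : cutKernel G b γ T a S =ᶠ[nhds x] 0 := by
  have h1 : ∀ l ∈ Finset.univ.filter fun l => b l = j, |a l * x l| < 1 := fun l hl =>
    h l (Finset.mem_filter.1 hl).2
  filter_upwards [boxBump_eventuallyEq_one h1] with z hz
  have h0 : ∏ j ∈ S, (1 - boxBump a (Finset.univ.filter fun l => b l = j) z) = 0 :=
    Finset.prod_eq_zero hj (by rw [hz, sub_self])
  simp [cutKernel, h0]

theorem contDiff_cutKernel {G : EuclideanSpace ℝ ι → ℂ} (hG : ContDiffOn ℝ ∞ G {0}ᶜ) {b : ι → J}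
    {γ : ι → ℕ} {T a : ι → ℝ} {S : Finset J} (hS : S.Nonempty) :
    ContDiff ℝ ∞ (cutKernel G b γ T a S) := by
  rw [contDiff_iff_contDiffAt]
  intro x
  by_cases hx : x = 0
  · obtain ⟨j, hj⟩ := hS
    refine contDiffAt_const.congr_of_eventuallyEq (cutKernel_eventuallyEq_zero hj fun l _ => ?_)
    simp [hx]
  · refine (hG.contDiffAt (isOpen_compl_singleton.mem_nhds hx)).mul (ContDiff.contDiffAt ?_)
    exact ((contDiff_boxBump _ _).mul (contDiff_prod fun l _ => (contDiff_coord l).pow _)).mul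
      (contDiff_prod fun j _ => contDiff_const.sub (contDiff_boxBump _ _))

theorem hasCompactSupport_cutKernel {G : EuclideanSpace ℝ ι → ℂ} {b : ι → J} {γ : ι → ℕ}
    {T a : ι → ℝ} {S : Finset J} (hT : ∀ l, 0 < T l) :
    HasCompactSupport (cutKernel G b γ T a S) :=
  (hasCompactSupport_boxBump_univ hT).mul_right.mul_right.mul_left

/-- The oscillatory integral estimate for a kernel. The map `p` assigns to each coordinate its
pivot, a coordinate whose frequency is as large as its scale and whose scale dominates that of all
the coordinates assigned to it. One integrates by parts in the pivots. -/
theorem exists_norm_fourier_cutKernel_le [DecidableEq ι] [Fintype J] (hf : IsExponentSystem f) (b : ι → J) (γ : ι → ℕ)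
    (CG : (ι → ℕ) → ℝ) {D : ℝ} (hD : 1 ≤ D) :
    ∃ C' : ℝ, 0 ≤ C' ∧ ∀ (G : EuclideanSpace ℝ ι → ℂ) (T a : ι → ℝ) (S : Finset J) (p : ι → ι)
      (ξ : EuclideanSpace ℝ ι), ContDiffOn ℝ ∞ G {0}ᶜ →
      (∀ (α : ι → ℕ) (x : EuclideanSpace ℝ ι), x ≠ 0 →
        ‖multiDeriv α G x‖ ≤ CG α * ∏ l, pNorm f l x ^ (-(1 + (α l : ℝ)))) →
      (∀ l, 0 < T l) → (∀ l, 0 < a l) → S.Nonempty → (∀ l, p (p l) = p l) →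
      (∀ l, a (p l) ≤ D * |ξ (p l)|) → (∀ l, a l ^ f (p l) l ≤ D * a (p l)) →
      (∀ l, T (p l) ≤ D * T l ^ f (p l) l) →
      (∀ l, ∃ j ∈ S, ∀ l₀, b l₀ = j → a l₀ ^ f l l₀ ≤ D * a l) →
      (∀ l, ∃ j ∈ S, ∀ l₀, b l₀ = j → p l₀ = p l) →
      (∀ l, b (p l) ∈ S → b l = b (p l)) →
      ‖𝓕 (cutKernel G b γ T a S) ξ‖ ≤ C' * ∏ l, (a l ^ γ l)⁻¹ := by
  obtain ⟨F, hF1, hF, hF'⟩ := exists_rpow_bounds hf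
  set n : ℝ := ((Fintype.card ι : ℕ) : ℝ) with hn
  have hn0 : 0 ≤ n := by positivity
  have hF0 : 0 < F := by linarith
  have hD0 : 0 < D := by linarith
  set Γ : ℕ := ∑ l, γ l with hΓ
  -- the number of integrations by parts that `exists_norm_fourier_le` asks for
  set M : ℕ := ⌈F * n * (F * Γ + 2)⌉₊ with hM
  set m : ℕ := M * Fintype.card ι with hm
  have h2F : 1 ≤ (2 : ℝ) ^ F := Real.one_le_rpow (by norm_num) hF0.le
  set c₁ : ℝ := 1 + n * 2 ^ F * D ^ 2 with hc₁
  have hc₁1 : 1 ≤ c₁ := le_add_of_nonneg_right (by positivity)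
  obtain ⟨B₁, hB₁1, hB₁⟩ := exists_scaledBound_one_sub_boxBump ι m hc₁1
  obtain ⟨B₂, hB₂1, hB₂⟩ := exists_scaledBound_boxBump ι m hc₁1
  set CGm : ℝ := ∑ k ∈ Finset.range (m + 1), ∑ α ∈ Finset.piAntidiag Finset.univ k, |CG α| with hCGm
  have hCGm0 : 0 ≤ CGm := Finset.sum_nonneg fun k _ => Finset.sum_nonneg fun α _ => abs_nonneg _
  set CA : ℝ := (Fintype.card ι + 1) ^ m * (CGm * D ^ Fintype.card ι) * D ^ m with hCA
  set CB : ℝ := (2 ^ m) ^ (Fintype.card ι + Γ) * (1 + n) ^ Γ with hCB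
  set CC : ℝ := (2 ^ m * B₁) ^ Fintype.card J with hCC
  set C₂ : ℝ := max D (max (2 ^ Fintype.card ι)
    (2 ^ m * (CA * (2 ^ m * ((2 ^ m * (B₂ * CB)) * CC))))) with hC₂
  have hC₂1 : 1 ≤ C₂ := hD.trans (le_max_left _ _)
  obtain ⟨C', hC'0, hosc⟩ := exists_norm_fourier_le (ι := ι) (c := D⁻¹) (C₀ := F * Γ)
    (C₁ := F * n) (by positivity) (inv_le_one_of_one_le₀ hD) hC₂1
    (Nat.le_ceil (F * n * (F * Γ + 2))) (by positivity) (by positivity)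
  refine ⟨C', hC'0, fun G T a S p ξ hGs hGb hT ha hS hpp hξ hap hTp hSa hSp hSb => ?_⟩
  -- the set of pivots
  set P : Finset ι := Finset.univ.image p with hP
  have hPp : ∀ q ∈ P, p q = q := by
    intro q hq
    obtain ⟨l, -, rfl⟩ := Finset.mem_image.1 hq
    exact hpp l
  set W : ℝ := ∏ l, (a l ^ γ l)⁻¹ with hW
  have hW0 : 0 ≤ W := Finset.prod_nonneg fun l _ => inv_nonneg.2 (pow_nonneg (ha l).le _)
  refine hosc _ P a W ξ (contDiff_cutKernel hGs hS) (hasCompactSupport_cutKernel hT) ha hW0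
    (fun q hq => ?_) fun x => ?_
  · have := hξ q
    rw [hPp q hq] at this
    rwa [inv_mul_le_iff₀ hD0]
  by_cases h1 : ∃ j ∈ S, ∀ l, b l = j → |a l * x l| < 1
  · obtain ⟨j, hj, h1⟩ := h1
    exact Or.inl (cutKernel_eventuallyEq_zero hj h1)
  by_cases h2 : ∃ l ∈ Finset.univ, 2 < |T l * x l|
  · left
    filter_upwards [boxBump_eventuallyEq_zero h2] with z hz
    simp [cutKernel, hz]
  right
  push Not at h1 h2
  set η : ι → ℝ := fun l => |a l * x l| with hη
  have hη0 : ∀ l, 0 ≤ η l := fun l => abs_nonneg _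
  have hηx : ∀ l, η l = a l * |x l| := fun l => by rw [hη]; simp [abs_mul, abs_of_pos (ha l)]
  have hx0 : x ≠ 0 := by
    rintro rfl
    obtain ⟨j, hj⟩ := hS
    obtain ⟨l, -, hl⟩ := h1 j hj
    simp at hl
    linarith
  -- `ρ q` is a rescaled form of `pNorm f q`, restricted to the coordinates with the pivot `q`; a
  -- derivative in the direction `q` gains it
  set ρ : ι → ℝ := fun q => ∑ l with p l = q, η l ^ f q l with hρ
  have hρle : ∀ l, η l ^ f (p l) l ≤ ρ (p l) := fun l =>
    Finset.single_le_sum (f := fun l' => η l' ^ f (p l) l')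
      (fun i _ => Real.rpow_nonneg (hη0 i) _) (by simp : l ∈ Finset.univ.filter fun l' => p l' = p l)
  have hρ0 : ∀ q, 0 ≤ ρ q := fun q => Finset.sum_nonneg fun l _ => Real.rpow_nonneg (hη0 l) _
  -- some block in `S` has the same pivot as `l`, and contains a variable that is not small
  have hρ1 : ∀ l, 1 ≤ ρ (p l) := by
    intro l
    obtain ⟨j, hj, h3⟩ := hSp l
    obtain ⟨l₀, hl₀, h4⟩ := h1 j hj
    have h5 := hρle l₀
    rw [h3 l₀ hl₀] at h5
    exact (Real.one_le_rpow h4 (hf.pos _ _).le).trans h5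
  have hρP : ∀ q ∈ P, 1 ≤ ρ q := fun q hq => by
    have := hρ1 q
    rwa [hPp q hq] at this
  have hρpow1 : ∀ q ∈ P, 1 ≤ ρ q ^ F := fun q hq => Real.one_le_rpow (hρP q hq) hF0.le
  have hρsum : ∀ (q : ι) (A : ℝ), 0 ≤ A → (∀ l, p l = q → η l ^ f q l ≤ A) → ρ q ≤ n * A := by
    intro q A hA h
    refine (Finset.sum_le_card_nsmul _ _ A fun l hl => h l (Finset.mem_filter.1 hl).2).trans ?_
    rw [nsmul_eq_mul]
    gcongr
    rw [hn]
    exact_mod_cast Finset.card_le_univ _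
  set H : ℝ := ∏ l, (1 + |a l * x l|) with hH
  have hH1 : ∀ l, 1 + η l ≤ H := fun l =>
    le_prod_of_one_le (t := fun l => 1 + |a l * x l|)
      (fun k _ => le_add_of_nonneg_right (abs_nonneg _)) (Finset.mem_univ l)
  have hHone : 1 ≤ H := by
    obtain ⟨j, hj⟩ := hS
    obtain ⟨l, -, -⟩ := h1 j hj
    linarith [hH1 l, hη0 l]
  have hH0 : 0 < H := by linarith
  -- the kernel norm in a pivot direction, and in an arbitrary direction
  have hpA : ∀ q ∈ P, ρ q / a q ≤ D * pNorm f q x := by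
    intro q hq
    rw [div_le_iff₀ (ha q)]
    calc ρ q ≤ ∑ l with p l = q, D * a q * |x l| ^ f q l := by
          refine Finset.sum_le_sum fun l hl => ?_
          have hl : p l = q := (Finset.mem_filter.1 hl).2
          rw [hηx, Real.mul_rpow (ha l).le (abs_nonneg _)]
          have := hap l
          rw [hl] at this
          gcongr
      _ ≤ ∑ l, D * a q * |x l| ^ f q l := by
          refine Finset.sum_le_sum_of_subset_of_nonneg (Finset.subset_univ _) fun l _ _ => ?_
          have := ha q
          positivity
      _ = D * pNorm f q x * a q := by
          rw [← Finset.mul_sum]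
          unfold pNorm
          ring
  have hpB : ∀ l, (pNorm f l x)⁻¹ ≤ D * a l := by
    intro l
    obtain ⟨j, hj, h3⟩ := hSa l
    obtain ⟨l₀, hl₀, h4⟩ := h1 j hj
    have h5 : 1 ≤ D * a l * pNorm f l x := by
      calc (1 : ℝ) ≤ η l₀ ^ f l l₀ := Real.one_le_rpow h4 (hf.pos _ _).le
        _ = a l₀ ^ f l l₀ * |x l₀| ^ f l l₀ := by
            rw [hηx, Real.mul_rpow (ha l₀).le (abs_nonneg _)]
        _ ≤ (D * a l) * pNorm f l x := by
            have := ha l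
            exact mul_le_mul (h3 l₀ hl₀) (rpow_le_pNorm l l₀ x) (by positivity) (by positivity)
    rw [inv_le_iff_one_le_mul₀ (pNorm_pos hx0 l)]
    exact h5
  set lam : ι → ℝ := fun l => if l ∈ P then ρ l / a l else 0 with hlam
  have hlamP : ∀ l ∈ P, |lam l| = ρ l / a l := fun l hl => by
    simp only [hlam, if_pos hl]
    exact abs_of_nonneg (div_nonneg (hρ0 l) (ha l).le)
  have hlamN : ∀ l, l ∉ P → lam l = 0 := fun l hl => by simp only [hlam, if_neg hl]
  have hηρ : ∀ q l, η l ^ f q l ≤ H ^ F := fun q l => by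
    calc η l ^ f q l ≤ H ^ f q l :=
          Real.rpow_le_rpow (hη0 l) (by linarith [hH1 l]) (hf.pos _ _).le
      _ ≤ H ^ F := Real.rpow_le_rpow_of_exponent_le hHone (hF _ _)
  refine ⟨ρ, fun q hq => (inv_le_one_of_one_le₀ hD).trans (hρP q hq), ?_, ?_⟩
  · -- every rescaled variable is controlled by the product of the numbers `ρ q`
    set Pi₀ : ℝ := ∏ q ∈ P, ρ q ^ F with hPi₀
    have hPi : ∀ q ∈ P, ρ q ^ F ≤ Pi₀ := fun q hq =>
      le_prod_of_one_le (t := fun q => ρ q ^ F) hρpow1 hq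
    have h3 : ∀ l, 1 + |a l * x l| ≤ 2 * Pi₀ := by
      intro l
      have hq : p l ∈ P := Finset.mem_image_of_mem _ (Finset.mem_univ l)
      have hfl := hf.pos (p l) l
      have h4 : η l ≤ ρ (p l) ^ F := by
        calc η l = (η l ^ f (p l) l) ^ (1 / f (p l) l) := by
              rw [← Real.rpow_mul (hη0 l), mul_one_div_cancel hfl.ne', Real.rpow_one]
          _ ≤ ρ (p l) ^ (1 / f (p l) l) :=
              Real.rpow_le_rpow (Real.rpow_nonneg (hη0 l) _) (hρle l) (by positivity)
          _ ≤ ρ (p l) ^ F := Real.rpow_le_rpow_of_exponent_le (hρ1 l) (hF' _ _)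
      have h5 := hPi _ hq
      have h6 := hρpow1 _ hq
      change 1 + η l ≤ _
      linarith
    calc ∏ l, (1 + |a l * x l|) ≤ ∏ _l : ι, (2 * Pi₀) :=
          Finset.prod_le_prod (fun l _ => by positivity) fun l _ => h3 l
      _ = 2 ^ Fintype.card ι * Pi₀ ^ Fintype.card ι := by
          rw [Finset.prod_const, Finset.card_univ, mul_pow]
      _ = 2 ^ Fintype.card ι * ∏ q ∈ P, ρ q ^ (F * n) := by
          rw [hPi₀, ← Finset.prod_pow]
          congr 1
          refine Finset.prod_congr rfl fun q _ => ?_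
          rw [hn, Real.rpow_mul (hρ0 q), Real.rpow_natCast]
      _ ≤ C₂ * ∏ q ∈ P, ρ q ^ (F * n) := by
          refine mul_le_mul_of_nonneg_right ((le_max_left _ _).trans (le_max_right _ _))
            (Finset.prod_nonneg fun q _ => Real.rpow_nonneg (hρ0 q) _)
  -- the four factors of the cut-off kernel
  have hsG : ScaledBound G x lam m (CA * ∏ l, a l) := by
    have hGx : ContDiffAt ℝ ∞ G x := hGs.contDiffAt (isOpen_compl_singleton.mem_nhds hx0)
    have h3 : ScaledBound G x (fun l => pNorm f l x) m
        ((Fintype.card ι + 1) ^ m * (CGm * D ^ Fintype.card ι * ∏ l, a l)) := by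
      refine ScaledBound.of_multiDeriv hGx fun α hα => ?_
      have h4 := hGb α x hx0
      have h5 : (∏ l, |pNorm f l x| ^ α l) * ∏ l, pNorm f l x ^ (-(1 + (α l : ℝ))) =
          ∏ l, (pNorm f l x)⁻¹ := by
        rw [← Finset.prod_mul_distrib]
        refine Finset.prod_congr rfl fun l _ => ?_
        have := pNorm_pos (f := f) hx0 l
        rw [abs_of_pos this, ← Real.rpow_natCast, ← Real.rpow_add this, ← Real.rpow_neg_one]
        congr 1
        ring
      have h6 : |CG α| ≤ CGm := by
        calc |CG α| ≤ ∑ α ∈ Finset.piAntidiag Finset.univ (∑ l, α l), |CG α| :=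
              Finset.single_le_sum (f := fun α => |CG α|) (fun α _ => abs_nonneg _)
                (Finset.mem_piAntidiag.2 ⟨rfl, fun _ _ => Finset.mem_univ _⟩)
          _ ≤ CGm := Finset.single_le_sum
              (f := fun k => ∑ α ∈ Finset.piAntidiag Finset.univ k, |CG α|)
              (fun k _ => Finset.sum_nonneg fun α _ => abs_nonneg _)
              (Finset.mem_range.2 (Nat.lt_succ_of_le hα))
      have h7 : ∏ l, (pNorm f l x)⁻¹ ≤ D ^ Fintype.card ι * ∏ l, a l := by
        calc ∏ l, (pNorm f l x)⁻¹ ≤ ∏ l, (D * a l) :=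
              Finset.prod_le_prod (fun l _ => inv_nonneg.2 (pNorm_nonneg l x)) fun l _ => hpB l
          _ = _ := by rw [Finset.prod_mul_distrib, Finset.prod_const, Finset.card_univ]
      have h8 : 0 ≤ ∏ l, (pNorm f l x)⁻¹ :=
        Finset.prod_nonneg fun l _ => inv_nonneg.2 (pNorm_nonneg l x)
      have h9 : 0 ≤ ∏ l, |pNorm f l x| ^ α l := Finset.prod_nonneg fun l _ => by positivity
      calc (∏ l, |pNorm f l x| ^ α l) * ‖multiDeriv α G x‖
          ≤ (∏ l, |pNorm f l x| ^ α l) * (CG α * ∏ l, pNorm f l x ^ (-(1 + (α l : ℝ)))) :=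
            mul_le_mul_of_nonneg_left h4 h9
        _ = CG α * ∏ l, (pNorm f l x)⁻¹ := by rw [mul_left_comm, h5]
        _ ≤ CGm * (D ^ Fintype.card ι * ∏ l, a l) :=
            mul_le_mul ((le_abs_self _).trans h6) h7 h8 hCGm0
        _ = _ := by ring
    refine (h3.mono_scale hGx hD (lam' := lam) fun l => ?_).mono (le_of_eq (by rw [hCA]; ring))
    have hp0 := pNorm_nonneg (f := f) l x
    rw [abs_of_nonneg hp0]
    by_cases hl : l ∈ P
    · rw [hlamP l hl]
      exact hpA l hl
    · rw [hlamN l hl, abs_zero]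
      positivity
  have hsT : ScaledBound (boxBump T Finset.univ) x lam m B₂ := by
    refine hB₂ T _ lam x fun l _ => ?_
    by_cases hl : l ∈ P
    · have hal := ha l
      have hTl := hT l
      rw [abs_mul, hlamP l hl, abs_of_pos hTl, div_mul_eq_mul_div, div_le_iff₀ hal]
      have h3 : ρ l ≤ n * (2 ^ F * D ^ 2 * a l / T l) := by
        refine hρsum l _ (by positivity) fun k hk => ?_
        have hak := ha k
        have hTk := hT k
        have h4 : η k ≤ 2 * (a k / T k) := by
          have h5 := h2 k (Finset.mem_univ k)
          rw [abs_mul, abs_of_pos hTk] at h5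
          rw [hηx, mul_div_assoc', le_div_iff₀ hTk]
          nlinarith
        have h5 := hap k
        have h6 := hTp k
        rw [hk] at h5 h6
        calc η k ^ f l k ≤ (2 * (a k / T k)) ^ f l k :=
              Real.rpow_le_rpow (hη0 k) h4 (hf.pos _ _).le
          _ = 2 ^ f l k * (a k ^ f l k / T k ^ f l k) := by
              rw [Real.mul_rpow (by norm_num) (by positivity), Real.div_rpow hak.le hTk.le]
          _ ≤ 2 ^ F * ((D * a l) / (T l / D)) := by
              have h7 : T l / D ≤ T k ^ f l k := by
                rw [div_le_iff₀ hD0]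
                linarith
              have h8 : (2 : ℝ) ^ f l k ≤ 2 ^ F :=
                Real.rpow_le_rpow_of_exponent_le (by norm_num) (hF _ _)
              have h9 : a k ^ f l k / T k ^ f l k ≤ (D * a l) / (T l / D) :=
                div_le_div₀ (by positivity) h5 (by positivity) h7
              exact mul_le_mul h8 h9 (by positivity) (by positivity)
          _ = 2 ^ F * D ^ 2 * a l / T l := by field_simp
      calc ρ l * T l ≤ n * (2 ^ F * D ^ 2 * a l / T l) * T l := by gcongr
        _ = (n * 2 ^ F * D ^ 2) * a l := by field_simp
        _ ≤ c₁ * a l := by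
            gcongr
            linarith
    · rw [hlamN l hl, zero_mul, abs_zero]
      linarith
  have hsM : ScaledBound (fun y => ∏ l, (y l : ℂ) ^ γ l) x lam m (CB * H ^ (F * Γ) * W) := by
    have hHF : H ≤ H ^ F := by
      simpa using Real.rpow_le_rpow_of_exponent_le hHone hF1
    have h3 := scaledBound_monomial (x := x) (lam := lam) (A := fun l => (1 + n) * H ^ F / a l)
      Finset.univ γ m (fun l _ => ?_) (fun l _ => ?_)
    · refine h3.mono (le_of_eq ?_)
      have e1 : ∏ l, ((1 + n) * H ^ F / a l) ^ γ l = ((1 + n) * H ^ F) ^ Γ * W := by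
        simp only [div_eq_mul_inv, mul_pow _ (_)⁻¹, inv_pow, Finset.prod_mul_distrib,
          Finset.prod_pow_eq_pow_sum]
        rfl
      rw [e1, mul_pow, ← Real.rpow_natCast (H ^ F), ← Real.rpow_mul hH0.le, hCB]
      ring
    · have hal := ha l
      rw [le_div_iff₀ hal]
      have h4 := hH1 l
      rw [hηx] at h4
      have h5 : 0 ≤ H ^ F := by positivity
      nlinarith [abs_nonneg (x l), mul_nonneg hn0 h5]
    · have hal := ha l
      by_cases hl : l ∈ P
      · rw [hlamP l hl]
        gcongr
        have h4 := hρsum l (H ^ F) (by positivity) fun k _ => hηρ l k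
        have h5 : 0 ≤ H ^ F := by positivity
        linarith
      · rw [hlamN l hl, abs_zero]
        positivity
  have hsC : ScaledBound (fun y => ∏ j ∈ S, (1 - boxBump a (Finset.univ.filter fun l => b l = j) y))
      x lam m CC := by
    have h3 := ScaledBound.prod (x := x) (lam := lam) (m := m) S
      (f := fun j y => 1 - boxBump a (Finset.univ.filter fun l => b l = j) y) (c := fun _ => B₁)
      (fun j _ => (contDiff_const.sub (contDiff_boxBump _ _)).contDiffAt) fun j hj => by
        refine hB₁ a _ lam x ?_
        by_cases h4 : ∃ l ∈ Finset.univ.filter fun l => b l = j, 2 < |a l * x l|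
        · exact Or.inl h4
        right
        push Not at h4
        intro l hl
        have hl : b l = j := (Finset.mem_filter.1 hl).2
        have hal := ha l
        by_cases hlP : l ∈ P
        · rw [abs_mul, hlamP l hlP, abs_of_pos hal, div_mul_cancel₀ _ hal.ne']
          refine (hρsum l (2 ^ F) (by positivity) fun k hk => ?_).trans ?_
          · have h5 : b k = j := by
              have := hSb k
              rw [hk, hl] at this
              exact this hj
            calc η k ^ f l k ≤ 2 ^ f l k :=
                  Real.rpow_le_rpow (hη0 k) (h4 k (by simp [h5])) (hf.pos _ _).le
              _ ≤ 2 ^ F := Real.rpow_le_rpow_of_exponent_le (by norm_num) (hF _ _)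
          · have h6 : n * 2 ^ F * 1 ≤ n * 2 ^ F * D ^ 2 :=
              mul_le_mul_of_nonneg_left (one_le_pow₀ hD) (by positivity)
            rw [hc₁]
            linarith
        · rw [hlamN l hlP, zero_mul, abs_zero]
          linarith
    refine h3.mono ?_
    rw [Finset.prod_const, ← mul_pow]
    exact pow_le_pow_right₀ (one_le_mul_of_one_le_of_one_le (one_le_pow₀ (by norm_num)) hB₁1)
      (Finset.card_le_univ S)
  have hall := ScaledBound.mul (hGs.contDiffAt (isOpen_compl_singleton.mem_nhds hx0))
    (((contDiff_boxBump _ _).mul (contDiff_prod fun l _ => (contDiff_coord l).pow _)).mul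
      (contDiff_prod fun j _ => contDiff_const.sub (contDiff_boxBump _ _))).contDiffAt hsG
    (ScaledBound.mul ((contDiff_boxBump _ _).mul
        (contDiff_prod fun l _ => (contDiff_coord l).pow _)).contDiffAt
      (contDiff_prod fun j _ => contDiff_const.sub (contDiff_boxBump _ _)).contDiffAt
      (ScaledBound.mul (contDiff_boxBump _ _).contDiffAt
        (contDiff_prod fun l _ => (contDiff_coord l).pow _).contDiffAt hsT hsM) hsC)
  refine ScaledBound.mono hall ?_
  have ha0 : 0 ≤ ∏ l, a l := Finset.prod_nonneg fun l _ => (ha l).le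
  have hHp : 0 ≤ H ^ (F * Γ) := by positivity
  calc 2 ^ m * (CA * (∏ l, a l) * (2 ^ m * (2 ^ m * (B₂ * (CB * H ^ (F * Γ) * W)) * CC)))
      = (2 ^ m * (CA * (2 ^ m * ((2 ^ m * (B₂ * CB)) * CC)))) *
          (W * (∏ l, a l) * H ^ (F * Γ)) := by ring
    _ ≤ C₂ * (W * (∏ l, a l) * H ^ (F * Γ)) := by
        refine mul_le_mul_of_nonneg_right ((le_max_right _ _).trans (le_max_right _ _)) ?_
        positivity
    _ = _ := by ring

end KernelOscillation

/-! ### Distributions and complex-valued test functions -/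

section Pairing

variable {ι : Type*} [Fintype ι]

/-- A smooth compactly supported real function, as a test function. -/
def testOf (φ : EuclideanSpace ℝ ι → ℝ) (h : ContDiff ℝ ∞ φ) (hc : HasCompactSupport φ) :
    𝓓((⊤ : TopologicalSpace.Opens (EuclideanSpace ℝ ι)), ℝ) where
  toFun := φ
  contDiff' := h
  hasCompactSupport' := hc
  tsupport_subset' := by simp

@[simp] theorem testOf_apply (φ : EuclideanSpace ℝ ι → ℝ) (h : ContDiff ℝ ∞ φ)
    (hc : HasCompactSupport φ) (x : EuclideanSpace ℝ ι) : testOf φ h hc x = φ x := rfl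

theorem ContDiff.re_comp {F : EuclideanSpace ℝ ι → ℂ} (h : ContDiff ℝ ∞ F) :
    ContDiff ℝ ∞ fun x => (F x).re := Complex.reCLM.contDiff.comp h

theorem ContDiff.im_comp {F : EuclideanSpace ℝ ι → ℂ} (h : ContDiff ℝ ∞ F) :
    ContDiff ℝ ∞ fun x => (F x).im := Complex.imCLM.contDiff.comp h

theorem HasCompactSupport.re_comp {E : Type*} [TopologicalSpace E] {F : E → ℂ} (h : HasCompactSupport F) :
    HasCompactSupport fun x => (F x).re := h.comp_left (g := Complex.re) rfl

theorem HasCompactSupport.im_comp {E : Type*} [TopologicalSpace E] {F : E → ℂ} (h : HasCompactSupport F) :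
    HasCompactSupport fun x => (F x).im := h.comp_left (g := Complex.im) rfl

open Classical in
/-- The complex linear extension of a functional on real test functions to complex-valued smooth
functions with compact support (and `0` for all other functions). -/
noncomputable def pairing (T : 𝓓((⊤ : TopologicalSpace.Opens (EuclideanSpace ℝ ι)), ℝ) → ℂ)
    (F : EuclideanSpace ℝ ι → ℂ) : ℂ :=
  if h : ContDiff ℝ ∞ F ∧ HasCompactSupport F then
    T (testOf (fun x => (F x).re) h.1.re_comp h.2.re_comp) +
      Complex.I * T (testOf (fun x => (F x).im) h.1.im_comp h.2.im_comp)
  else 0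

theorem pairing_eq (T : 𝓓((⊤ : TopologicalSpace.Opens (EuclideanSpace ℝ ι)), ℝ) → ℂ)
    {F : EuclideanSpace ℝ ι → ℂ} (h : ContDiff ℝ ∞ F) (hc : HasCompactSupport F) :
    pairing T F = T (testOf (fun x => (F x).re) h.re_comp hc.re_comp) +
      Complex.I * T (testOf (fun x => (F x).im) h.im_comp hc.im_comp) :=
  dif_pos ⟨h, hc⟩

variable (K : 𝓓'((⊤ : TopologicalSpace.Opens (EuclideanSpace ℝ ι)), ℂ))

theorem pairing_add {F G : EuclideanSpace ℝ ι → ℂ} (hF : ContDiff ℝ ∞ F)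
    (hFc : HasCompactSupport F) (hG : ContDiff ℝ ∞ G) (hGc : HasCompactSupport G) :
    pairing K (fun x => F x + G x) = pairing K F + pairing K G := by
  rw [pairing_eq _ hF hFc, pairing_eq _ hG hGc, pairing_eq _ (hF.add hG) (hFc.add hGc)]
  have h1 : testOf (fun x => (F x + G x).re) (hF.add hG).re_comp (hFc.add hGc).re_comp =
      testOf (fun x => (F x).re) hF.re_comp hFc.re_comp +
        testOf (fun x => (G x).re) hG.re_comp hGc.re_comp := by
    ext x; simp
  have h2 : testOf (fun x => (F x + G x).im) (hF.add hG).im_comp (hFc.add hGc).im_comp =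
      testOf (fun x => (F x).im) hF.im_comp hFc.im_comp +
        testOf (fun x => (G x).im) hG.im_comp hGc.im_comp := by
    ext x; simp
  rw [h1, h2, map_add, map_add]
  ring

theorem pairing_const_mul {F : EuclideanSpace ℝ ι → ℂ} (hF : ContDiff ℝ ∞ F)
    (hFc : HasCompactSupport F) (c : ℂ) :
    pairing K (fun x => c * F x) = c * pairing K F := by
  rw [pairing_eq _ hF hFc, pairing_eq _ (contDiff_const.mul hF) hFc.mul_left]
  have h1 : testOf (fun x => (c * F x).re) (contDiff_const.mul hF).re_comp hFc.mul_left.re_comp =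
      c.re • testOf (fun x => (F x).re) hF.re_comp hFc.re_comp -
        c.im • testOf (fun x => (F x).im) hF.im_comp hFc.im_comp := by
    ext x; simp
  have h2 : testOf (fun x => (c * F x).im) (contDiff_const.mul hF).im_comp hFc.mul_left.im_comp =
      c.re • testOf (fun x => (F x).im) hF.im_comp hFc.im_comp +
        c.im • testOf (fun x => (F x).re) hF.re_comp hFc.re_comp := by
    ext x; simp
  rw [h1, h2, map_add, map_sub, map_smul, map_smul, map_smul, map_smul]
  simp only [Complex.real_smul]
  set a := K (testOf (fun x => (F x).re) hF.re_comp hFc.re_comp)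
  set b := K (testOf (fun x => (F x).im) hF.im_comp hFc.im_comp)
  conv_rhs => rw [← Complex.re_add_im c]
  linear_combination -(c.im : ℂ) * b * Complex.I_mul_I

theorem pairing_sub {F G : EuclideanSpace ℝ ι → ℂ} (hF : ContDiff ℝ ∞ F)
    (hFc : HasCompactSupport F) (hG : ContDiff ℝ ∞ G) (hGc : HasCompactSupport G) :
    pairing K (fun x => F x - G x) = pairing K F - pairing K G := by
  have e : (fun x => F x - G x) = fun x => F x + -1 * G x := by funext x; ring
  rw [e, pairing_add K hF hFc (contDiff_const.mul hG) hGc.mul_left, pairing_const_mul K hG hGc]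
  ring

theorem pairing_zero : pairing K (fun _ => 0) = 0 := by
  have := pairing_const_mul K (F := fun _ => 0) contDiff_const HasCompactSupport.zero 0
  simpa using this

theorem pairing_sum {κ : Type*} (s : Finset κ) {F : κ → EuclideanSpace ℝ ι → ℂ}
    (hF : ∀ i ∈ s, ContDiff ℝ ∞ (F i)) (hFc : ∀ i ∈ s, HasCompactSupport (F i)) :
    pairing K (fun x => ∑ i ∈ s, F i x) = ∑ i ∈ s, pairing K (F i) := by
  classical
  induction s using Finset.induction_on with
  | empty => simpa using pairing_zero K
  | insert a s ha ih =>
    have h1 : ∀ t ⊆ insert a s, HasCompactSupport fun x => ∑ i ∈ t, F i x := by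
      intro t
      induction t using Finset.induction_on with
      | empty => intro _; simp only [Finset.sum_empty]; exact HasCompactSupport.zero
      | insert b t hb ih =>
        intro ht
        simp only [Finset.sum_insert hb]
        exact (hFc b (ht (Finset.mem_insert_self _ _))).add
          (ih fun i hi => ht (Finset.mem_insert_of_mem hi))
    simp only [Finset.sum_insert ha]
    rw [pairing_add K (hF a (Finset.mem_insert_self _ _)) (hFc a (Finset.mem_insert_self _ _))
      (ContDiff.sum fun i hi => hF i (Finset.mem_insert_of_mem hi)) (h1 s (Finset.subset_insert _ _)),
      ih (fun i hi => hF i (Finset.mem_insert_of_mem hi))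
        fun i hi => hFc i (Finset.mem_insert_of_mem hi)]

theorem tsupport_ofReal {E : Type*} [TopologicalSpace E] (φ : E → ℝ) :
    tsupport (fun x => (φ x : ℂ)) = tsupport φ := by
  have hs : Function.support (fun x => (φ x : ℂ)) = Function.support φ := by
    ext x; simp
  unfold tsupport
  rw [hs]

theorem hasCompactSupport_ofReal {E : Type*} [TopologicalSpace E] {φ : E → ℝ} (h : HasCompactSupport φ) :
    HasCompactSupport fun x => (φ x : ℂ) := by
  unfold HasCompactSupport at h ⊢
  rwa [tsupport_ofReal]

theorem contDiff_ofReal {φ : EuclideanSpace ℝ ι → ℝ} (h : ContDiff ℝ ∞ φ) :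
    ContDiff ℝ ∞ fun x => (φ x : ℂ) := Complex.ofRealCLM.contDiff.comp h

theorem pairing_ofReal (φ : 𝓓((⊤ : TopologicalSpace.Opens (EuclideanSpace ℝ ι)), ℝ)) :
    pairing K (fun x => (φ x : ℂ)) = K φ := by
  rw [pairing_eq _ (contDiff_ofReal φ.contDiff) (hasCompactSupport_ofReal φ.hasCompactSupport)]
  have h1 : testOf (fun x => ((φ x : ℂ)).re) (contDiff_ofReal φ.contDiff).re_comp
      (hasCompactSupport_ofReal φ.hasCompactSupport).re_comp = φ := by
    ext x; simp
  have h2 : testOf (fun x => ((φ x : ℂ)).im) (contDiff_ofReal φ.contDiff).im_comp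
      (hasCompactSupport_ofReal φ.hasCompactSupport).im_comp = 0 := by
    ext x; simp
  rw [h1, h2, map_zero, mul_zero, add_zero]

theorem integrable_mul_of_zero_notMem_tsupport {Φ g : EuclideanSpace ℝ ι → ℂ}
    (hΦ : Continuous Φ) (hΦc : HasCompactSupport Φ) (h0 : 0 ∉ tsupport Φ)
    (hg : ContinuousOn g {0}ᶜ) : Integrable fun x => Φ x * g x := by
  have hcont : Continuous fun x => Φ x * g x := by
    refine continuous_of_tsupport fun x hx => ?_
    have hx' : x ∈ tsupport Φ := closure_mono (fun y hy => by
      rw [Function.mem_support] at hy ⊢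
      exact left_ne_zero_of_mul hy) hx
    refine hΦ.continuousAt.mul (hg.continuousAt (isOpen_compl_singleton.mem_nhds ?_))
    exact fun h => h0 (h ▸ hx')
  exact hcont.integrable_of_hasCompactSupport hΦc.mul_right

/-- A distribution that is given by a function away from the origin is so on complex-valued test
functions, too. -/
theorem pairing_eq_integral {T : 𝓓((⊤ : TopologicalSpace.Opens (EuclideanSpace ℝ ι)), ℝ) → ℂ}
    {g : EuclideanSpace ℝ ι → ℂ} (hT : IsGivenAwayFromZeroBy T g) {Φ : EuclideanSpace ℝ ι → ℂ}
    (hΦ : ContDiff ℝ ∞ Φ) (hΦc : HasCompactSupport Φ) (h0 : 0 ∉ tsupport Φ) :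
    pairing T Φ = ∫ x, Φ x * g x := by
  have hre : 0 ∉ tsupport fun x => (Φ x).re := fun h => h0 (closure_mono (fun y hy => by
    rw [Function.mem_support] at hy ⊢
    intro h; simp [h] at hy) h)
  have him : 0 ∉ tsupport fun x => (Φ x).im := fun h => h0 (closure_mono (fun y hy => by
    rw [Function.mem_support] at hy ⊢
    intro h; simp [h] at hy) h)
  rw [pairing_eq _ hΦ hΦc, hT.2 _ hre, hT.2 _ him, ← integral_const_mul, ← integral_add]
  · refine integral_congr_ae (.of_forall fun x => ?_)
    simp only [testOf_apply]
    conv_rhs => rw [← Complex.re_add_im (Φ x)]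
    ring
  · refine integrable_mul_of_zero_notMem_tsupport (contDiff_ofReal hΦ.re_comp).continuous
      (hasCompactSupport_ofReal hΦc.re_comp) ?_ hT.1.continuousOn
    rw [tsupport_ofReal]; exact hre
  · refine Integrable.const_mul (integrable_mul_of_zero_notMem_tsupport
      (contDiff_ofReal hΦ.im_comp).continuous
      (hasCompactSupport_ofReal hΦc.im_comp) ?_ hT.1.continuousOn) _
    rw [tsupport_ofReal]; exact him

variable [DecidableEq ι]

theorem abs_multiDeriv_re_le {γ : ι → ℕ} {F : EuclideanSpace ℝ ι → ℂ} (hF : ContDiff ℝ ∞ F)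
    (x : EuclideanSpace ℝ ι) : |multiDeriv γ (fun y => (F y).re) x| ≤ ‖multiDeriv γ F x‖ := by
  have e : multiDeriv γ (fun y => (F y).re) x = (multiDeriv γ F x).re := by
    unfold multiDeriv
    have e := Complex.reCLM.iteratedFDeriv_comp_left (f := F) (x := x)
      (i := Fintype.card (Σ l, Fin (γ l))) hF.contDiffAt (by exact_mod_cast le_top)
    have e' : (fun y => (F y).re) = Complex.reCLM ∘ F := rfl
    rw [e', e]
    rfl
  rw [e]
  exact Complex.abs_re_le_norm _

theorem abs_multiDeriv_im_le {γ : ι → ℕ} {F : EuclideanSpace ℝ ι → ℂ} (hF : ContDiff ℝ ∞ F)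
    (x : EuclideanSpace ℝ ι) : |multiDeriv γ (fun y => (F y).im) x| ≤ ‖multiDeriv γ F x‖ := by
  have e : multiDeriv γ (fun y => (F y).im) x = (multiDeriv γ F x).im := by
    unfold multiDeriv
    have e := Complex.imCLM.iteratedFDeriv_comp_left (f := F) (x := x)
      (i := Fintype.card (Σ l, Fin (γ l))) hF.contDiffAt (by exact_mod_cast le_top)
    have e' : (fun y => (F y).im) = Complex.imCLM ∘ F := rfl
    rw [e', e]
    rfl
  rw [e]
  exact Complex.abs_im_le_norm _

theorem multiDeriv_add_of_contDiffAt {γ : ι → ℕ} {u v : EuclideanSpace ℝ ι → ℂ}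
    {x : EuclideanSpace ℝ ι} (hu : ContDiffAt ℝ ∞ u x) (hv : ContDiffAt ℝ ∞ v x) (c : ℂ) :
    multiDeriv γ (fun y => u y + c * v y) x = multiDeriv γ u x + c * multiDeriv γ v x := by
  unfold multiDeriv
  have e := iteratedFDeriv_add_apply (i := Fintype.card (Σ l, Fin (γ l))) (x := x) (f := u)
    (g := c • v) (hu.of_le (by exact_mod_cast le_top))
    ((hv.const_smul c).of_le (by exact_mod_cast le_top))
  have e2 := iteratedFDeriv_const_smul_apply (i := Fintype.card (Σ l, Fin (γ l))) (x := x) (a := c)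
    (hv.of_le (by exact_mod_cast le_top))
  have e' : (fun y => u y + c * v y) = u + c • v := rfl
  rw [e', e, e2]
  rfl

end Pairing

/-! ### The cancellation conditions for complex-valued test functions -/

namespace DilationStructure

variable {N n : ℕ} (D : DilationStructure N n) {e : Matrix (Fin n) (Fin n) ℝ}

/-- The cancellation condition for `L = ∅`, for complex-valued test functions. -/
theorem IsProperKernel.exists_norm_pairing_dilate_le {K : D.Distr} (hK : D.IsProperKernel e K)
    (B : ℕ → ℝ) : ∃ C : ℝ, 0 ≤ C ∧ ∀ Ψ : D.Space → ℂ, ContDiff ℝ ∞ Ψ → HasCompactSupport Ψ →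
      (∀ x ∈ tsupport Ψ, ∀ j, D.nrm j (D.comp x j) < 1) →
      (∀ (m : ℕ) (γ : Fin N → ℕ), ∑ l, γ l ≤ m → ∀ x, ‖multiDeriv γ Ψ x‖ ≤ B m) →
      ∀ R : Fin n → ℝ, (∀ j, 0 < R j) → ‖pairing K fun x => Ψ (D.dilate R x)‖ ≤ C := by
  obtain ⟨C, hC⟩ := hK.cancellation_empty B
  refine ⟨|C| + |C|, by positivity, fun Ψ hΨ hΨc hsupp hB R hR => ?_⟩
  have hre : D.SupportedInUnitBall fun x => (Ψ x).re := fun t ht =>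
    hsupp t (closure_mono (fun y hy => by
      rw [Function.mem_support] at hy ⊢
      intro h; simp [h] at hy) ht)
  have him : D.SupportedInUnitBall fun x => (Ψ x).im := fun t ht =>
    hsupp t (closure_mono (fun y hy => by
      rw [Function.mem_support] at hy ⊢
      intro h; simp [h] at hy) ht)
  have h1 := hC (testOf _ hΨ.re_comp hΨc.re_comp) hre
    (fun m γ hγ x => (abs_multiDeriv_re_le hΨ x).trans (hB m γ hγ x)) R hR
  have h2 := hC (testOf _ hΨ.im_comp hΨc.im_comp) him
    (fun m γ hγ x => (abs_multiDeriv_im_le hΨ x).trans (hB m γ hγ x)) R hR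
  by_cases h : ContDiff ℝ ∞ (fun x => Ψ (D.dilate R x)) ∧
      HasCompactSupport fun x => Ψ (D.dilate R x)
  · rw [pairing_eq _ h.1 h.2]
    refine (norm_add_le _ _).trans (add_le_add (h1.trans (le_abs_self _)) ?_)
    rw [norm_mul, Complex.norm_I, one_mul]
    exact h2.trans (le_abs_self _)
  · unfold pairing
    rw [dif_neg h, norm_zero]
    positivity

/-- The cancellation condition for `L ≠ ∅`, for complex-valued test functions. -/
theorem IsProperKernel.exists_partialKernel (he : BasicHypothesis e) {K : D.Distr}
    (hK : D.IsProperKernel e K) {L : Finset (Fin n)} (hL : L.Nonempty) (B : ℕ → ℝ) :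
    ∃ C : (D.Coord L → ℕ) → ℝ, ∀ Ψ : D.SubSpace Lᶜ → ℂ, ContDiff ℝ ∞ Ψ → HasCompactSupport Ψ →
      (∀ x ∈ tsupport Ψ, ∀ j : {j // j ∈ Lᶜ}, D.nrm j.1 (D.subComp x j) < 1) →
      (∀ (m : ℕ) (γ : D.Coord Lᶜ → ℕ), ∑ l, γ l ≤ m → ∀ x, ‖multiDeriv γ Ψ x‖ ≤ B m) →
      ∀ R : Fin n → ℝ, (∀ j, 0 < R j) → ∃ G : D.SubSpace L → ℂ, ContDiffOn ℝ ∞ G {0}ᶜ ∧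
        (∀ (α : D.Coord L → ℕ) (x : D.SubSpace L), x ≠ 0 → ‖multiDeriv α G x‖ ≤
          C α * ∏ l, pNorm (D.subExponent e L) l x ^ (-(1 + (α l : ℝ)))) ∧
        ∀ Φ : D.SubSpace L → ℂ, ContDiff ℝ ∞ Φ → HasCompactSupport Φ → 0 ∉ tsupport Φ →
          ContDiff ℝ ∞ (fun x => Φ (D.restrict L x) * Ψ (D.subDilate R (D.restrict Lᶜ x))) →
          HasCompactSupport (fun x => Φ (D.restrict L x) * Ψ (D.subDilate R (D.restrict Lᶜ x))) →
          pairing K (fun x => Φ (D.restrict L x) * Ψ (D.subDilate R (D.restrict Lᶜ x))) =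
            ∫ x, Φ x * G x := by
  obtain ⟨C, hC⟩ := hK.cancellation L hL B
  choose C₂ hC₂1 hC₂ using fun γ => D.exists_subKernelWeight_equiv he L γ
  refine ⟨fun α => |C 0 α| * C₂ α + |C 0 α| * C₂ α, fun Ψ hΨ hΨc hsupp hB R hR => ?_⟩
  have hre : D.SubSupportedInUnitBall fun x => (Ψ x).re := fun t ht =>
    hsupp t (closure_mono (fun y hy => by
      rw [Function.mem_support] at hy ⊢
      intro h; simp [h] at hy) ht)
  have him : D.SubSupportedInUnitBall fun x => (Ψ x).im := fun t ht =>
    hsupp t (closure_mono (fun y hy => by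
      rw [Function.mem_support] at hy ⊢
      intro h; simp [h] at hy) ht)
  obtain ⟨g₁, hg₁, hb₁⟩ := hC (testOf _ hΨ.re_comp hΨc.re_comp) hre
    (fun m γ hγ x => (abs_multiDeriv_re_le hΨ x).trans (hB m γ hγ x)) R hR
  obtain ⟨g₂, hg₂, hb₂⟩ := hC (testOf _ hΨ.im_comp hΨc.im_comp) him
    (fun m γ hγ x => (abs_multiDeriv_im_le hΨ x).trans (hB m γ hγ x)) R hR
  have hbd : ∀ g : D.SubSpace L → ℂ, (∀ (M : ℕ) (γ : D.Coord L → ℕ) (x : D.SubSpace L), x ≠ 0 →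
      ‖multiDeriv γ g x‖ ≤ C M γ * (1 + ‖x‖) ^ (-(M : ℝ)) *
        ∏ j ∈ L, D.subNorm e L j x ^ (-(D.Q j + D.subWeight L γ j))) →
      ∀ (α : D.Coord L → ℕ) (x : D.SubSpace L), x ≠ 0 → ‖multiDeriv α g x‖ ≤
        |C 0 α| * C₂ α * ∏ l, pNorm (D.subExponent e L) l x ^ (-(1 + (α l : ℝ))) := by
    intro g hg α x hx
    have h1 := hg 0 α x hx
    rw [Nat.cast_zero, neg_zero, Real.rpow_zero, mul_one] at h1
    have h2 : 0 ≤ ∏ j ∈ L, D.subNorm e L j x ^ (-(D.Q j + D.subWeight L α j)) :=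
      Finset.prod_nonneg fun j hj => Real.rpow_nonneg (D.subNorm_pos he hx hj).le _
    rw [mul_assoc]
    exact h1.trans (mul_le_mul (le_abs_self _) (hC₂ α x hx).2 h2 (abs_nonneg _))
  refine ⟨fun x => g₁ x + Complex.I * g₂ x, hg₁.1.add (contDiffOn_const.mul hg₂.1),
    fun α x hx => ?_, fun Φ hΦ hΦc h0 hs hc => ?_⟩
  · have hx' : ({0}ᶜ : Set (D.SubSpace L)) ∈ nhds x := isOpen_compl_singleton.mem_nhds hx
    rw [multiDeriv_add_of_contDiffAt (hg₁.1.contDiffAt hx') (hg₂.1.contDiffAt hx'), add_mul]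
    refine (norm_add_le _ _).trans (add_le_add (hbd _ hb₁ α x hx) ?_)
    rw [norm_mul, Complex.norm_I, one_mul]
    exact hbd _ hb₂ α x hx
  · rw [pairing_eq _ hs hc]
    have e1 : testOf _ hs.re_comp hc.re_comp =
        D.tensorTest L R hR (testOf _ hΦ.re_comp hΦc.re_comp) (testOf _ hΨ.re_comp hΨc.re_comp) -
        D.tensorTest L R hR (testOf _ hΦ.im_comp hΦc.im_comp)
          (testOf _ hΨ.im_comp hΨc.im_comp) := by
      ext x
      exact Complex.mul_re _ _
    have e2 : testOf _ hs.im_comp hc.im_comp =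
        D.tensorTest L R hR (testOf _ hΦ.re_comp hΦc.re_comp) (testOf _ hΨ.im_comp hΨc.im_comp) +
        D.tensorTest L R hR (testOf _ hΦ.im_comp hΦc.im_comp)
          (testOf _ hΨ.re_comp hΨc.re_comp) := by
      ext x
      exact Complex.mul_im _ _
    rw [e1, e2, map_add, map_sub]
    have h1 := pairing_eq_integral hg₁ hΦ hΦc h0
    have h2 := pairing_eq_integral hg₂ hΦ hΦc h0
    rw [pairing_eq _ hΦ hΦc] at h1 h2
    have h3 : ∫ x, Φ x * (g₁ x + Complex.I * g₂ x) =
        (∫ x, Φ x * g₁ x) + Complex.I * ∫ x, Φ x * g₂ x := by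
      rw [← integral_const_mul, ← integral_add]
      · refine integral_congr_ae (.of_forall fun x => ?_)
        beta_reduce
        ring
      · exact integrable_mul_of_zero_notMem_tsupport hΦ.continuous hΦc h0 hg₁.1.continuousOn
      · exact (integrable_mul_of_zero_notMem_tsupport hΦ.continuous hΦc h0
          hg₂.1.continuousOn).const_mul _
    rw [h3, ← h1, ← h2]
    linear_combination (-K (D.tensorTest L R hR (testOf _ hΦ.im_comp hΦc.im_comp)
          (testOf _ hΨ.im_comp hΨc.im_comp))) * Complex.I_mul_I

end DilationStructure

/-! ### Pivot coordinates of a frequency -/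

section Pivots

variable {ι J : Type*} [Fintype ι] [Fintype J] [DecidableEq J] {e : J → J → ℝ}

/-- Every block `j` whose frequency scale `A_j` is not governed by the truncation `T_j` is
dominated by a block `β(j)` which contains a coordinate whose frequency is comparable to the scale
of that block. The blocks of the latter kind are those of `X`. -/
theorem exists_pivots (he : IsExponentSystem e) {b : ι → J} (hb : Function.Surjective b) :
    ∃ C : ℝ, 1 ≤ C ∧ ∀ (T A : J → ℝ) (r : ι → ℝ), (∀ j, 1 ≤ T j) → (∀ j k, T k ≤ T j ^ e k j) →
      (∀ l, 0 ≤ r l) → (∀ j, A j = T j + ∑ l, r l ^ (1 / e (b l) j)) →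
      ∃ (X : Finset J) (β : J → J) (q : J → ι), (∀ j ∈ X, β j = j) ∧
        (∀ j ∈ X, b (q j) = j ∧ A j ≤ C * r (q j)) ∧
        ∀ j ∉ X, A j ≤ 2 * T j ∨ β j ∈ X ∧ A j ^ e (β j) j ≤ C * A (β j) := by
  classical
  obtain ⟨F, hF1, hF, -⟩ := exists_rpow_bounds he
  have hF0 : 0 < F := by linarith
  set n : ℝ := 1 + ((Fintype.card ι : ℕ) : ℝ) with hn
  have hn1 : 1 ≤ n := le_add_of_nonneg_right (by positivity)
  have hn0 : 0 < n := by linarith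
  have h2n : 1 ≤ (2 * n) ^ F := Real.one_le_rpow (by linarith) hF0.le
  set C : ℝ := n * (2 * n) ^ F with hC
  have hC1 : 1 ≤ C := one_le_mul_of_one_le_of_one_le hn1 h2n
  refine ⟨C, hC1, fun T A r hT hTT hr hA => ?_⟩
  have hsum0 : ∀ j, 0 ≤ ∑ l, r l ^ (1 / e (b l) j) := fun j =>
    Finset.sum_nonneg fun l _ => Real.rpow_nonneg (hr l) _
  have hTA : ∀ j, T j ≤ A j := fun j => by rw [hA]; linarith [hsum0 j]
  have hA1 : ∀ j, 1 ≤ A j := fun j => (hT j).trans (hTA j)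
  have hrA : ∀ l j, r l ^ (1 / e (b l) j) ≤ A j := fun l j => by
    rw [hA]
    have := Finset.single_le_sum (f := fun l => r l ^ (1 / e (b l) j))
      (fun l _ => Real.rpow_nonneg (hr l) _) (Finset.mem_univ l)
    linarith [hT j]
  -- the frequency scales satisfy the basic inequality of the dual norms
  have hgrow : ∀ j k, A k ≤ n * A j ^ e k j := by
    intro j k
    have h1 : T k ≤ A j ^ e k j := (hTT j k).trans
      (Real.rpow_le_rpow (by linarith [hT j]) (hTA j) (he.pos _ _).le)
    have h2 : ∀ l, r l ^ (1 / e (b l) k) ≤ A j ^ e k j := by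
      intro l
      rcases le_total (r l) 1 with h | h
      · exact (Real.rpow_le_one (hr l) h (one_div_pos.2 (he.pos _ _)).le).trans
          (Real.one_le_rpow (hA1 j) (he.pos _ _).le)
      · calc r l ^ (1 / e (b l) k) ≤ r l ^ (1 / e (b l) j * e k j) := by
              refine Real.rpow_le_rpow_of_exponent_le h ?_
              rw [one_div_mul_eq_div, div_le_div_iff₀ (he.pos _ _) (he.pos _ _), one_mul, mul_comm]
              exact he.triangle _ _ _
          _ = (r l ^ (1 / e (b l) j)) ^ e k j := Real.rpow_mul (hr l) _ _
          _ ≤ _ := Real.rpow_le_rpow (Real.rpow_nonneg (hr l) _) (hrA l j) (he.pos _ _).le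
    rw [hA k, hn, add_mul, one_mul]
    refine add_le_add h1 ((Finset.sum_le_sum fun l _ => h2 l).trans (le_of_eq ?_))
    rw [Finset.sum_const, Finset.card_univ, nsmul_eq_mul]
  -- if `A j` is not governed by `T j`, one of the coordinates contributes substantially to it
  have hpivot : ∀ j, ¬ A j ≤ 2 * T j → ∃ l, A j ^ e (b l) j ≤ (2 * n) ^ F * r l := by
    intro j hj
    have h1 : ∃ l, A j / (2 * n) ≤ r l ^ (1 / e (b l) j) := by
      by_contra! h
      have h2 : ∑ l, r l ^ (1 / e (b l) j) ≤ ∑ _l : ι, A j / (2 * n) :=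
        Finset.sum_le_sum fun l _ => (h l).le
      rw [Finset.sum_const, Finset.card_univ, nsmul_eq_mul] at h2
      have h3 : ((Fintype.card ι : ℕ) : ℝ) * (A j / (2 * n)) ≤ n * (A j / (2 * n)) := by
        have := hA1 j
        gcongr
        rw [hn]; linarith
      have h4 : n * (A j / (2 * n)) = A j / 2 := by field_simp
      have := hA j
      exact hj (by linarith)
    obtain ⟨l, hl⟩ := h1
    refine ⟨l, ?_⟩
    have hep := he.pos (b l) j
    rw [div_le_iff₀ (by positivity)] at hl
    calc A j ^ e (b l) j ≤ (r l ^ (1 / e (b l) j) * (2 * n)) ^ e (b l) j :=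
          Real.rpow_le_rpow (by linarith [hA1 j]) hl hep.le
      _ = r l * (2 * n) ^ e (b l) j := by
          rw [Real.mul_rpow (Real.rpow_nonneg (hr l) _) (by positivity), ← Real.rpow_mul (hr l),
            one_div_mul_cancel hep.ne', Real.rpow_one]
      _ ≤ r l * (2 * n) ^ F := by
          have := hr l
          gcongr
          · linarith
          · exact hF _ _
      _ = _ := mul_comm _ _
  set X : Finset J := Finset.univ.filter fun j => ∃ l, b l = j ∧ A j ≤ C * r l with hX
  have hq : ∀ j, ∃ l, j ∈ X → b l = j ∧ A j ≤ C * r l := by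
    intro j
    by_cases h : j ∈ X
    · obtain ⟨-, l, hl⟩ := Finset.mem_filter.1 h
      exact ⟨l, fun _ => hl⟩
    · exact ⟨(hb j).choose, fun h' => absurd h' h⟩
  have hβ : ∀ j, ∃ k, (j ∈ X → k = j) ∧
      (j ∉ X → A j ≤ 2 * T j ∨ k ∈ X ∧ A j ^ e k j ≤ C * A k) := by
    intro j
    by_cases h : j ∈ X
    · exact ⟨j, fun _ => rfl, fun h' => absurd h h'⟩
    · by_cases h2 : A j ≤ 2 * T j
      · exact ⟨j, fun _ => rfl, fun _ => Or.inl h2⟩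
      obtain ⟨l, hl⟩ := hpivot j h2
      refine ⟨b l, fun h' => absurd h' h, fun _ => Or.inr ⟨?_, ?_⟩⟩
      · refine Finset.mem_filter.2 ⟨Finset.mem_univ _, l, rfl, (hgrow j (b l)).trans ?_⟩
        rw [hC, mul_assoc]
        gcongr
      · refine hl.trans ?_
        have h3 : r l ≤ A (b l) := by
          have := hrA l (b l)
          rwa [he.diag, div_one, Real.rpow_one] at this
        have h4 : (2 * n) ^ F ≤ C := le_mul_of_one_le_left (by positivity) hn1
        have := hr l
        gcongr
  choose q hq using hq
  choose β hβ1 hβ2 using hβ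
  exact ⟨X, β, q, hβ1, hq, hβ2⟩

end Pivots

/-! ### Modulated bump functions -/

section ModulatedBump

variable {ι : Type*} [Fintype ι]

/-- The character `t ↦ e^{-2πi c t}` of the line. -/
noncomputable def lineChar (c t : ℝ) : ℂ := Complex.exp ((-(2 * Real.pi * c) * Complex.I : ℂ) * t)

theorem contDiff_lineChar (c : ℝ) : ContDiff ℝ ∞ (lineChar c) :=
  (contDiff_const.mul Complex.ofRealCLM.contDiff).cexp

theorem norm_iteratedDeriv_lineChar (k : ℕ) (c t : ℝ) :
    ‖iteratedDeriv k (lineChar c) t‖ = (2 * Real.pi * |c|) ^ k := by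
  have h : iteratedDeriv k (lineChar c) = fun t => (-(2 * Real.pi * c) * Complex.I : ℂ) ^ k *
      lineChar c t := by
    induction k with
    | zero => funext t; simp
    | succ k ih =>
      rw [iteratedDeriv_succ, ih]
      funext t
      have h1 : HasDerivAt (lineChar c) (lineChar c t * (-(2 * Real.pi * c) * Complex.I : ℂ)) t := by
        have := ((Complex.ofRealCLM.hasDerivAt (x := t)).const_mul
          (-(2 * Real.pi * c) * Complex.I : ℂ)).cexp
        unfold lineChar
        simpa using this
      rw [(h1.const_mul _).deriv]
      ring
  rw [h, norm_mul, norm_pow]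
  have h1 : ‖lineChar c t‖ = 1 := by
    unfold lineChar
    rw [Complex.norm_exp]
    simp
  rw [h1, mul_one]
  simp [abs_of_pos Real.pi_pos]

theorem lineChar_mul (c s t : ℝ) : lineChar c (s * t) = lineChar (c * s) t := by
  unfold lineChar
  push_cast
  ring_nf

/-- The product of the one-dimensional characters is the kernel of the Fourier transform. -/
theorem prod_lineChar (ξ x : EuclideanSpace ℝ ι) :
    ∏ l, lineChar (ξ l) (x l) = (Real.fourierChar (-(inner ℝ x ξ)) : ℂ) := by
  unfold lineChar
  rw [← Complex.exp_sum, Real.fourierChar_apply]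
  congr 1
  rw [PiLp.inner_apply]
  push_cast
  rw [← Finset.sum_neg_distrib, Finset.mul_sum, Finset.sum_mul]
  refine Finset.sum_congr rfl fun l _ => ?_
  simp
  ring

/-- The product of a bump function, a monomial and a character. -/
noncomputable def modBump (r : ι → ℝ) (γ : ι → ℕ) (c : ι → ℝ) (x : EuclideanSpace ℝ ι) : ℂ :=
  ∏ l, (lineBump (r l * x l) * (x l : ℂ) ^ γ l * lineChar (c l) (x l))

theorem contDiff_modBump (r : ι → ℝ) (γ : ι → ℕ) (c : ι → ℝ) : ContDiff ℝ ∞ (modBump r γ c) :=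
  contDiff_prod fun l _ => ((contDiff_lineBump.comp (by fun_prop)).mul
    ((contDiff_coord l).pow _)).mul ((contDiff_lineChar _).comp (by fun_prop))

theorem modBump_eq (r : ι → ℝ) (γ : ι → ℕ) (ξ x : EuclideanSpace ℝ ι) :
    modBump r γ ξ x = boxBump r Finset.univ x * (∏ l, (x l : ℂ) ^ γ l) *
      (Real.fourierChar (-(inner ℝ x ξ)) : ℂ) := by
  rw [← prod_lineChar]
  unfold modBump boxBump
  rw [Finset.prod_mul_distrib, Finset.prod_mul_distrib]

theorem hasCompactSupport_modBump {r : ι → ℝ} (hr : ∀ l, 0 < r l) (γ : ι → ℕ) (c : ι → ℝ) :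
    HasCompactSupport (modBump r γ c) := by
  have : modBump r γ c = fun x => boxBump r Finset.univ x *
      ((∏ l, (x l : ℂ) ^ γ l) * ∏ l, lineChar (c l) (x l)) := by
    funext x
    unfold modBump boxBump
    rw [Finset.prod_mul_distrib, Finset.prod_mul_distrib, mul_assoc]
  rw [this]
  exact (hasCompactSupport_boxBump_univ hr).mul_right

/-- The modulated bump functions whose parameters lie in a bounded range form a bounded family of
test functions. -/
theorem exists_norm_multiDeriv_modBump_mul_boxBump_le [DecidableEq ι] (γ : ι → ℕ) {κ R : ℝ}
    (hκ : 0 < κ) : ∃ B : ℕ → ℝ, ∀ r c : ι → ℝ, (∀ l, |r l| ≤ R) → (∀ l, |c l| ≤ 1) →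
      ∀ (m : ℕ) (α : ι → ℕ), ∑ l, α l ≤ m → ∀ x,
        ‖multiDeriv α (fun x => modBump r γ c x * boxBump (fun _ => κ) Finset.univ x) x‖ ≤ B m := by
  choose B hB1 hB using exists_lineBump_bound
  set c₁ : ℝ := max 1 (max R κ) with hc₁
  have hc1 : 1 ≤ c₁ := le_max_left _ _
  set A : ℝ := max 1 (2 / κ) with hA
  have hA1 : 1 ≤ A := le_max_left _ _
  have hA0 : 0 < A := by linarith
  set D : ℕ → ℝ := fun m => (2 ^ m) ^ Fintype.card ι * ∏ l, (2 ^ m * (2 ^ m *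
    (2 ^ m * (c₁ ^ m * B m * ((2 ^ m) ^ γ l * A ^ γ l)) * (2 * Real.pi + 1) ^ m) * (c₁ ^ m * B m)))
  have hpi := Real.pi_pos
  have hD0 : ∀ m, 0 ≤ D m := fun m => by
    have := hB1 m
    refine mul_nonneg (by positivity) (Finset.prod_nonneg fun l _ => by positivity)
  refine ⟨D, fun r c hr hc m α hα x => ?_⟩
  by_cases hx : ∃ l ∈ Finset.univ, 2 < |κ * x l|
  · have h0 : (fun x => modBump r γ c x * boxBump (fun _ => κ) Finset.univ x) =ᶠ[nhds x] 0 := by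
      filter_upwards [boxBump_eventuallyEq_zero (a := fun _ => κ) hx] with z hz
      simp [hz]
    rw [multiDeriv_congr h0]
    unfold multiDeriv
    simpa using hD0 m
  push Not at hx
  have hxA : ∀ l, |x l| ≤ A := fun l => by
    have h := hx l (Finset.mem_univ l)
    rw [abs_mul, abs_of_pos hκ, ← le_div_iff₀' hκ] at h
    exact h.trans (le_max_right _ _)
  have e : (fun x => modBump r γ c x * boxBump (fun _ => κ) Finset.univ x) = fun x =>
      ∏ l, ((lineBump (r l * x l) * (x l : ℂ) ^ γ l * lineChar (c l) (x l)) *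
        lineBump (κ * x l)) := by
    funext x
    unfold modBump boxBump
    rw [← Finset.prod_mul_distrib]
  rw [e]
  have hs1 : ∀ (a : ℝ) (l : ι), ContDiff ℝ ∞ fun y : EuclideanSpace ℝ ι => lineBump (a * y l) :=
    fun a l => contDiff_lineBump.comp (by fun_prop)
  have hs2 : ∀ (c : ℝ) (l : ι), ContDiff ℝ ∞ fun y : EuclideanSpace ℝ ι => lineChar c (y l) :=
    fun c l => (contDiff_lineChar c).comp (by fun_prop)
  have hsb := ScaledBound.prod (x := x) (lam := fun _ => 1) (m := m) Finset.univ
    (f := fun l x => (lineBump (r l * x l) * (x l : ℂ) ^ γ l * lineChar (c l) (x l)) *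
        lineBump (κ * x l))
    (c := fun l => 2 ^ m * (2 ^ m *
      (2 ^ m * (c₁ ^ m * B m * ((2 ^ m) ^ γ l * A ^ γ l)) * (2 * Real.pi + 1) ^ m) *
        (c₁ ^ m * B m)))
    (fun l _ => ((((hs1 _ l).mul ((contDiff_coord l).pow _)).mul (hs2 _ l)).mul
      (hs1 _ l)).contDiffAt) fun l _ => by
    have h1 : ScaledBound (fun y : EuclideanSpace ℝ ι => lineBump (r l * y l)) x (fun _ => 1) m
        (c₁ ^ m * B m) := scaledBound_lineBump (hB m) hc1 (by
          rw [one_mul]; exact (hr l).trans ((le_max_left _ _).trans (le_max_right _ _))) x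
    have h4 : ScaledBound (fun y : EuclideanSpace ℝ ι => lineBump (κ * y l)) x (fun _ => 1) m
        (c₁ ^ m * B m) := scaledBound_lineBump (hB m) hc1 (by
          rw [one_mul, abs_of_pos hκ]; exact (le_max_right _ _).trans (le_max_right _ _)) x
    have h2 : ScaledBound (fun y : EuclideanSpace ℝ ι => (y l : ℂ) ^ γ l) x (fun _ => 1) m
        ((2 ^ m) ^ γ l * A ^ γ l) := by
      have h := ScaledBound.prod (x := x) (lam := fun _ => (1 : ℝ)) (m := m) (Finset.range (γ l))
        (f := fun _ y => (y l : ℂ)) (c := fun _ => A)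
        (fun _ _ => (contDiff_coord l).contDiffAt)
        (fun _ _ => scaledBound_coord m (hxA l) (by simpa using hA1))
      simpa using h
    have h3 : ScaledBound (fun y : EuclideanSpace ℝ ι => lineChar (c l) (y l)) x (fun _ => 1) m
        ((2 * Real.pi + 1) ^ m) := by
      refine ScaledBound.oneVar (contDiff_lineChar _) l fun k hk => ?_
      rw [norm_iteratedDeriv_lineChar, abs_one, one_pow, one_mul]
      have h5 : 2 * Real.pi * |c l| ≤ 2 * Real.pi + 1 := by
        have := hc l
        nlinarith
      exact (pow_le_pow_left₀ (by positivity) h5 k).trans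
        (pow_le_pow_right₀ (by linarith) hk)
    have h12 := ScaledBound.mul (hs1 (r l) l).contDiffAt
      ((contDiff_coord l).pow (γ l)).contDiffAt h1 h2
    have h123 := ScaledBound.mul ((hs1 (r l) l).mul ((contDiff_coord l).pow (γ l))).contDiffAt
      (hs2 (c l) l).contDiffAt h12 h3
    have h := ScaledBound.mul (((hs1 (r l) l).mul ((contDiff_coord l).pow (γ l))).mul
      (hs2 (c l) l)).contDiffAt (hs1 κ l).contDiffAt h123 h4
    refine h.mono (le_of_eq ?_)
    ring
  have := hsb.multiDeriv_le (contDiff_prod fun l _ => ((((hs1 _ l).mul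
    ((contDiff_coord l).pow _)).mul (hs2 _ l)).mul (hs1 _ l))).contDiffAt hα
  simpa using this

theorem abs_mul_le_of_mem_tsupport_boxBump {κ : ℝ} {u : EuclideanSpace ℝ ι → ℂ}
    {x : EuclideanSpace ℝ ι}
    (hx : x ∈ tsupport fun x => u x * boxBump (fun _ => κ) Finset.univ x) (l : ι) :
    |κ * x l| ≤ 2 := by
  by_contra h
  push Not at h
  refine notMem_tsupport_iff_eventuallyEq.2 ?_ hx
  filter_upwards [boxBump_eventuallyEq_zero (a := fun _ => κ) ⟨l, Finset.mem_univ l, h⟩] with z hz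
  simp [hz]

end ModulatedBump

/-! ### Localised pairings with a proper kernel -/

namespace DilationStructure

variable {N n : ℕ} (D : DilationStructure N n) {e : Matrix (Fin n) (Fin n) ℝ}

/-- A product over all coordinates splits into those of `ℝ^L` and those of `ℝ^{L^c}`. -/
theorem prod_split {M : Type*} [CommMonoid M] (L : Finset (Fin n)) (g : Fin N → M) :
    ∏ l, g l = (∏ l : D.Coord L, g l.1) * ∏ l : D.Coord Lᶜ, g l.1 := by
  rw [← (D.splitEquiv L).prod_comp g, Fintype.prod_sum_type]
  rfl

/-- The cutoff function to the set where the variables of the block `j` are bounded by the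
scales `1 / a_l`. -/
noncomputable def blockBump (a : Fin N → ℝ) (j : Fin n) (x : D.Space) : ℂ :=
  boxBump a (Finset.univ.filter fun l => D.block l = j) x

theorem contDiff_blockBump (a : Fin N → ℝ) (j : Fin n) : ContDiff ℝ ∞ (D.blockBump a j) :=
  contDiff_boxBump _ _

theorem blockBump_eq_boxBump_restrict (a : Fin N → ℝ) {L : Finset (Fin n)} {j : Fin n} (hj : j ∈ L)
    (x : D.Space) : D.blockBump a j x = boxBump (fun l : D.Coord L => a l.1)
      (Finset.univ.filter fun l => D.block l.1 = j) (D.restrict L x) := by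
  unfold blockBump boxBump
  rw [Finset.prod_filter, Finset.prod_filter, D.prod_split L]
  have : ∏ l : D.Coord Lᶜ, (if D.block l.1 = j then lineBump (a l.1 * x l.1) else 1) = 1 := by
    refine Finset.prod_eq_one fun l _ => if_neg ?_
    rintro h
    exact Finset.mem_compl.1 l.2 (h ▸ hj)
  rw [this, mul_one]
  rfl

theorem prod_blockBump_compl (a : Fin N → ℝ) (L : Finset (Fin n)) (x : D.Space) :
    ∏ j ∈ Lᶜ, D.blockBump a j x = boxBump (fun l : D.Coord Lᶜ => a l.1) Finset.univ
      (D.restrict Lᶜ x) := by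
  unfold blockBump boxBump
  simp_rw [Finset.prod_filter]
  rw [Finset.prod_comm]
  simp_rw [Finset.prod_ite_eq]
  rw [D.prod_split L]
  have h1 : ∏ l : D.Coord L, (if D.block l.1 ∈ Lᶜ then lineBump (a l.1 * x l.1) else 1) = 1 :=
    Finset.prod_eq_one fun l _ => if_neg fun h => Finset.mem_compl.1 h l.2
  rw [h1, one_mul]
  refine Finset.prod_congr rfl fun l _ => ?_
  rw [if_pos l.2]
  rfl

/-- A modulated bump function in the rescaled variables `a_l x_l`. If the scales `a_l` dominate both
the scales `T_l` and the frequencies `ξ_l`, then the parameters on the right are bounded. -/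
theorem modBump_rescale {ι : Type*} [Fintype ι] {a : ι → ℝ} (ha : ∀ l, 0 < a l) (T : ι → ℝ)
    (γ : ι → ℕ) (ξ : ι → ℝ) (x : EuclideanSpace ℝ ι) : modBump T γ ξ x =
      (∏ l, ((a l ^ γ l)⁻¹ : ℝ) : ℝ) *
        modBump (fun l => T l / a l) γ (fun l => ξ l / a l) (diagMap a x) := by
  unfold modBump
  push_cast
  rw [← Finset.prod_mul_distrib]
  refine Finset.prod_congr rfl fun l _ => ?_
  have h := (ha l).ne'
  have h' : (a l : ℂ) ≠ 0 := by exact_mod_cast h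
  have e1 : T l / a l * (a l * x l) = T l * x l := by field_simp
  rw [diagMap_apply, lineChar_mul, div_mul_cancel₀ _ h, e1]
  push_cast
  rw [mul_pow]
  field_simp

variable {D}

/-- A modulated bump function, localised to small values of the variables outside `L` and cut off
from small values in the blocks of `S ⊆ L`, is paired with a proper kernel by means of the partial
kernel on `ℝ^L`, to which the oscillatory integral estimate applies. -/
theorem IsProperKernel.exists_norm_pairing_cut_le (he : BasicHypothesis e) {K : D.Distr}
    (hK : D.IsProperKernel e K) {L : Finset (Fin n)} (hL : L.Nonempty) (γ : Fin N → ℕ) {κ : ℝ}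
    (hκ : 1 ≤ κ) (hball : ∀ x : D.SubSpace Lᶜ, (∀ l, |κ * x l| ≤ 2) → ∀ j : {j // j ∈ Lᶜ},
      D.nrm j.1 (D.subComp x j) < 1) {R : ℝ} (hR : 1 ≤ R) :
    ∃ C : ℝ, 0 ≤ C ∧ ∀ (A : Fin n → ℝ) (a T : Fin N → ℝ) (ξ : D.Space) (S : Finset (Fin n))
      (p : D.Coord L → D.Coord L), (∀ j, 0 < A j) → (∀ l, a l = A (D.block l) ^ D.d l) →
      (∀ l, 0 < T l) → (∀ l, T l ≤ R * a l) → (∀ l, |ξ l| ≤ a l) → S.Nonempty → S ⊆ L →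
      (∀ l, p (p l) = p l) → (∀ l : D.Coord L, κ * a (p l) ≤ R * |ξ (p l)|) →
      (∀ l : D.Coord L, (κ * a l) ^ D.subExponent e L (p l) l ≤ R * (κ * a (p l))) →
      (∀ l : D.Coord L, T (p l) ≤ R * T l ^ D.subExponent e L (p l) l) →
      (∀ l : D.Coord L, ∃ j ∈ S, ∀ l₀ : D.Coord L, D.block l₀ = j →
        (κ * a l₀) ^ D.subExponent e L l l₀ ≤ R * (κ * a l)) →
      (∀ l : D.Coord L, ∃ j ∈ S, ∀ l₀ : D.Coord L, D.block l₀ = j → p l₀ = p l) →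
      (∀ l : D.Coord L, D.block (p l) ∈ S → D.block l = D.block (p l)) →
      ‖pairing K fun x => modBump T γ ξ x * ((∏ j ∈ S, (1 - D.blockBump (fun l => κ * a l) j x)) *
        ∏ j ∈ Lᶜ, D.blockBump (fun l => κ * a l) j x)‖ ≤ C * ∏ l, (a l ^ γ l)⁻¹ := by
  have hκ0 : 0 < κ := by linarith
  obtain ⟨B, hB⟩ := exists_norm_multiDeriv_modBump_mul_boxBump_le (ι := D.Coord Lᶜ)
    (fun l => γ l.1) (R := R) hκ0
  obtain ⟨CG, hCG⟩ := hK.exists_partialKernel D he hL B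
  obtain ⟨C, hC0, hC⟩ := exists_norm_fourier_cutKernel_le (D.isExponentSystem_subExponent he L)
    (fun l => D.block l.1) (fun l => γ l.1) CG hR
  refine ⟨C, hC0, fun A a T ξ S p hA ha hT hTa hξ hS hSL hpp h1 h2 h3 h4 h5 h6 => ?_⟩
  have ha0 : ∀ l, 0 < a l := fun l => by rw [ha]; exact Real.rpow_pos_of_pos (hA _) _
  set ψ : D.SubSpace Lᶜ → ℂ := fun z => modBump (fun l => T l.1 / a l.1) (fun l => γ l.1)
    (fun l => ξ l.1 / a l.1) z * boxBump (fun _ => κ) Finset.univ z with hψ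
  have hψs : ContDiff ℝ ∞ ψ := (contDiff_modBump _ _ _).mul (contDiff_boxBump _ _)
  have hψc : HasCompactSupport ψ :=
    (hasCompactSupport_boxBump_univ fun _ => hκ0).mul_left
  -- the partial kernel on `ℝ^L` that belongs to `ψ`, a function of the remaining variables on the
  -- unit scale
  obtain ⟨G, hGs, hGb, hG⟩ := hCG ψ hψs hψc
    (fun x hx => hball x fun l => abs_mul_le_of_mem_tsupport_boxBump hx l)
    (hB _ _ (fun l => by
        rw [abs_div, abs_of_pos (hT _), abs_of_pos (ha0 _), div_le_iff₀ (ha0 _)]; exact hTa _)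
      (fun l => by
        rw [abs_div, abs_of_pos (ha0 _), div_le_one (ha0 _)]; exact hξ _)) A hA
  set ξL : D.SubSpace L := D.restrict L ξ with hξL
  set Φ : D.SubSpace L → ℂ := fun y => modBump (fun l => T l.1) (fun l => γ l.1) ξL y *
    ∏ j ∈ S, (1 - boxBump (fun l : D.Coord L => κ * a l.1)
      (Finset.univ.filter fun l => D.block l.1 = j) y) with hΦ
  have hms := contDiff_modBump (fun l : D.Coord L => T l.1) (fun l => γ l.1) ξL
  have hmc := hasCompactSupport_modBump (r := fun l : D.Coord L => T l.1) (fun l => hT l.1)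
    (fun l => γ l.1) ξL
  have hΦs : ContDiff ℝ ∞ Φ := hms.mul
    (contDiff_prod fun j _ => contDiff_const.sub (contDiff_boxBump _ _))
  have hΦc : HasCompactSupport Φ := hmc.mul_right
  have hΦ0 : 0 ∉ tsupport Φ := by
    obtain ⟨j, hj⟩ := hS
    refine notMem_tsupport_iff_eventuallyEq.2 ?_
    filter_upwards [boxBump_eventuallyEq_one (a := fun l : D.Coord L => κ * a l.1) (x := 0)
      (s := Finset.univ.filter fun l => D.block l.1 = j) (fun l _ => by simp)] with z hz
    have h0 : ∏ j ∈ S, (1 - boxBump (fun l : D.Coord L => κ * a l.1)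
        (Finset.univ.filter fun l => D.block l.1 = j) z) = 0 :=
      Finset.prod_eq_zero hj (by rw [hz, sub_self])
    simp [hΦ, h0]
  set W : ℝ := ∏ l : D.Coord Lᶜ, (a l.1 ^ γ l.1)⁻¹ with hW
  have hW0 : 0 < W := Finset.prod_pos fun l _ => inv_pos.2 (pow_pos (ha0 _) _)
  have hWc : (W : ℂ) ≠ 0 := by exact_mod_cast hW0.ne'
  set u : D.Space → ℂ := fun x => modBump T γ ξ x *
    ((∏ j ∈ S, (1 - D.blockBump (fun l => κ * a l) j x)) *
        ∏ j ∈ Lᶜ, D.blockBump (fun l => κ * a l) j x) with hu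
  have huc : HasCompactSupport u := (hasCompactSupport_modBump hT _ _).mul_right
  have hue : u = fun x => W * (Φ (D.restrict L x) * ψ (D.subDilate A (D.restrict Lᶜ x))) := by
    funext x
    have e1 : modBump T γ ξ x = modBump (fun l : D.Coord L => T l.1) (fun l => γ l.1) ξL
        (D.restrict L x) * modBump (fun l : D.Coord Lᶜ => T l.1) (fun l => γ l.1)
          (fun l => ξ l.1) (D.restrict Lᶜ x) := D.prod_split L _
    have e2 : diagMap (fun l : D.Coord Lᶜ => a l.1) (D.restrict Lᶜ x) =
        D.subDilate A (D.restrict Lᶜ x) := by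
      ext l
      simp [subDilate, ha]
    have e3 : ∏ j ∈ S, (1 - D.blockBump (fun l => κ * a l) j x) =
        ∏ j ∈ S, (1 - boxBump (fun l : D.Coord L => κ * a l.1)
          (Finset.univ.filter fun l => D.block l.1 = j) (D.restrict L x)) :=
      Finset.prod_congr rfl fun j hj => by rw [D.blockBump_eq_boxBump_restrict _ (hSL hj)]
    have e4 : boxBump (fun l : D.Coord Lᶜ => κ * a l.1) Finset.univ (D.restrict Lᶜ x) =
        boxBump (fun _ => κ) Finset.univ (D.subDilate A (D.restrict Lᶜ x)) := by
      unfold boxBump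
      refine Finset.prod_congr rfl fun l _ => ?_
      simp [subDilate, ha, mul_assoc]
    simp only [hu, hΦ, hψ]
    rw [e1, modBump_rescale (fun l : D.Coord Lᶜ => ha0 l.1) _ _ _ (D.restrict Lᶜ x), e2, e3,
      D.prod_blockBump_compl, e4]
    ring
  have hcs : ContDiff ℝ ∞ fun x => Φ (D.restrict L x) * ψ (D.subDilate A (D.restrict Lᶜ x)) := by
    refine (hΦs.comp ?_).mul (hψs.comp ?_)
    · unfold restrict
      fun_prop
    · unfold subDilate restrict
      fun_prop
  have hcc : HasCompactSupport fun x =>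
      Φ (D.restrict L x) * ψ (D.subDilate A (D.restrict Lᶜ x)) := by
    have e : (fun x => Φ (D.restrict L x) * ψ (D.subDilate A (D.restrict Lᶜ x))) =
        fun x => (W : ℂ)⁻¹ * u x := by
      funext x
      rw [hue]
      field_simp
    rw [e]
    exact huc.mul_left
  have hFK : ∫ y, Φ y * G y = 𝓕 (cutKernel G (fun l : D.Coord L => D.block l.1) (fun l => γ l.1)
      (fun l => T l.1) (fun l => κ * a l.1) S) ξL := by
    rw [Real.fourier_eq]
    refine integral_congr_ae (.of_forall fun y => ?_)
    simp only [hΦ, modBump_eq, cutKernel, Circle.smul_def, smul_eq_mul]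
    ring
  rw [hue, pairing_const_mul K hcs hcc, hG Φ hΦs hΦc hΦ0 hcs hcc, hFK, norm_mul,
    Complex.norm_real, Real.norm_of_nonneg hW0.le, D.prod_split L (fun l => (a l ^ γ l)⁻¹)]
  have hmain := hC G (fun l => T l.1) (fun l => κ * a l.1) S p ξL hGs hGb (fun l => hT _)
    (fun l => mul_pos hκ0 (ha0 _)) hS hpp h1 h2 h3 h4 h5 h6
  have hκa : ∏ l : D.Coord L, ((κ * a l.1) ^ γ l.1)⁻¹ ≤ ∏ l : D.Coord L, (a l.1 ^ γ l.1)⁻¹ := by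
    refine Finset.prod_le_prod (fun l _ => by have := ha0 l.1; positivity) fun l _ => ?_
    have := ha0 l.1
    gcongr
    nlinarith
  calc W * ‖𝓕 (cutKernel G (fun l : D.Coord L => D.block l.1) (fun l => γ l.1)
      (fun l => T l.1) (fun l => κ * a l.1) S) ξL‖
      ≤ W * (C * ∏ l : D.Coord L, (a l.1 ^ γ l.1)⁻¹) := by
        gcongr
        exact hmain.trans (by gcongr)
    _ = _ := by ring

/-- A modulated bump function which is localised to small values of all variables is a dilate of a
test function from a bounded family, so that the cancellation condition for `L = ∅` applies. -/
theorem IsProperKernel.exists_norm_pairing_localised_le {K : D.Distr}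
    (hK : D.IsProperKernel e K) (γ : Fin N → ℕ) {κ : ℝ}
    (hκ : 0 < κ) (hball : ∀ x : D.Space, (∀ l, |κ * x l| ≤ 2) → ∀ j, D.nrm j (D.comp x j) < 1)
    (R : ℝ) :
    ∃ C : ℝ, 0 ≤ C ∧ ∀ (A : Fin n → ℝ) (a T : Fin N → ℝ) (ξ : D.Space), (∀ j, 0 < A j) →
      (∀ l, a l = A (D.block l) ^ D.d l) →
      (∀ l, 0 < T l) → (∀ l, T l ≤ R * a l) → (∀ l, |ξ l| ≤ a l) →
      ‖pairing K fun x => modBump T γ ξ x * ∏ j, D.blockBump (fun l => κ * a l) j x‖ ≤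
        C * ∏ l, (a l ^ γ l)⁻¹ := by
  obtain ⟨B, hB⟩ := exists_norm_multiDeriv_modBump_mul_boxBump_le γ (R := R) hκ
  obtain ⟨C, hC0, hC⟩ := hK.exists_norm_pairing_dilate_le D B
  refine ⟨C, hC0, fun A a T ξ hA ha hT hTa hξ => ?_⟩
  have ha0 : ∀ l, 0 < a l := fun l => by rw [ha]; exact Real.rpow_pos_of_pos (hA _) _
  set ψ : D.Space → ℂ := fun z => modBump (fun l => T l / a l) γ
    (fun l => ξ l / a l) z * boxBump (fun _ => κ) Finset.univ z with hψ
  have hψs : ContDiff ℝ ∞ ψ := (contDiff_modBump _ _ _).mul (contDiff_boxBump _ _)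
  have hψc : HasCompactSupport ψ := (hasCompactSupport_boxBump_univ fun _ => hκ).mul_left
  have hb := hC ψ hψs hψc (fun x hx => hball x fun l => abs_mul_le_of_mem_tsupport_boxBump hx l)
    (hB _ _ (fun l => by
        rw [abs_div, abs_of_pos (hT _), abs_of_pos (ha0 _), div_le_iff₀ (ha0 _)]; exact hTa _)
      (fun l => by
        rw [abs_div, abs_of_pos (ha0 _), div_le_one (ha0 _)]; exact hξ _)) A hA
  set W : ℝ := ∏ l, (a l ^ γ l)⁻¹ with hW
  have hW0 : 0 < W := Finset.prod_pos fun l _ => inv_pos.2 (pow_pos (ha0 _) _)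
  have hWc : (W : ℂ) ≠ 0 := by exact_mod_cast hW0.ne'
  set u : D.Space → ℂ := fun x => modBump T γ ξ x *
    ∏ j, D.blockBump (fun l => κ * a l) j x with hu
  have huc : HasCompactSupport u := (hasCompactSupport_modBump hT _ _).mul_right
  have hue : u = fun x => W * ψ (D.dilate A x) := by
    funext x
    have e2 : diagMap a x = D.dilate A x := by
      ext l
      simp [dilate, ha]
    have e4 : ∏ j, D.blockBump (fun l => κ * a l) j x =
        boxBump (fun _ => κ) Finset.univ (D.dilate A x) := by
      unfold blockBump boxBump
      rw [Finset.prod_fiberwise]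
      refine Finset.prod_congr rfl fun l _ => ?_
      simp [dilate, ha, mul_assoc]
    simp only [hu, hψ]
    rw [modBump_rescale ha0, e2, e4]
    ring
  have hcs : ContDiff ℝ ∞ fun x => ψ (D.dilate A x) := by
    refine hψs.comp ?_
    unfold dilate
    fun_prop
  have hcc : HasCompactSupport fun x => ψ (D.dilate A x) := by
    have e : (fun x => ψ (D.dilate A x)) = fun x => (W : ℂ)⁻¹ * u x := by
      funext x
      rw [hue]
      field_simp
    rw [e]
    exact huc.mul_left
  rw [hue, pairing_const_mul K hcs hcc, norm_mul, Complex.norm_real, Real.norm_of_nonneg hW0.le,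
    mul_comm]
  gcongr

end DilationStructure

/-! ### A partition of unity adapted to the pivots -/

/-- A partition of unity adapted to the pivots: one localises in the blocks of `Y`, and then
in those blocks of `X` that are not the pivot `β(j)` of a block `j` from which one has been cut
off. -/
theorem sum_prod_cut_eq_one {J : Type*} [Fintype J] [DecidableEq J] {X Y : Finset J}
    (hXY : Disjoint Y X) {β : J → J} {c : J → ℂ}
    (hc : ∀ j, j ∉ X → j ∉ Y → c j = 1) (hβ : ∀ j ∈ Y, β j ∈ X) :
    ∑ s ∈ Y.powerset.sigma fun S => (X \ S.image β).powerset,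
      (∏ j ∈ s.1 ∪ s.2, (1 - c j)) * ∏ j ∈ ((s.1 ∪ s.2) ∪ s.1.image β)ᶜ, c j = 1 := by
  have hone : ∀ Z : Finset J, ∑ S ∈ Z.powerset, (∏ j ∈ S, (1 - c j)) * ∏ j ∈ Z \ S, c j = 1 := by
    intro Z
    rw [← Finset.prod_add]
    exact Finset.prod_eq_one fun j _ => by ring
  rw [Finset.sum_sigma]
  refine Eq.trans (Finset.sum_congr rfl fun S hS => ?_) (hone Y)
  rw [Finset.mem_powerset] at hS
  refine Eq.trans ?_ ((congrArg (((∏ j ∈ S, (1 - c j)) * ∏ j ∈ Y \ S, c j) * ·)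
    (hone (X \ S.image β))).trans (mul_one _))
  rw [Finset.mul_sum]
  refine Finset.sum_congr rfl fun S' hS' => ?_
  rw [Finset.mem_powerset] at hS'
  have hS'X : S' ⊆ X := hS'.trans Finset.sdiff_subset
  dsimp only
  rw [Finset.prod_union (hXY.mono hS hS'X)]
  have h1 : ∏ j ∈ ((S ∪ S') ∪ S.image β)ᶜ, c j =
      (∏ j ∈ Y \ S, c j) * ∏ j ∈ (X \ S.image β) \ S', c j := by
    rw [← Finset.prod_union (hXY.mono Finset.sdiff_subset
      (Finset.sdiff_subset.trans Finset.sdiff_subset))]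
    symm
    refine Finset.prod_subset (fun j hj => ?_) fun j hj hj' => hc j ?_ ?_
    · simp only [Finset.mem_union, Finset.mem_sdiff, Finset.mem_compl, not_or] at hj ⊢
      rcases hj with ⟨hY, hS1⟩ | ⟨⟨hX, hi⟩, hS2⟩
      · refine ⟨⟨hS1, fun h => Finset.disjoint_left.1 hXY hY (hS'X h)⟩, fun h => ?_⟩
        obtain ⟨i, hi, rfl⟩ := Finset.mem_image.1 h
        exact Finset.disjoint_left.1 hXY hY (hβ i (hS hi))
      · exact ⟨⟨fun h => Finset.disjoint_left.1 hXY (hS h) hX, hS2⟩, hi⟩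
    · intro hX
      simp only [Finset.mem_union, Finset.mem_sdiff, Finset.mem_compl, not_or, not_and] at hj hj'
      exact hj'.2 ⟨hX, hj.2⟩ hj.1.2
    · intro hY
      simp only [Finset.mem_union, Finset.mem_sdiff, Finset.mem_compl, not_or, not_and] at hj hj'
      exact hj'.1 hY hj.1.1
  rw [h1]
  ring

theorem BasicHypothesis.isExponentSystem {n : ℕ} {e : Matrix (Fin n) (Fin n) ℝ}
    (he : BasicHypothesis e) : IsExponentSystem e := ⟨he.pos, he.diag, he.triangle⟩

/-! ### Pairing a proper kernel with modulated bump functions -/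

namespace DilationStructure

variable {N n : ℕ} (D : DilationStructure N n) (e : Matrix (Fin n) (Fin n) ℝ)

/-- The frequency scale of the block `j`, truncated from below by `τ ^ t_j`. -/
noncomputable def freqScale (t : Fin n → ℝ) (τ : ℝ) (ξ : D.Space) (j : Fin n) : ℝ :=
  τ ^ t j + ∑ l, (|ξ l| ^ (1 / D.d l)) ^ (1 / e (D.block l) j)

/-- The frequency scale of the coordinate `l`. -/
noncomputable def coordScale (t : Fin n → ℝ) (τ : ℝ) (ξ : D.Space) (l : Fin N) : ℝ :=
  D.freqScale e t τ ξ (D.block l) ^ D.d l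

/-- The scale of the coordinate `l` at which the test functions are truncated. -/
noncomputable def truncScale (t : Fin n → ℝ) (τ : ℝ) (l : Fin N) : ℝ := (τ ^ t (D.block l)) ^ D.d l

/-- `κ` and `κ₁` are such that a box of size `2 / κ` lies in the unit ball, and a box of size
`2 / κ₁` is small in comparison with one of size `1 / κ`. -/
structure IsBumpScale (κ κ₁ : ℝ) : Prop where
  one_le : 1 ≤ κ
  le_right : κ ≤ κ₁
  ball : ∀ x : D.Space, (∀ l, |κ * x l| ≤ 2) → ∀ j, D.nrm j (D.comp x j) < 1
  subBall : ∀ (L : Finset (Fin n)) (x : D.SubSpace L), (∀ l, |κ * x l| ≤ 2) →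
    ∀ j : {j // j ∈ L}, D.nrm j.1 (D.subComp x j) < 1
  le : ∀ l, κ * (2 * 2 ^ D.d l) ≤ κ₁

/-- Suitable scales exist, since a small box lies in the unit ball (`exists_nrm_bounds`). -/
theorem exists_isBumpScale : ∃ κ κ₁, D.IsBumpScale κ κ₁ := by
  obtain ⟨C, hC, h⟩ := D.exists_nrm_bounds
  set κ : ℝ := 1 + ∑ l, 2 * (2 * C) ^ D.d l with hκ
  have hκ1 : 1 ≤ κ := le_add_of_nonneg_right (Finset.sum_nonneg fun l _ => by positivity)
  have hκl : ∀ l, 2 * (2 * C) ^ D.d l ≤ κ := fun l => by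
    have := Finset.single_le_sum (f := fun l => 2 * (2 * C) ^ D.d l) (fun l _ => by positivity)
      (Finset.mem_univ l)
    linarith
  have hs : ∀ l, (0 : ℝ) ≤ 2 * 2 ^ D.d l := fun l => by positivity
  have key : ∀ (l : Fin N) (s : ℝ), |κ * s| ≤ 2 → |s| ^ (1 / D.d l) ≤ (2 * C)⁻¹ := by
    intro l s hs
    have hd := D.d_pos l
    rw [one_div, Real.rpow_inv_le_iff_of_pos (abs_nonneg _) (by positivity) hd,
      Real.inv_rpow (by positivity), ← one_div, le_div_iff₀ (by positivity)]
    rw [abs_mul, abs_of_pos (by linarith)] at hs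
    have h1 := mul_le_mul_of_nonneg_right (hκl l) (abs_nonneg s)
    linarith
  refine ⟨κ, κ + ∑ l, κ * (2 * 2 ^ D.d l), hκ1, le_add_of_nonneg_right (Finset.sum_nonneg fun l _ =>
    by have := hs l; positivity), fun x hx j => ?_, fun L x hx j => ?_, fun l => ?_⟩
  · refine ((h j (D.comp x j)).2 (2 * C)⁻¹ (by positivity) fun l => key l.1 _ (hx l.1)).trans_lt ?_
    rw [mul_inv, mul_comm]
    field_simp
    norm_num
  · refine ((h j.1 (D.subComp x j)).2 (2 * C)⁻¹ (by positivity)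
      fun l => key l.1 _ (hx ⟨l.1, l.2.symm ▸ j.2⟩)).trans_lt ?_
    rw [mul_inv, mul_comm]
    field_simp
    norm_num
  · have := Finset.single_le_sum (f := fun l => κ * (2 * 2 ^ D.d l)) (fun l _ =>
      by have := hs l; positivity) (Finset.mem_univ l)
    linarith

variable {D e}

/-- The key estimate for the passage from kernels to multipliers: the pairing of a proper kernel
with a truncated monomial times a character is, uniformly in the truncation, as small as the
corresponding derivative of a multiplier. The variables are decomposed by means of
`sum_prod_cut_eq_one`, and each of the terms is controlled by the cancellation condition for one set
`L`. -/
theorem IsProperKernel.exists_norm_pairing_modBump_le (he : BasicHypothesis e) {K : D.Distr}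
    (hK : D.IsProperKernel e K) {t : Fin n → ℝ} (ht : ∀ j k, t j ≤ e j k * t k)
    (ht0 : ∀ j, 0 < t j) {κ κ₁ : ℝ} (hκ : D.IsBumpScale κ κ₁) (γ : Fin N → ℕ) :
    ∃ C : ℝ, 0 ≤ C ∧ ∀ (τ : ℝ) (ξ : D.Space), 1 ≤ τ →
      ‖pairing K (modBump (fun l => κ₁ * D.truncScale t τ l) γ ξ)‖ ≤
        C * ∏ l, (D.coordScale e t τ ξ l ^ γ l)⁻¹ := by
  obtain ⟨Cp, hCp1, hpiv⟩ := exists_pivots he.isExponentSystem D.block_surjective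
  obtain ⟨F, hF1, hF, -⟩ := exists_rpow_bounds (D.isExponentSystem_exponent he)
  have hκ1 := hκ.one_le
  have hκ₁1 := hκ1.trans hκ.le_right
  have hκ0 : 0 < κ := by linarith
  have hκ₁0 : 0 < κ₁ := by linarith
  have hCp0 : 0 < Cp := by linarith
  set m : ℝ := ∑ l, D.d l with hm
  have hm' : ∀ l, D.d l ≤ m := fun l =>
    Finset.single_le_sum (f := D.d) (fun l _ => (D.d_pos l).le) (Finset.mem_univ l)
  have hm0 : 0 ≤ m := Finset.sum_nonneg fun l _ => (D.d_pos l).le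
  have hκF : 1 ≤ κ ^ F := Real.one_le_rpow hκ1 (by linarith)
  have hCpm : 1 ≤ Cp ^ m := Real.one_le_rpow hCp1 hm0
  set Q : ℝ := κ ^ F * Cp ^ m with hQ
  have hQ1 : 1 ≤ Q := one_le_mul_of_one_le_of_one_le hκF hCpm
  -- one constant for all the comparisons of scales below
  set R : ℝ := κ₁ * Q with hR
  have hκ₁R : κ₁ ≤ R := le_mul_of_one_le_right hκ₁0.le hQ1
  have hQR : Q ≤ R := le_mul_of_one_le_left (by linarith) hκ₁1
  have hR1 : 1 ≤ R := hQ1.trans hQR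
  obtain ⟨C₀, hC₀0, hC₀⟩ := hK.exists_norm_pairing_localised_le γ hκ0 hκ.ball R
  have hex : ∀ L : {L : Finset (Fin n) // L.Nonempty}, _ := fun L =>
    hK.exists_norm_pairing_cut_le he L.2 γ hκ1 (hκ.subBall L.1ᶜ) hR1
  choose C₁ hC₁0 hC₁ using hex
  set C : ℝ := C₀ + ∑ L, C₁ L with hC
  have hC1' : 0 ≤ ∑ L, C₁ L := Finset.sum_nonneg fun L _ => hC₁0 L
  have hC0 : 0 ≤ C := by positivity
  refine ⟨Fintype.card (Σ _ : Finset (Fin n), Finset (Fin n)) * C, by positivity,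
    fun τ ξ hτ => ?_⟩
  set A := D.freqScale e t τ ξ with hA
  set a := D.coordScale e t τ ξ with ha
  set T : Fin n → ℝ := fun j => τ ^ t j with hT
  have hT1 : ∀ j, 1 ≤ T j := fun j => Real.one_le_rpow hτ (ht0 j).le
  have hTT : ∀ j k, T k ≤ T j ^ e k j := fun j k => by
    rw [hT]
    beta_reduce
    rw [← Real.rpow_mul (by linarith)]
    refine Real.rpow_le_rpow_of_exponent_le hτ ?_
    rw [mul_comm]
    exact ht k j
  have hr0 : ∀ l, 0 ≤ |ξ l| ^ (1 / D.d l) := fun l => by positivity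
  obtain ⟨X, β, q, hβX, hq, hact⟩ := hpiv T A (fun l => |ξ l| ^ (1 / D.d l)) hT1 hTT hr0
    fun j => rfl
  have hsum0 : ∀ j, 0 ≤ ∑ l, (|ξ l| ^ (1 / D.d l)) ^ (1 / e (D.block l) j) := fun j =>
    Finset.sum_nonneg fun l _ => Real.rpow_nonneg (hr0 l) _
  have hTA : ∀ j, T j ≤ A j := fun j => le_add_of_nonneg_right (hsum0 j)
  have hA1 : ∀ j, 1 ≤ A j := fun j => (hT1 j).trans (hTA j)
  have hA0 : ∀ j, 0 < A j := fun j => by linarith [hA1 j]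
  have haA : ∀ l, a l = A (D.block l) ^ D.d l := fun l => rfl
  have ha0 : ∀ l, 0 < a l := fun l => Real.rpow_pos_of_pos (hA0 _) _
  have hTl0 : ∀ l, 0 < D.truncScale t τ l := fun l =>
    Real.rpow_pos_of_pos (by linarith [hT1 (D.block l)]) _
  have hTa : ∀ l, D.truncScale t τ l ≤ a l := fun l =>
    Real.rpow_le_rpow (by linarith [hT1 (D.block l)]) (hTA _) (D.d_pos l).le
  have hξa : ∀ l, |ξ l| ≤ a l := fun l => by
    have h1 : |ξ l| ^ (1 / D.d l) ≤ A (D.block l) := by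
      have := Finset.single_le_sum
        (f := fun l' => (|ξ l'| ^ (1 / D.d l')) ^ (1 / e (D.block l') (D.block l)))
        (fun l' _ => Real.rpow_nonneg (hr0 l') _) (Finset.mem_univ l)
      beta_reduce at this
      rw [he.diag, div_one, Real.rpow_one] at this
      have h2 := hT1 (D.block l)
      rw [hA]
      unfold freqScale
      linarith
    rwa [one_div, Real.rpow_inv_le_iff_of_pos (abs_nonneg _) (hA0 _).le (D.d_pos l)] at h1
  -- comparison of the coordinate scales, from that of the block scales
  have hcomp : ∀ l l' : Fin N, A (D.block l') ^ e (D.block l) (D.block l') ≤ Cp * A (D.block l) →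
      (κ * a l') ^ D.exponent e l l' ≤ R * (κ * a l) := by
    intro l l' h
    have hd := D.d_pos l
    have hd' := D.d_pos l'
    have h1 : a l' ^ D.exponent e l l' = (A (D.block l') ^ e (D.block l) (D.block l')) ^ D.d l := by
      rw [haA, ← Real.rpow_mul (hA0 _).le, ← Real.rpow_mul (hA0 _).le]
      congr 1
      unfold exponent
      field_simp
    rw [Real.mul_rpow hκ0.le (ha0 _).le, h1]
    calc κ ^ D.exponent e l l' * (A (D.block l') ^ e (D.block l) (D.block l')) ^ D.d l
        ≤ κ ^ F * (Cp * A (D.block l)) ^ D.d l := by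
          have h3 := hA0 (D.block l')
          gcongr
          exact hF _ _
      _ = κ ^ F * Cp ^ D.d l * a l := by rw [Real.mul_rpow hCp0.le (hA0 _).le, haA]; ring
      _ ≤ R * (κ * a l) := by
          have h3 := ha0 l
          have h4 : κ ^ F * Cp ^ D.d l ≤ R := by
            refine le_trans ?_ hQR
            rw [hQ]
            gcongr
            exact hm' l
          have h5 : a l ≤ κ * a l := le_mul_of_one_le_left h3.le hκ1
          gcongr
  -- `Y` consists of the blocks which are not pivots and whose scale is not governed by the
  -- truncation
  set Y : Finset (Fin n) := Finset.univ.filter fun j => j ∉ X ∧ ¬ A j ≤ 2 * T j with hY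
  have hXY : Disjoint Y X := Finset.disjoint_left.2 fun j hj => (Finset.mem_filter.1 hj).2.1
  have hYβ : ∀ j ∈ Y, β j ∈ X ∧ A j ^ e (β j) j ≤ Cp * A (β j) := fun j hj => by
    obtain ⟨-, h1, h2⟩ := Finset.mem_filter.1 hj
    exact (hact j h1).resolve_left h2
  set T' : Fin N → ℝ := fun l => κ₁ * D.truncScale t τ l with hT'
  have hT'0 : ∀ l, 0 < T' l := fun l => mul_pos hκ₁0 (hTl0 l)
  set c : D.Space → Fin n → ℂ := fun x j => D.blockBump (fun l => κ * a l) j x with hc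
  set I := Y.powerset.sigma fun S => (X \ S.image β).powerset with hI
  set term : (Σ _ : Finset (Fin n), Finset (Fin n)) → D.Space → ℂ := fun s x =>
    modBump T' γ ξ x * ((∏ j ∈ s.1 ∪ s.2, (1 - c x j)) *
      ∏ j ∈ ((s.1 ∪ s.2) ∪ s.1.image β)ᶜ, c x j) with hterm
  have hpart : modBump T' γ ξ = fun x => ∑ s ∈ I, term s x := by
    funext x
    simp only [hterm]
    rw [← Finset.mul_sum]
    by_cases h0 : modBump T' γ ξ x = 0
    · rw [h0, zero_mul]
    rw [sum_prod_cut_eq_one hXY (fun j hjX hjY => ?_) fun j hj => (hYβ j hj).1, mul_one]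
    -- a block outside `X ∪ Y` needs no localisation, since the truncation already localises it
    have hAj : A j ≤ 2 * T j := by
      by_contra h
      exact hjY (Finset.mem_filter.2 ⟨Finset.mem_univ _, hjX, h⟩)
    refine boxBump_eq_one fun l hl => ?_
    have hlj : D.block l = j := (Finset.mem_filter.1 hl).2
    have h1 : |T' l * x l| < 2 := by
      by_contra h
      have h2 := Finset.prod_ne_zero_iff.1 h0 l (Finset.mem_univ l)
      rw [lineBump_eq_zero (not_lt.1 h)] at h2
      simp at h2
    have h2 : a l ≤ 2 ^ D.d l * D.truncScale t τ l := by
      rw [haA, hlj]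
      unfold truncScale
      rw [hlj, ← Real.mul_rpow (by norm_num) (by linarith [hT1 j])]
      exact Real.rpow_le_rpow (hA0 j).le hAj (D.d_pos l).le
    rw [abs_mul, abs_of_pos (mul_pos hκ0 (ha0 l))]
    rw [abs_mul, abs_of_pos (hT'0 l)] at h1
    have h3 := hκ.le l
    have h4 := abs_nonneg (x l)
    have h5 := hTl0 l
    have h6 : 2 * (κ * a l * |x l|) ≤ T' l * |x l| := by
      calc 2 * (κ * a l * |x l|) ≤ 2 * (κ * (2 ^ D.d l * D.truncScale t τ l) * |x l|) := by gcongr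
        _ = κ * (2 * 2 ^ D.d l) * D.truncScale t τ l * |x l| := by ring
        _ ≤ κ₁ * D.truncScale t τ l * |x l| := by gcongr
    linarith
  have hterms : ∀ s, ContDiff ℝ ∞ (term s) := fun s => (contDiff_modBump _ _ _).mul
    ((contDiff_prod fun j _ => contDiff_const.sub (D.contDiff_blockBump _ j)).mul
      (contDiff_prod fun j _ => D.contDiff_blockBump _ j))
  have htermc : ∀ s, HasCompactSupport (term s) := fun s =>
    (hasCompactSupport_modBump hT'0 γ ξ).mul_right
  rw [hpart, pairing_sum K I (fun s _ => hterms s) fun s _ => htermc s]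
  set W : ℝ := ∏ l, (a l ^ γ l)⁻¹ with hW
  have hW0 : 0 ≤ W := Finset.prod_nonneg fun l _ => inv_nonneg.2 (pow_nonneg (ha0 l).le _)
  have hT'a : ∀ l, T' l ≤ R * a l := fun l => by
    have := hTa l
    have := hTl0 l
    rw [hT']
    beta_reduce
    gcongr
  have hbound : ∀ s ∈ I, ‖pairing K (term s)‖ ≤ C * W := by
    rintro ⟨S₁, S₂⟩ hs
    obtain ⟨hS₁, hS₂⟩ := Finset.mem_sigma.1 hs
    rw [Finset.mem_powerset] at hS₁ hS₂
    dsimp only at hS₁ hS₂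
    have hS₂X : S₂ ⊆ X := hS₂.trans Finset.sdiff_subset
    by_cases hS : (S₁ ∪ S₂).Nonempty
    swap
    · rw [Finset.not_nonempty_iff_eq_empty, Finset.union_eq_empty] at hS
      obtain ⟨rfl, rfl⟩ := hS
      have h1 := hC₀ A a T' ξ hA0 haA hT'0 hT'a hξa
      have e1 : term ⟨∅, ∅⟩ = fun x => modBump T' γ ξ x * ∏ j, D.blockBump (fun l => κ * a l) j x := by
        funext x
        simp [hterm, hc]
      rw [e1]
      refine h1.trans ?_
      gcongr
      rw [hC]
      linarith
    set L : Finset (Fin n) := (S₁ ∪ S₂) ∪ S₁.image β with hL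
    have hLne : L.Nonempty := hS.mono Finset.subset_union_left
    have hLcases : ∀ j ∈ L, j ∈ S₁ ∨ j ∈ X := by
      intro j hj
      simp only [hL, Finset.mem_union] at hj
      rcases hj with (h | h) | h
      · exact Or.inl h
      · exact Or.inr (hS₂X h)
      · obtain ⟨i, hi, rfl⟩ := Finset.mem_image.1 h
        exact Or.inr (hYβ i (hS₁ hi)).1
    have hβmem : ∀ j ∈ L, β j ∈ X ∧ β j ∈ L := by
      intro j hj
      rcases hLcases j hj with h | h
      · exact ⟨(hYβ j (hS₁ h)).1, Finset.mem_union_right _ (Finset.mem_image_of_mem _ h)⟩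
      · rw [hβX j h]; exact ⟨h, hj⟩
    have hβA : ∀ j ∈ L, A j ^ e (β j) j ≤ Cp * A (β j) := by
      intro j hj
      rcases hLcases j hj with h | h
      · exact (hYβ j (hS₁ h)).2
      · rw [hβX j h, he.diag, Real.rpow_one]
        exact le_mul_of_one_le_left (hA0 j).le hCp1
    have hbq : ∀ l : D.Coord L, D.block (q (β (D.block l.1))) = β (D.block l.1) := fun l =>
      (hq _ (hβmem _ l.2).1).1
    set p : D.Coord L → D.Coord L := fun l => ⟨q (β (D.block l.1)), by
      rw [hbq l]; exact (hβmem _ l.2).2⟩ with hp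
    have hbp : ∀ l : D.Coord L, D.block (p l).1 = β (D.block l.1) := hbq
    have hpp : ∀ l l' : D.Coord L, β (D.block l.1) = β (D.block l'.1) → p l = p l' := by
      intro l l' h
      simp only [hp, h]
    -- every block of `L` dominates, and has the same pivot as, a block which has been cut off from
    -- small values of its variables
    have hcut : ∀ l : D.Coord L, ∃ j ∈ S₁ ∪ S₂, A j ^ e (D.block l.1) j ≤ Cp * A (D.block l.1) ∧
        β j = β (D.block l.1) := by
      intro l
      by_cases h : D.block l.1 ∈ S₁ ∪ S₂
      · refine ⟨_, h, ?_, rfl⟩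
        rw [he.diag, Real.rpow_one]
        exact le_mul_of_one_le_left (hA0 _).le hCp1
      · have h2 := (Finset.mem_union.1 l.2).resolve_left h
        obtain ⟨i, hi, hil⟩ := Finset.mem_image.1 h2
        have h3 := hYβ i (hS₁ hi)
        rw [hil] at h3
        exact ⟨i, Finset.mem_union_left _ hi, h3.2, by rw [hil, hβX _ h3.1]⟩
    have h1 := hC₁ ⟨L, hLne⟩ A a T' ξ (S₁ ∪ S₂) p hA0 haA hT'0 hT'a hξa hS
      Finset.subset_union_left
      (fun l => hpp _ _ (by rw [hbp, hβX _ (hβmem _ l.2).1]))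
      (fun l => ?_) (fun l => hcomp _ _ ?_) (fun l => ?_) (fun l => ?_) (fun l => ?_)
      fun l hl => ?_
    · refine h1.trans ?_
      gcongr
      have := Finset.single_le_sum (f := C₁) (fun L _ => hC₁0 L) (Finset.mem_univ ⟨L, hLne⟩)
      rw [hC]
      linarith
    · have h2 := (hq _ (hβmem _ l.2).1).2
      have hd := D.d_pos (p l).1
      have h3 : a (p l).1 ≤ Cp ^ m * |ξ (p l).1| := by
        rw [haA, hbp]
        calc A (β (D.block l.1)) ^ D.d (p l).1
            ≤ (Cp * |ξ (p l).1| ^ (1 / D.d (p l).1)) ^ D.d (p l).1 :=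
              Real.rpow_le_rpow (hA0 _).le h2 hd.le
          _ = Cp ^ D.d (p l).1 * |ξ (p l).1| := by
              rw [Real.mul_rpow hCp0.le (by positivity), ← Real.rpow_mul (abs_nonneg _),
                one_div_mul_cancel hd.ne', Real.rpow_one]
          _ ≤ _ := by
              gcongr
              exact hm' _
      have h4 : κ ≤ κ ^ F := by
        simpa using Real.rpow_le_rpow_of_exponent_le hκ1 hF1
      calc κ * a (p l).1 ≤ κ ^ F * (Cp ^ m * |ξ (p l).1|) := by
            have := ha0 (p l).1
            gcongr
        _ = Q * |ξ (p l).1| := by rw [hQ]; ring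
        _ ≤ _ := by gcongr
    · rw [hbp]
      exact hβA _ l.2
    · have hd := D.d_pos (p l).1
      have hd' := D.d_pos l.1
      have hex := (D.isExponentSystem_exponent he).pos (p l).1 l.1
      have h2 : D.truncScale t τ (p l).1 ≤
          D.truncScale t τ l.1 ^ D.exponent e (p l).1 l.1 := by
        have h3 : D.truncScale t τ l.1 ^ D.exponent e (p l).1 l.1 =
            (T (D.block l.1) ^ e (D.block (p l).1) (D.block l.1)) ^ D.d (p l).1 := by
          have h4 : 0 ≤ T (D.block l.1) := by linarith [hT1 (D.block l.1)]
          unfold truncScale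
          rw [← Real.rpow_mul h4, ← Real.rpow_mul h4]
          congr 1
          unfold exponent
          field_simp
        rw [h3]
        exact Real.rpow_le_rpow (by linarith [hT1 (D.block (p l).1)]) (hTT _ _) hd.le
      have h5 : 1 ≤ κ₁ ^ D.exponent e (p l).1 l.1 := Real.one_le_rpow hκ₁1 hex.le
      have h6 := hTl0 l.1
      change κ₁ * _ ≤ R * (κ₁ * _) ^ D.exponent e (p l).1 l.1
      rw [Real.mul_rpow hκ₁0.le h6.le]
      have h7 : 0 ≤ D.truncScale t τ l.1 ^ D.exponent e (p l).1 l.1 := by positivity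
      have h8 := hTl0 (p l).1
      exact mul_le_mul hκ₁R (h2.trans (le_mul_of_one_le_left h7 h5)) h8.le (by linarith)
    · obtain ⟨j, hj, h2, -⟩ := hcut l
      refine ⟨j, hj, fun l₀ hl₀ => hcomp _ _ ?_⟩
      rw [hl₀]
      exact h2
    · obtain ⟨j, hj, -, h2⟩ := hcut l
      refine ⟨j, hj, fun l₀ hl₀ => hpp _ _ ?_⟩
      rw [hl₀]
      exact h2
    · -- a pivot block of `S₁ ∪ S₂` belongs to `S₂`, and is not the pivot of a block of `S₁`
      rw [hbp] at hl ⊢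
      rcases Finset.mem_union.1 hl with h | h
      · exact absurd (hβmem _ l.2).1 (Finset.disjoint_left.1 hXY (hS₁ h))
      · rcases hLcases _ l.2 with h2 | h2
        · exact absurd (Finset.mem_image_of_mem β h2) (Finset.mem_sdiff.1 (hS₂ h)).2
        · exact (hβX _ h2).symm
  refine (norm_sum_le _ _).trans ((Finset.sum_le_card_nsmul _ _ _ hbound).trans ?_)
  rw [nsmul_eq_mul, mul_assoc]
  have h1 : (I.card : ℝ) ≤ Fintype.card (Σ _ : Finset (Fin n), Finset (Fin n)) := by
    exact_mod_cast Finset.card_le_univ I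
  gcongr

end DilationStructure

/-! ### Kernels cut off from the origin -/

section Tail

variable {ι : Type*} [Fintype ι]

theorem ScaledBound.norm_iteratedFDeriv_le {u : EuclideanSpace ℝ ι → ℂ} {x : EuclideanSpace ℝ ι}
    {m : ℕ} {C : ℝ} (h : ScaledBound u x (fun _ => 1) m C) {k : ℕ} (hk : k ≤ m) :
    ‖iteratedFDeriv ℝ k u x‖ ≤ C := by
  have h1 := h k hk
  have e : (fun z : EuclideanSpace ℝ ι => u (x + diagMap (fun _ => 1) z)) = fun z => u (x + z) := by
    funext z
    congr 2
    ext l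
    simp
  rwa [e, iteratedFDeriv_comp_add_left, add_zero] at h1

theorem multiDeriv_const [DecidableEq ι] (γ : ι → ℕ) (c : ℂ) (x : EuclideanSpace ℝ ι) :
    multiDeriv γ (fun _ => c) x = if γ = 0 then c else 0 := by
  split_ifs with h
  · subst h
    rw [multiDeriv_zero]
  · unfold multiDeriv
    have h1 : Fintype.card (Σ l, Fin (γ l)) ≠ 0 := by
      rw [Fintype.card_sigma]
      simp only [Fintype.card_fin]
      intro h2
      exact h (funext fun l => (Finset.sum_eq_zero_iff.1 h2) l (Finset.mem_univ l))
    rw [iteratedFDeriv_const_of_ne h1]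
    rfl

/-- A function that is smooth away from the origin becomes smooth when it is multiplied by a
function vanishing near the origin. -/
theorem contDiff_mul_of_eventuallyEq_zero {χ g : EuclideanSpace ℝ ι → ℂ} (hχ : ContDiff ℝ ∞ χ)
    (hg : ContDiffOn ℝ ∞ g {0}ᶜ) (h0 : χ =ᶠ[nhds 0] 0) : ContDiff ℝ ∞ fun x => χ x * g x := by
  rw [contDiff_iff_contDiffAt]
  intro x
  by_cases hx : x = 0
  · subst hx
    have : (fun x => χ x * g x) =ᶠ[nhds 0] fun _ => 0 := by
      filter_upwards [h0] with z hz
      simp [hz]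
    exact contDiffAt_const.congr_of_eventuallyEq this
  · exact hχ.contDiffAt.mul (hg.contDiffAt (isOpen_compl_singleton.mem_nhds hx))

/-- A kernel which decays rapidly at infinity, cut off from the origin, is a Schwartz function. -/
theorem exists_schwartzMap_cutoff [DecidableEq ι] {f : ι → ι → ℝ} (hf : IsExponentSystem f)
    {g : EuclideanSpace ℝ ι → ℂ} (hg : ContDiffOn ℝ ∞ g {0}ᶜ)
    (hb : ∀ (M : ℕ) (γ : ι → ℕ), ∃ C : ℝ, ∀ x, x ≠ 0 → ‖multiDeriv γ g x‖ ≤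
      C * (∏ l, pNorm f l x ^ (-(1 + (γ l : ℝ)))) * (1 + ‖x‖) ^ (-(M : ℝ)))
    {T : ι → ℝ} (hT : ∀ l, 0 < T l) :
    ∃ h : 𝓢(EuclideanSpace ℝ ι, ℂ), ∀ x, h x = (1 - boxBump T Finset.univ x) * g x := by
  obtain ⟨F, hF1, hF, -⟩ := exists_rpow_bounds hf
  have hχs : ContDiff ℝ ∞ fun x : EuclideanSpace ℝ ι => 1 - boxBump T Finset.univ x :=
    contDiff_const.sub (contDiff_boxBump _ _)
  have h0 : (fun x : EuclideanSpace ℝ ι => 1 - boxBump T Finset.univ x) =ᶠ[nhds 0] 0 := by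
    filter_upwards [boxBump_eventuallyEq_one (a := T) (s := Finset.univ)
      (x := (0 : EuclideanSpace ℝ ι)) (fun l _ => by simp)] with z hz
    simp [hz]
  have hs := contDiff_mul_of_eventuallyEq_zero hχs hg h0
  refine ⟨⟨fun x => (1 - boxBump T Finset.univ x) * g x, hs, fun k n => ?_⟩, fun x => rfl⟩
  choose C hC using hb k
  set Tm : ℝ := 1 + ∑ l, T l with hTm
  have hTm1 : 1 ≤ Tm := le_add_of_nonneg_right (Finset.sum_nonneg fun l _ => (hT l).le)
  have hTl : ∀ l, T l ≤ Tm := fun l => by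
    have := Finset.single_le_sum (f := T) (fun l _ => (hT l).le) (Finset.mem_univ l)
    linarith
  have hTm0 : 0 < Tm := by linarith
  obtain ⟨B, hB1, hB⟩ := exists_scaledBound_one_sub_boxBump ι n hTm1
  set P : (ι → ℕ) → ℝ := fun γ => |C γ| * ∏ l, (Tm ^ F) ^ (1 + (γ l : ℝ)) with hP
  have hP0 : ∀ γ, 0 ≤ P γ := fun γ => by positivity
  set Cg : ℝ := ∑ j ∈ Finset.range (n + 1), ∑ γ ∈ Finset.piAntidiag Finset.univ j, P γ with hCg
  have hCg0 : 0 ≤ Cg := Finset.sum_nonneg fun j _ => Finset.sum_nonneg fun γ _ => hP0 γ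
  have hPle : ∀ γ : ι → ℕ, ∑ l, γ l ≤ n → P γ ≤ Cg := fun γ hγ =>
    (Finset.single_le_sum (f := P) (fun γ _ => hP0 γ) (Finset.mem_piAntidiag.2
      ⟨rfl, fun _ _ => Finset.mem_univ _⟩)).trans
    (Finset.single_le_sum (f := fun j => ∑ γ ∈ Finset.piAntidiag (Finset.univ : Finset ι) j, P γ)
      (fun j _ => Finset.sum_nonneg fun γ _ => hP0 γ) (Finset.mem_range.2 (Nat.lt_succ_of_le hγ)))
  refine ⟨2 ^ n * (B * ((Fintype.card ι + 1 : ℝ) ^ n * Cg)), fun x => ?_⟩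
  by_cases hx : ∀ l ∈ Finset.univ, |T l * x l| < 1
  · have h1 : (fun x => (1 - boxBump T Finset.univ x) * g x) =ᶠ[nhds x] fun _ => 0 := by
      filter_upwards [boxBump_eventuallyEq_one hx] with z hz
      simp [hz]
    rw [(h1.iteratedFDeriv ℝ n).eq_of_nhds]
    have h2 : iteratedFDeriv ℝ n (fun _ : EuclideanSpace ℝ ι => (0 : ℂ)) x = 0 := by simp
    rw [h2, norm_zero, mul_zero]
    positivity
  push Not at hx
  obtain ⟨l₀, -, hl₀⟩ := hx
  have hx0 : x ≠ 0 := by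
    rintro rfl
    simp at hl₀
    linarith
  have hxl : Tm⁻¹ ≤ |x l₀| := by
    rw [abs_mul, abs_of_pos (hT l₀)] at hl₀
    rw [inv_le_iff_one_le_mul₀' hTm0]
    exact hl₀.trans (mul_le_mul_of_nonneg_right (hTl l₀) (abs_nonneg _))
  have hp : ∀ l, (Tm ^ F)⁻¹ ≤ pNorm f l x := fun l => by
    refine le_trans ?_ (rpow_le_pNorm l l₀ x)
    rw [← Real.inv_rpow hTm0.le]
    calc Tm⁻¹ ^ F ≤ Tm⁻¹ ^ f l l₀ := Real.rpow_le_rpow_of_exponent_ge (by positivity)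
          (inv_le_one_of_one_le₀ hTm1) (hF _ _)
      _ ≤ _ := Real.rpow_le_rpow (by positivity) hxl (hf.pos _ _).le
  have hgx : ContDiffAt ℝ ∞ g x := hg.contDiffAt (isOpen_compl_singleton.mem_nhds hx0)
  have hy : (0 : ℝ) < (1 + ‖x‖) ^ (-(k : ℝ)) := by positivity
  have hgS : ScaledBound g x (fun _ => 1) n
      ((Fintype.card ι + 1 : ℝ) ^ n * (Cg * (1 + ‖x‖) ^ (-(k : ℝ)))) := by
    refine ScaledBound.of_multiDeriv hgx fun γ hγ => ?_
    simp only [abs_one, one_pow, Finset.prod_const_one, one_mul]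
    refine (hC γ x hx0).trans ?_
    gcongr
    refine le_trans ?_ (hPle γ hγ)
    have h1 : ∏ l, pNorm f l x ^ (-(1 + (γ l : ℝ))) ≤ ∏ l, (Tm ^ F) ^ (1 + (γ l : ℝ)) := by
      refine Finset.prod_le_prod (fun l _ => Real.rpow_nonneg (pNorm_nonneg l x) _) fun l _ => ?_
      rw [Real.rpow_neg (pNorm_nonneg l x), ← Real.inv_rpow (pNorm_nonneg l x)]
      refine Real.rpow_le_rpow (inv_nonneg.2 (pNorm_nonneg l x)) ?_ (by positivity)
      exact inv_le_of_inv_le₀ (by positivity) (hp l)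
    have h2 : 0 ≤ ∏ l, pNorm f l x ^ (-(1 + (γ l : ℝ))) :=
      Finset.prod_nonneg fun l _ => Real.rpow_nonneg (pNorm_nonneg l x) _
    exact mul_le_mul (le_abs_self _) h1 h2 (abs_nonneg _)
  have hm := ScaledBound.mul hχs.contDiffAt hgx
    (hB T Finset.univ (fun _ => 1) x (Or.inr fun l _ => by
      rw [one_mul, abs_of_pos (hT l)]; exact hTl l)) hgS
  have h3 := hm.norm_iteratedFDeriv_le le_rfl
  have h4 : ‖x‖ ^ k * (1 + ‖x‖) ^ (-(k : ℝ)) ≤ 1 := by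
    rw [Real.rpow_neg (by positivity), Real.rpow_natCast, ← div_eq_mul_inv,
      div_le_one (by positivity)]
    exact pow_le_pow_left₀ (norm_nonneg _) (by linarith) _
  calc ‖x‖ ^ k * ‖iteratedFDeriv ℝ n (fun x => (1 - boxBump T Finset.univ x) * g x) x‖
      ≤ ‖x‖ ^ k * (2 ^ n * (B * ((Fintype.card ι + 1 : ℝ) ^ n * (Cg * (1 + ‖x‖) ^ (-(k : ℝ)))))) := by
        gcongr
    _ = (‖x‖ ^ k * (1 + ‖x‖) ^ (-(k : ℝ))) * (2 ^ n * (B * ((Fintype.card ι + 1 : ℝ) ^ n * Cg))) := by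
        ring
    _ ≤ _ := mul_le_of_le_one_left (by positivity) h4

/-- The derivatives of the Fourier transform of a kernel which has been cut off from the origin and
from infinity, in terms of the pairing with modulated bump functions. -/
theorem multiDeriv_fourier_boxBump_sub [DecidableEq ι]
    {T : 𝓓((⊤ : TopologicalSpace.Opens (EuclideanSpace ℝ ι)), ℝ) → ℂ}
    (K : 𝓓'((⊤ : TopologicalSpace.Opens (EuclideanSpace ℝ ι)), ℂ))
    (hTK : T = fun φ => K φ) {g : EuclideanSpace ℝ ι → ℂ} (hg : IsGivenAwayFromZeroBy T g)
    {a a' : ι → ℝ} (ha : ∀ l, 0 < a l) (ha' : ∀ l, 0 < a' l) (γ : ι → ℕ)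
    (ξ : EuclideanSpace ℝ ι) :
    multiDeriv γ (𝓕 fun x => (boxBump a Finset.univ x - boxBump a' Finset.univ x) * g x) ξ =
      (∏ l, (-(2 * Real.pi * Complex.I)) ^ γ l) *
        (pairing K (modBump a γ ξ) - pairing K (modBump a' γ ξ)) := by
  subst hTK
  set χ : EuclideanSpace ℝ ι → ℂ := fun x => boxBump a Finset.univ x - boxBump a' Finset.univ x
    with hχ
  have hχs : ContDiff ℝ ∞ χ := (contDiff_boxBump _ _).sub (contDiff_boxBump _ _)
  have hχc : HasCompactSupport χ :=
    (hasCompactSupport_boxBump_univ ha).sub (hasCompactSupport_boxBump_univ ha')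
  have h0 : χ =ᶠ[nhds 0] 0 := by
    filter_upwards [boxBump_eventuallyEq_one (a := a) (s := Finset.univ)
      (x := (0 : EuclideanSpace ℝ ι)) (fun l _ => by simp),
      boxBump_eventuallyEq_one (a := a') (s := Finset.univ)
      (x := (0 : EuclideanSpace ℝ ι)) (fun l _ => by simp)] with z hz hz'
    simp [hχ, hz, hz']
  have hus := contDiff_mul_of_eventuallyEq_zero hχs hg.1 h0
  have huc : HasCompactSupport fun x => χ x * g x := hχc.mul_right
  rw [multiDeriv_fourier (fun k => ?_) hus.continuous.aestronglyMeasurable,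
    ← pairing_sub K (contDiff_modBump _ _ _) (hasCompactSupport_modBump ha _ _)
      (contDiff_modBump _ _ _) (hasCompactSupport_modBump ha' _ _)]
  swap
  · exact ((continuous_norm.pow k).mul hus.continuous.norm).integrable_of_hasCompactSupport
      huc.norm.mul_left
  set Φ : EuclideanSpace ℝ ι → ℂ := fun x => modBump a γ ξ x - modBump a' γ ξ x with hΦ
  have hΦe : ∀ x, Φ x = χ x * ((∏ l, (x l : ℂ) ^ γ l) * (Real.fourierChar (-(inner ℝ x ξ)) : ℂ)) := by
    intro x
    simp only [hΦ, modBump_eq, hχ]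
    ring
  have hΦ0 : 0 ∉ tsupport Φ := by
    refine notMem_tsupport_iff_eventuallyEq.2 ?_
    filter_upwards [h0] with z hz
    rw [hΦe, hz]
    simp
  rw [pairing_eq_integral hg ((contDiff_modBump _ _ _).sub (contDiff_modBump _ _ _))
    ((hasCompactSupport_modBump ha _ _).sub (hasCompactSupport_modBump ha' _ _)) hΦ0,
    ← integral_const_mul, Real.fourier_eq]
  refine integral_congr_ae (.of_forall fun x => ?_)
  change _ = _ * (Φ x * g x)
  simp only [Circle.smul_def, smul_eq_mul, mul_pow, Finset.prod_mul_distrib]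
  rw [hΦe]
  ring

end Tail

/-! ### Test functions concentrated near the origin -/

namespace DilationStructure

variable {N n : ℕ} {D : DilationStructure N n} {e : Matrix (Fin n) (Fin n) ℝ}

/-- The pairing of a proper kernel with test functions which are concentrated near the origin and
vanish there becomes small. -/
theorem IsProperKernel.exists_norm_pairing_sub_le {K : D.Distr} (hK : D.IsProperKernel e K)
    {t : Fin n → ℝ} {κ κ₁ : ℝ} (hκ : D.IsBumpScale κ κ₁)
    {φ : D.Space → ℂ} (hφ : ContDiff ℝ ∞ φ) (hφc : HasCompactSupport φ) :
    ∃ C : ℝ, ∀ τ r : ℝ, 0 < τ → 0 < r → r ≤ 1 → (∀ l, (D.truncScale t τ l)⁻¹ ≤ r) →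
      ‖pairing K fun x => boxBump (fun l => κ₁ * D.truncScale t τ l) Finset.univ x *
        (φ x - φ 0)‖ ≤ C * r := by
  have hκ0 : 0 < κ := by linarith [hκ.one_le]
  have hκκ := hκ.le_right
  have hκ₁0 : 0 < κ₁ := by linarith
  have hbd : ∀ k : ℕ, ∃ B : ℝ, ∀ x, ‖iteratedFDeriv ℝ k φ x‖ ≤ B := fun k =>
    (hφc.iteratedFDeriv k).exists_bound_of_continuous
      (hφ.continuous_iteratedFDeriv (by exact_mod_cast le_top))
  choose Bφ hBφ using hbd
  have hBφ0 : ∀ k, 0 ≤ Bφ k := fun k => (norm_nonneg _).trans (hBφ k 0)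
  choose Bχ hBχ1 hBχ using fun m => exists_scaledBound_boxBump (Fin N) m
    (le_max_left (1 : ℝ) κ₁)
  set ρ : ℝ := N * (2 / κ₁) with hρ
  have hρ0 : 0 ≤ ρ := by positivity
  set B : ℕ → ℝ := fun m => 2 ^ m * (Bχ m * (Bφ 1 * ρ + ∑ k ∈ Finset.range (m + 1), Bφ k)) with hB
  have hsum0 : ∀ m, 0 ≤ ∑ k ∈ Finset.range (m + 1), Bφ k := fun m =>
    Finset.sum_nonneg fun k _ => hBφ0 k
  have hB0 : ∀ m, 0 ≤ B m := fun m => by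
    have h1 := hBχ1 m
    have h2 := hBφ0 1
    have h3 := hsum0 m
    positivity
  obtain ⟨C, hC0, hC⟩ := hK.exists_norm_pairing_dilate_le D B
  refine ⟨C, fun τ r hτ hr hr1 hTr => ?_⟩
  have hT0 : ∀ l, 0 < D.truncScale t τ l := fun l => by
    unfold truncScale
    positivity
  set Δ : D.Space →L[ℝ] D.Space := diagMap fun l => (D.truncScale t τ l)⁻¹ with hΔ
  have hΔn : ‖Δ‖ ≤ r := ScaledBound.norm_diagMap_le hr.le fun l => by
    rw [abs_of_pos (inv_pos.2 (hT0 l))]; exact hTr l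
  set w : D.Space → ℂ := fun z => φ (Δ z) - φ 0 with hw
  have hws : ContDiff ℝ ∞ w := (hφ.comp Δ.contDiff).sub contDiff_const
  set Ψ : D.Space → ℂ := fun z => (r : ℂ)⁻¹ * (boxBump (fun _ => κ₁) Finset.univ z * w z) with hΨ
  have hrc : (r : ℂ) ≠ 0 := by exact_mod_cast hr.ne'
  have hχs := contDiff_boxBump (fun _ : Fin N => κ₁) Finset.univ
  have hχc := hasCompactSupport_boxBump_univ (fun _ : Fin N => hκ₁0)
  have hχws : ContDiff ℝ ∞ fun z => boxBump (fun _ => κ₁) Finset.univ z * w z := hχs.mul hws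
  have hΨs : ContDiff ℝ ∞ Ψ := contDiff_const.mul hχws
  have hΨc : HasCompactSupport Ψ := hχc.mul_right.mul_left
  have hsupp : ∀ x ∈ tsupport Ψ, ∀ l, |κ₁ * x l| ≤ 2 := by
    intro x hx l
    by_contra h
    push Not at h
    refine notMem_tsupport_iff_eventuallyEq.2 ?_ hx
    filter_upwards [boxBump_eventuallyEq_zero (a := fun _ => κ₁) ⟨l, Finset.mem_univ l, h⟩]
      with z hz
    simp [hΨ, hz]
  have hball : ∀ x ∈ tsupport Ψ, ∀ j, D.nrm j (D.comp x j) < 1 := fun x hx =>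
    hκ.ball x fun l => by
      refine le_trans ?_ (hsupp x hx l)
      rw [abs_mul, abs_mul, abs_of_pos hκ0, abs_of_pos hκ₁0]
      gcongr
  -- after rescaling, the difference `φ x - φ 0` and all its derivatives are of size `r` on the
  -- support of the cutoff function, so that `Ψ` ranges over a bounded family of test functions
  have hwk : ∀ z : D.Space, ‖z‖ ≤ ρ → ∀ m k, k ≤ m → ‖iteratedFDeriv ℝ k w z‖ ≤
      (Bφ 1 * ρ + ∑ k ∈ Finset.range (m + 1), Bφ k) * r := by
    intro z hz m k hk
    rcases Nat.eq_zero_or_pos k with rfl | hk0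
    · rw [norm_iteratedFDeriv_zero]
      have h1 : ‖φ (Δ z) - φ 0‖ ≤ Bφ 1 * ‖Δ z - 0‖ :=
        Convex.norm_image_sub_le_of_norm_fderiv_le (s := Set.univ)
          (fun x _ => (hφ.differentiable (by simp)).differentiableAt)
          (fun x _ => by rw [← norm_iteratedFDeriv_one]; exact hBφ 1 x) convex_univ
          (Set.mem_univ _) (Set.mem_univ _)
      rw [sub_zero] at h1
      have h2 : ‖Δ z‖ ≤ r * ρ := (Δ.le_opNorm z).trans (by gcongr)
      calc ‖w z‖ ≤ Bφ 1 * ‖Δ z‖ := h1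
        _ ≤ Bφ 1 * (r * ρ) := by have := hBφ0 1; gcongr
        _ = Bφ 1 * ρ * r := by ring
        _ ≤ _ := by
          have := hsum0 m
          gcongr
          linarith
    · have e1 : iteratedFDeriv ℝ k w z = iteratedFDeriv ℝ k (φ ∘ Δ) z := by
        have e2 := iteratedFDeriv_sub_apply (𝕜 := ℝ) (i := k) (x := z) (f := φ ∘ Δ)
          (g := fun _ => φ 0)
          ((hφ.comp Δ.contDiff).contDiffAt.of_le (by exact_mod_cast le_top)) contDiffAt_const
        rw [iteratedFDeriv_const_of_ne hk0.ne', Pi.zero_apply, sub_zero] at e2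
        exact e2
      rw [e1, Δ.iteratedFDeriv_comp_right (n := ∞) hφ _ (by exact_mod_cast le_top)]
      refine (ContinuousMultilinearMap.norm_compContinuousLinearMap_le _ _).trans ?_
      rw [Finset.prod_const, Finset.card_univ, Fintype.card_fin]
      have h1 : ‖Δ‖ ^ k ≤ r := by
        calc ‖Δ‖ ^ k ≤ r ^ k := pow_le_pow_left₀ (norm_nonneg _) hΔn k
          _ ≤ r ^ 1 := pow_le_pow_of_le_one hr.le hr1 hk0
          _ = r := pow_one r
      have h2 : Bφ k ≤ ∑ k ∈ Finset.range (m + 1), Bφ k :=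
        Finset.single_le_sum (f := Bφ) (fun k _ => hBφ0 k) (Finset.mem_range.2 (by omega))
      have h3 : 0 ≤ Bφ 1 * ρ := mul_nonneg (hBφ0 1) hρ0
      refine mul_le_mul ((hBφ k _).trans (by linarith)) h1 (by positivity) ?_
      have := hsum0 m
      linarith
  have hΨB : ∀ (m : ℕ) (α : Fin N → ℕ), ∑ l, α l ≤ m → ∀ x, ‖multiDeriv α Ψ x‖ ≤ B m := by
    intro m α hα x
    by_cases hx : x ∈ tsupport Ψ
    swap
    · rw [multiDeriv_eq_zero_of_notMem_tsupport hx, norm_zero]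
      exact hB0 m
    have hxn : ‖x‖ ≤ ρ := by
      have h1 := EuclideanSpace.norm_le_card_mul (x := x) (A := 2 / κ₁) fun l => by
        have := hsupp x hx l
        rwa [abs_mul, abs_of_pos hκ₁0, ← le_div_iff₀' hκ₁0] at this
      simpa using h1
    rw [hΨ, multiDeriv_const_mul hχws, norm_mul, norm_inv, Complex.norm_real,
      Real.norm_of_nonneg hr.le, inv_mul_le_iff₀ hr]
    have h1 : ScaledBound w x (fun _ => 1) m
        ((Bφ 1 * ρ + ∑ k ∈ Finset.range (m + 1), Bφ k) * r) := by
      intro k hk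
      have e1 : (fun z : D.Space => w (x + diagMap (fun _ => 1) z)) = fun z => w (x + z) := by
        funext z
        congr 2
        ext l
        simp
      rw [e1, iteratedFDeriv_comp_add_left, add_zero]
      exact hwk x hxn m k hk
    have h2 := ScaledBound.mul hχs.contDiffAt hws.contDiffAt
      (hBχ m (fun _ => κ₁) Finset.univ (fun _ => 1) x fun l _ => by
        rw [one_mul, abs_of_pos hκ₁0]; exact le_max_right _ _) h1
    refine ((norm_multiDeriv_le α _ x).trans (h2.norm_iteratedFDeriv_le hα)).trans (le_of_eq ?_)
    rw [hB]
    ring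
  have hmain := hC Ψ hΨs hΨc hball hΨB (fun j => τ ^ t j) fun j => Real.rpow_pos_of_pos hτ _
  have e : (fun x => boxBump (fun l => κ₁ * D.truncScale t τ l) Finset.univ x * (φ x - φ 0)) =
      fun x => (r : ℂ) * Ψ (D.dilate (fun j => τ ^ t j) x) := by
    funext x
    have e1 : Δ (D.dilate (fun j => τ ^ t j) x) = x := by
      ext l
      have := (hT0 l).ne'
      change (D.truncScale t τ l)⁻¹ * (D.truncScale t τ l * x l) = x l
      field_simp
    have e2 : boxBump (fun _ => κ₁) Finset.univ (D.dilate (fun j => τ ^ t j) x) =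
        boxBump (fun l => κ₁ * D.truncScale t τ l) Finset.univ x := by
      unfold boxBump
      refine Finset.prod_congr rfl fun l _ => ?_
      change lineBump (κ₁ * (D.truncScale t τ l * x l)) = _
      rw [mul_assoc]
    simp only [hΨ, hw]
    rw [e1, e2, mul_inv_cancel_left₀ hrc]
  have hcs : ContDiff ℝ ∞ fun x => Ψ (D.dilate (fun j => τ ^ t j) x) := by
    refine hΨs.comp ?_
    unfold dilate
    fun_prop
  have hcc : HasCompactSupport fun x => Ψ (D.dilate (fun j => τ ^ t j) x) := by
    have e3 : (fun x => Ψ (D.dilate (fun j => τ ^ t j) x)) = fun x => (r : ℂ)⁻¹ *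
        (boxBump (fun l => κ₁ * D.truncScale t τ l) Finset.univ x * (φ x - φ 0)) := by
      funext x
      rw [congrFun e x, inv_mul_cancel_left₀ hrc]
    rw [e3]
    exact (hasCompactSupport_boxBump_univ fun l => mul_pos hκ₁0 (hT0 l)).mul_right.mul_left
  rw [e, pairing_const_mul K hcs hcc, norm_mul, Complex.norm_real, Real.norm_of_nonneg hr.le,
    mul_comm]
  gcongr

/-- The frequency scales are at least as large as the scales of truncation. -/
theorem one_le_coordScale {t : Fin n → ℝ} (ht : ∀ j, 0 < t j) {τ : ℝ} (hτ : 1 ≤ τ) (ξ : D.Space)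
    (l : Fin N) : 1 ≤ D.truncScale t τ l ∧ D.truncScale t τ l ≤ D.coordScale e t τ ξ l := by
  have h1 : 1 ≤ τ ^ t (D.block l) := Real.one_le_rpow hτ (ht _).le
  refine ⟨Real.one_le_rpow h1 (D.d_pos l).le, Real.rpow_le_rpow (by linarith) ?_ (D.d_pos l).le⟩
  exact le_add_of_nonneg_right (Finset.sum_nonneg fun l _ => by positivity)

/-- The frequency scale of a coordinate dominates the dual norm, so that the key estimate yields the
weights of a multiplier. -/
theorem one_add_qNorm_le (he : BasicHypothesis e) {t : Fin n → ℝ} (ht : ∀ j, 0 < t j) {τ : ℝ}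
    (hτ : 1 ≤ τ) (ξ : D.Space) (l : Fin N) :
    1 + qNorm (D.exponent e) l ξ ≤ (1 + N) * D.coordScale e t τ ξ l := by
  have h1 := (one_le_coordScale (e := e) ht hτ ξ l)
  have h2 : ∀ k, |ξ k| ^ (1 / D.exponent e k l) ≤ D.coordScale e t τ ξ l := by
    intro k
    have hd := D.d_pos l
    have hk := D.d_pos k
    have hek := he.pos (D.block k) (D.block l)
    have e1 : |ξ k| ^ (1 / D.exponent e k l) =
        ((|ξ k| ^ (1 / D.d k)) ^ (1 / e (D.block k) (D.block l))) ^ D.d l := by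
      rw [← Real.rpow_mul (abs_nonneg _), ← Real.rpow_mul (abs_nonneg _)]
      congr 1
      unfold exponent
      field_simp
    rw [e1]
    refine Real.rpow_le_rpow (by positivity) ?_ hd.le
    have h3 := Finset.single_le_sum
      (f := fun k => (|ξ k| ^ (1 / D.d k)) ^ (1 / e (D.block k) (D.block l)))
      (fun k _ => by positivity) (Finset.mem_univ k)
    have h4 : 0 ≤ τ ^ t (D.block l) := by positivity
    unfold freqScale
    beta_reduce at h3
    linarith
  have h5 : qNorm (D.exponent e) l ξ ≤ N * D.coordScale e t τ ξ l := by
    refine (Finset.sum_le_sum fun k _ => h2 k).trans (le_of_eq ?_)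
    simp
  linarith [h1.1.trans h1.2]

end DilationStructure

/-! ### The Fourier transform of a proper kernel -/

theorem SchwartzMap.exists_norm_multiDeriv_le {ι : Type*} [Fintype ι] [DecidableEq ι]
    (h : 𝓢(EuclideanSpace ℝ ι, ℂ)) (γ : ι → ℕ) (k : ℕ) :
    ∃ C : ℝ, 0 ≤ C ∧ ∀ ξ, (1 + ‖ξ‖) ^ k * ‖multiDeriv γ h ξ‖ ≤ C := by
  obtain ⟨C, hC⟩ : ∃ C : ℝ, ∀ ξ, (1 + ‖ξ‖) ^ k * ‖iteratedFDeriv ℝ (∑ l, γ l) h ξ‖ ≤ C :=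
    ⟨_, fun ξ => SchwartzMap.one_add_le_sup_seminorm_apply (𝕜 := ℝ) (m := (k, ∑ l, γ l)) le_rfl
      le_rfl h ξ⟩
  refine ⟨|C|, abs_nonneg _, fun ξ => le_trans ?_ ((hC ξ).trans (le_abs_self _))⟩
  gcongr
  exact norm_multiDeriv_le γ h ξ

/-- The weights of multipliers grow at most polynomially. -/
theorem IsExponentSystem.exists_prod_one_add_qNorm_le {ι : Type*} [Fintype ι] {f : ι → ι → ℝ}
    (hf : IsExponentSystem f) (γ : ι → ℕ) : ∃ (C : ℝ) (k : ℕ), 0 ≤ C ∧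
      ∀ ξ, ∏ l, (1 + qNorm f l ξ) ^ γ l ≤ C * (1 + ‖ξ‖) ^ k := by
  obtain ⟨F, hF1, -, hF⟩ := exists_rpow_bounds hf
  set k : ℕ := ⌈F⌉₊ with hk
  refine ⟨∏ l, (1 + (Fintype.card ι : ℝ)) ^ γ l, ∑ l, k * γ l, by positivity, fun ξ => ?_⟩
  rw [← Finset.prod_pow_eq_pow_sum, ← Finset.prod_mul_distrib]
  have h0 : ∀ l, 0 ≤ 1 + qNorm f l ξ := fun l => by linarith [qNorm_nonneg (f := f) l ξ]
  refine Finset.prod_le_prod (fun l _ => pow_nonneg (h0 l) _) fun l _ => ?_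
  rw [pow_mul, ← mul_pow]
  refine pow_le_pow_left₀ (h0 l) ?_ _
  have h1 : (1 : ℝ) ≤ 1 + ‖ξ‖ := by linarith [norm_nonneg ξ]
  have h2 : ∀ j, |ξ j| ^ (1 / f j l) ≤ (1 + ‖ξ‖) ^ k := fun j => by
    have h3 : |ξ j| ≤ 1 + ‖ξ‖ := (PiLp.norm_apply_le ξ j).trans (by linarith)
    calc |ξ j| ^ (1 / f j l) ≤ (1 + ‖ξ‖) ^ (1 / f j l) :=
          Real.rpow_le_rpow (abs_nonneg _) h3 (one_div_pos.2 (hf.pos _ _)).le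
      _ ≤ (1 + ‖ξ‖) ^ (k : ℝ) :=
          Real.rpow_le_rpow_of_exponent_le h1 ((hF _ _).trans (Nat.le_ceil F))
      _ = _ := Real.rpow_natCast _ _
  have h4 : qNorm f l ξ ≤ Fintype.card ι * (1 + ‖ξ‖) ^ k := by
    refine (Finset.sum_le_sum fun j _ => h2 j).trans (le_of_eq ?_)
    simp
  have h5 : 1 ≤ (1 + ‖ξ‖) ^ k := one_le_pow₀ h1
  linarith

namespace DilationStructure

variable {N n : ℕ} {D : DilationStructure N n} {e : Matrix (Fin n) (Fin n) ℝ}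

/-- A proper kernel is the inverse Fourier transform of a smooth function which satisfies
the differential inequalities of a multiplier. This function is the limit of the Fourier transforms
of the kernel cut off from the origin, corrected by constants. -/
theorem IsProperKernel.exists_integral_eq (he : BasicHypothesis e) {K : D.Distr}
    (hK : D.IsProperKernel e K) : ∃ m : D.Space → ℂ, ContDiff ℝ ∞ m ∧
      (∀ γ : Fin N → ℕ, ∃ C : ℝ, 0 ≤ C ∧ ∀ ξ, ‖multiDeriv γ m ξ‖ ≤
        C * ∏ l, ((1 + qNorm (D.exponent e) l ξ) ^ γ l)⁻¹) ∧
      ∀ (φ : D.Test) (f : 𝓢(D.Space, ℂ)), (∀ x, f x = (φ x : ℂ)) →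
        K φ = ∫ ξ, m ξ * (𝓕⁻ f) ξ := by
  obtain ⟨t, ht0, ht⟩ := he.isExponentSystem.exists_weights
  obtain ⟨κ, κ₁, hκ⟩ := D.exists_isBumpScale
  have hκ₁0 : 0 < κ₁ := by linarith [hκ.one_le, hκ.le_right]
  have hf := D.isExponentSystem_exponent he
  obtain ⟨g, hg, hgb⟩ := hK.differential
  have hgb' : ∀ (M : ℕ) (γ : Fin N → ℕ), ∃ C : ℝ, ∀ x, x ≠ 0 → ‖multiDeriv γ g x‖ ≤
      C * (∏ l, pNorm (D.exponent e) l x ^ (-(1 + (γ l : ℝ)))) * (1 + ‖x‖) ^ (-(M : ℝ)) := by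
    intro M γ
    obtain ⟨C, hC⟩ := hgb M γ
    obtain ⟨C', -, hC'⟩ := D.exists_kernelWeight_equiv he γ
    refine ⟨|C| * C', fun x hx => (hC x hx).trans ?_⟩
    gcongr ?_ * _
    rw [mul_assoc]
    have h1 : 0 ≤ ∏ j, D.norm e j x ^ (-(D.Q j + D.weight γ j)) :=
      Finset.prod_nonneg fun j _ => Real.rpow_nonneg (D.norm_pos he hx j).le _
    exact mul_le_mul (le_abs_self _) (hC' x hx).2 h1 (abs_nonneg _)
  set T : ℕ → Fin N → ℝ := fun s l => κ₁ * D.truncScale t (2 ^ s) l with hT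
  have h2s : ∀ s : ℕ, (1 : ℝ) ≤ 2 ^ s := fun s => one_le_pow₀ (by norm_num)
  have htr : ∀ (s : ℕ) (ξ : D.Space) l, 1 ≤ D.truncScale t (2 ^ s) l ∧
      D.truncScale t (2 ^ s) l ≤ D.coordScale e t (2 ^ s) ξ l := fun s ξ l =>
    one_le_coordScale ht0 (h2s s) ξ l
  have hT0 : ∀ s l, 0 < T s l := fun s l => mul_pos hκ₁0 (by linarith [(htr s 0 l).1])
  -- the truncation scales grow geometrically
  obtain ⟨c₀, hc₀, hc₀t⟩ := exists_pos_le_of_finite (t := fun l => t (D.block l) * D.d l)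
    fun l => mul_pos (ht0 _) (D.d_pos l)
  set r : ℝ := 2 ^ (-c₀) with hr
  have hr0 : 0 < r := by positivity
  have hr1 : r < 1 := Real.rpow_lt_one_of_one_lt_of_neg (by norm_num) (by linarith)
  have hrs1 : ∀ s : ℕ, r ^ s ≤ 1 := fun s => pow_le_one₀ hr0.le hr1.le
  have hTr : ∀ (s : ℕ) l, (D.truncScale t (2 ^ s) l)⁻¹ ≤ r ^ s := by
    intro s l
    unfold truncScale
    rw [← Real.rpow_natCast, ← Real.rpow_mul (by norm_num), ← Real.rpow_mul (by norm_num),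
      ← Real.rpow_neg (by norm_num), hr, ← Real.rpow_natCast, ← Real.rpow_mul (by norm_num)]
    refine Real.rpow_le_rpow_of_exponent_le (by norm_num) ?_
    have h1 := hc₀t l
    have h2 : (0 : ℝ) ≤ s := Nat.cast_nonneg s
    nlinarith [mul_le_mul_of_nonneg_left h1 h2]
  -- `h` is the part of the kernel away from the origin, and `u s` the part between two truncations
  obtain ⟨h, hh⟩ := exists_schwartzMap_cutoff hf hg.1 hgb' (hT0 0)
  set u : ℕ → D.Space → ℂ := fun s x =>
    (boxBump (T 0) Finset.univ x - boxBump (T s) Finset.univ x) * g x with hu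
  have hu0 : ∀ s, (fun x : D.Space => boxBump (T 0) Finset.univ x - boxBump (T s) Finset.univ x)
      =ᶠ[nhds 0] 0 := fun s => by
    filter_upwards [boxBump_eventuallyEq_one (a := T 0) (s := Finset.univ)
      (x := (0 : D.Space)) (fun l _ => by simp),
      boxBump_eventuallyEq_one (a := T s) (s := Finset.univ)
      (x := (0 : D.Space)) (fun l _ => by simp)] with z hz hz'
    simp [hz, hz']
  have hus : ∀ s, ContDiff ℝ ∞ (u s) := fun s => contDiff_mul_of_eventuallyEq_zero
    ((contDiff_boxBump _ _).sub (contDiff_boxBump _ _)) hg.1 (hu0 s)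
  have huc : ∀ s, HasCompactSupport (u s) := fun s =>
    ((hasCompactSupport_boxBump_univ (hT0 0)).sub
      (hasCompactSupport_boxBump_univ (hT0 s))).mul_right
  set P : (Fin N → ℕ) → ℕ → D.Space → ℂ := fun γ s ξ => pairing K (modBump (T s) γ ξ) with hP
  choose C hC0 hC using fun γ => hK.exists_norm_pairing_modBump_le he ht ht0 hκ γ
  have hPC : ∀ γ s ξ, ‖P γ s ξ‖ ≤ C γ * ∏ l, (D.coordScale e t (2 ^ s) ξ l ^ γ l)⁻¹ :=
    fun γ s ξ => hC γ (2 ^ s) ξ (h2s s)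
  have hcs1 : ∀ (s : ℕ) (ξ : D.Space) l, 1 ≤ D.coordScale e t (2 ^ s) ξ l := fun s ξ l =>
    (htr s ξ l).1.trans (htr s ξ l).2
  have hP1 : ∀ s ξ, ‖P 0 s ξ‖ ≤ C 0 := fun s ξ => by simpa using hPC 0 s ξ
  -- The constant `P 0 s 0`, which is the pairing of `K` with the truncation, makes up for the part
  -- of `K` that is concentrated near the origin.
  set v : ℕ → D.Space → ℂ := fun s ξ => (𝓕 (h : D.Space → ℂ) ξ + 1 * 𝓕 (u s) ξ) + 1 * P 0 s 0
    with hv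
  have hhs : ContDiff ℝ ∞ (𝓕 (h : D.Space → ℂ)) := by
    rw [← SchwartzMap.fourier_coe]
    exact (𝓕 h).smooth'
  have hFus : ∀ s, ContDiff ℝ ∞ (𝓕 (u s)) := fun s =>
    contDiff_fourier_of_hasCompactSupport (hus s) (huc s)
  have hvs : ∀ s, ContDiff ℝ ∞ (v s) := fun s =>
    (hhs.add (contDiff_const.mul (hFus s))).add contDiff_const
  set cγ : (Fin N → ℕ) → ℂ := fun γ => ∏ l, (-(2 * Real.pi * Complex.I)) ^ γ l with hcγ
  have hdv : ∀ γ s ξ, multiDeriv γ (v s) ξ = multiDeriv γ (𝓕 (h : D.Space → ℂ)) ξ +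
      cγ γ * (P γ 0 ξ - P γ s ξ) + if γ = 0 then P 0 s 0 else 0 := by
    intro γ s ξ
    simp only [hv]
    rw [multiDeriv_add_of_contDiffAt (u := fun ξ => 𝓕 (h : D.Space → ℂ) ξ + 1 * 𝓕 (u s) ξ)
        (v := fun _ => P 0 s 0) (hhs.add (contDiff_const.mul (hFus s))).contDiffAt
        contDiffAt_const, multiDeriv_const,
      multiDeriv_add_of_contDiffAt hhs.contDiffAt (hFus s).contDiffAt, one_mul, one_mul,
      multiDeriv_fourier_boxBump_sub K rfl hg (hT0 0) (hT0 s)]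
  have hdiff : ∀ γ s ξ, multiDeriv γ (fun ξ => v (s + 1) ξ - v s ξ) ξ =
      cγ γ * (P γ s ξ - P γ (s + 1) ξ) + if γ = 0 then P 0 (s + 1) 0 - P 0 s 0 else 0 := by
    intro γ s ξ
    rw [multiDeriv_sub (hvs _) (hvs _), hdv, hdv]
    split_ifs <;> ring
  -- a derivative of positive order gains at least one of the truncation scales
  have hPr : ∀ γ, γ ≠ 0 → ∀ s ξ, ‖P γ s ξ‖ ≤ C γ * r ^ s := by
    intro γ hγ s ξ
    refine (hPC γ s ξ).trans (mul_le_mul_of_nonneg_left ?_ (hC0 γ))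
    obtain ⟨l₀, hl₀⟩ := Function.ne_iff.1 hγ
    have h1 : ∏ l, (D.coordScale e t (2 ^ s) ξ l ^ γ l)⁻¹ ≤
        (D.coordScale e t (2 ^ s) ξ l₀ ^ γ l₀)⁻¹ := by
      rw [← Finset.mul_prod_erase _ _ (Finset.mem_univ l₀)]
      refine mul_le_of_le_one_right ?_ (Finset.prod_le_one (fun l _ => ?_) fun l _ => ?_)
      · have := hcs1 s ξ l₀
        positivity
      · have := hcs1 s ξ l
        positivity
      · exact inv_le_one_of_one_le₀ (one_le_pow₀ (hcs1 s ξ l))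
    refine h1.trans (le_trans ?_ (hTr s l₀))
    have h2 := (htr s ξ l₀).1
    refine inv_anti₀ (by linarith) ((htr s ξ l₀).2.trans ?_)
    exact le_self_pow₀ (hcs1 s ξ l₀) hl₀
  have hdr : ∀ γ, γ ≠ 0 → ∀ s ξ, ‖multiDeriv γ (fun ξ => v (s + 1) ξ - v s ξ) ξ‖ ≤
      ‖cγ γ‖ * (C γ + C γ) * r ^ s := by
    intro γ hγ s ξ
    rw [hdiff, if_neg hγ, add_zero, norm_mul, mul_assoc]
    refine mul_le_mul_of_nonneg_left ((norm_sub_le _ _).trans ?_) (norm_nonneg _)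
    have h1 := hPr γ hγ s ξ
    have h2 := hPr γ hγ (s + 1) ξ
    have h3 : C γ * r ^ (s + 1) ≤ C γ * r ^ s :=
      mul_le_mul_of_nonneg_left (pow_le_pow_of_le_one hr0.le hr1.le (Nat.le_succ s)) (hC0 γ)
    linarith
  obtain ⟨m, hm, hlim⟩ := exists_contDiffOn_limit_of_multiDeriv isOpen_univ hvs hr0.le hr1
    fun γ x _ => by
    by_cases hγ : γ = 0
    swap
    · exact ⟨_, .of_forall fun y s => hdr γ hγ s y⟩
    subst hγ
    -- the difference vanishes at the origin, so that the mean value theorem applies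
    set B : ℝ := Fintype.card (Fin N) ^ 1 *
      ∑ γ ∈ Finset.piAntidiag (Finset.univ : Finset (Fin N)) 1, ‖cγ γ‖ * (C γ + C γ) with hB
    have hB0 : 0 ≤ B := by
      have : ∀ γ, 0 ≤ ‖cγ γ‖ * (C γ + C γ) := fun γ => by have := hC0 γ; positivity
      exact mul_nonneg (by positivity) (Finset.sum_nonneg fun γ _ => this γ)
    refine ⟨B * (‖x‖ + 1), ?_⟩
    have hev : ∀ᶠ y in nhds x, ‖y‖ < ‖x‖ + 1 :=
      continuous_norm.continuousAt.eventually_lt_const (lt_add_one _)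
    filter_upwards [hev] with y hy s
    rw [multiDeriv_zero]
    have hws : ContDiff ℝ ∞ fun ξ => v (s + 1) ξ - v s ξ := (hvs _).sub (hvs _)
    have hz : v (s + 1) 0 - v s 0 = 0 := by
      have h1 := hdiff 0 s 0
      rw [multiDeriv_zero, if_pos rfl] at h1
      rw [h1]
      simp [hcγ]
    have hfd : ∀ ξ, ‖fderiv ℝ (fun ξ => v (s + 1) ξ - v s ξ) ξ‖ ≤ B * r ^ s := by
      intro ξ
      rw [← norm_iteratedFDeriv_one]
      refine (norm_iteratedFDeriv_le_of_multiDeriv_sum (k := 1)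
        (B := fun γ => ‖cγ γ‖ * (C γ + C γ) * r ^ s)
        (hws.contDiffAt.of_le (by exact_mod_cast le_top)) fun γ hγ => hdr γ ?_ s ξ).trans
        (le_of_eq ?_)
      · rintro rfl
        simp at hγ
      · rw [← Finset.sum_mul, hB, mul_assoc]
    have h1 := Convex.norm_image_sub_le_of_norm_fderiv_le (s := Set.univ) (x := 0) (y := y)
      (fun ξ _ => (hws.differentiable (by simp)).differentiableAt) (fun ξ _ => hfd ξ) convex_univ
      (Set.mem_univ _) (Set.mem_univ _)
    rw [hz, sub_zero, sub_zero] at h1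
    have hrs : 0 ≤ r ^ s := pow_nonneg hr0.le s
    calc ‖v (s + 1) y - v s y‖ ≤ B * r ^ s * ‖y‖ := h1
      _ ≤ B * r ^ s * (‖x‖ + 1) := by gcongr
      _ = _ := by ring
  have hmbd : ∀ γ : Fin N → ℕ, ∃ C : ℝ, 0 ≤ C ∧ ∀ s ξ, ‖multiDeriv γ (v s) ξ‖ ≤
      C * ∏ l, ((1 + qNorm (D.exponent e) l ξ) ^ γ l)⁻¹ := by
    intro γ
    obtain ⟨Cq, k, hCq0, hCq⟩ := hf.exists_prod_one_add_qNorm_le γ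
    obtain ⟨Ch, hCh0, hCh⟩ := (𝓕 h).exists_norm_multiDeriv_le γ k
    set CN : ℝ := ∏ l, (1 + (N : ℝ)) ^ γ l with hCN
    have hCN0 : 0 ≤ CN := by positivity
    refine ⟨Ch * Cq + ‖cγ γ‖ * (C γ * CN + C γ * CN) + C 0, ?_, fun s ξ => ?_⟩
    · have := hC0 γ
      have := hC0 0
      positivity
    set W : ℝ := ∏ l, ((1 + qNorm (D.exponent e) l ξ) ^ γ l)⁻¹ with hW
    have hq1 : ∀ l, 1 ≤ 1 + qNorm (D.exponent e) l ξ := fun l => by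
      linarith [qNorm_nonneg (f := D.exponent e) l ξ]
    have hWpos : 0 < ∏ l, (1 + qNorm (D.exponent e) l ξ) ^ γ l :=
      Finset.prod_pos fun l _ => pow_pos (by linarith [hq1 l]) _
    have hWe : W = (∏ l, (1 + qNorm (D.exponent e) l ξ) ^ γ l)⁻¹ := Finset.prod_inv_distrib _
    have h1 : ‖multiDeriv γ (𝓕 (h : D.Space → ℂ)) ξ‖ ≤ Ch * Cq * W := by
      have h2 := hCh ξ
      rw [SchwartzMap.fourier_coe] at h2
      rw [hWe, ← div_eq_mul_inv, le_div_iff₀ hWpos]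
      calc ‖multiDeriv γ (𝓕 (h : D.Space → ℂ)) ξ‖ * ∏ l, (1 + qNorm (D.exponent e) l ξ) ^ γ l
          ≤ ‖multiDeriv γ (𝓕 (h : D.Space → ℂ)) ξ‖ * (Cq * (1 + ‖ξ‖) ^ k) := by
            gcongr
            exact hCq ξ
        _ = Cq * ((1 + ‖ξ‖) ^ k * ‖multiDeriv γ (𝓕 (h : D.Space → ℂ)) ξ‖) := by ring
        _ ≤ Cq * Ch := by gcongr
        _ = _ := mul_comm _ _
    have h2 : ∀ s, ‖P γ s ξ‖ ≤ C γ * CN * W := by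
      intro s
      refine (hPC γ s ξ).trans ?_
      rw [mul_assoc]
      refine mul_le_mul_of_nonneg_left ?_ (hC0 γ)
      rw [hCN, hW, ← Finset.prod_mul_distrib]
      refine Finset.prod_le_prod (fun l _ => ?_) fun l _ => ?_
      · have := hcs1 s ξ l
        positivity
      · have h3 := hcs1 s ξ l
        have h4 := hq1 l
        rw [← div_eq_mul_inv, inv_eq_one_div, div_le_div_iff₀ (by positivity) (by positivity),
          one_mul, ← mul_pow]
        exact pow_le_pow_left₀ (by linarith) (one_add_qNorm_le he ht0 (h2s s) ξ l) _
    have h3 : ‖(if γ = 0 then P 0 s 0 else 0 : ℂ)‖ ≤ C 0 * W := by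
      split_ifs with hγ
      · have hW1 : W = 1 := by simp [hW, hγ]
        rw [hW1, mul_one]
        exact hP1 s 0
      · rw [norm_zero]
        have := hC0 0
        rw [hWe]
        positivity
    rw [hdv]
    refine (norm_add₃_le).trans ?_
    rw [norm_mul, add_mul, add_mul]
    refine add_le_add (add_le_add h1 ?_) h3
    rw [mul_assoc]
    refine mul_le_mul_of_nonneg_left ((norm_sub_le _ _).trans ?_) (norm_nonneg _)
    have h4 := h2 0
    have h5 := h2 s
    linarith
  have hms : ContDiff ℝ ∞ m := contDiffOn_univ.1 hm
  refine ⟨m, hms, fun γ => ?_, fun φ f hφf => ?_⟩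
  · obtain ⟨C', hC'0, hC'⟩ := hmbd γ
    exact ⟨C', hC'0, fun ξ => le_of_tendsto (hlim γ ξ (Set.mem_univ _)).norm
      (.of_forall fun s => hC' s ξ)⟩
  -- the identity holds in the limit, by dominated convergence
  have hfφ : (f : D.Space → ℂ) = fun x => (φ x : ℂ) := funext hφf
  have hφs : ContDiff ℝ ∞ fun x => (φ x : ℂ) := contDiff_ofReal φ.contDiff
  have hφc : HasCompactSupport fun x => (φ x : ℂ) := hasCompactSupport_ofReal φ.hasCompactSupport
  have hinv : 𝓕 ((𝓕⁻ f : 𝓢(D.Space, ℂ)) : D.Space → ℂ) = f := by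
    rw [← SchwartzMap.fourier_coe, FourierTransform.fourier_fourierInv_eq]
  have hfi : Integrable ((𝓕⁻ f : 𝓢(D.Space, ℂ)) : D.Space → ℂ) := (𝓕⁻ f).integrable
  have hlim1 : Filter.Tendsto (fun s => ∫ ξ, v s ξ * (𝓕⁻ f) ξ) Filter.atTop
      (nhds (∫ ξ, m ξ * (𝓕⁻ f) ξ)) := by
    obtain ⟨C', hC'0, hC'⟩ := hmbd 0
    refine tendsto_integral_of_dominated_convergence (fun ξ => C' * ‖(𝓕⁻ f) ξ‖)
      (fun s => ((hvs s).continuous.mul (𝓕⁻ f).continuous).aestronglyMeasurable)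
      (hfi.norm.const_mul _) (fun s => .of_forall fun ξ => ?_) (.of_forall fun ξ => ?_)
    · rw [norm_mul]
      have h1 := hC' s ξ
      rw [multiDeriv_zero] at h1
      gcongr
      simpa using h1
    · have h1 := hlim 0 ξ (Set.mem_univ _)
      simp only [multiDeriv_zero] at h1
      exact h1.mul_const _
  have hχ : ∀ s, modBump (T s) 0 (0 : D.Space) = boxBump (T s) Finset.univ := fun s => by
    funext x
    rw [modBump_eq]
    simp
  have hid : ∀ s, ∫ ξ, v s ξ * (𝓕⁻ f) ξ = K φ -
      pairing K fun x => boxBump (T s) Finset.univ x * ((φ x : ℂ) - (φ 0 : ℂ)) := by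
    intro s
    set w : D.Space → ℂ := fun x => h x + u s x with hw
    have hwe : ∀ x, w x = (1 - boxBump (T s) Finset.univ x) * g x := fun x => by
      simp only [hw, hu, hh]
      ring
    have hui : Integrable (u s) := (hus s).continuous.integrable_of_hasCompactSupport (huc s)
    have hwi : Integrable w := h.integrable.add hui
    have hwF : ∀ ξ, 𝓕 w ξ = 𝓕 (h : D.Space → ℂ) ξ + 𝓕 (u s) ξ := by
      intro ξ
      simp only [Real.fourier_eq, hw, smul_add]
      exact integral_add ((Real.fourierIntegral_convergent_iff ξ).2 h.integrable)
        ((Real.fourierIntegral_convergent_iff ξ).2 hui)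
    have e1 : ∀ ξ, v s ξ * (𝓕⁻ f) ξ = (𝓕⁻ f) ξ * 𝓕 w ξ + P 0 s 0 * (𝓕⁻ f) ξ := fun ξ => by
      rw [hwF]
      simp only [hv]
      ring
    have hi1 : Integrable fun ξ => (𝓕⁻ f) ξ * 𝓕 w ξ := by
      refine hfi.mul_bdd (c := ∫ x, ‖w x‖) ?_ (.of_forall fun ξ => ?_)
      · have : 𝓕 w = fun ξ => 𝓕 (h : D.Space → ℂ) ξ + 𝓕 (u s) ξ := funext hwF
        rw [this]
        exact (hhs.add (hFus s)).continuous.aestronglyMeasurable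
      · exact VectorFourier.norm_fourierIntegral_le_integral_norm _ _ _ _ _
    simp_rw [e1]
    rw [integral_add hi1 (hfi.const_mul _), integral_const_mul, integral_mul_fourier_eq hfi hwi,
      hinv]
    -- Fourier inversion at the origin turns the constant into a multiple of `φ 0`
    have e2 : ∫ ξ, (𝓕⁻ f) ξ = (φ 0 : ℂ) := by
      have h1 := congrFun hinv 0
      rw [Real.fourier_eq, hφf] at h1
      rw [← h1]
      refine integral_congr_ae (.of_forall fun ξ => ?_)
      simp
    have hbs := contDiff_boxBump (T s) Finset.univ
    have hbc := hasCompactSupport_boxBump_univ (hT0 s)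
    have e3 : ∫ x, w x * f x = pairing K
        fun x => (1 - boxBump (T s) Finset.univ x) * (φ x : ℂ) := by
      rw [pairing_eq_integral hg ((contDiff_const.sub hbs).mul hφs) hφc.mul_left]
      · refine integral_congr_ae (.of_forall fun x => ?_)
        beta_reduce
        rw [hwe, hφf]
        ring
      · refine notMem_tsupport_iff_eventuallyEq.2 ?_
        filter_upwards [boxBump_eventuallyEq_one (a := T s) (s := Finset.univ)
          (x := (0 : D.Space)) (fun l _ => by simp)] with z hz
        simp [hz]
    have e4 : (fun x => (1 - boxBump (T s) Finset.univ x) * (φ x : ℂ)) = fun x =>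
        (φ x : ℂ) - boxBump (T s) Finset.univ x * (φ x : ℂ) := by funext x; ring
    have e5 : (fun x => boxBump (T s) Finset.univ x * ((φ x : ℂ) - (φ 0 : ℂ))) = fun x =>
        boxBump (T s) Finset.univ x * (φ x : ℂ) - (φ 0 : ℂ) * boxBump (T s) Finset.univ x := by
      funext x; ring
    rw [e2, e3, e4, e5, pairing_sub K hφs hφc (hbs.mul hφs) hbc.mul_right,
      pairing_sub K (hbs.mul hφs) hbc.mul_right (contDiff_const.mul hbs) hbc.mul_left,
      pairing_const_mul K hbs hbc, pairing_ofReal]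
    simp only [hP]
    rw [hχ]
    ring
  have hlim2 : Filter.Tendsto (fun s => ∫ ξ, v s ξ * (𝓕⁻ f) ξ) Filter.atTop (nhds (K φ)) := by
    obtain ⟨C', hC'⟩ := hK.exists_norm_pairing_sub_le (t := t) hκ hφs hφc
    have h1 : Filter.Tendsto (fun s => pairing K fun x => boxBump (T s) Finset.univ x *
        ((φ x : ℂ) - (φ 0 : ℂ))) Filter.atTop (nhds 0) := by
      refine squeeze_zero_norm (a := fun s : ℕ => C' * r ^ s) (fun s =>
        hC' (2 ^ s) (r ^ s) (by positivity) (by positivity) (hrs1 s) (hTr s)) ?_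
      simpa using (tendsto_pow_atTop_nhds_zero_of_lt_one hr0.le hr1).const_mul C'
    simp_rw [hid]
    simpa using h1.const_sub (K φ)
  exact tendsto_nhds_unique hlim2 hlim1

end DilationStructure

/-! ### Duality -/

namespace DilationStructure

variable {N n : ℕ} {D : DilationStructure N n} {e : Matrix (Fin n) (Fin n) ℝ}

/-- The Fourier transform of a proper kernel is a multiplier. -/
theorem IsProperKernel.exists_mem_multipliers (he : BasicHypothesis e) {K : D.Distr}
    (hK : D.IsProperKernel e K) : ∃ m ∈ D.multipliers e, D.HasFourierTransform K m := by
  obtain ⟨m, hm, hb, hKm⟩ := hK.exists_integral_eq he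
  have hq : ∀ (l : Fin N) ξ, 1 ≤ 1 + qNorm (D.exponent e) l ξ := fun l ξ => by
    linarith [qNorm_nonneg (f := D.exponent e) l ξ]
  choose C hC0 hC using hb
  refine ⟨m, ⟨hm, fun γ => ?_⟩, ?_⟩
  · obtain ⟨C', -, hC'⟩ := D.exists_multiplierWeight_equiv he γ
    refine ⟨C γ * C', fun ξ => (hC γ ξ).trans ?_⟩
    rw [mul_assoc]
    refine mul_le_mul_of_nonneg_left (le_trans (le_of_eq ?_) (hC' ξ).1) (hC0 γ)
    refine Finset.prod_congr rfl fun l _ => ?_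
    rw [Real.rpow_neg (by linarith [hq l ξ]), Real.rpow_natCast]
  · have hbd : ∀ γ ξ, ‖multiDeriv γ m ξ‖ ≤ C γ := fun γ ξ =>
      (hC γ ξ).trans (mul_le_of_le_one_right (hC0 γ) (Finset.prod_le_one
        (fun l _ => inv_nonneg.2 (pow_nonneg (by linarith [hq l ξ]) _))
        fun l _ => inv_le_one_of_one_le₀ (one_le_pow₀ (hq l ξ))))
    have hg : Function.HasTemperateGrowth m := ⟨hm, fun k => ⟨0, _, fun ξ => by
      rw [pow_zero, mul_one]
      exact norm_iteratedFDeriv_le_of_multiDeriv_sum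
        (hm.contDiffAt.of_le (by exact_mod_cast le_top)) fun γ _ => hbd γ ξ⟩⟩
    refine ⟨𝓕⁻ (hg.toTemperedDistribution volume), fun φ f hφ => ?_, fun f => ?_⟩
    · rw [hKm φ f hφ, TemperedDistribution.fourierInv_apply,
        Function.HasTemperateGrowth.toTemperedDistribution_apply volume hg]
      exact integral_congr_ae (.of_forall fun ξ => mul_comm _ _)
    · rw [FourierTransform.fourier_fourierInv_eq,
        Function.HasTemperateGrowth.toTemperedDistribution_apply volume hg]
      exact integral_congr_ae (.of_forall fun ξ => mul_comm _ _)

/-- The inverse Fourier transform of a multiplier is a proper kernel. -/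
theorem HasFourierTransform.isProperKernel (he : BasicHypothesis e) {K : D.Distr} {m : D.Space → ℂ}
    (hm : m ∈ D.multipliers e) (hK : D.HasFourierTransform K m) : D.IsProperKernel e K := by
  obtain ⟨T, hKT, hT⟩ := hK
  obtain ⟨C, hC⟩ := D.exists_isSymbol_of_mem_multipliers he hm
  refine D.isProperKernel_of_integral he (m := fun ξ => m (-ξ)) (hm.1.comp contDiff_neg)
    (hC.comp_neg hm.1) fun φ => ?_
  set f : 𝓢(D.Space, ℂ) := (hasCompactSupport_ofReal φ.hasCompactSupport).toSchwartzMap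
    (contDiff_ofReal φ.contDiff) with hf
  have hfφ : (f : D.Space → ℂ) = fun x => (φ x : ℂ) := rfl
  have h1 : T f = (𝓕 T) (𝓕⁻ f) := by
    rw [TemperedDistribution.fourier_apply, FourierTransform.fourier_fourierInv_eq]
  rw [hKT φ f fun x => rfl, h1, hT, ← integral_neg_eq_self, SchwartzMap.fourierInv_coe, hfφ]
  refine integral_congr_ae (.of_forall fun ξ => ?_)
  simp only [Real.fourierInv_eq_fourier_neg, neg_neg]

end DilationStructure

theorem mainTheorem2 {N n : ℕ} (D : DilationStructure N n) (e : Matrix (Fin n) (Fin n) ℝ)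
    (he : BasicHypothesis e) :
    (∀ K ∈ D.properKernels e, ∃ m ∈ D.multipliers e, D.HasFourierTransform K m) ∧
      D.properKernels e = D.inverseFourierTransforms (D.multipliers e) := by
  refine ⟨fun K hK => DilationStructure.IsProperKernel.exists_mem_multipliers he hK,
    Set.Subset.antisymm
      (fun K hK => DilationStructure.IsProperKernel.exists_mem_multipliers he hK) ?_⟩
  rintro K ⟨m, hm, hK⟩
  exact DilationStructure.HasFourierTransform.isProperKernel he hm hK
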